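/- Let $M$ be a smooth (second countable, Hausdorff, finite-dimensional) manifold, $p\ge 0$ and $r_1,\dots,r_p\ge 0$. **Definitions.** A *graded vector bundle* $\mathcal V=\bigoplus_{k=1}^p \mathcal V_{-k}$ over $M$ consists of smooth vector bundles $\mathcal V_{-k}\to M$ of rank $r_k$, placed in degree $-k$. Put $V_0=C^\infty(M)$, $V_{-k}=\Gamma(\mathcal V_{-k})$, $V_\bullet=\bigoplus_{k=0}^p V_{-k}$. A *$p$-term $L_\infty[1]$-algebroid* structure on $\mathcal V$ is a family of graded symmetric $\mathbb R$-multilinear maps $a_n\colon S^nV_\bullet\to V_\bullet$ of degree $+1$ ($n\ge 1$) satisfying the Jacobi identities $\sum_{i+j=n+1}\sum_{\sigma\in \mathrm{Unsh}(j,i-1)}\epsilon(\sigma)\,a_i(a_j(v_{\sigma 1},\dots,v_{\sigma j}),v_{\sigma (j+1)},\dots,v_{\sigma n})=0$ for all $n\ge 1$ ($\epsilon$ the Koszul sign), such that $a_n$ is $C^\infty(M)$-linear for $n\neq 2$, $a_2(X,fY)=a_2(X,f)\,Y+f\,a_2(X,Y)$ for $f\in V_0$, and functions enter only through $a_2(X,f)\in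 C^\infty(M)$ with $X$ of degree $-1$: $a_2(X,f)=0$ if $|X|\ne -1$, and for $n\ne 2$ the map $a_n$ vanishes if one argument is in $V_0$ and has no component in $V_0$. An *N-manifold* $\mathcal M$ of degree (at most) $p$ with body $M$ is a sheaf of $\mathbb N$-graded, graded commutative algebras on $M$, with smooth functions on $M$ in degree $0$, that is locally of the form smooth functions $\otimes$ exterior algebra on the odd coordinates $\otimes$ polynomials in the even coordinates of positive degree, with $r_k$ coordinates of degree $k$, $1\le k\le p$. A *Q-structure* on it is a graded derivation $Q$ of degree $+1$ of the structure sheaf with $Q^2=0$; $(\mathcal M,Q)$ is then a *$Qp$-manifold*. The functions locally generated by those of degree at most $k$ are the functions on $\mathcal M_k$; this gives the tower $\mathcal M=\mathcal M_p\to\mathcal M_{p-1}\to\dots\to\mathcal M_1\to \mathcal M_0=M$. A *splitting* $\sigma$ is a choice of a section $\mathcal M_{k-1}\to\mathcal M_k$ of each projection (a morphism of graded ringed spaces over $M$). We say that $\mathcal V$ *arises from* $\sigma$, $\mathcal M\cong\mathcal V$, if for each $k$ the sheaf of sections of $\mathcal V_{-k}^*$ is identified, $C^\infty$-linearly, with the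 sheaf of functions of degree $k$ on $\mathcal M_k$ vanishing along the section $\mathcal M_{k-1}\to\mathcal M_k$. **Proposition.** A $p$-term $L_\infty[1]$-algebroid is the same as a $Qp$-manifold with a splitting of its tower. Precisely: 1. For each N-manifold $\mathcal M$ with splitting there is a graded vector bundle $\mathcal V$ that arises from it; and each graded vector bundle $\mathcal V$ arises from some N-manifold with splitting, $\mathcal M=\mathcal V$. 2. Let $\mathcal M\cong\mathcal V$ as above. Each Q-structure $Q$ on $\mathcal M$ determines a unique $p$-term $L_\infty[1]$-algebroid structure $(a_n)$ on $\mathcal V$ together with a unique smooth bundle map $\rho\colon\mathcal V\to TM$ (nonzero in degree $-1$ only), and each $p$-term $L_\infty[1]$-algebroid structure $(a_n)$ determines a unique Q-structure $Q$ together with a unique such $\rho$, such that the following holds. For every open $U\subseteq M$ and all global sections $e_\alpha$ of the bundles $\mathcal V_{-k}$ that form a frame over $U$, with $q^\alpha$ the coordinates on $\mathcal M|_U$ given by the dual coframe, $$Q=\rho^i_\alpha\, q^\alpha\,\partial_{x^i}+\sum_{n\ge 1}\frac{(-1)^{n-1}}{n!}\,C^\beta_{\alpha_1\dots\alpha_n}\,q^{\alpha_1}\cdots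 q^{\alpha_n}\,\partial_{q^\beta},\qquad a_n(e_{\alpha_1},\dots,e_{\alpha_n})=C^\beta_{\alpha_1\dots\alpha_n}\,e_\beta$$ (with $\rho(e_\alpha)=\rho_\alpha^i\partial_{x^i}$), and $a_2(X,f)=\rho(X)[f]$ for all homogeneous sections $X$ of $\mathcal V$ and all $f\in C^\infty(M)$. 3. If $\mathcal M\cong\mathcal V$ and $\mathcal M'\cong\mathcal V'$ arise from splittings, each isomorphism $\mathcal M\to\mathcal M'$ over $\mathrm{id}_M$ respecting the splittings is induced by a unique isomorphism $\mathcal V\to\mathcal V'$ of graded vector bundles over $\mathrm{id}_M$, and conversely; it intertwines two Q-structures if and only if the bundle isomorphism intertwines the corresponding brackets. -/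

import Mathlib

open scoped Manifold ContDiff
open TopologicalSpace Bundle

universe u v v' w w'

noncomputable section

namespace GradedGeometry

/-! ## Graded manifolds -/

section Base

variable {m : ℕ} {M : Type u} [TopologicalSpace M] [ChartedSpace (EuclideanSpace ℝ (Fin m)) M]

/-- The smooth real functions on an open set `U`. -/
abbrev Smooth (m : ℕ) {M : Type u} [TopologicalSpace M]
    [ChartedSpace (EuclideanSpace ℝ (Fin m)) M] (U : Opens M) : Type u :=
  C^∞⟮𝓡 m, U; ℝ⟯

/-- Restriction of a global smooth function to an open set. -/
def globRes (U : Opens M) (f : C^∞⟮𝓡 m, M; ℝ⟯) : Smooth m U :=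
  ⟨fun x => f x, f.contMDiff.comp contMDiff_subtype_val⟩

end Base

/-- The indices of the coordinates of positive degree: `r j` coordinates in degree `j + 1`,
for `j = 0, …, p - 1`. -/
abbrev Idx {p : ℕ} (r : Fin p → ℕ) : Type := Σ j : Fin p, Fin (r j)

/-- Exponents of the monomials in the coordinates of positive degree: the coordinates of odd degree
occur at most once. -/
def MultiExp {p : ℕ} (r : Fin p → ℕ) : Type :=
  {J : Idx r → ℕ // ∀ α : Idx r, Odd ((α.1 : ℕ) + 1) → J α ≤ 1}

/-- The ordered monomial `q ^ J` in elements `q α` of a (noncommutative) ring. -/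
def monomialOf {p : ℕ} {r : Fin p → ℕ} {A : Type v} [Ring A] (q : Idx r → A) (J : Idx r → ℕ) : A :=
  ((List.finRange p).map fun j =>
    ((List.finRange (r j)).map fun i => q ⟨j, i⟩ ^ J ⟨j, i⟩).prod).prod

/-- An N-manifold of degree (at most) `p` with body `M`: a sheaf `O` of `ℕ`-graded,
graded commutative real algebras on `M` that is locally of the form
"smooth functions ⊗ exterior algebra in the coordinates of odd degree
⊗ polynomials in the coordinates of positive even degree",
with `r j` coordinates of degree `j + 1`, `j = 0, …, p - 1`.
(It is a sheaf of graded algebras: glueing takes place in each degree.) -/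
structure NManifold (m : ℕ) (M : Type u) [TopologicalSpace M]
    [ChartedSpace (EuclideanSpace ℝ (Fin m)) M] {p : ℕ} (r : Fin p → ℕ) where
  /-- functions over an open set of the body -/
  O : Opens M → Type v
  instRing : ∀ U, Ring (O U)
  instAlgebra : ∀ U, Algebra ℝ (O U)
  /-- the homogeneous functions of degree `n` -/
  gr : ∀ U, ℕ → Submodule ℝ (O U)
  gradedMonoid : ∀ U, SetLike.GradedMonoid (gr U)
  isInternal : ∀ U, DirectSum.IsInternal (gr U)
  graded_comm : ∀ (U : Opens M) (i j : ℕ) (f g : O U), f ∈ gr U i → g ∈ gr U j →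
    f * g = (-1 : ℝ) ^ (i * j) • (g * f)
  /-- restriction -/
  res : ∀ {U V : Opens M}, U ≤ V → (O V →ₐ[ℝ] O U)
  res_self : ∀ (U : Opens M) (f : O U), res (le_refl U) f = f
  res_res : ∀ {U V W : Opens M} (h : U ≤ V) (h' : V ≤ W) (f : O W),
    res h (res h' f) = res (h.trans h') f
  res_mem : ∀ {U V : Opens M} (h : U ≤ V) (n : ℕ) (f : O V), f ∈ gr V n → res h f ∈ gr U n
  locality : ∀ {ι : Type u} (U : ι → Opens M) (f : O (iSup U)),
    (∀ i, res (le_iSup U i) f = 0) → f = 0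
  glueing : ∀ {ι : Type u} (U : ι → Opens M) (n : ℕ) (f : ∀ i, O (U i)),
    (∀ i, f i ∈ gr (U i) n) →
    (∀ i j, res (inf_le_left : U i ⊓ U j ≤ U i) (f i) =
      res (inf_le_right : U i ⊓ U j ≤ U j) (f j)) →
    ∃ g ∈ gr (iSup U) n, ∀ i, res (le_iSup U i) g = f i
  /-- the functions of degree `0` are the smooth functions on the body -/
  fn : ∀ U, Smooth m U →ₐ[ℝ] O U
  fn_injective : ∀ U, Function.Injective (fn U)
  fn_range : ∀ U, Set.range (fn U) = (gr U 0 : Set (O U))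
  fn_res : ∀ {U V : Opens M} (h : U ≤ V) (f : Smooth m V),
    res h (fn V f) = fn U (ContMDiffMap.restrictRingHom (𝓡 m) 𝓘(ℝ, ℝ) ℝ h f)
  /-- local coordinates -/
  exists_coordinates : ∀ x : M, ∃ U : Opens M, x ∈ U ∧ ∃ q : Idx r → O U,
    (∀ α, q α ∈ gr U ((α.1 : ℕ) + 1)) ∧
    ∀ (U' : Opens M) (h : U' ≤ U),
      Function.Bijective (fun c : MultiExp r →₀ Smooth m U' =>
        c.sum fun J f => fn U' f * monomialOf (fun α => res h (q α)) J.1)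

attribute [instance] NManifold.instRing NManifold.instAlgebra

section Tower

variable {m : ℕ} {M : Type u} [TopologicalSpace M] [ChartedSpace (EuclideanSpace ℝ (Fin m)) M]
  {p : ℕ} {r : Fin p → ℕ}

namespace NManifold

/-- The subalgebra generated by the functions on `U` of degree at most `k`. -/
def generated (N : NManifold.{u, v} m M r) (k : ℕ) (U : Opens M) : Subalgebra ℝ (N.O U) :=
  Algebra.adjoin ℝ {f | ∃ i ≤ k, f ∈ N.gr U i}

theorem res_generated (N : NManifold.{u, v} m M r) (k : ℕ) {U V : Opens M} (h : U ≤ V)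
    (f : N.O V) (hf : f ∈ N.generated k V) : N.res h f ∈ N.generated k U := by
  have h1 : N.generated k V ≤ (N.generated k U).comap (N.res h) := by
    refine Algebra.adjoin_le ?_
    rintro g ⟨i, hi, hg⟩
    exact Algebra.subset_adjoin ⟨i, hi, N.res_mem h i g hg⟩
  exact h1 hf

/-- The stage `𝓜_k` of the tower `𝓜_p → ⋯ → 𝓜_1 → 𝓜_0 = M`, given by its structure sheaf: the
subsheaf of those functions that are locally generated by functions of degree at most `k`.
The projections of the tower are dual to the inclusions of these sheaves. -/
def level (N : NManifold.{u, v} m M r) (k : ℕ) (U : Opens M) : Subalgebra ℝ (N.O U) where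
  carrier := {f | ∀ x ∈ U, ∃ (U' : Opens M) (h : U' ≤ U), x ∈ U' ∧ N.res h f ∈ N.generated k U'}
  mul_mem' := by
    intro f g hf hg x hx
    obtain ⟨U₁, h₁, hx₁, hf⟩ := hf x hx
    obtain ⟨U₂, h₂, hx₂, hg⟩ := hg x hx
    refine ⟨U₁ ⊓ U₂, inf_le_left.trans h₁, ⟨hx₁, hx₂⟩, ?_⟩
    rw [map_mul]
    refine mul_mem ?_ ?_
    · have := N.res_generated k (inf_le_left : U₁ ⊓ U₂ ≤ U₁) _ hf
      rwa [N.res_res] at this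
    · have := N.res_generated k (inf_le_right : U₁ ⊓ U₂ ≤ U₂) _ hg
      rwa [N.res_res] at this
  add_mem' := by
    intro f g hf hg x hx
    obtain ⟨U₁, h₁, hx₁, hf⟩ := hf x hx
    obtain ⟨U₂, h₂, hx₂, hg⟩ := hg x hx
    refine ⟨U₁ ⊓ U₂, inf_le_left.trans h₁, ⟨hx₁, hx₂⟩, ?_⟩
    rw [map_add]
    refine add_mem ?_ ?_
    · have := N.res_generated k (inf_le_left : U₁ ⊓ U₂ ≤ U₁) _ hf
      rwa [N.res_res] at this
    · have := N.res_generated k (inf_le_right : U₁ ⊓ U₂ ≤ U₂) _ hg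
      rwa [N.res_res] at this
  algebraMap_mem' := by
    intro c x hx
    refine ⟨U, le_refl U, hx, ?_⟩
    rw [AlgHom.commutes]
    exact Subalgebra.algebraMap_mem _ c

end NManifold

/-- A Q-structure: a vector field of degree `+1`, i.e. a graded derivation of the structure sheaf
of degree `+1`, of square zero. A `Qp`-manifold is an N-manifold of degree `p` with a
Q-structure. -/
structure QStructure (N : NManifold.{u, v} m M r) where
  Q : ∀ U, N.O U →ₗ[ℝ] N.O U
  degree : ∀ (U : Opens M) (n : ℕ) (f : N.O U), f ∈ N.gr U n → Q U f ∈ N.gr U (n + 1)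
  derivation : ∀ (U : Opens M) (n : ℕ) (f g : N.O U), f ∈ N.gr U n →
    Q U (f * g) = Q U f * g + (-1 : ℝ) ^ n • (f * Q U g)
  natural : ∀ {U V : Opens M} (h : U ≤ V) (f : N.O V), N.res h (Q V f) = Q U (N.res h f)
  square : ∀ (U : Opens M) (f : N.O U), Q U (Q U f) = 0

/-- A splitting of the tower of affine fibrations: for every `k = j + 1 = 1, …, p` a section
`𝓜_{k-1} → 𝓜_k` of the projection `𝓜_k → 𝓜_{k-1}`. Such a morphism of graded ringed spaces over
`M` is given by its pullback `s j`, a morphism of sheaves of graded algebras that restricts to the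
identity on the functions on `𝓜_{k-1}`. -/
structure Splitting (N : NManifold.{u, v} m M r) where
  s : ∀ (j : Fin p) (U : Opens M), N.level ((j : ℕ) + 1) U →ₐ[ℝ] N.level (j : ℕ) U
  degree : ∀ (j : Fin p) (U : Opens M) (n : ℕ) (f : N.level ((j : ℕ) + 1) U),
    (f : N.O U) ∈ N.gr U n → (s j U f : N.O U) ∈ N.gr U n
  natural : ∀ (j : Fin p) {U V : Opens M} (h : U ≤ V) (f : N.level ((j : ℕ) + 1) V)
    (g : N.level ((j : ℕ) + 1) U), (g : N.O U) = N.res h f → (s j U g : N.O U) = N.res h (s j V f)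
  retract : ∀ (j : Fin p) (U : Opens M) (f : N.level ((j : ℕ) + 1) U),
    (f : N.O U) ∈ N.level (j : ℕ) U → (s j U f : N.O U) = f

/-- The fibre-linear functions of degree `j + 1` on `𝓜_{j+1}`, identified with a vector bundle over
`𝓜_j` by the splitting: those functions of degree `j + 1` that vanish along the section
`𝓜_j → 𝓜_{j+1}`. -/
def Splitting.linFun {N : NManifold.{u, v} m M r} (σ : Splitting N) (j : Fin p) (U : Opens M) :
    Set (N.O U) :=
  {f | f ∈ N.gr U ((j : ℕ) + 1) ∧ ∃ h : f ∈ N.level ((j : ℕ) + 1) U, σ.s j U ⟨f, h⟩ = 0}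

end Tower

/-! ## Graded vector bundles -/

/-- A graded vector bundle over `M` concentrated in degrees `-p, …, -1`; `E j` is the smooth vector
bundle, of rank `r j`, in degree `-(j + 1)`. -/
structure GradedBundle (m : ℕ) (M : Type u) [TopologicalSpace M]
    [ChartedSpace (EuclideanSpace ℝ (Fin m)) M] {p : ℕ} (r : Fin p → ℕ) where
  E : Fin p → M → Type w
  instAddCommGroup : ∀ j x, AddCommGroup (E j x)
  instModule : ∀ j x, Module ℝ (E j x)
  instTopFiber : ∀ j x, TopologicalSpace (E j x)
  instTop : ∀ j, TopologicalSpace (TotalSpace (EuclideanSpace ℝ (Fin (r j))) (E j))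
  instFiberBundle : ∀ j, FiberBundle (EuclideanSpace ℝ (Fin (r j))) (E j)
  instVectorBundle : ∀ j, VectorBundle ℝ (EuclideanSpace ℝ (Fin (r j))) (E j)
  instSmooth : ∀ j, ContMDiffVectorBundle ∞ (EuclideanSpace ℝ (Fin (r j))) (E j) (𝓡 m)

attribute [instance] GradedBundle.instAddCommGroup GradedBundle.instModule
  GradedBundle.instTopFiber GradedBundle.instTop GradedBundle.instFiberBundle
  GradedBundle.instVectorBundle GradedBundle.instSmooth

section Bundles

variable {m : ℕ} {M : Type u} [TopologicalSpace M] [ChartedSpace (EuclideanSpace ℝ (Fin m)) M]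
  {p : ℕ} {r : Fin p → ℕ}

namespace GradedBundle

/-- The smooth sections of the bundle in degree `-(j + 1)`. -/
abbrev Sect (V : GradedBundle.{u, w} m M r) (j : Fin p) : Type (max u w) :=
  Cₛ^∞⟮𝓡 m; EuclideanSpace ℝ (Fin (r j)), V.E j⟯

/-- The graded vector space `V_•`: the smooth functions in degree `0` and the sections of the
bundle `E j` in degree `-(j + 1)`. -/
abbrev Sec (V : GradedBundle.{u, w} m M r) : Type (max u w) :=
  C^∞⟮𝓡 m, M; ℝ⟯ × (∀ j : Fin p, V.Sect j)

/-- The elements of degree `d`. -/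
def gr (V : GradedBundle.{u, w} m M r) (d : ℤ) : Submodule ℝ V.Sec where
  carrier := {v | (d ≠ 0 → v.1 = 0) ∧ ∀ j : Fin p, d ≠ -((j : ℤ) + 1) → v.2 j = 0}
  add_mem' := by
    rintro a b ⟨ha, ha'⟩ ⟨hb, hb'⟩
    exact ⟨fun h => by simp [ha h, hb h], fun j h => by simp [ha' j h, hb' j h]⟩
  zero_mem' := ⟨fun _ => rfl, fun _ _ => rfl⟩
  smul_mem' := by
    rintro c a ⟨ha, ha'⟩
    exact ⟨fun h => by simp [ha h], fun j h => by simp [ha' j h]⟩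

/-- A function, as an element of degree `0`. -/
def ofFun (V : GradedBundle.{u, w} m M r) (f : C^∞⟮𝓡 m, M; ℝ⟯) : V.Sec := (f, 0)

/-- A section of `E j`, as an element of degree `-(j + 1)`. -/
def ofSect (V : GradedBundle.{u, w} m M r) (j : Fin p) (X : V.Sect j) : V.Sec := (0, Pi.single j X)

/-- Multiplication by a smooth function. -/
def mulFun (V : GradedBundle.{u, w} m M r) (f : C^∞⟮𝓡 m, M; ℝ⟯) (v : V.Sec) : V.Sec :=
  (f * v.1, fun j => ⟨fun x => f x • v.2 j x, f.contMDiff.smul_section (v.2 j).contMDiff⟩)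

/-- The smooth sections over `U` of the bundle dual to `E j`: smooth families of covectors. -/
def Covec (V : GradedBundle.{u, w} m M r) (j : Fin p) (U : Opens M) :
    Submodule ℝ (∀ x : U, V.E j x →ₗ[ℝ] ℝ) where
  carrier := {θ | ∀ X : V.Sect j, ContMDiff (𝓡 m) 𝓘(ℝ, ℝ) ∞ (fun x : U => θ x (X x))}
  add_mem' := fun ha hb X => (ha X).add (hb X)
  zero_mem' := fun _ => contMDiff_const
  smul_mem' := fun c _ ha X => (contMDiff_const (c := c)).mul (ha X)

/-- The function on `U` obtained by pairing a covector field on `U` with a global section. -/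
def pair (V : GradedBundle.{u, w} m M r) {j : Fin p} {U : Opens M} (θ : V.Covec j U)
    (X : V.Sect j) : Smooth m U :=
  ⟨fun x => θ.1 x (X x), θ.2 X⟩

end GradedBundle

/-- Global sections of the bundles `E j` that form a frame over `U`, with the dual coframe. -/
structure Frame (V : GradedBundle.{u, w} m M r) (U : Opens M) where
  e : ∀ α : Idx r, V.Sect α.1
  θ : ∀ α : Idx r, V.Covec α.1 U
  dual : ∀ (j : Fin p) (i i' : Fin (r j)) (x : U),
    (θ ⟨j, i⟩).1 x (e ⟨j, i'⟩ x) = if i = i' then 1 else 0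

/-- The frame element with index `α`, an element of `V_•`. -/
def Frame.vec {V : GradedBundle.{u, w} m M r} {U : Opens M} (b : Frame V U) (α : Idx r) : V.Sec :=
  V.ofSect α.1 (b.e α)

/-- A smooth bundle map `ρ : V → TM` of degree `+1`, i.e. nonzero in degree `-1` only. -/
structure Anchor [IsManifold (𝓡 m) ∞ M] (V : GradedBundle.{u, w} m M r) where
  map : ∀ (j : Fin p) (x : M), V.E j x →ₗ[ℝ] TangentSpace (𝓡 m) x
  smooth : ∀ (j : Fin p) (X : V.Sect j), ContMDiff (𝓡 m) (𝓡 m).tangent ∞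
    (fun x => (⟨x, map j x (X x)⟩ : TangentBundle (𝓡 m) M))
  degree : ∀ (j : Fin p) (x : M), (j : ℕ) ≠ 0 → map j x = 0

/-- The function `ρ(X)[f]`, for a section `X` of `E j`. -/
def Anchor.deriv [IsManifold (𝓡 m) ∞ M] {V : GradedBundle.{u, w} m M r} (ρ : Anchor V)
    {j : Fin p} (X : V.Sect j) (f : C^∞⟮𝓡 m, M; ℝ⟯) : C^∞⟮𝓡 m, M; ℝ⟯ :=
  ⟨fun x => (mfderiv (𝓡 m) 𝓘(ℝ, ℝ) f x (ρ.map j x (X x)) : ℝ), by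
    have h1 := f.contMDiff.contMDiff_tangentMap (m := ∞) (n := ∞) le_rfl
    have h2 := h1.comp (ρ.smooth j X)
    exact (contMDiff_snd_tangentBundle_modelSpace ℝ 𝓘(ℝ, ℝ)).comp h2⟩

end Bundles

/-! ## `L_∞[1]`-algebroids -/

/-- The Koszul sign of the unshuffle of `n` elements of degrees `d` that moves the elements with
index in `S` to the front. -/
def koszul {n : ℕ} (d : Fin n → ℤ) (S : Finset (Fin n)) : ℤˣ :=
  ∏ ij ∈ (Sᶜ ×ˢ S).filter (fun ij => ij.1 < ij.2), Int.negOnePow (d ij.1 * d ij.2)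

section Algebroids

variable {m : ℕ} {M : Type u} [TopologicalSpace M] [ChartedSpace (EuclideanSpace ℝ (Fin m)) M]
  {p : ℕ} {r : Fin p → ℕ}

/-- A `p`-term `L_∞[1]`-algebroid structure on the graded bundle `V`, with
`V_• = Γ(V_{-p}) ⊕ ⋯ ⊕ Γ(V_{-1}) ⊕ C^∞(M)`. The functions occur in the brackets only through
`a_2(X, f) ∈ C^∞(M)` for `X` of degree `-1`. -/
structure LInftyAlgebroid (V : GradedBundle.{u, w} m M r) where
  /-- the `n`-ary bracket (the degree condition forces `a 0 = 0`) -/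
  a : ∀ n : ℕ, MultilinearMap ℝ (fun _ : Fin n => V.Sec) V.Sec
  degree : ∀ (n : ℕ) (d : Fin n → ℤ) (v : Fin n → V.Sec), (∀ i, v i ∈ V.gr (d i)) →
    a n v ∈ V.gr ((∑ i, d i) + 1)
  symm : ∀ (n : ℕ) (d : Fin n → ℤ) (v : Fin n → V.Sec), (∀ i, v i ∈ V.gr (d i)) →
    ∀ i j : Fin n, (i : ℕ) + 1 = j →
      a n (v ∘ Equiv.swap i j) = Int.negOnePow (d i * d j) • a n v
  linear : ∀ (n : ℕ) (v : Fin n → V.Sec) (i : Fin n) (f : C^∞⟮𝓡 m, M; ℝ⟯), n ≠ 2 →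
    a n (Function.update v i (V.mulFun f (v i))) = V.mulFun f (a n v)
  leibniz : ∀ (X Y : V.Sec) (f : C^∞⟮𝓡 m, M; ℝ⟯),
    a 2 ![X, V.mulFun f Y] = V.mulFun (a 2 ![X, V.ofFun f]).1 Y + V.mulFun f (a 2 ![X, Y])
  bracket_fun : ∀ (d : ℤ) (X : V.Sec) (f : C^∞⟮𝓡 m, M; ℝ⟯), X ∈ V.gr d → d ≠ -1 →
    a 2 ![X, V.ofFun f] = 0
  fun_arg : ∀ (n : ℕ) (v : Fin n → V.Sec) (i : Fin n), n ≠ 2 → v i ∈ V.gr 0 → a n v = 0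
  fun_val : ∀ (n : ℕ) (v : Fin n → V.Sec), n ≠ 2 → (a n v).1 = 0
  /-- the Jacobi identities; unshuffles are described by the set `S` of the indices of the
  arguments of the inner bracket -/
  jacobi : ∀ (n : ℕ) (d : Fin n → ℤ) (v : Fin n → V.Sec), (∀ i, v i ∈ V.gr (d i)) →
    ∑ S ∈ (Finset.univ : Finset (Finset (Fin n))).filter (fun S => S.Nonempty),
      koszul d S • a (Sᶜ.card + 1)
        (Matrix.vecCons (a S.card (fun i => v (S.orderEmbOfFin rfl i)))
          (fun i => v (Sᶜ.orderEmbOfFin rfl i))) = 0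

/-! ## The correspondence -/

/-- The statement that the graded bundle `V` arises from the splitting `σ`: an isomorphism of
sheaves of `C^∞`-modules between the sections of the dual of `E j` and the fibre-linear functions
of degree `j + 1`, for every `j`. It identifies `𝓜` with `V`. -/
structure Identification {N : NManifold.{u, v} m M r} (σ : Splitting N)
    (V : GradedBundle.{u, w} m M r) where
  coord : ∀ (j : Fin p) (U : Opens M), V.Covec j U →ₗ[ℝ] N.O U
  injective : ∀ (j : Fin p) (U : Opens M), Function.Injective (coord j U)
  range : ∀ (j : Fin p) (U : Opens M), Set.range (coord j U) = σ.linFun j U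
  natural : ∀ (j : Fin p) {U U' : Opens M} (h : U' ≤ U) (θ : V.Covec j U) (θ' : V.Covec j U'),
    (∀ x : U', θ'.1 x = θ.1 ⟨x, h x.2⟩) → coord j U' θ' = N.res h (coord j U θ)
  linear : ∀ (j : Fin p) (U : Opens M) (f : Smooth m U) (θ θ' : V.Covec j U),
    (∀ x : U, θ'.1 x = f x • θ.1 x) → coord j U θ' = N.fn U f * coord j U θ

/-- The Q-structure `Q`, the brackets `a` and the anchor `ρ` correspond to each other. With the
coordinates `q^α = coord (θ α)` dual to a frame `e_α` of `V` over `U`,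
`Q = ρ^i_α q^α ∂/∂x^i + ∑_{n ≥ 1} (-1)^(n-1) / n! C^β_{α₁…αₙ} q^{α₁} ⋯ q^{αₙ} ∂/∂q^β`
where `a_n(e_{α₁}, …, e_{αₙ}) = C^β_{α₁…αₙ} e_β`, and `a_2(X, f) = ρ(X)[f]`.
(For degree reasons `C = 0` unless `n ≤ p + 1`.) -/
structure Corresponds [IsManifold (𝓡 m) ∞ M] {N : NManifold.{u, v} m M r} {σ : Splitting N}
    {V : GradedBundle.{u, w} m M r} (ι : Identification σ V) (Q : QStructure N)
    (A : LInftyAlgebroid V) (ρ : Anchor V) : Prop where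
  on_functions : ∀ (U : Opens M) (b : Frame V U) (f : C^∞⟮𝓡 m, M; ℝ⟯),
    Q.Q U (N.fn U (globRes U f)) =
      ∑ α : Idx r, N.fn U (globRes U (ρ.deriv (b.e α) f)) * ι.coord α.1 U (b.θ α)
  on_coordinates : ∀ (U : Opens M) (b : Frame V U) (β : Idx r),
    Q.Q U (ι.coord β.1 U (b.θ β)) =
      ∑ n ∈ Finset.Icc 1 (p + 1), ((-1 : ℝ) ^ (n - 1) / (n.factorial : ℝ)) •
        ∑ α : Fin n → Idx r,
          N.fn U (V.pair (b.θ β) ((A.a n (fun i => b.vec (α i))).2 β.1)) *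
            (List.ofFn fun i => ι.coord (α i).1 U (b.θ (α i))).prod
  bracket_fun : ∀ (j : Fin p) (X : V.Sect j) (f : C^∞⟮𝓡 m, M; ℝ⟯),
    A.a 2 ![V.ofSect j X, V.ofFun f] = V.ofFun (ρ.deriv X f)

/-! ## Isomorphisms -/

/-- An isomorphism, over the identity of `M`, of N-manifolds with splittings: an isomorphism of
sheaves of graded algebras that is compatible with the smooth functions on `M` and with the
sections of the two towers. -/
structure SplitIso {N : NManifold.{u, v} m M r} {N' : NManifold.{u, v'} m M r}
    (σ : Splitting N) (σ' : Splitting N') where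
  e : ∀ U, N.O U ≃ₐ[ℝ] N'.O U
  natural : ∀ {U U' : Opens M} (h : U' ≤ U) (f : N.O U), N'.res h (e U f) = e U' (N.res h f)
  degree : ∀ (U : Opens M) (n : ℕ) (f : N.O U), f ∈ N.gr U n → e U f ∈ N'.gr U n
  fn : ∀ (U : Opens M) (f : Smooth m U), e U (N.fn U f) = N'.fn U f
  split : ∀ (j : Fin p) (U : Opens M) (f : N.level ((j : ℕ) + 1) U)
    (f' : N'.level ((j : ℕ) + 1) U), (f' : N'.O U) = e U f →
    (σ'.s j U f' : N'.O U) = e U (σ.s j U f)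

/-- An isomorphism, over the identity of `M`, of graded vector bundles. -/
structure BundleIso (V : GradedBundle.{u, w} m M r) (V' : GradedBundle.{u, w'} m M r) where
  e : ∀ (j : Fin p) (x : M), V.E j x ≃ₗ[ℝ] V'.E j x
  smooth : ∀ j : Fin p, ContMDiff ((𝓡 m).prod 𝓘(ℝ, EuclideanSpace ℝ (Fin (r j))))
    ((𝓡 m).prod 𝓘(ℝ, EuclideanSpace ℝ (Fin (r j)))) ∞
    (fun y : TotalSpace (EuclideanSpace ℝ (Fin (r j))) (V.E j) =>
      (⟨y.1, e j y.1 y.2⟩ : TotalSpace (EuclideanSpace ℝ (Fin (r j))) (V'.E j)))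
  smooth_symm : ∀ j : Fin p, ContMDiff ((𝓡 m).prod 𝓘(ℝ, EuclideanSpace ℝ (Fin (r j))))
    ((𝓡 m).prod 𝓘(ℝ, EuclideanSpace ℝ (Fin (r j)))) ∞
    (fun y : TotalSpace (EuclideanSpace ℝ (Fin (r j))) (V'.E j) =>
      (⟨y.1, (e j y.1).symm y.2⟩ : TotalSpace (EuclideanSpace ℝ (Fin (r j))) (V.E j)))

/-- The map induced on `V_•`; it is the identity on functions. -/
def BundleIso.onSec {V : GradedBundle.{u, w} m M r} {V' : GradedBundle.{u, w'} m M r}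
    (Φ : BundleIso V V') (v : V.Sec) : V'.Sec :=
  (v.1, fun j => ⟨fun x => Φ.e j x (v.2 j x), (Φ.smooth j).comp (v.2 j).contMDiff⟩)

/-- An isomorphism `φ` of split N-manifolds and an isomorphism `Φ` of graded bundles induce each
other: `φ` maps the linear function of a covector field to that of its transport under `Φ`. -/
def Induces {N : NManifold.{u, v} m M r} {N' : NManifold.{u, v'} m M r}
    {σ : Splitting N} {σ' : Splitting N'}
    {V : GradedBundle.{u, w} m M r} {V' : GradedBundle.{u, w'} m M r}
    (ι : Identification σ V) (ι' : Identification σ' V')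
    (φ : SplitIso σ σ') (Φ : BundleIso V V') : Prop :=
  ∀ (j : Fin p) (U : Opens M) (θ : V.Covec j U) (θ' : V'.Covec j U),
    (∀ (x : U) (y : V.E j x), θ'.1 x (Φ.e j x y) = θ.1 x y) →
    φ.e U (ι.coord j U θ) = ι'.coord j U θ'

end Algebroids

end GradedGeometry

end

set_option linter.unusedSectionVars false

noncomputable section

namespace GradedGeometry

variable {m : ℕ} {M : Type u} [TopologicalSpace M] [ChartedSpace (EuclideanSpace ℝ (Fin m)) M]
  [T2Space M] [IsManifold (𝓡 m) ∞ M] {p : ℕ} {r : Fin p → ℕ}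
  {N : NManifold.{u, v} m M r} {N' : NManifold.{u, v'} m M r} {σ : Splitting N} {σ' : Splitting N'}
  {V : GradedBundle.{u, w} m M r} {V' : GradedBundle.{u, w'} m M r}
  {ι : Identification σ V} {ι' : Identification σ' V'}
  {U W : Opens M} {j : Fin p} {n : ℕ} {d : ℤ} {x : M} {f : N.O U} {q : Idx r → N.O U}

open Finset (sum_congr sum_eq_single sum_eq_zero sum_add_distrib smul_sum mul_sum mem_univ sum_mul
  sum_comm prod_congr card_univ sum_le_sum sum_const sum_insert sum_induction sum_const_zero
  subset_univ mem_compl sum_mul_sum prod_subset)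
open Function (update update_self update_of_ne Injective Bijective Surjective)
open Submodule (span smul_mem subset_span span_induction mem_iSup_of_mem)
open List (ofFn finRange mem_ofFn' ofFn_succ mem_cons_self mem_cons_of_mem)

local notation "𝒞" => C^∞⟮𝓡 m, M; ℝ⟯

local notation "𝓔" j:max => EuclideanSpace ℝ (Fin (r j))

section

open GradedBundle NManifold

section Monomials

variable {A : Type*} [Ring A] [Algebra ℝ A]

/-- The elements `a`, `b`, regarded as having degrees `i`, `j`, commute up to the Koszul sign. -/
def SignComm (i j : ℕ) (a b : A) : Prop := a * b = (-1 : ℝ) ^ (i * j) • (b * a)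

lemma SignComm.mul_left {i i' j : ℕ} {a a' b : A} (h : SignComm i j a b) (h' : SignComm i' j a' b) :
    SignComm (i + i') j (a * a') b := by
  unfold SignComm at *
  rw [mul_assoc, h', mul_smul_comm, ← mul_assoc, h, smul_mul_assoc, smul_smul, mul_assoc]
  congr 1
  ring

lemma SignComm.symm {i j : ℕ} {a b : A} (h : SignComm i j a b) : SignComm j i b a := by
  unfold SignComm at *
  rw [h, smul_smul, ← pow_add, mul_comm j i, ← two_mul, pow_mul]
  simp

lemma SignComm.mul_right {i j j' : ℕ} {a b b' : A} (h : SignComm i j a b)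
    (h' : SignComm i j' a b') : SignComm i (j + j') a (b * b') :=
  (h.symm.mul_left h'.symm).symm

lemma signComm_one_left (j : ℕ) (b : A) : SignComm 0 j 1 b := by simp [SignComm]

lemma SignComm.pow_left {i j : ℕ} {a b : A} (h : SignComm i j a b) (k : ℕ) :
    SignComm (k * i) j (a ^ k) b := by
  induction k with
  | zero => simpa using signComm_one_left j b
  | succ k ih => rw [pow_succ, add_mul, one_mul]; exact ih.mul_left h

lemma SignComm.sq_eq_zero {i : ℕ} {a : A} (h : SignComm i i a a) (hi : Odd i) : a * a = 0 := by
  have h1 : a * a = -(a * a) := by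
    have := h
    rw [SignComm, (hi.mul hi).neg_one_pow] at this
    simpa using this
  have h2 : (2 : ℝ) • (a * a) = 0 := by
    rw [two_smul]; nth_rewrite 1 [h1]; simp
  exact (smul_eq_zero.mp h2).resolve_left two_ne_zero

variable {I : Type*} (deg : I → ℕ)

/-- The ordered product of the powers `q α ^ J α` along a list. -/
def listMonomial (q : I → A) (L : List I) (J : I → ℕ) : A := (L.map fun α => q α ^ J α).prod

/-- The total degree of the exponents along a list. -/
def listDeg (L : List I) (J : I → ℕ) : ℕ := (L.map fun α => J α * deg α).sum

/-- The exponent of the sign that normal orders a product of two ordered monomials. -/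
def orderExp : List I → (I → ℕ) → (I → ℕ) → ℕ
  | [], _, _ => 0
  | α :: L, J, K => listDeg deg L J * (K α * deg α) + orderExp L J K

variable {deg}

lemma signComm_listMonomial {q : I → A} (hq : ∀ α β, SignComm (deg α) (deg β) (q α) (q β))
    (L : List I) (J : I → ℕ) (α : I) :
    SignComm (listDeg deg L J) (deg α) (listMonomial q L J) (q α) := by
  induction L with
  | nil => exact signComm_one_left _ _
  | cons β L ih =>
    simp only [listDeg, listMonomial, List.map_cons, List.prod_cons, List.sum_cons]
    exact ((hq β α).pow_left _).mul_left ih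

lemma listMonomial_mul {q : I → A} (hq : ∀ α β, SignComm (deg α) (deg β) (q α) (q β)) (L : List I)
    (J K : I → ℕ) : listMonomial q L J * listMonomial q L K =
    (-1 : ℝ) ^ orderExp deg L J K • listMonomial q L (J + K) := by
  induction L with
  | nil => simp [listMonomial, orderExp]
  | cons α L ih =>
    have h1 : SignComm (listDeg deg L J) (K α * deg α) (listMonomial q L J) (q α ^ K α) :=
      ((signComm_listMonomial hq L J α).symm.pow_left (K α)).symm
    have h2 : ∀ J, listMonomial q (α :: L) J = q α ^ J α * listMonomial q L J := fun J => rfl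
    calc _ = q α ^ J α * (listMonomial q L J * q α ^ K α) * listMonomial q L K := by
          simp only [h2, mul_assoc]
      _ = (-1 : ℝ) ^ (listDeg deg L J * (K α * deg α)) •
          (q α ^ (J α + K α) * (listMonomial q L J * listMonomial q L K)) := by
          rw [h1, mul_smul_comm, smul_mul_assoc, pow_add]
          simp only [mul_assoc]
      _ = _ := by
          rw [ih, mul_smul_comm, smul_smul, ← pow_add, h2]
          rfl

lemma listMonomial_eq_zero {q : I → A} (hq : ∀ α, SignComm (deg α) (deg α) (q α) (q α)) {L : List I}
    {J : I → ℕ} {α : I} (hα : α ∈ L) (hodd : Odd (deg α)) (hJ : 2 ≤ J α) : listMonomial q L J =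
    0 := by
  refine List.prod_eq_zero (List.mem_map.2 ⟨α, hα, ?_⟩)
  obtain ⟨k, hk⟩ := Nat.exists_eq_add_of_le hJ
  rw [hk, pow_add, pow_two, (hq α).sq_eq_zero hodd, zero_mul]

end Monomials

/-- The degree of the coordinate with index `α`. -/
def idxDeg (α : Idx r) : ℕ := (α.1 : ℕ) + 1

/-- All indices, in lexicographic order. -/
def idxList (r : Fin p → ℕ) : List (Idx r) :=
  (finRange p).flatMap fun j => (finRange (r j)).map fun i => ⟨j, i⟩

lemma mem_idxList (α : Idx r) : α ∈ idxList r := by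
  obtain ⟨j, i⟩ := α
  simp [idxList]

lemma nodup_idxList (r : Fin p → ℕ) : (idxList r).Nodup := by
  refine List.nodup_flatMap.2 ⟨fun j _ => ?_, ?_⟩
  · exact (List.nodup_finRange _).map (fun a b h => by simpa using h)
  · refine (List.nodup_finRange p).imp fun {a b} hab => ?_
    simp only [Function.onFun]
    intro x hx hx'
    simp only [List.mem_map, List.mem_finRange, true_and] at hx hx'
    obtain ⟨i, rfl⟩ := hx
    obtain ⟨i', h⟩ := hx'
    exact hab (congrArg Sigma.fst h).symm

lemma monomialOf_eq {A : Type*} [Ring A] (q : Idx r → A) (J : Idx r → ℕ) : monomialOf q J =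
    listMonomial q (idxList r) J := by
  unfold monomialOf listMonomial idxList
  rw [List.map_flatMap, List.flatMap, List.prod_flatten, List.map_map]
  congr 1
  refine List.map_congr_left fun j _ => ?_
  simp [Function.comp_def]

def expDeg (J : Idx r → ℕ) : ℕ := ∑ α, J α * idxDeg α

lemma listDeg_idxList (J : Idx r → ℕ) : listDeg idxDeg (idxList r) J = expDeg J := by
  unfold listDeg expDeg
  rw [← List.sum_toFinset _ (nodup_idxList r)]
  congr 1
  ext α
  simp [mem_idxList]

lemma expDeg_add (J K : Idx r → ℕ) : expDeg (J + K) = expDeg J + expDeg K := by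
  simp [expDeg, add_mul, sum_add_distrib]

lemma expDeg_single (α : Idx r) (k : ℕ) : expDeg (Pi.single α k) = k * idxDeg α := by
  unfold expDeg
  rw [sum_eq_single α]
  · simp
  · intro β _ h; simp [Pi.single_eq_of_ne h]
  · simp

lemma le_expDeg (J : Idx r → ℕ) (α : Idx r) : J α * idxDeg α ≤ expDeg J :=
  Finset.single_le_sum (f := fun α => J α * idxDeg α) (fun _ _ => Nat.zero_le _)
    (mem_univ α)

lemma le_expDeg' (J : Idx r → ℕ) (α : Idx r) : J α ≤ expDeg J :=
  (Nat.le_mul_of_pos_right _ (Nat.succ_pos _)).trans (le_expDeg J α)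

lemma expDeg_eq_zero {J : Idx r → ℕ} (h : expDeg J = 0) : J = 0 := by
  funext α
  have := le_expDeg' J α
  simp only [Pi.zero_apply]
  omega

lemma finite_expDeg_le (n : ℕ) : {J : MultiExp r | expDeg J.1 ≤ n}.Finite := by
  have h1 : {J : Idx r → ℕ | ∀ α, J α ∈ Set.Iic n}.Finite := by
    simpa [Set.pi] using Set.Finite.pi (fun _ : Idx r => Set.finite_Iic n)
  have h2 := h1.preimage (f := fun J : MultiExp r => J.1) (Subtype.val_injective.injOn)
  exact h2.subset fun J hJ α => (le_expDeg' J.1 α).trans hJ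

instance (n : ℕ) : Finite {J : MultiExp r // expDeg J.1 = n} :=
  ((finite_expDeg_le n).subset fun _ h => le_of_eq h).to_subtype

/-- Exponents that occur at most once in odd degrees. -/
def MultiExp.mk (J : Idx r → ℕ) (h : ∀ α : Idx r, Odd ((α.1 : ℕ) + 1) → J α ≤ 1) : MultiExp r :=
  ⟨J, h⟩

def MultiExp.zero : MultiExp r := ⟨0, fun _ _ => Nat.zero_le _⟩

def MultiExp.single (α : Idx r) : MultiExp r :=
  ⟨Pi.single α 1, fun β _ => by
    by_cases h : β = α
    · subst h; simp
    · simp [Pi.single_eq_of_ne h]⟩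

lemma MultiExp.eq_single_or (J : MultiExp r) (j : Fin p) (h : expDeg J.1 ≤ (j : ℕ) + 1) :
    (∃ i, J = MultiExp.single ⟨j, i⟩) ∨ ∀ α : Idx r, J.1 α ≠ 0 → α.1 < j := by
  by_cases hJ : ∃ α : Idx r, J.1 α ≠ 0 ∧ j ≤ α.1
  · left
    obtain ⟨α, h0, hα⟩ := hJ
    have h1 := le_expDeg J.1 α
    have h2 : (j : ℕ) ≤ α.1 := hα
    have h3 : 1 ≤ J.1 α := Nat.one_le_iff_ne_zero.2 h0
    have h4 : J.1 α = 1 ∧ (α.1 : ℕ) = j := by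
      unfold idxDeg at h1
      constructor
      · nlinarith
      · nlinarith
    have h5 : α.1 = j := Fin.ext h4.2
    obtain ⟨j', i⟩ := α
    obtain rfl : j' = j := h5
    refine ⟨i, Subtype.ext ?_⟩
    have h6 : J.1 = Pi.single ⟨j', i⟩ 1 + (J.1 - Pi.single ⟨j', i⟩ 1) := by
      funext β
      by_cases hb : β = ⟨j', i⟩
      · subst hb; simp [h4.1]
      · simp [Pi.single_eq_of_ne hb]
    have h7 : expDeg (J.1 - Pi.single ⟨j', i⟩ 1) = 0 := by
      have := congrArg expDeg h6
      rw [expDeg_add, expDeg_single] at this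
      simp only [idxDeg] at this
      omega
    rw [h6, expDeg_eq_zero h7]
    rfl
  · right
    push Not at hJ
    exact fun α h => hJ α h

lemma monomialOf_zero {A : Type*} [Ring A] (q : Idx r → A) : monomialOf q 0 = 1 := by
  simp [monomialOf]

lemma monomialOf_multiExp_zero {A : Type*} [Ring A] (q : Idx r → A) :
    monomialOf q (MultiExp.zero : MultiExp r).1 = 1 :=
  monomialOf_zero q

lemma monomialOf_single {A : Type*} [Ring A] (q : Idx r → A) (α : Idx r) :
    monomialOf q (MultiExp.single α).1 = q α := by
  rw [monomialOf_eq]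
  unfold listMonomial
  have key : ∀ L : List (Idx r), L.Nodup →
      (L.map fun β => q β ^ (MultiExp.single α).1 β).prod = if α ∈ L then q α else 1 := by
    intro L
    induction L with
    | nil => simp
    | cons β L ih =>
      intro h
      rw [List.map_cons, List.prod_cons, ih (List.nodup_cons.1 h).2]
      by_cases hb : β = α
      · subst hb
        simp [MultiExp.single, (List.nodup_cons.1 h).1]
      · simp [MultiExp.single, Ne.symm hb]
  rw [key _ (nodup_idxList r), if_pos (mem_idxList α)]

lemma map_monomialOf {A B : Type*} [Ring A] [Ring B] (φ : A →+* B) (q : Idx r → A) (J : Idx r → ℕ) :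
    φ (monomialOf q J) = monomialOf (fun α => φ (q α)) J := by
  simp [monomialOf_eq, listMonomial, map_list_prod, Function.comp_def]

lemma monomialOf_mem {A S : Type*} [Ring A] [SetLike S A] [SubmonoidClass S A] (s : S)
    {q : Idx r → A} {J : Idx r → ℕ} (h : ∀ α, J α ≠ 0 → q α ∈ s) : monomialOf q J ∈ s := by
  rw [monomialOf_eq]
  refine list_prod_mem fun x hx => ?_
  obtain ⟨α, -, rfl⟩ := List.mem_map.1 hx
  by_cases h0 : J α = 0
  · simp [h0]
  · exact pow_mem (h α h0) _

section Universal

variable {R A B : Type*} [CommRing R] [Algebra ℝ R] [Ring A] [Algebra ℝ A] [Ring B] [Algebra ℝ B]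

/-- Elements `q α` of an algebra that commute with the functions and, up to the Koszul sign, with
each other. -/
structure GradedCommuting (fn : R →ₐ[ℝ] A) (q : Idx r → A) : Prop where
  comm : ∀ α β, SignComm (idxDeg α) (idxDeg β) (q α) (q β)
  comm_fn : ∀ f α, fn f * q α = q α * fn f

/-- The linear combination of monomials with given coefficients. -/
def expand (fn : R →ₐ[ℝ] A) (q : Idx r → A) : (MultiExp r →₀ R) →ₗ[ℝ] A :=
  Finsupp.lsum ℝ fun J => (LinearMap.mulRight ℝ (monomialOf q J.1)).comp fn.toLinearMap

lemma expand_apply (fn : R →ₐ[ℝ] A) (q : Idx r → A) (c : MultiExp r →₀ R) : expand fn q c =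
    c.sum fun J f => fn f * monomialOf q J.1 := rfl

lemma expand_single (fn : R →ₐ[ℝ] A) (q : Idx r → A) (J : MultiExp r) (f : R) :
    expand fn q (Finsupp.single J f) = fn f * monomialOf q J.1 := by
  rw [expand_apply, Finsupp.sum_single_index]
  simp

lemma expand_single_zero (fn : R →ₐ[ℝ] A) (q : Idx r → A) (f : R) :
    expand fn q (Finsupp.single MultiExp.zero f) = fn f := by
  rw [expand_single, monomialOf_multiExp_zero, mul_one]

lemma expand_single_single (fn : R →ₐ[ℝ] A) (q : Idx r → A) (α : Idx r) (f : R) :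
    expand fn q (Finsupp.single (MultiExp.single α) f) = fn f * q α := by
  rw [expand_single, monomialOf_single]

open Classical in
/-- The product of two terms of an expansion. -/
def termMul (J K : MultiExp r) (f g : R) : MultiExp r →₀ R :=
  if h : ∀ α : Idx r, Odd ((α.1 : ℕ) + 1) → (J.1 + K.1) α ≤ 1 then
    Finsupp.single (MultiExp.mk (J.1 + K.1) h) ((-1 : ℝ) ^ orderExp idxDeg (idxList r) J.1 K.1 • (f * g))
  else 0

lemma GradedCommuting.comm_monomial {fn : R →ₐ[ℝ] A} {q : Idx r → A} (hq : GradedCommuting fn q)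
    (f : R) (J : Idx r → ℕ) : fn f * monomialOf q J = monomialOf q J * fn f := by
  have : monomialOf q J ∈ Subalgebra.centralizer ℝ {fn f} := by
    refine monomialOf_mem _ fun α _ => ?_
    rw [Subalgebra.mem_centralizer_iff]
    rintro _ rfl
    exact hq.comm_fn f α
  rw [Subalgebra.mem_centralizer_iff] at this
  exact this _ rfl

lemma GradedCommuting.monomial_mul {fn : R →ₐ[ℝ] A} {q : Idx r → A} (hq : GradedCommuting fn q)
    (J K : Idx r → ℕ) : monomialOf q J * monomialOf q K =
    (-1 : ℝ) ^ orderExp idxDeg (idxList r) J K • monomialOf q (J + K) := by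
  simp only [monomialOf_eq]
  exact listMonomial_mul hq.comm _ _ _

lemma GradedCommuting.monomial_eq_zero {fn : R →ₐ[ℝ] A} {q : Idx r → A} (hq : GradedCommuting fn q)
    {J : Idx r → ℕ} (h : ¬ ∀ α : Idx r, Odd ((α.1 : ℕ) + 1) → J α ≤ 1) : monomialOf q J = 0 := by
  push Not at h
  obtain ⟨α, h1, h2⟩ := h
  rw [monomialOf_eq]
  exact listMonomial_eq_zero (fun α => hq.comm α α) (mem_idxList α) h1 h2

lemma GradedCommuting.expand_termMul {fn : R →ₐ[ℝ] A} {q : Idx r → A} (hq : GradedCommuting fn q)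
    (J K : MultiExp r) (f g : R) : expand fn q (termMul J K f g) =
    expand fn q (Finsupp.single J f) * expand fn q (Finsupp.single K g) := by
  have h1 : fn f * monomialOf q J.1 * (fn g * monomialOf q K.1) =
      fn (f * g) * ((-1 : ℝ) ^ orderExp idxDeg (idxList r) J.1 K.1 • monomialOf q (J.1 + K.1)) := by
    rw [← hq.monomial_mul, map_mul, mul_assoc, ← mul_assoc (monomialOf q J.1), ← hq.comm_monomial]
    simp only [mul_assoc]
  rw [expand_single, expand_single, h1]
  unfold termMul
  split_ifs with h
  · rw [expand_single, map_smul, smul_mul_assoc, mul_smul_comm]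
    rfl
  · rw [hq.monomial_eq_zero h]
    simp

lemma GradedCommuting.range_expand {fn : R →ₐ[ℝ] A} {q : Idx r → A} (hq : GradedCommuting fn q) :
    LinearMap.range (expand fn q) =
    Subalgebra.toSubmodule (Algebra.adjoin ℝ (Set.range fn ∪ Set.range q)) := by
  set S := Algebra.adjoin ℝ (Set.range fn ∪ Set.range q) with hS
  have hfn : ∀ f, fn f ∈ S := fun f => Algebra.subset_adjoin (Or.inl ⟨f, rfl⟩)
  have hqS : ∀ α, q α ∈ S := fun α => Algebra.subset_adjoin (Or.inr ⟨α, rfl⟩)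
  apply le_antisymm
  · rintro _ ⟨c, rfl⟩
    rw [expand_apply]
    exact S.sum_mem fun J _ => S.mul_mem (hfn _) (monomialOf_mem S fun α _ => hqS α)
  · let T : Subalgebra ℝ A := Submodule.toSubalgebra (LinearMap.range (expand fn q))
      ⟨Finsupp.single MultiExp.zero 1, by simp [expand_single_zero]⟩ (by
        rintro _ _ ⟨c, rfl⟩ ⟨d, rfl⟩
        induction c using Finsupp.induction_linear with
        | zero => simp
        | add c c' h h' => rw [map_add, add_mul]; exact add_mem h h'
        | single J f =>
          induction d using Finsupp.induction_linear with
          | zero => simp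
          | add c c' h h' => rw [map_add, mul_add]; exact add_mem h h'
          | single K g => exact ⟨_, hq.expand_termMul J K f g⟩)
    have : S ≤ T := by
      refine Algebra.adjoin_le ?_
      rintro _ (⟨f, rfl⟩ | ⟨α, rfl⟩)
      · exact ⟨Finsupp.single MultiExp.zero f, expand_single_zero fn q f⟩
      · exact ⟨Finsupp.single (MultiExp.single α) 1, by simp [expand_single, monomialOf_single]⟩
    exact this

lemma exists_algHom_of_coordinates {fn : R →ₐ[ℝ] A} {q : Idx r → A} (hq : GradedCommuting fn q)
    (hbij : Bijective (expand fn q)) {φ₀ : R →ₐ[ℝ] B} {b : Idx r → B} (hb : GradedCommuting φ₀ b) :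
    ∃ φ : A →ₐ[ℝ] B, (∀ f, φ (fn f) = φ₀ f) ∧ ∀ α, φ (q α) = b α := by
  let e := LinearEquiv.ofBijective (expand fn q) hbij
  let φ : A →ₗ[ℝ] B := (expand φ₀ b).comp e.symm.toLinearMap
  have hφ : ∀ c, φ (expand fn q c) = expand φ₀ b c := fun c => by
    have : e.symm (expand fn q c) = c := e.symm_apply_apply c
    simp [φ, this]
  have hfn : ∀ f, φ (fn f) = φ₀ f := fun f => by
    have := hφ (Finsupp.single MultiExp.zero f)
    simpa [expand_single_zero] using this
  have hqα : ∀ α, φ (q α) = b α := fun α => by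
    have := hφ (Finsupp.single (MultiExp.single α) 1)
    simpa [expand_single, monomialOf_single] using this
  refine ⟨AlgHom.ofLinearMap φ ?_ ?_, hfn, hqα⟩
  · rw [← map_one fn, hfn, map_one]
  · intro x y
    obtain ⟨c, rfl⟩ := hbij.2 x
    obtain ⟨d, rfl⟩ := hbij.2 y
    induction c using Finsupp.induction_linear with
    | zero => simp
    | add c c' h h' => simp only [map_add, add_mul, h, h']
    | single J f =>
      induction d using Finsupp.induction_linear with
      | zero => simp
      | add c c' h h' => simp only [map_add, mul_add, h, h']
      | single K g => rw [← hq.expand_termMul, hφ, hφ, hφ, hb.expand_termMul]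

lemma algHom_ext_of_coordinates {fn : R →ₐ[ℝ] A} {q : Idx r → A} (hsurj : Surjective (expand fn q))
    {φ ψ : A →ₐ[ℝ] B} (h0 : ∀ f, φ (fn f) = ψ (fn f)) (h : ∀ α, φ (q α) = ψ (q α)) : φ = ψ := by
  ext x
  obtain ⟨c, rfl⟩ := hsurj x
  simp only [expand_apply, Finsupp.sum, map_sum, map_mul, h0]
  refine sum_congr rfl fun J _ => ?_
  congr 1
  have h1 := map_monomialOf (φ : A →+* B) q J.1
  have h2 := map_monomialOf (ψ : A →+* B) q J.1
  simp only [RingHom.coe_coe] at h1 h2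
  rw [h1, h2]
  congr 1
  funext α
  exact h α

end Universal

def Smooth.res {U V : Opens M} (h : U ≤ V) : Smooth m V →ₐ[ℝ] Smooth m U :=
  { ContMDiffMap.restrictRingHom (𝓡 m) 𝓘(ℝ, ℝ) ℝ h with commutes' := fun _ => rfl }

@[simp] lemma Smooth.res_apply {U V : Opens M} (h : U ≤ V) (f : Smooth m V) (x : U) :
    Smooth.res h f x = f ⟨x, h x.2⟩ := rfl

lemma Smooth.ext {f g : Smooth m U} (h : ∀ x, f x = g x) : f = g :=
  ContMDiffMap.ext h

open Classical in
def extZero (f : U → ℝ) (x : M) : ℝ := if h : x ∈ U then f ⟨x, h⟩ else 0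

lemma extZero_apply (f : U → ℝ) (x : U) : extZero f x = f x := by
  simp [extZero]

lemma extZero_of_mem (f : U → ℝ) (h : x ∈ U) : extZero f x = f ⟨x, h⟩ := by
  simp [extZero, h]

lemma contMDiff_iff_extZero {f : U → ℝ} : ContMDiff (𝓡 m) 𝓘(ℝ, ℝ) ∞ f ↔ ∀ x ∈ U,
    ContMDiffAt (𝓡 m) 𝓘(ℝ, ℝ) ∞ (extZero f) x := by
  have h1 : f = fun x : U => extZero f x := by
    funext x; rw [extZero_apply]
  constructor
  · intro h x hx
    have := h ⟨x, hx⟩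
    rw [h1] at this
    exact contMDiffAt_subtype_iff.1 this
  · intro h x
    rw [h1]
    exact contMDiffAt_subtype_iff.2 (h x x.2)

lemma Smooth.contMDiffAt (f : Smooth m U) (hx : x ∈ U) :
    ContMDiffAt (𝓡 m) 𝓘(ℝ, ℝ) ∞ (extZero f) x :=
  contMDiff_iff_extZero.1 f.contMDiff x hx

lemma contMDiff_of_locally {f : U → ℝ} (h : ∀ x ∈ U, ∃ (W : Opens M) (_ : x ∈ W) (g : Smooth m W),
      ∀ (y : M) (hy : y ∈ W) (hy' : y ∈ U), f ⟨y, hy'⟩ = g ⟨y, hy⟩) :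
    ContMDiff (𝓡 m) 𝓘(ℝ, ℝ) ∞ f := by
  rw [contMDiff_iff_extZero]
  intro x hx
  obtain ⟨W, hW, g, hg⟩ := h x hx
  refine (g.contMDiffAt hW).congr_of_eventuallyEq ?_
  filter_upwards [(W ⊓ U).isOpen.mem_nhds ⟨hW, hx⟩] with y hy
  rw [extZero_of_mem f hy.2, extZero_of_mem _ hy.1, hg]

namespace NManifold

variable (N)

instance (U : Opens M) : SetLike.GradedMonoid (N.gr U) := N.gradedMonoid U

variable {N}

lemma ext_locally {f g : N.O U}
    (h : ∀ x ∈ U, ∃ (W : Opens M) (hW : W ≤ U), x ∈ W ∧ N.res hW f = N.res hW g) : f = g := by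
  choose! W hW hx hf using h
  let W' : U → Opens M := fun x => W x
  have h1 : iSup W' ≤ U := iSup_le fun x => hW x x.2
  have h2 : U ≤ iSup W' := fun x hxU => (le_iSup W' ⟨x, hxU⟩) (hx x hxU)
  have h3 : N.res h1 (f - g) = 0 := by
    refine N.locality W' _ fun x => ?_
    rw [N.res_res, map_sub, sub_eq_zero]
    exact hf x x.2
  have h4 := congrArg (N.res h2) h3
  rw [N.res_res, map_zero] at h4
  rw [← sub_eq_zero, ← h4]
  exact (N.res_self U _).symm

lemma exists_glue (W : M → Opens M) (hW : ∀ x ∈ U, W x ≤ U) (hx : ∀ x ∈ U, x ∈ W x)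
    (f : ∀ x, N.O (W x)) (hf : ∀ x ∈ U, f x ∈ N.gr (W x) n) (hfg : ∀ x ∈ U, ∀ y ∈ U,
      N.res (inf_le_left : W x ⊓ W y ≤ W x) (f x) = N.res (inf_le_right : W x ⊓ W y ≤ W y) (f y)) :
    ∃ g ∈ N.gr U n, ∀ x (hx : x ∈ U), N.res (hW x hx) g = f x := by
  let W' : U → Opens M := fun x => W x
  have h1 : iSup W' ≤ U := iSup_le fun x => hW x x.2
  have h2 : U ≤ iSup W' := fun x hxU => (le_iSup W' ⟨x, hxU⟩) (hx x hxU)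
  obtain ⟨g, hg, hg'⟩ := N.glueing W' n (fun x => f x) (fun x => hf x x.2)
    fun x y => hfg x x.2 y y.2
  refine ⟨N.res h2 g, N.res_mem h2 n g hg, fun x hxU => ?_⟩
  rw [N.res_res]
  exact hg' ⟨x, hxU⟩

lemma fn_mem (U : Opens M) (f : Smooth m U) : N.fn U f ∈ N.gr U 0 := by
  have : N.fn U f ∈ (N.gr U 0 : Set (N.O U)) := by
    rw [← N.fn_range]; exact ⟨f, rfl⟩
  exact this

lemma res_fn {U V : Opens M} (h : U ≤ V) (f : Smooth m V) : N.res h (N.fn V f) =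
    N.fn U (Smooth.res h f) := N.fn_res h f

lemma gr_mul_mem {i j : ℕ} {f g : N.O U} (hf : f ∈ N.gr U i) (hg : g ∈ N.gr U j) : f * g ∈
    N.gr U (i + j) := SetLike.mul_mem_graded hf hg

lemma fn_mul_mem (f : Smooth m U) {g : N.O U} (hg : g ∈ N.gr U n) : N.fn U f * g ∈ N.gr U n := by
  simpa using gr_mul_mem (fn_mem U f) hg

lemma signComm {i j : ℕ} {f g : N.O U} (hf : f ∈ N.gr U i) (hg : g ∈ N.gr U j) :
    SignComm i j f g := N.graded_comm U i j f g hf hg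

lemma induction_homogeneous {P : N.O U → Prop} (f : N.O U) (h0 : P 0)
    (hadd : ∀ f g, P f → P g → P (f + g)) (hom : ∀ n, ∀ f ∈ N.gr U n, P f) : P f := by
  obtain ⟨x, rfl⟩ := (N.isInternal U).2 f
  induction x using DirectSum.induction_on with
  | zero => simpa using h0
  | of n x => simpa using hom n x x.2
  | add x y hx hy => rw [map_add]; exact hadd _ _ hx hy

variable (N) in
/-- The linear map that multiplies the homogeneous functions of degree `n` by `c n`. -/
def scale (U : Opens M) (c : ℕ → ℝ) : N.O U →ₗ[ℝ] N.O U :=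
  (DirectSum.toModule ℝ ℕ (N.O U) fun n => c n • (N.gr U n).subtype).comp
    (LinearEquiv.ofBijective (DirectSum.coeLinearMap (N.gr U)) (N.isInternal U)).symm.toLinearMap

lemma scale_of_mem (c : ℕ → ℝ) (hf : f ∈ N.gr U n) : N.scale U c f = c n • f := by
  have h1 : (LinearEquiv.ofBijective (DirectSum.coeLinearMap (N.gr U)) (N.isInternal U)).symm f =
      DirectSum.lof ℝ ℕ (fun n => N.gr U n) n ⟨f, hf⟩ := by
    rw [LinearEquiv.symm_apply_eq]
    exact (DirectSum.coeLinearMap_lof (N.gr U) n ⟨f, hf⟩).symm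
  simp only [scale, LinearMap.comp_apply, LinearEquiv.coe_coe]
  rw [h1, DirectSum.toModule_lof]
  rfl

lemma res_scale {U V : Opens M} (h : U ≤ V) (c : ℕ → ℝ) (f : N.O V) : N.res h (N.scale V c f) =
    N.scale U c (N.res h f) := by
  induction f using induction_homogeneous with
  | h0 => simp
  | hadd f g hf hg => simp [hf, hg]
  | hom n f hf => rw [scale_of_mem c hf, scale_of_mem c (N.res_mem h n f hf), map_smul]

lemma scale_scale (c d : ℕ → ℝ) (f : N.O U) : N.scale U c (N.scale U d f) =
    N.scale U (fun n => c n * d n) f := by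
  induction f using induction_homogeneous with
  | h0 => simp
  | hadd f g hf hg => simp [hf, hg]
  | hom n f hf => rw [scale_of_mem d hf, scale_of_mem _ hf, map_smul, scale_of_mem c hf, smul_smul,
      mul_comm]

lemma scale_one (f : N.O U) : N.scale U (fun _ => 1) f = f := by
  induction f using induction_homogeneous with
  | h0 => simp
  | hadd f g hf hg => simp [hf, hg]
  | hom n f hf => rw [scale_of_mem _ hf, one_smul]

lemma scale_mul (c : ℕ → ℝ) (hc : ∀ i j, c (i + j) = c i * c j) (f g : N.O U) :
    N.scale U c (f * g) = N.scale U c f * N.scale U c g := by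
  induction f using induction_homogeneous with
  | h0 => simp
  | hadd f f' hf hg => simp [hf, hg, add_mul]
  | hom n f hf =>
    induction g using induction_homogeneous with
    | h0 => simp
    | hadd f g hf hg => simp [hf, hg, mul_add]
    | hom k g hg =>
      rw [scale_of_mem _ hf, scale_of_mem _ hg, scale_of_mem _ (gr_mul_mem hf hg), hc,
        smul_mul_smul_comm]

variable (N) in
def comp (U : Opens M) (n : ℕ) : N.O U →ₗ[ℝ] N.O U := N.scale U (Pi.single n 1)

lemma comp_of_mem (hf : f ∈ N.gr U n) : N.comp U n f = f := by
  rw [comp, scale_of_mem _ hf]; simp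

lemma comp_of_mem_ne {n k : ℕ} (hf : f ∈ N.gr U n) (h : n ≠ k) : N.comp U k f = 0 := by
  rw [comp, scale_of_mem _ hf]; simp [h]

lemma comp_mem (n : ℕ) (f : N.O U) : N.comp U n f ∈ N.gr U n := by
  induction f using induction_homogeneous with
  | h0 => simp
  | hadd f g hf hg => rw [map_add]; exact add_mem hf hg
  | hom k f hf =>
    by_cases h : k = n
    · subst h; rwa [comp_of_mem hf]
    · rw [comp_of_mem_ne hf h]; exact zero_mem _

lemma exists_fn_eq (hf : f ∈ N.gr U 0) : ∃ g, N.fn U g = f := by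
  have : f ∈ (N.gr U 0 : Set (N.O U)) := hf
  rwa [← N.fn_range] at this

variable (N) in
/-- The component of degree `0` of a function, as a smooth function: its restriction to the body. -/
def body (U : Opens M) : N.O U →ₗ[ℝ] Smooth m U where
  toFun f := (exists_fn_eq (comp_mem 0 f)).choose
  map_add' f g := by
    apply N.fn_injective
    refine (exists_fn_eq (comp_mem 0 (f + g))).choose_spec.trans ?_
    rw [map_add, map_add, (exists_fn_eq (comp_mem 0 f)).choose_spec,
      (exists_fn_eq (comp_mem 0 g)).choose_spec]
  map_smul' c f := by
    apply N.fn_injective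
    refine (exists_fn_eq (comp_mem 0 (c • f))).choose_spec.trans ?_
    rw [RingHom.id_apply, map_smul, map_smul, (exists_fn_eq (comp_mem 0 f)).choose_spec]

lemma fn_body (f : N.O U) : N.fn U (N.body U f) = N.comp U 0 f :=
  (exists_fn_eq (comp_mem 0 f)).choose_spec

@[simp] lemma body_fn (f : Smooth m U) : N.body U (N.fn U f) = f := by
  apply N.fn_injective
  rw [fn_body, comp_of_mem (fn_mem U f)]

lemma body_of_mem (hf : f ∈ N.gr U n) (hn : n ≠ 0) : N.body U f = 0 := by
  apply N.fn_injective
  rw [fn_body, comp_of_mem_ne hf hn, map_zero]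

@[simp] lemma body_mul (f g : N.O U) : N.body U (f * g) = N.body U f * N.body U g := by
  induction f using induction_homogeneous with
  | h0 => simp
  | hadd f f' hf hg => simp [hf, hg, add_mul]
  | hom n f hf =>
    induction g using induction_homogeneous with
    | h0 => simp
    | hadd f g hf hg => simp [hf, hg, mul_add]
    | hom k g hg =>
      by_cases h : n = 0 ∧ k = 0
      · obtain ⟨rfl, rfl⟩ := h
        obtain ⟨f, rfl⟩ := exists_fn_eq hf
        obtain ⟨g, rfl⟩ := exists_fn_eq hg
        rw [← map_mul, body_fn, body_fn, body_fn]
      · rw [body_of_mem (gr_mul_mem hf hg) (by omega)]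
        by_cases hn : n = 0
        · rw [body_of_mem hg (by omega), mul_zero]
        · rw [body_of_mem hf hn, zero_mul]

lemma res_body {U V : Opens M} (h : U ≤ V) (f : N.O V) : Smooth.res h (N.body V f) =
    N.body U (N.res h f) := by
  apply N.fn_injective
  rw [← res_fn, fn_body, fn_body, comp, comp, res_scale]

/-- Exponents of the monomials of degree `n`. -/
abbrev _root_.GradedGeometry.MonExp {p : ℕ} (r : Fin p → ℕ) (n : ℕ) : Type :=
  {J : MultiExp r // expDeg J.1 = n}

instance (n : ℕ) : Fintype (MonExp r n) := Fintype.ofFinite _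

variable (N) in
/-- Linear combinations of the monomials of degree `n`. -/
def expandDeg (U : Opens M) (q : Idx r → N.O U) (n : ℕ) : (MonExp r n → Smooth m U) →ₗ[ℝ] N.O U :=
  ∑ J : MonExp r n, (LinearMap.mulRight ℝ (monomialOf q J.1.1)).comp
    ((N.fn U).toLinearMap.comp (LinearMap.proj J))

lemma expandDeg_apply (q : Idx r → N.O U) (n : ℕ) (c : MonExp r n → Smooth m U) :
    N.expandDeg U q n c = ∑ J, N.fn U (c J) * monomialOf q J.1.1 := by
  simp [expandDeg]

lemma monomialOf_mem_gr {q : Idx r → N.O U} (hq : ∀ α, q α ∈ N.gr U (idxDeg α)) (J : Idx r → ℕ) :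
    monomialOf q J ∈ N.gr U (expDeg J) := by
  rw [← listDeg_idxList, monomialOf_eq]
  induction idxList r with
  | nil => exact SetLike.one_mem_graded (N.gr U)
  | cons α L ih =>
    refine gr_mul_mem ?_ ih
    have := SetLike.pow_mem_graded (A := N.gr U) (J α) (hq α)
    simpa using this

lemma expandDeg_mem (hq : ∀ α, q α ∈ N.gr U (idxDeg α)) (n : ℕ) (c : MonExp r n → Smooth m U) :
    N.expandDeg U q n c ∈ N.gr U n := by
  rw [expandDeg_apply]
  refine Submodule.sum_mem _ fun J _ => fn_mul_mem _ ?_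
  have := monomialOf_mem_gr hq J.1.1
  rwa [J.2] at this

lemma res_expandDeg {U V : Opens M} (h : U ≤ V) (q : Idx r → N.O V) (n : ℕ)
    (c : MonExp r n → Smooth m V) : N.res h (N.expandDeg V q n c) =
    N.expandDeg U (fun α => N.res h (q α)) n fun J => Smooth.res h (c J) := by
  simp only [expandDeg_apply, map_sum, map_mul, res_fn]
  refine sum_congr rfl fun J _ => ?_
  congr 1
  exact map_monomialOf (N.res h : N.O V →+* N.O U) q _

lemma gradedCommuting (hq : ∀ α, q α ∈ N.gr U (idxDeg α)) : GradedCommuting (N.fn U) q where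
  comm α β := signComm (hq α) (hq β)
  comm_fn f α := by
    have := signComm (fn_mem U f) (hq α)
    simpa [SignComm] using this

lemma comp_expand {q : Idx r → N.O U} (hq : ∀ α, q α ∈ N.gr U (idxDeg α)) (n : ℕ)
    (c : MultiExp r →₀ Smooth m U) : N.comp U n (expand (N.fn U) q c) =
    N.expandDeg U q n fun J => c J.1 := by
  classical
  rw [expandDeg_apply]
  induction c using Finsupp.induction_linear with
  | zero => simp
  | add c d hc hd => simp [hc, hd, sum_add_distrib, add_mul]
  | single K f =>
    rw [expand_single]
    have h1 := fn_mul_mem f (monomialOf_mem_gr hq K.1)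
    by_cases h : expDeg K.1 = n
    · subst h
      rw [comp_of_mem h1, sum_eq_single ⟨K, rfl⟩]
      · simp
      · intro J _ hJ
        rw [Finsupp.single_eq_of_ne, map_zero, zero_mul]
        intro h; exact hJ (Subtype.ext h)
      · simp
    · rw [comp_of_mem_ne h1 h, sum_eq_zero]
      intro J _
      rw [Finsupp.single_eq_of_ne, map_zero, zero_mul]
      intro h'; exact h (by rw [← h']; exact J.2)

lemma expandDeg_eq_expand (q : Idx r → N.O U) (n : ℕ) (c : MonExp r n → Smooth m U) : ∃ d,
    expand (N.fn U) q d = N.expandDeg U q n c := by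
  refine ⟨∑ J, Finsupp.single J.1 (c J), ?_⟩
  rw [map_sum, expandDeg_apply]
  simp only [expand_single]

lemma bijective_expand_iff (hq : ∀ α, q α ∈ N.gr U (idxDeg α)) : Bijective (expand (N.fn U) q) ↔
    ∀ n, Injective (N.expandDeg U q n) ∧ ∀ f ∈ N.gr U n, ∃ c, N.expandDeg U q n c = f := by
  classical
  constructor
  · rintro ⟨hi, hs⟩ n
    constructor
    · rw [← LinearMap.ker_eq_bot, LinearMap.ker_eq_bot']
      intro c hc
      have h1 : expand (N.fn U) q (∑ J : MonExp r n, Finsupp.single J.1 (c J)) = 0 := by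
        rw [map_sum, ← hc, expandDeg_apply]
        simp only [expand_single]
      have h2 := hi (h1.trans (map_zero _).symm)
      funext J
      have h3 := DFunLike.congr_fun h2 J.1
      rw [Finsupp.finsetSum_apply, sum_eq_single J] at h3
      · simpa using h3
      · intro K _ hK
        rw [Finsupp.single_eq_of_ne]
        intro h; exact hK (Subtype.ext h.symm)
      · simp
    · intro f hf
      obtain ⟨c, rfl⟩ := hs f
      exact ⟨_, by rw [← comp_expand hq, comp_of_mem hf]⟩
  · intro h
    constructor
    · rw [← LinearMap.ker_eq_bot, LinearMap.ker_eq_bot']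
      intro c hc
      ext1 J
      have h1 := comp_expand hq (expDeg J.1) c
      rw [hc, map_zero] at h1
      have h2 := (h (expDeg J.1)).1 (h1.symm.trans (map_zero _).symm)
      exact congrFun h2 ⟨J, rfl⟩
    · intro f
      induction f using induction_homogeneous with
      | h0 => exact ⟨0, map_zero _⟩
      | hadd f g hf hg =>
        obtain ⟨c, rfl⟩ := hf
        obtain ⟨d, rfl⟩ := hg
        exact ⟨c + d, map_add _ _ _⟩
      | hom n f hf =>
        obtain ⟨c, rfl⟩ := (h n).2 f hf
        exact expandDeg_eq_expand q n c

variable (N) in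
/-- Coordinates of positive degree over `U`. -/
structure IsCoordinates (U : Opens M) (q : Idx r → N.O U) : Prop where
  mem : ∀ α, q α ∈ N.gr U (idxDeg α)
  bijective : ∀ (U' : Opens M) (h : U' ≤ U),
    Bijective (expand (N.fn U') fun α => N.res h (q α))

variable (N) in
lemma exists_isCoordinates (x : M) : ∃ U : Opens M, x ∈ U ∧ ∃ q, N.IsCoordinates U q := by
  obtain ⟨U, hx, q, hq, hb⟩ := N.exists_coordinates x
  exact ⟨U, hx, q, hq, hb⟩

lemma IsCoordinates.res {U V : Opens M} {q : Idx r → N.O V} (hq : N.IsCoordinates V q) (h : U ≤ V) :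
    N.IsCoordinates U fun α => N.res h (q α) where
  mem α := N.res_mem h _ _ (hq.mem α)
  bijective U' h' := by
    simp only [N.res_res]
    exact hq.bijective U' (h'.trans h)

lemma IsCoordinates.bijective_self (hq : N.IsCoordinates U q) : Bijective (expand (N.fn U) q) := by
  have := hq.bijective U le_rfl
  simpa only [N.res_self] using this

lemma IsCoordinates.injective_expandDeg (hq : N.IsCoordinates U q) (n : ℕ) :
    Injective (N.expandDeg U q n) :=
  ((bijective_expand_iff hq.mem).1 hq.bijective_self n).1

lemma IsCoordinates.exists_expandDeg (hq : N.IsCoordinates U q) (hf : f ∈ N.gr U n) : ∃ c,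
    N.expandDeg U q n c = f :=
  ((bijective_expand_iff hq.mem).1 hq.bijective_self n).2 f hf

lemma isCoordinates_of_locally (hq : ∀ α, q α ∈ N.gr U (idxDeg α))
    (h : ∀ x ∈ U, ∃ (W : Opens M) (hW : W ≤ U), x ∈ W ∧ N.IsCoordinates W fun α => N.res hW (q α)) :
    N.IsCoordinates U q := by
  refine ⟨hq, fun U' hU => ?_⟩
  have hq' : ∀ α, N.res hU (q α) ∈ N.gr U' (idxDeg α) := fun α => N.res_mem hU _ _ (hq α)
  have h' : ∀ x ∈ U', ∃ (W : Opens M) (hW : W ≤ U'), x ∈ W ∧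
      N.IsCoordinates W fun α => N.res hW (N.res hU (q α)) := by
    intro x hx
    obtain ⟨W, hW, hxW, hc⟩ := h x (hU hx)
    refine ⟨W ⊓ U', inf_le_right, ⟨hxW, hx⟩, ?_⟩
    have := hc.res (inf_le_left : W ⊓ U' ≤ W)
    simpa only [N.res_res] using this
  choose! W hW hxW hc using h'
  rw [bijective_expand_iff hq']
  intro n
  constructor
  · rw [← LinearMap.ker_eq_bot, LinearMap.ker_eq_bot']
    intro c hc0
    funext J
    refine Smooth.ext fun x => ?_
    have h1 := congrArg (N.res (hW x x.2)) hc0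
    rw [res_expandDeg, map_zero] at h1
    have h2 := (hc x x.2).injective_expandDeg n (h1.trans (map_zero _).symm)
    have h3 := DFunLike.congr_fun (congrFun h2 J) (⟨x, hxW x x.2⟩ : W x)
    exact h3
  · intro f hf
    have h1 : ∀ x (hx : x ∈ U'), ∃ c, N.expandDeg (W x)
        (fun α => N.res (hW x hx) (N.res hU (q α))) n c = N.res (hW x hx) f :=
      fun x hx => (hc x hx).exists_expandDeg (N.res_mem _ _ _ hf)
    choose c hc' using h1
    have hcompat : ∀ x hx y hy (z : M) (hzx : z ∈ W x) (hzy : z ∈ W y) J,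
        c x hx J ⟨z, hzx⟩ = c y hy J ⟨z, hzy⟩ := by
      intro x hx y hy z hzx hzy J
      have h2 := congrArg (N.res (inf_le_left : W x ⊓ W y ≤ W x)) (hc' x hx)
      have h3 := congrArg (N.res (inf_le_right : W x ⊓ W y ≤ W y)) (hc' y hy)
      rw [res_expandDeg] at h2 h3
      simp only [N.res_res] at h2 h3
      have h4 := ((hc x hx).res (inf_le_left : W x ⊓ W y ≤ W x)).injective_expandDeg n
      simp only [N.res_res] at h4
      have h5 := h4 (h2.trans h3.symm)
      exact DFunLike.congr_fun (congrFun h5 J) (⟨z, hzx, hzy⟩ : (W x ⊓ W y : Opens M))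
    let d : MonExp r n → Smooth m U' := fun J => ⟨fun x => c x x.2 J ⟨x, hxW x x.2⟩,
      contMDiff_of_locally fun x hx => ⟨W x, hxW x hx, c x hx J, fun y hy hy' =>
        hcompat _ _ _ _ _ _ _ _⟩⟩
    refine ⟨d, ext_locally fun x hx => ⟨W x, hW x hx, hxW x hx, ?_⟩⟩
    rw [res_expandDeg, ← hc' x hx]
    congr 1
    funext J
    refine Smooth.ext fun y => ?_
    exact hcompat _ _ _ _ _ _ _ _

lemma bijective_of_surjective {q q' : Idx r → N.O U} (hq : N.IsCoordinates U q)
    (hq' : ∀ α, q' α ∈ N.gr U (idxDeg α)) (hs : Surjective (expand (N.fn U) q')) :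
    Bijective (expand (N.fn U) q') := by
  rw [bijective_expand_iff hq']
  intro n
  have hs' : ∀ f ∈ N.gr U n, ∃ c, N.expandDeg U q' n c = f := by
    intro f hf
    obtain ⟨c, rfl⟩ := hs f
    exact ⟨_, by rw [← comp_expand hq', comp_of_mem hf]⟩
  refine ⟨?_, hs'⟩
  have hm : ∀ (q : Idx r → N.O U), (∀ α, q α ∈ N.gr U (idxDeg α)) → ∀ J : MonExp r n,
      monomialOf q J.1.1 ∈ N.gr U n := by
    intro q hq J
    have := monomialOf_mem_gr hq J.1.1
    rwa [J.2] at this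
  choose a ha using fun J => hq.exists_expandDeg (hm q' hq' J)
  choose b hb using fun J => hs' _ (hm q hq.mem J)
  classical
  have hexp : ∀ c : MonExp r n → Smooth m U,
      N.expandDeg U q' n c = N.expandDeg U q n (Matrix.vecMul c (Matrix.of a)) := by
    intro c
    rw [expandDeg_apply, expandDeg_apply]
    simp only [← ha, expandDeg_apply, Matrix.vecMul, dotProduct, map_sum, map_mul, mul_sum,
      sum_mul, Matrix.of_apply, mul_assoc]
    rw [sum_comm]
  have hBA : Matrix.of b * Matrix.of a = 1 := by
    ext1 K L
    have h1 : N.expandDeg U q n (Matrix.vecMul (b K) (Matrix.of a)) =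
        N.expandDeg U q n (Pi.single K 1) := by
      rw [← hexp, hb, expandDeg_apply, sum_eq_single K]
      · simp
      · intro J _ hJ; simp [Pi.single_eq_of_ne hJ]
      · simp
    have h2 := congrFun (hq.injective_expandDeg n h1) L
    rw [Matrix.one_apply]
    rw [Pi.single_apply] at h2
    refine Eq.trans ?_ (h2.trans ?_)
    · rfl
    · simp [eq_comm]
  have hAB := mul_eq_one_comm.1 hBA
  rw [← LinearMap.ker_eq_bot, LinearMap.ker_eq_bot']
  intro c hc
  rw [hexp] at hc
  have h3 := hq.injective_expandDeg n (hc.trans (map_zero _).symm)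
  rw [← Matrix.vecMul_one c, ← hAB, ← Matrix.vecMul_vecMul, h3, Matrix.zero_vecMul]

end NManifold

lemma exists_common_open {ι : Type*} [Finite ι] (hx : x ∈ U) {P : ι → Opens M → Prop}
    (hP : ∀ i (W W' : Opens M), W' ≤ W → P i W → P i W') (h : ∀ i, ∃ W ≤ U, x ∈ W ∧ P i W) : ∃ W ≤
    U, x ∈ W ∧ ∀ i, P i W := by
  classical
  cases nonempty_fintype ι
  choose W hW hxW hPW using h
  refine ⟨U ⊓ Finset.univ.inf W, inf_le_left, ⟨hx, ?_⟩, fun i => ?_⟩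
  · have : (x : M) ∈ ((Finset.univ.inf W : Opens M) : Set M) := by
      rw [Opens.coe_finset_inf]
      simpa using fun i => hxW i
    exact this
  · exact hP i (W i) _ (inf_le_right.trans (Finset.inf_le (mem_univ i))) (hPW i)

namespace NManifold

lemma mem_generated {i k : ℕ} (h : i ≤ k) (hf : f ∈ N.gr U i) : f ∈
    N.generated k U := Algebra.subset_adjoin ⟨i, h, hf⟩

lemma generated_le_level (k : ℕ) (U : Opens M) : N.generated k U ≤ N.level k U :=
  fun f hf _ hx => ⟨U, le_rfl, hx, by rwa [N.res_self]⟩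

lemma generated_mono {k l : ℕ} (h : k ≤ l) (U : Opens M) : N.generated k U ≤ N.generated l U :=
  Algebra.adjoin_mono fun _ ⟨i, hi, hf⟩ => ⟨i, hi.trans h, hf⟩

lemma level_mono {k l : ℕ} (h : k ≤ l) (U : Opens M) : N.level k U ≤ N.level l U := by
  intro f hf x hx
  obtain ⟨W, hW, hxW, hf⟩ := hf x hx
  exact ⟨W, hW, hxW, generated_mono h W hf⟩

lemma mem_level {i k : ℕ} (h : i ≤ k) (hf : f ∈ N.gr U i) : f ∈
    N.level k U := generated_le_level k U (mem_generated h hf)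

lemma fn_mem_level (k : ℕ) (f : Smooth m U) : N.fn U f ∈ N.level k U :=
  mem_level (Nat.zero_le k) (fn_mem U f)

lemma level_res {U V : Opens M} (h : U ≤ V) {k : ℕ} {f : N.O V} (hf : f ∈ N.level k V) : N.res h f ∈
    N.level k U := by
  intro x hx
  obtain ⟨W, hW, hxW, hf⟩ := hf x (h hx)
  refine ⟨W ⊓ U, inf_le_right, ⟨hxW, hx⟩, ?_⟩
  have := N.res_generated k (inf_le_left : W ⊓ U ≤ W) _ hf
  rwa [N.res_res] at this ⊢

variable (N) in
/-- The functions generated by the coordinates of degree at most `k`. -/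
def polynomials (U : Opens M) (q : Idx r → N.O U) (k : ℕ) : Subalgebra ℝ (N.O U) :=
  Algebra.adjoin ℝ (Set.range (N.fn U) ∪ q '' {α | (α.1 : ℕ) < k})

lemma fn_mem_polynomials (q : Idx r → N.O U) (k : ℕ) (f : Smooth m U) : N.fn U f ∈
    N.polynomials U q k := Algebra.subset_adjoin (Or.inl ⟨f, rfl⟩)

lemma mem_polynomials (q : Idx r → N.O U) {k : ℕ} {α : Idx r} (h : (α.1 : ℕ) < k) : q α ∈
    N.polynomials U q k := Algebra.subset_adjoin (Or.inr ⟨α, h, rfl⟩)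

lemma polynomials_le_generated (hq : ∀ α, q α ∈ N.gr U (idxDeg α)) (k : ℕ) : N.polynomials U q k ≤
    N.generated k U := by
  refine Algebra.adjoin_le ?_
  rintro _ (⟨f, rfl⟩ | ⟨α, hα, rfl⟩)
  · exact mem_generated (Nat.zero_le k) (fn_mem U f)
  · exact mem_generated (Nat.succ_le_of_lt hα) (hq α)

lemma IsCoordinates.generated_le (hq : N.IsCoordinates U q) (k : ℕ) : N.generated k U ≤
    N.polynomials U q k := by
  refine Algebra.adjoin_le ?_
  rintro f ⟨i, hi, hf⟩
  obtain ⟨c, rfl⟩ := hq.exists_expandDeg hf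
  rw [expandDeg_apply]
  refine (N.polynomials U q k).sum_mem fun J _ =>
    (N.polynomials U q k).mul_mem (fn_mem_polynomials q k _) (monomialOf_mem _ fun α hα => ?_)
  refine mem_polynomials q ?_
  have h1 := le_expDeg J.1.1 α
  have h2 := J.2
  have h3 : 1 ≤ J.1.1 α := Nat.one_le_iff_ne_zero.2 hα
  unfold idxDeg at h1
  nlinarith

lemma IsCoordinates.exists_linear_add (hq : N.IsCoordinates U q) (j : Fin p) (hn : n ≤ (j : ℕ) + 1)
    (hf : f ∈ N.gr U n) : ∃ c : Fin (r j) → Smooth m U, ∃ g ∈ N.polynomials U q j, f = ∑ i,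
    N.fn U (c i) * q ⟨j, i⟩ + g := by
  classical
  obtain ⟨d, rfl⟩ := hq.exists_expandDeg hf
  rw [expandDeg_apply]
  refine sum_induction _ (fun f => ∃ c : Fin (r j) → Smooth m U, ∃ g ∈ N.polynomials U q j,
      f = ∑ i, N.fn U (c i) * q ⟨j, i⟩ + g) ?_ ?_ ?_
  · rintro _ _ ⟨c, g, hg, rfl⟩ ⟨c', g', hg', rfl⟩
    refine ⟨c + c', g + g', add_mem hg hg', ?_⟩
    simp only [Pi.add_apply, map_add, add_mul, sum_add_distrib]
    abel
  · exact ⟨0, 0, zero_mem _, by simp⟩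
  · intro J _
    rcases J.1.eq_single_or j (J.2.trans_le hn) with ⟨i, hi⟩ | h
    · refine ⟨Pi.single i (d J), 0, zero_mem _, ?_⟩
      rw [sum_eq_single i]
      · rw [hi, monomialOf_single]; simp
      · intro k _ hk; simp [Pi.single_eq_of_ne hk]
      · simp
    · refine ⟨0, _, ?_, by simp; rfl⟩
      exact mul_mem (S := Subalgebra ℝ (N.O U)) (fn_mem_polynomials q _ _)
        (monomialOf_mem _ fun α hα => mem_polynomials q (h α hα))

end NManifold

namespace Splitting

variable (σ)

variable {σ}

lemma res_mem_linFun {U V : Opens M} (h : U ≤ V) {f : N.O V} (hf : f ∈ σ.linFun j V) : N.res h f ∈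
    σ.linFun j U := by
  obtain ⟨h1, h2, h3⟩ := hf
  refine ⟨N.res_mem h _ _ h1, level_res h h2, Subtype.ext ?_⟩
  rw [σ.natural j h ⟨f, h2⟩ ⟨N.res h f, level_res h h2⟩ rfl, h3]
  simp

lemma eq_zero_of_mem_linFun (hf : f ∈ σ.linFun j U) (hf' : f ∈ N.level j U) : f = 0 := by
  obtain ⟨_, h2, h3⟩ := hf
  have := σ.retract j U ⟨f, h2⟩ hf'
  rw [h3] at this
  exact this.symm

lemma sub_mem_linFun (hf : f ∈ N.gr U ((j : ℕ) + 1)) : f - σ.s j U ⟨f, mem_level le_rfl hf⟩ ∈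
    σ.linFun j U := by
  set g := σ.s j U ⟨f, mem_level le_rfl hf⟩ with hg
  have h1 : (g : N.O U) ∈ N.level ((j : ℕ) + 1) U := level_mono (Nat.le_succ _) U g.2
  refine ⟨Submodule.sub_mem _ hf (σ.degree j U _ ⟨f, _⟩ hf),
    sub_mem (mem_level le_rfl hf) h1, ?_⟩
  have h2 : (⟨f - g, sub_mem (mem_level le_rfl hf) h1⟩ : N.level ((j : ℕ) + 1) U) =
      ⟨f, mem_level le_rfl hf⟩ - ⟨g, h1⟩ := rfl
  rw [h2, map_sub, ← hg, sub_eq_zero]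
  exact Subtype.ext (σ.retract j U ⟨g, h1⟩ g.2).symm

lemma fn_mul_mem_linFun (c : Smooth m U) (hf : f ∈ σ.linFun j U) : N.fn U c * f ∈ σ.linFun j U := by
  obtain ⟨h1, h2, h3⟩ := hf
  refine ⟨fn_mul_mem c h1, mul_mem (S := Subalgebra ℝ (N.O U)) (fn_mem_level _ c) h2, ?_⟩
  have h4 : (⟨N.fn U c * f, mul_mem (S := Subalgebra ℝ (N.O U)) (fn_mem_level _ c) h2⟩ :
      N.level ((j : ℕ) + 1) U) = ⟨N.fn U c, fn_mem_level _ c⟩ * ⟨f, h2⟩ := rfl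
  rw [h4, map_mul, h3, mul_zero]

lemma sum_mem_linFun {ι : Type*} (s : Finset ι) {f : ι → N.O U} (hf : ∀ i, f i ∈ σ.linFun j U) :
    ∑ i ∈ s, f i ∈ σ.linFun j U := by
  refine sum_induction _ (· ∈ σ.linFun j U) ?_ ?_ fun i _ => hf i
  · rintro _ _ ⟨h1, h2, h3⟩ ⟨h1', h2', h3'⟩
    refine ⟨add_mem h1 h1', add_mem h2 h2', ?_⟩
    rw [← AddMemClass.mk_add_mk _ _ _ h2 h2', map_add, h3, h3', add_zero]
  · exact ⟨zero_mem _, zero_mem _, map_zero (σ.s j U)⟩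

lemma mem_linFun_of_locally (hf : f ∈ N.gr U ((j : ℕ) + 1))
    (h : ∀ x ∈ U, ∃ (W : Opens M) (hW : W ≤ U), x ∈ W ∧ N.res hW f ∈ σ.linFun j W) : f ∈
    σ.linFun j U := by
  have h1 : f ∈ N.level ((j : ℕ) + 1) U := mem_level le_rfl hf
  refine ⟨hf, h1, Subtype.ext (ext_locally fun x hx => ?_)⟩
  obtain ⟨W, hW, hxW, -, h2, h3⟩ := h x hx
  refine ⟨W, hW, hxW, ?_⟩
  rw [← σ.natural j hW ⟨f, h1⟩ ⟨N.res hW f, h2⟩ rfl, h3]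
  simp

variable (σ) in
/-- Fibre-linear functions over `U` that span the fibre-linear functions over every smaller open
set. -/
structure IsLinFrame (U : Opens M) (y : Idx r → N.O U) : Prop where
  mem : ∀ α, y α ∈ σ.linFun α.1 U
  span : ∀ (U' : Opens M) (h : U' ≤ U) (j : Fin p), ∀ f ∈ σ.linFun j U',
    ∃ c : Fin (r j) → Smooth m U', f = ∑ i, N.fn U' (c i) * N.res h (y ⟨j, i⟩)

lemma IsLinFrame.res {U V : Opens M} {y : Idx r → N.O V} (hy : σ.IsLinFrame V y) (h : U ≤ V) :
    σ.IsLinFrame U fun α => N.res h (y α) where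
  mem α := res_mem_linFun h (hy.mem α)
  span U' h' j f hf := by
    simp only [N.res_res]
    exact hy.span U' (h'.trans h) j f hf

lemma _root_.GradedGeometry.NManifold.IsCoordinates.isLinFrame (hq : N.IsCoordinates U q) :
    σ.IsLinFrame U fun α => q α - σ.s α.1 U ⟨q α, mem_level le_rfl (hq.mem α)⟩ where
  mem α := sub_mem_linFun (hq.mem α)
  span U' h j f hf := by
    have hy : ∀ i, N.res h (q ⟨j, i⟩ - σ.s j U ⟨q ⟨j, i⟩, mem_level le_rfl (hq.mem ⟨j, i⟩)⟩) ∈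
      σ.linFun j U' := fun i => res_mem_linFun h (sub_mem_linFun (hq.mem ⟨j, i⟩))
    obtain ⟨c, g, hg, hfg⟩ := (hq.res h).exists_linear_add j le_rfl hf.1
    refine ⟨c, ?_⟩
    rw [← sub_eq_zero]
    apply eq_zero_of_mem_linFun (σ := σ) (j := j)
    · have h1 := sum_mem_linFun (σ := σ) (j := j) (Finset.univ : Finset (Option (Fin (r j))))
        (f := fun i => i.elim f fun i => N.fn U' (-c i) *
          N.res h (q ⟨j, i⟩ - σ.s j U ⟨q ⟨j, i⟩, mem_level le_rfl (hq.mem ⟨j, i⟩)⟩)) (by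
          rintro (_ | i)
          · exact hf
          · exact fn_mul_mem_linFun _ (hy i))
      rw [Fintype.sum_option] at h1
      simpa [sub_eq_add_neg] using h1
    · have h2 : f - ∑ i, N.fn U' (c i) *
          N.res h (q ⟨j, i⟩ - σ.s j U ⟨q ⟨j, i⟩, mem_level le_rfl (hq.mem ⟨j, i⟩)⟩) =
          g + ∑ i, N.fn U' (c i) *
            N.res h (σ.s j U ⟨q ⟨j, i⟩, mem_level le_rfl (hq.mem ⟨j, i⟩)⟩ : N.O U) := by
        rw [hfg]
        simp only [map_sub, mul_sub, Finset.sum_sub_distrib]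
        abel
      rw [h2]
      refine add_mem (generated_le_level _ _ (polynomials_le_generated (hq.res h).mem _ hg)) ?_
      exact Subalgebra.sum_mem _ fun i _ => mul_mem (fn_mem_level _ _) (level_res h (Subtype.mem _))

variable (σ) in
lemma exists_isLinFrame (x : M) : ∃ U : Opens M, x ∈ U ∧ ∃ y, σ.IsLinFrame U y := by
  obtain ⟨U, hx, q, hq⟩ := N.exists_isCoordinates x
  exact ⟨U, hx, _, hq.isLinFrame⟩

lemma IsLinFrame.isCoordinates {y : Idx r → N.O U} (hy : σ.IsLinFrame U y) :
    N.IsCoordinates U y := by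
  have hmem : ∀ α, y α ∈ N.gr U (idxDeg α) := fun α => (hy.mem α).1
  refine isCoordinates_of_locally hmem fun x hx => ?_
  obtain ⟨V, hxV, q, hq⟩ := N.exists_isCoordinates x
  let T : ∀ W : Opens M, W ≤ V ⊓ U → Subalgebra ℝ (N.O W) := fun W hW =>
    Algebra.adjoin ℝ (Set.range (N.fn W) ∪ Set.range fun α => N.res (hW.trans inf_le_right) (y α))
  have hT : ∀ (W W' : Opens M) (hW : W ≤ V ⊓ U) (h : W' ≤ W), ∀ f ∈ T W hW,
      N.res h f ∈ T W' (h.trans hW) := by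
    intro W W' hW h
    suffices T W hW ≤ (T W' (h.trans hW)).comap (N.res h) from this
    refine Algebra.adjoin_le ?_
    rintro _ (⟨f, rfl⟩ | ⟨α, rfl⟩)
    · exact Algebra.subset_adjoin (Or.inl ⟨_, (res_fn h f).symm⟩)
    · exact Algebra.subset_adjoin (Or.inr ⟨α, (N.res_res _ _ _).symm⟩)
  let P : Idx r → Opens M → Prop := fun α W =>
    ∃ hW : W ≤ V ⊓ U, N.res (hW.trans inf_le_left) (q α) ∈ T W hW
  have hP : ∀ α (W W' : Opens M), W' ≤ W → P α W → P α W' := by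
    rintro α W W' h ⟨hW, hα⟩
    refine ⟨h.trans hW, ?_⟩
    have := hT W W' hW h _ hα
    rwa [N.res_res] at this
  have hlow : ∀ (j : ℕ) (α : Idx r), (α.1 : ℕ) = j → ∃ W ≤ V ⊓ U, x ∈ W ∧ P α W := by
    intro j
    induction j using Nat.strong_induction_on with
    | _ j ih =>
    rintro ⟨j', i⟩ hj
    simp only at hj
    obtain ⟨W, hW, hxW, hPW⟩ := exists_common_open (ι := {β : Idx r // (β.1 : ℕ) < j})
      (P := fun β => P β.1) (⟨hxV, hx⟩ : x ∈ V ⊓ U) (fun β => hP β.1)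
      fun β => ih _ β.2 β.1 rfl
    have hqW := hq.res (hW.trans inf_le_left)
    set s := σ.s j' W ⟨_, mem_level le_rfl (hqW.mem ⟨j', i⟩)⟩ with hs
    obtain ⟨W', hW', hxW', hsW⟩ := s.2 x hxW
    have hqW' := hq.res (hW'.trans (hW.trans inf_le_left))
    have h1 : N.res hW' s ∈ T W' (hW'.trans hW) := by
      refine (hqW'.generated_le j').trans ?_ hsW
      refine Algebra.adjoin_le ?_
      rintro _ (⟨f, rfl⟩ | ⟨β, hβ, rfl⟩)
      · exact Algebra.subset_adjoin (Or.inl ⟨_, rfl⟩)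
      · exact (hP β _ _ hW' (hPW ⟨β, by simpa [← hj] using hβ⟩)).2
    have h2 := sub_mem_linFun (σ := σ) (hqW.mem ⟨j', i⟩)
    obtain ⟨c, hc⟩ := hy.span W' ((hW'.trans hW).trans inf_le_right) j' _ (res_mem_linFun hW' h2)
    refine ⟨W', hW'.trans hW, hxW', hW'.trans hW, ?_⟩
    rw [map_sub, N.res_res, sub_eq_iff_eq_add] at hc
    rw [hc]
    refine add_mem (Subalgebra.sum_mem _ fun k _ => mul_mem
      (Algebra.subset_adjoin (Or.inl ⟨_, rfl⟩)) (Algebra.subset_adjoin (Or.inr ⟨⟨j', k⟩, rfl⟩))) h1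
  obtain ⟨W, hW, hxW, hPW⟩ := exists_common_open (⟨hxV, hx⟩ : x ∈ V ⊓ U) hP fun α => hlow _ α rfl
  refine ⟨W, hW.trans inf_le_right, hxW, fun α => N.res_mem _ _ _ (hmem α), fun W' h' => ?_⟩
  simp only [N.res_res]
  have hqW := hq.res ((h'.trans hW).trans inf_le_left)
  refine bijective_of_surjective hqW (fun α => N.res_mem _ _ _ (hmem α)) ?_
  have hgc := gradedCommuting (N := N) (q := fun α => N.res ((h'.trans hW).trans inf_le_right) (y α))
    fun α => N.res_mem _ _ _ (hmem α)
  have hgc' := gradedCommuting hqW.mem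
  have hr := LinearMap.range_eq_top.2 hqW.bijective_self.2
  refine LinearMap.range_eq_top.1 (top_le_iff.1 ?_)
  rw [hgc.range_expand, ← hr, hgc'.range_expand]
  refine Subalgebra.toSubmodule.monotone (Algebra.adjoin_le ?_)
  rintro _ (⟨f, rfl⟩ | ⟨α, rfl⟩)
  · exact Algebra.subset_adjoin (Or.inl ⟨_, rfl⟩)
  · exact (hP α _ _ h' (hPW α)).2

end Splitting

lemma exists_bump (U : Opens M) (hx : x ∈ U) : ∃ χ : 𝒞, tsupport χ ⊆ U ∧ ∃ W ≤ U, x ∈ W ∧ ∀ y ∈ W,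
    χ y = 1 := by
  obtain ⟨f, -, hf⟩ := (SmoothBumpFunction.nhds_basis_tsupport (I := 𝓡 m) x).mem_iff.1
    (U.isOpen.mem_nhds hx)
  obtain ⟨W, hW, hWo, hxW⟩ := mem_nhds_iff.1 f.eventuallyEq_one
  exact ⟨⟨f, f.contMDiff⟩, hf, ⟨W, hWo⟩ ⊓ U, inf_le_right, ⟨hxW, hx⟩, fun y hy => hW hy.1⟩

/-- The product of a function supported in `U` and a smooth function on `U`, extended by zero. -/
def cutoff (χ : 𝒞) (hχ : tsupport χ ⊆ U) (f : Smooth m U) : 𝒞 :=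
  ⟨fun x => χ x * extZero f x, by
    refine contMDiff_of_tsupport fun x hx => ?_
    have h1 : x ∈ U := hχ (closure_mono (Function.support_mul_subset_left _ _) hx)
    exact χ.contMDiff.contMDiffAt.mul (f.contMDiffAt h1)⟩

lemma cutoff_apply (χ : 𝒞) (hχ : tsupport χ ⊆ U) (f : Smooth m U) (x : U) : cutoff χ hχ f x =
    χ x * f x := by
  change χ x * extZero f x = _
  rw [extZero_apply]

lemma exists_global (f : Smooth m U) (hx : x ∈ U) : ∃ F : 𝒞, ∃ (W : Opens M) (hW : W ≤ U), x ∈ W ∧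
    Smooth.res hW f = globRes W F := by
  obtain ⟨χ, hχ, W, hW, hxW, h1⟩ := exists_bump (m := m) U hx
  refine ⟨cutoff χ hχ f, W, hW, hxW, Smooth.ext fun y => ?_⟩
  have := cutoff_apply χ hχ f ⟨y, hW y.2⟩
  simp only [h1 y y.2, one_mul] at this
  exact this.symm

lemma globRes_mul (U : Opens M) (f g : 𝒞) : globRes U (f * g) = globRes U f * globRes U g := rfl

lemma res_globRes {U V : Opens M} (h : U ≤ V) (f : 𝒞) : Smooth.res h (globRes V f) =
    globRes U f := rfl

namespace GradedBundle

lemma Covec.ext {θ θ' : V.Covec j U} (h : ∀ x y, θ.1 x y = θ'.1 x y) : θ = θ' :=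
  Subtype.ext (funext fun x => LinearMap.ext (h x))

def Covec.res (h : U ≤ W) : V.Covec j W →ₗ[ℝ] V.Covec j U where
  toFun θ := ⟨fun x => θ.1 ⟨x, h x.2⟩, fun X => (θ.2 X).comp (contMDiff_inclusion h)⟩
  map_add' _ _ := rfl
  map_smul' _ _ := rfl

def Covec.mul (f : Smooth m U) (θ : V.Covec j U) : V.Covec j U :=
  ⟨fun x => f x • θ.1 x, fun X => f.contMDiff.mul (θ.2 X)⟩

@[simp] lemma Covec.mul_apply (f : Smooth m U) (θ : V.Covec j U) (x : U) : (Covec.mul f θ).1 x =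
    f x • θ.1 x := rfl

@[simp] lemma pair_apply (θ : V.Covec j U) (X : V.Sect j) (x : U) : V.pair θ X x =
    θ.1 x (X x) := rfl

lemma covec_sum_apply {κ : Type*} (s : Finset κ) (θ : κ → V.Covec j U) (x : U) :
    (∑ i ∈ s, θ i).1 x = ∑ i ∈ s, (θ i).1 x := by
  rw [Submodule.coe_sum, Finset.sum_apply]

lemma mem_covec_of_locally {θ : ∀ x : U, V.E j x →ₗ[ℝ] ℝ} (h : ∀ x ∈ U,
      ∃ (W : Opens M) (_ : x ∈ W) (η : V.Covec j W), ∀ (y : M) (hy : y ∈ W) (hy' : y ∈ U),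
      θ ⟨y, hy'⟩ = η.1 ⟨y, hy⟩) : θ ∈ V.Covec j U := by
  intro X
  refine contMDiff_of_locally fun x hx => ?_
  obtain ⟨W, hW, η, hη⟩ := h x hx
  exact ⟨W, hW, V.pair η X, fun y hy hy' => by rw [hη y hy hy']; rfl⟩

end GradedBundle

lemma finrank_fiber (V : GradedBundle.{u, w} m M r) (j : Fin p) (x : M) :
    Module.finrank ℝ (V.E j x) = r j := by
  have e := (trivializationAt (𝓔 j) (V.E j) x).linearEquivAt ℝ x
    (mem_baseSet_trivializationAt _ _ x)
  rw [e.finrank_eq]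
  simp

lemma finite_fiber (V : GradedBundle.{u, w} m M r) (j : Fin p) (x : M) :
    Module.Finite ℝ (V.E j x) := by
  have e := (trivializationAt (𝓔 j) (V.E j) x).linearEquivAt ℝ x
    (mem_baseSet_trivializationAt _ _ x)
  exact Module.Finite.equiv e.symm

namespace Frame

variable {U : Opens M} (b : Frame V U)

def res (b : Frame V W) (h : U ≤ W) : Frame V U where
  e := b.e
  θ α := Covec.res h (b.θ α)
  dual j i i' x := b.dual j i i' ⟨x, h x.2⟩

lemma sum_smul (j : Fin p) (x : U) (y : V.E j x) : ∑ i,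
    (b.θ ⟨j, i⟩).1 x y • (b.e ⟨j, i⟩ x : V.E j x) = y := by
  have := finite_fiber V j x
  let s : Fin (r j) → V.E j x := fun i => b.e ⟨j, i⟩ x
  have hli : LinearIndependent ℝ s := by
    rw [Fintype.linearIndependent_iff]
    intro c hc i
    have h1 := congrArg ((b.θ ⟨j, i⟩).1 x) hc
    simpa [s, b.dual] using h1
  have hsp := hli.span_eq_top_of_card_eq_finrank' (by rw [finrank_fiber]; simp)
  have hy : y ∈ span ℝ (Set.range s) := by
    rw [hsp]; trivial
  obtain ⟨c, rfl⟩ := (Submodule.mem_span_range_iff_exists_fun ℝ).1 hy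
  refine sum_congr rfl fun i _ => ?_
  simp [s, b.dual]

lemma covec_eq (θ : V.Covec j U) : θ = ∑ i, Covec.mul (V.pair θ (b.e ⟨j, i⟩)) (b.θ ⟨j, i⟩) := by
  refine Covec.ext fun x y => ?_
  rw [covec_sum_apply]
  conv_lhs => rw [← b.sum_smul j x y]
  simp [mul_comm]

end Frame

lemma exists_frame_of_trivializations (V : GradedBundle.{u, w} m M r)
    (e : ∀ j, Trivialization (𝓔 j) (π (𝓔 j) (V.E j))) [∀ j, MemTrivializationAtlas (e j)]
    (hx : x ∈ U) (hxe : ∀ j, x ∈ (e j).baseSet) : ∃ W ≤ U, x ∈ W ∧ ∃ b : Frame V W,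
    ∀ α (y : W) (z : V.E α.1 y), (y : M) ∈ (e α.1).baseSet ∧ (b.θ α).1 y z =
    (e α.1 ⟨y, z⟩).2 α.2 := by
  obtain ⟨U', hU', hxU', hb⟩ := exists_common_open (P := fun j W => (W : Set M) ⊆ (e j).baseSet) hx
    (fun j W W' h h' => (show (W' : Set M) ⊆ W from h).trans h')
    fun j => ⟨U ⊓ ⟨(e j).baseSet, (e j).open_baseSet⟩, inf_le_left,
      ⟨hx, hxe j⟩, fun y hy => hy.2⟩
  obtain ⟨χ, hχ, W, hW, hxW, h1⟩ := exists_bump (m := m) U' hxU'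
  let B := fun j => (EuclideanSpace.basisFun (Fin (r j)) ℝ).toBasis
  refine ⟨W, hW.trans hU', hxW, ⟨fun α => ⟨fun y => χ y • (e α.1).localFrame (B α.1) α.2 y, ?_⟩,
    fun α => ⟨fun y => (EuclideanSpace.proj α.2 : _ →L[ℝ] ℝ).toLinearMap.comp
      ((e α.1).linearMapAt ℝ y), fun X => ?_⟩, ?_⟩, fun α y z => ⟨hb α.1 (hW y.2), ?_⟩⟩
  · exact ContMDiffOn.smul_section_of_tsupport χ.contMDiff.contMDiffOn U'.isOpen hχ
      (((e α.1).contMDiffOn_localFrame_baseSet ∞ (B α.1) α.2).mono (hb α.1))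
  · refine contMDiff_of_locally fun y hy => ⟨U', hW hy, ⟨fun y => ((e α.1) ⟨y, X y⟩).2 α.2, ?_⟩, ?_⟩
    · intro y
      refine (contMDiffAt_subtype_iff (f := fun y => ((e α.1) ⟨y, X y⟩).2 α.2)).2 ?_
      have h2 := ((e α.1).contMDiffAt_section_iff (IB := 𝓡 m) (n := ∞) (hb α.1 y.2)).1
        X.contMDiff.contMDiffAt
      exact ((EuclideanSpace.proj α.2 : EuclideanSpace ℝ (Fin (r α.1)) →L[ℝ] ℝ).contDiff
        |>.contMDiff.contMDiffAt).comp _ h2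
    · intro z hz hz'
      have := (e α.1).coe_linearMapAt_of_mem (R := ℝ) (hb α.1 hz)
      simp only [LinearMap.comp_apply]
      rw [this]
      rfl
  · intro j i i' y
    have hy := hb j (hW y.2)
    have h3 := (e j).coe_linearMapAt_of_mem (R := ℝ) hy
    change ((EuclideanSpace.proj i : _ →L[ℝ] ℝ).toLinearMap.comp ((e j).linearMapAt ℝ y))
      (χ y • (e j).localFrame (B j) i' y) = _
    rw [h1 y y.2, one_smul, Trivialization.localFrame_apply_of_mem_baseSet _ _ hy,
      Trivialization.basisAt, Module.Basis.map_apply]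
    have h4 : (e j).linearMapAt ℝ (y : M) (((e j).linearEquivAt ℝ (y : M) hy).symm (B j i')) =
        B j i' := by
      have := ((e j).linearEquivAt ℝ (y : M) hy).apply_symm_apply (B j i')
      rw [h3]
      exact this
    rw [LinearMap.comp_apply, h4]
    simp [B, EuclideanSpace.basisFun_apply]
  · have h3 := (e α.1).coe_linearMapAt_of_mem (R := ℝ) (hb α.1 (hW y.2))
    simp only [LinearMap.comp_apply]
    rw [h3]
    rfl

lemma exists_frame (V : GradedBundle.{u, w} m M r) (hx : x ∈ U) : ∃ W ≤ U, x ∈ W ∧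
    Nonempty (Frame V W) := by
  obtain ⟨W, hW, hxW, b, -⟩ := exists_frame_of_trivializations V
    (fun j => trivializationAt (𝓔 j) (V.E j) x) hx
    fun j => mem_baseSet_trivializationAt _ _ x
  exact ⟨W, hW, hxW, ⟨b⟩⟩

lemma contMDiff_section_of_frames (Z : ∀ x, V.E j x) (h : ∀ x : M, ∃ U : Opens M, x ∈ U ∧ ∃ b :
      Frame V U, ∀ i, ∃ g : Smooth m U, ∀ y : U, (b.θ ⟨j, i⟩).1 y (Z y) = g y) :
    ContMDiff (𝓡 m) ((𝓡 m).prod 𝓘(ℝ, (𝓔 j))) ∞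
    (fun x => (⟨x, Z x⟩ : TotalSpace (𝓔 j) (V.E j))) := by
  intro x
  obtain ⟨U, hx, b, hb⟩ := h x
  choose g hg using hb
  have h1 : ContMDiffAt (𝓡 m) ((𝓡 m).prod 𝓘(ℝ, (𝓔 j))) ∞
      (fun x => (⟨x, ∑ i, extZero (g i) x • (b.e ⟨j, i⟩ : V.Sect j) x⟩ :
        TotalSpace (𝓔 j) (V.E j))) x :=
    ContMDiffAt.sum_section fun i _ =>
      ((g i).contMDiffAt hx).smul_section (b.e ⟨j, i⟩).contMDiff.contMDiffAt
  refine h1.congr_of_eventuallyEq ?_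
  filter_upwards [U.isOpen.mem_nhds hx] with y hy
  congr 1
  rw [← b.sum_smul j ⟨y, hy⟩ (Z y)]
  refine sum_congr rfl fun i _ => ?_
  rw [hg i ⟨y, hy⟩, extZero_of_mem _ hy]

lemma exists_sect_apply_eq (y : V.E j x) : ∃ X : V.Sect j, X x = y := by
  obtain ⟨U, -, hx, ⟨b⟩⟩ := exists_frame V (Opens.mem_top x)
  refine ⟨∑ i, (b.θ ⟨j, i⟩).1 ⟨x, hx⟩ y • (b.e ⟨j, i⟩ : V.Sect j), ?_⟩
  conv_rhs => rw [← b.sum_smul j ⟨x, hx⟩ y]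
  change ContMDiffSection.coeAddHom _ _ _ _ _ _ = _
  rw [map_sum, Finset.sum_apply]
  rfl

lemma sect_ext_of_covec {X Y : V.Sect j}
    (h : ∀ (U : Opens M) (θ : V.Covec j U) (x : U), θ.1 x (X x) = θ.1 x (Y x)) : X = Y := by
  ext x
  obtain ⟨U, -, hx, ⟨b⟩⟩ := exists_frame V (Opens.mem_top x)
  rw [← b.sum_smul j ⟨x, hx⟩ (X x), ← b.sum_smul j ⟨x, hx⟩ (Y x)]
  simp only [h]

lemma exists_sect (Λ : ∀ U, V.Covec j U →ₗ[ℝ] Smooth m U) (hres :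
      ∀ {U W : Opens M} (h : U ≤ W) (θ : V.Covec j W), Λ U (Covec.res h θ) = Smooth.res h (Λ W θ))
    (hmul : ∀ U (f : Smooth m U) (θ : V.Covec j U), Λ U (Covec.mul f θ) = f * Λ U θ) : ∃ Z :
    V.Sect j, ∀ U (θ : V.Covec j U), V.pair θ Z = Λ U θ := by
  choose W _ hxW b using fun x : M => exists_frame V (Opens.mem_top x)
  let b' := fun x => (b x).some
  let Z : ∀ x, V.E j x := fun x =>
    ∑ i, Λ (W x) ((b' x).θ ⟨j, i⟩) ⟨x, hxW x⟩ • ((b' x).e ⟨j, i⟩ : V.Sect j) x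
  have hZ : ∀ U (θ : V.Covec j U) (x : U), θ.1 x (Z x) = Λ U θ x := by
    intro U θ x
    let c := (b' x).res (inf_le_right : U ⊓ W x ≤ W x)
    have h1 := c.covec_eq (Covec.res (inf_le_left : U ⊓ W x ≤ U) θ)
    have h2 := congrArg (fun η => Λ (U ⊓ W x) η ⟨x, x.2, hxW x⟩) h1
    simp only [map_sum, hmul] at h2
    rw [hres, Smooth.res_apply] at h2
    rw [h2]
    change _ = ContMDiffMap.evalRingHom (I := 𝓡 m) (I' := 𝓘(ℝ, ℝ)) (n := ∞)
      (⟨x, x.2, hxW x⟩ : (U ⊓ W x : Opens M)) _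
    rw [map_sum]
    simp only [map_sum, map_smul]
    refine sum_congr rfl fun i _ => ?_
    rw [map_mul, mul_comm, smul_eq_mul]
    congr 1
    have := congrArg (fun f => f ⟨x, x.2, hxW x⟩)
      (hres (inf_le_right : U ⊓ W x ≤ W x) ((b' x).θ ⟨j, i⟩))
    exact this.symm
  refine ⟨⟨Z, contMDiff_section_of_frames Z fun x => ⟨W x, hxW x, b' x, fun i =>
    ⟨Λ (W x) ((b' x).θ ⟨j, i⟩), fun y => hZ _ _ y⟩⟩⟩, fun U θ => Smooth.ext fun x => hZ U θ x⟩

namespace Identification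

variable (ι)

lemma coord_mem_linFun (θ : V.Covec j U) : ι.coord j U θ ∈ σ.linFun j U := by
  rw [← ι.range]
  exact ⟨θ, rfl⟩

lemma coord_mem (θ : V.Covec j U) : ι.coord j U θ ∈ N.gr U ((j : ℕ) + 1) := (ι.coord_mem_linFun θ).1

lemma res_coord (h : U ≤ W) (θ : V.Covec j W) : N.res h (ι.coord j W θ) =
    ι.coord j U (Covec.res h θ) :=
  (ι.natural j h θ _ fun _ => rfl).symm

lemma coord_mul (f : Smooth m U) (θ : V.Covec j U) : ι.coord j U (Covec.mul f θ) =
    N.fn U f * ι.coord j U θ :=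
  ι.linear j U f θ _ fun _ => rfl

/-- The coordinates given by a frame. -/
def frameCoord (b : Frame V U) (α : Idx r) : N.O U := ι.coord α.1 U (b.θ α)

lemma frameCoord_mem (b : Frame V U) (α : Idx r) : ι.frameCoord b α ∈
    N.gr U (idxDeg α) := ι.coord_mem _

lemma res_frameCoord (h : U ≤ W) (b : Frame V W) (α : Idx r) : N.res h (ι.frameCoord b α) =
    ι.frameCoord (b.res h) α := ι.res_coord h _

lemma coord_eq_sum (b : Frame V U) (θ : V.Covec j U) : ι.coord j U θ = ∑ i,
    N.fn U (V.pair θ (b.e ⟨j, i⟩)) * ι.frameCoord b ⟨j, i⟩ := by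
  conv_lhs => rw [b.covec_eq θ]
  rw [map_sum]
  exact sum_congr rfl fun i _ => ι.coord_mul _ _

lemma isLinFrame (b : Frame V U) : σ.IsLinFrame U (ι.frameCoord b) where
  mem α := ι.coord_mem_linFun _
  span U' h j f hf := by
    rw [← ι.range] at hf
    obtain ⟨θ, rfl⟩ := hf
    refine ⟨fun i => V.pair θ (b.e ⟨j, i⟩), ?_⟩
    rw [ι.coord_eq_sum (b.res h) θ]
    simp only [ι.res_frameCoord]
    rfl

lemma isCoordinates (b : Frame V U) : N.IsCoordinates U (ι.frameCoord b) :=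
  (ι.isLinFrame b).isCoordinates

end Identification

namespace NManifold

variable (N) in
/-- The functions of degree `n`, for an integer `n`. -/
def grInt (U : Opens M) (n : ℤ) : Submodule ℝ (N.O U) := if 0 ≤ n then N.gr U n.toNat else ⊥

@[simp] lemma grInt_natCast (U : Opens M) (n : ℕ) : N.grInt U n = N.gr U n := by
  simp [grInt]

lemma grInt_of_neg (U : Opens M) {n : ℤ} (h : n < 0) : N.grInt U n = ⊥ := by
  simp [grInt, h]

lemma mem_grInt_cases {n : ℤ} (hf : f ∈ N.grInt U n) : f = 0 ∨ ∃ k : ℕ, n = k ∧ f ∈ N.gr U k := by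
  by_cases h : 0 ≤ n
  · obtain ⟨k, rfl⟩ := Int.eq_ofNat_of_zero_le h
    exact Or.inr ⟨k, rfl, by simpa using hf⟩
  · rw [grInt_of_neg U (not_le.1 h)] at hf
    exact Or.inl (by simpa using hf)

lemma mem_grInt_of_eq {n k : ℤ} (hf : f ∈ N.grInt U n) (h : n = k) : f ∈ N.grInt U k := h ▸ hf

lemma fn_mem_grInt (U : Opens M) (f : Smooth m U) : N.fn U f ∈ N.grInt U 0 := by
  have h := grInt_natCast (N := N) U 0
  rw [Nat.cast_zero] at h
  rw [h]
  exact fn_mem U f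

lemma grInt_mul_mem {i j : ℤ} {f g : N.O U} (hf : f ∈ N.grInt U i) (hg : g ∈ N.grInt U j) : f * g ∈
    N.grInt U (i + j) := by
  rcases mem_grInt_cases hf with rfl | ⟨a, rfl, ha⟩
  · simp
  rcases mem_grInt_cases hg with rfl | ⟨b, rfl, hb⟩
  · simp
  rw [← Nat.cast_add, grInt_natCast]
  exact gr_mul_mem ha hb

lemma body_of_mem_grInt {n : ℤ} (hf : f ∈ N.grInt U n) (hn : n ≠ 0) : N.body U f = 0 := by
  rcases mem_grInt_cases hf with rfl | ⟨a, rfl, ha⟩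
  · simp
  · exact body_of_mem ha (by exact_mod_cast hn)

lemma mul_comm_grInt {i j : ℤ} {f g : N.O U} (hf : f ∈ N.grInt U i) (hg : g ∈ N.grInt U j) : f * g =
    (-1 : ℝ) ^ (i * j) • (g * f) := by
  rcases mem_grInt_cases hf with rfl | ⟨a, rfl, ha⟩
  · simp
  rcases mem_grInt_cases hg with rfl | ⟨b, rfl, hb⟩
  · simp
  have := signComm ha hb
  rw [SignComm] at this
  rw [this]
  norm_cast

variable (N) in
/-- The automorphism that multiplies the functions of degree `n` by `(-1) ^ (d * n)`. -/
def twist (U : Opens M) (d : ℤ) : N.O U →ₗ[ℝ] N.O U := N.scale U fun n => (-1 : ℝ) ^ (d * n)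

lemma twist_of_mem (d : ℤ) (hf : f ∈ N.gr U n) : N.twist U d f =
    (-1 : ℝ) ^ (d * n) • f := scale_of_mem _ hf

lemma twist_of_mem_grInt (d : ℤ) {n : ℤ} (hf : f ∈ N.grInt U n) : N.twist U d f =
    (-1 : ℝ) ^ (d * n) • f := by
  rcases mem_grInt_cases hf with rfl | ⟨a, rfl, ha⟩
  · simp
  · exact twist_of_mem d ha

@[simp] lemma twist_fn (U : Opens M) (d : ℤ) (f : Smooth m U) : N.twist U d (N.fn U f) =
    N.fn U f := by
  rw [twist_of_mem d (fn_mem U f)]; simp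

lemma twist_mul (d : ℤ) (f g : N.O U) : N.twist U d (f * g) = N.twist U d f * N.twist U d g := by
  refine scale_mul _ (fun i j => ?_) f g
  push_cast
  rw [mul_add, zpow_add₀ (by norm_num)]

lemma twist_mem (d : ℤ) (hf : f ∈ N.gr U n) : N.twist U d f ∈ N.gr U n := by
  rw [twist_of_mem d hf]; exact smul_mem _ _ hf

lemma neg_one_zpow_mul_self (n : ℤ) : (-1 : ℝ) ^ n * (-1 : ℝ) ^ n = 1 := by
  rw [← mul_zpow]; simp

lemma twist_twist (d : ℤ) (f : N.O U) : N.twist U d (N.twist U d f) = f := by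
  rw [twist, scale_scale]
  simp only [neg_one_zpow_mul_self]
  exact scale_one f

lemma res_twist (h : U ≤ W) (d : ℤ) (f : N.O W) : N.res h (N.twist W d f) =
    N.twist U d (N.res h f) := res_scale h _ f

lemma exists_glue_operator {B : Opens M → Prop}
    (hB : ∀ (U : Opens M), ∀ x ∈ U, ∃ W ≤ U, x ∈ W ∧ B W) (hB' : ∀ U W, U ≤ W → B W → B U)
    (T : ∀ U, B U → N.O U →ₗ[ℝ] N'.O U) (d : ℤ) (hT : ∀ U W (h : U ≤ W) (hW : B W) (f : N.O W),
      N'.res h (T W hW f) = T U (hB' U W h hW) (N.res h f))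
    (hd : ∀ U (hU : B U) n, ∀ f ∈ N.gr U n, T U hU f ∈ N'.grInt U (n + d)) : ∃ S : ∀ U,
    N.O U →ₗ[ℝ] N'.O U, (∀ U hU, S U = T U hU) ∧
    (∀ U W (h : U ≤ W) (f : N.O W), N'.res h (S W f) = S U (N.res h f)) ∧ ∀ U n, ∀ f ∈ N.gr U n,
    S U f ∈ N'.grInt U (n + d) := by
  have huniq : ∀ U (f : N.O U) (g g' : N'.O U),
      (∀ W (h : W ≤ U) (hW : B W), N'.res h g = T W hW (N.res h f)) →
      (∀ W (h : W ≤ U) (hW : B W), N'.res h g' = T W hW (N.res h f)) → g = g' := by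
    intro U f g g' hg hg'
    refine ext_locally fun x hx => ?_
    obtain ⟨W, hW, hxW, hBW⟩ := hB U x hx
    exact ⟨W, hW, hxW, (hg W hW hBW).trans (hg' W hW hBW).symm⟩
  have hhom : ∀ U n, ∀ f ∈ N.gr U n, ∃ g ∈ N'.grInt U (n + d),
      ∀ W (h : W ≤ U) (hW : B W), N'.res h g = T W hW (N.res h f) := by
    intro U n f hf
    by_cases hn : (n : ℤ) + d < 0
    · refine ⟨0, zero_mem _, fun W h hW => ?_⟩
      have := hd W hW n _ (N.res_mem h _ _ hf)
      rw [grInt_of_neg W hn, Submodule.mem_bot] at this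
      rw [this, map_zero]
    · obtain ⟨k, hk⟩ := Int.eq_ofNat_of_zero_le (not_lt.1 hn)
      choose! W hW hxW hBW using hB U
      classical
      let F : ∀ x, N'.O (W x) := fun x => if hx : x ∈ U then
        T (W x) (hBW x hx) (N.res (hW x hx) f) else 0
      have hF : ∀ x (hx : x ∈ U), F x = T (W x) (hBW x hx) (N.res (hW x hx) f) :=
        fun x hx => by simp [F, hx]
      obtain ⟨g, hg, hg'⟩ := exists_glue (N := N') (U := U) (n := k) W hW hxW F (by
          intro x hx
          rw [hF x hx]
          have := hd _ (hBW x hx) n _ (N.res_mem (hW x hx) _ _ hf)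
          rw [hk] at this
          simpa using this) (by
          intro x hx y hy
          rw [hF x hx, hF y hy, hT _ _ _ (hBW x hx), hT _ _ _ (hBW y hy), N.res_res, N.res_res])
      refine ⟨g, by rw [hk]; simpa using hg, fun W' h' hW' => ?_⟩
      refine ext_locally fun x hx => ⟨W' ⊓ W x, inf_le_left, ⟨hx, hxW x (h' hx)⟩, ?_⟩
      have h1 := congrArg (N'.res (inf_le_right : W' ⊓ W x ≤ W x)) (hg' x (h' hx))
      rw [hF x (h' hx), hT _ _ _ (hBW x (h' hx)), N.res_res, N'.res_res] at h1
      rw [N'.res_res, hT _ _ _ hW', N.res_res, h1]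
  have hex : ∀ U (f : N.O U), ∃ g, ∀ W (h : W ≤ U) (hW : B W),
      N'.res h g = T W hW (N.res h f) := by
    intro U f
    induction f using induction_homogeneous with
    | h0 => exact ⟨0, by simp⟩
    | hadd f f' hf hf' =>
      obtain ⟨g, hg⟩ := hf
      obtain ⟨g', hg'⟩ := hf'
      exact ⟨g + g', fun W h hW => by simp [hg W h hW, hg' W h hW]⟩
    | hom n f hf =>
      obtain ⟨g, -, hg⟩ := hhom U n f hf
      exact ⟨g, hg⟩
  choose S hS using hex
  refine ⟨fun U => ⟨⟨S U, fun f g => ?_⟩, fun c f => ?_⟩, fun U hU => ?_, fun U W h f => ?_, ?_⟩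
  · exact huniq U _ _ _ (hS U _) fun W h hW => by simp [hS U f W h hW, hS U g W h hW]
  · exact huniq U _ _ _ (hS U _) fun W h hW => by simp [hS U f W h hW]
  · ext f
    exact huniq U f _ _ (hS U f) fun W h hW => hT W U h hU f
  · refine huniq U _ _ _ (fun W' h' hW' => ?_) (hS U _)
    change N'.res h' (N'.res h (S W f)) = _
    rw [N'.res_res, hS W f, N.res_res]
  · intro U n f hf
    obtain ⟨g, hg, hg'⟩ := hhom U n f hf
    have := huniq U f _ _ (hS U f) hg'
    change S U f ∈ _
    rwa [this]

/-- Right derivations of degree `d` over `U`. -/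
structure IsRightDer (U : Opens M) (d : ℤ) (R : N.O U →ₗ[ℝ] N.O U) : Prop where
  rule : ∀ f g, R (f * g) = f * R g + R f * N.twist U d g
  degree : ∀ n, ∀ f ∈ N.gr U n, R f ∈ N.grInt U (n + d)

lemma IsRightDer.map_one {R : N.O U →ₗ[ℝ] N.O U} (hR : IsRightDer U d R) : R 1 = 0 := by
  have h1 := hR.rule 1 1
  have h2 : N.twist U d 1 = 1 := by rw [← _root_.map_one (N.fn U), twist_fn]
  rw [h2, one_mul, mul_one] at h1
  simpa using h1

lemma IsCoordinates.adjoin_eq_top (hq : N.IsCoordinates U q) :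
    Algebra.adjoin ℝ (Set.range (N.fn U) ∪ Set.range q) = ⊤ := by
  have h1 := (gradedCommuting hq.mem).range_expand
  rw [LinearMap.range_eq_top.2 hq.bijective_self.2] at h1
  exact Subalgebra.toSubmodule_injective h1.symm

lemma IsRightDer.ext {d : ℤ} {q : Idx r → N.O U} (hq : N.IsCoordinates U q)
    {R R' : N.O U →ₗ[ℝ] N.O U} (hR : IsRightDer U d R) (hR' : IsRightDer U d R')
    (hfn : ∀ f, R (N.fn U f) = R' (N.fn U f)) (h : ∀ α, R (q α) = R' (q α)) : R = R' := by
  ext f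
  have hf : f ∈ Algebra.adjoin ℝ (Set.range (N.fn U) ∪ Set.range q) := by
    rw [hq.adjoin_eq_top]; trivial
  induction hf using Algebra.adjoin_induction with
  | mem f hf =>
    rcases hf with ⟨f, rfl⟩ | ⟨α, rfl⟩
    · exact hfn f
    · exact h α
  | algebraMap c => rw [Algebra.algebraMap_eq_smul_one, map_smul, map_smul, hR.map_one, hR'.map_one]
  | add f g _ _ hf hg => simp [hf, hg]
  | mul f g _ _ hf hg => rw [hR.rule, hR'.rule, hf, hg]

def tri {A : Type*} [Ring A] (a e c : A) : Matrix (Fin 2) (Fin 2) A := !![a, e; 0, c]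

lemma tri_mul {A : Type*} [Ring A] (a e c a' e' c' : A) : tri a e c * tri a' e' c' =
    tri (a * a') (a * e' + e * c') (c * c') := by
  simp [tri]

lemma tri_add {A : Type*} [Ring A] (a e c a' e' c' : A) : tri a e c + tri a' e' c' =
    tri (a + a') (e + e') (c + c') := by
  simp [tri]

lemma smul_tri {A : Type*} [Ring A] [Algebra ℝ A] (s : ℝ) (a e c : A) : s • tri a e c =
    tri (s • a) (s • e) (s • c) := by
  simp [tri]

lemma tri_one {A : Type*} [Ring A] : (1 : Matrix (Fin 2) (Fin 2) A) = tri 1 0 1 :=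
  Matrix.one_fin_two

lemma gradedCommuting_tri (hq : ∀ α, q α ∈ N.gr U (idxDeg α)) (d : ℤ) (δ : Smooth m U →ₗ[ℝ] N.O U)
    (hδd : ∀ f, δ f ∈ N.grInt U d) {φ₀ : Smooth m U →ₐ[ℝ] Matrix (Fin 2) (Fin 2) (N.O U)}
    (hφ₀ : ∀ f, φ₀ f = tri (N.fn U f) (δ f) (N.fn U f)) (e : Idx r → N.O U)
    (he : ∀ α, e α ∈ N.grInt U (idxDeg α + d)) :
    GradedCommuting φ₀ fun α => tri (q α) (e α) (N.twist U d (q α)) := by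
  have hqZ : ∀ α, q α ∈ N.grInt U (idxDeg α) := fun α => by simpa using hq α
  have hne : (-1 : ℝ) ≠ 0 := by norm_num
  refine ⟨fun α β => ?_, fun f α => ?_⟩
  · have h1 : q α * q β = (-1 : ℝ) ^ (idxDeg α * idxDeg β) • (q β * q α) := signComm (hq α) (hq β)
    have h2 := mul_comm_grInt (hqZ α) (he β)
    have h3 := mul_comm_grInt (he α) (hqZ β)
    have h4 := twist_of_mem d (hq α)
    have h5 := twist_of_mem d (hq β)
    have key : q α * e β + e α * N.twist U d (q β) = (-1 : ℝ) ^ (idxDeg α * idxDeg β) •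
        (q β * e α + e β * N.twist U d (q α)) := by
      rw [h4, h5, h2, mul_smul_comm, h3, smul_add, smul_smul, mul_smul_comm, smul_smul, add_comm]
      congr 2
      · rw [← zpow_natCast]
        rw [show ((idxDeg α + d) * idxDeg β : ℤ) =
          ((idxDeg α * idxDeg β : ℕ) : ℤ) + d * idxDeg β by push_cast; ring, zpow_add₀ hne,
          mul_left_comm, neg_one_zpow_mul_self, mul_one]
      · rw [← zpow_natCast, ← zpow_add₀ hne]
        congr 1
        push_cast
        ring
    unfold SignComm
    rw [tri_mul, tri_mul, smul_tri, h1, key, ← twist_mul, ← twist_mul, h1, map_smul]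
  · have h1 := mul_comm_grInt (fn_mem_grInt U f) (he α)
    have h2 := mul_comm_grInt (hδd f) (hqZ α)
    have h3 := (gradedCommuting hq).comm_fn f α
    have h4 := twist_of_mem d (hq α)
    have key : N.fn U f * e α + δ f * N.twist U d (q α) = q α * δ f + e α * N.fn U f := by
      rw [h1, h4, mul_smul_comm, h2, smul_smul, neg_one_zpow_mul_self, add_comm]
      simp
    rw [hφ₀, tri_mul, tri_mul, h3, key, h4, mul_smul_comm, smul_mul_assoc, h3]

lemma exists_isRightDer (hq : N.IsCoordinates U q) (d : ℤ) (δ : Smooth m U →ₗ[ℝ] N.O U)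
    (hδ : ∀ f g, δ (f * g) = N.fn U f * δ g + δ f * N.fn U g) (hδd : ∀ f, δ f ∈ N.grInt U d)
    (e : Idx r → N.O U) (he : ∀ α, e α ∈ N.grInt U (idxDeg α + d)) : ∃ R, IsRightDer U d R ∧
    (∀ f, R (N.fn U f) = δ f) ∧ ∀ α, R (q α) = e α := by
  have hδ1 : δ 1 = 0 := by
    have := hδ 1 1
    simpa using this
  let φ₀ : Smooth m U →ₐ[ℝ] Matrix (Fin 2) (Fin 2) (N.O U) := AlgHom.ofLinearMap
    { toFun f := tri (N.fn U f) (δ f) (N.fn U f)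
      map_add' f g := by rw [tri_add, map_add, map_add]
      map_smul' c f := by rw [RingHom.id_apply, smul_tri, map_smul, map_smul] }
    (by
      change tri (N.fn U 1) (δ 1) (N.fn U 1) = 1
      rw [hδ1, map_one, tri_one])
    (by
      intro f g
      change tri (N.fn U (f * g)) (δ (f * g)) (N.fn U (f * g)) =
        tri (N.fn U f) (δ f) (N.fn U f) * tri (N.fn U g) (δ g) (N.fn U g)
      rw [tri_mul, hδ, map_mul])
  let b : Idx r → Matrix (Fin 2) (Fin 2) (N.O U) := fun α => tri (q α) (e α) (N.twist U d (q α))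
  have hb : GradedCommuting φ₀ b := gradedCommuting_tri hq.mem d δ hδd (fun _ => rfl) e he
  obtain ⟨φ, hφ, hφ'⟩ := exists_algHom_of_coordinates (gradedCommuting hq.mem) hq.bijective_self hb
  have hdiag : ∀ f, φ f 0 0 = f ∧ φ f 1 0 = 0 ∧ φ f 1 1 = N.twist U d f := by
    intro f
    have hf : f ∈ Algebra.adjoin ℝ (Set.range (N.fn U) ∪ Set.range q) := by
      rw [hq.adjoin_eq_top]; trivial
    induction hf using Algebra.adjoin_induction with
    | mem f hf =>
      rcases hf with ⟨f, rfl⟩ | ⟨α, rfl⟩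
      · rw [hφ, twist_fn]; exact ⟨rfl, rfl, rfl⟩
      · rw [hφ']; exact ⟨rfl, rfl, rfl⟩
    | algebraMap c =>
      have h1 : N.twist U d (algebraMap ℝ _ c) = algebraMap ℝ _ c := by
        rw [← (N.fn U).commutes, twist_fn]
      rw [φ.commutes, h1]
      simp [Matrix.algebraMap_matrix_apply]
    | add f g _ _ hf hg => simp [hf, hg]
    | mul f g _ _ hf hg =>
      obtain ⟨h1, h2, h3⟩ := hf
      obtain ⟨h1', h2', h3'⟩ := hg
      simp [Matrix.mul_apply, Fin.sum_univ_two, h1, h2, h3, h1', h2', h3', twist_mul]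
  let R : N.O U →ₗ[ℝ] N.O U :=
    { toFun f := φ f 0 1
      map_add' f g := by simp
      map_smul' c f := by simp }
  have hrule : ∀ f g, R (f * g) = f * R g + R f * N.twist U d g := by
    intro f g
    change φ (f * g) 0 1 = _
    rw [map_mul, Matrix.mul_apply, Fin.sum_univ_two, (hdiag f).1, (hdiag g).2.2]
    rfl
  have hRfn : ∀ f, R (N.fn U f) = δ f := fun f => by
    change φ _ 0 1 = _
    rw [hφ]; rfl
  have hRq : ∀ α, R (q α) = e α := fun α => by
    change φ _ 0 1 = _
    rw [hφ']; rfl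
  have hR1 : R 1 = 0 := by
    rw [← map_one (N.fn U), hRfn, hδ1]
  have hmul : ∀ (i j : ℕ) (f g : N.O U), f ∈ N.gr U i → R f ∈ N.grInt U (i + d) → g ∈ N.gr U j →
      R g ∈ N.grInt U (j + d) → R (f * g) ∈ N.grInt U ((i + j : ℕ) + d) := by
    intro i j f g hf hf' hg hg'
    rw [hrule]
    refine add_mem ?_ ?_
    · have h1 : f ∈ N.grInt U i := by simpa using hf
      exact mem_grInt_of_eq (grInt_mul_mem h1 hg') (by push_cast; ring)
    · have h1 : N.twist U d g ∈ N.grInt U j := by simpa using twist_mem d hg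
      exact mem_grInt_of_eq (grInt_mul_mem hf' h1) (by push_cast; ring)
  have hpow : ∀ α k, R (q α ^ k) ∈ N.grInt U ((k * idxDeg α : ℕ) + d) := by
    intro α k
    induction k with
    | zero => rw [pow_zero, hR1]; exact zero_mem _
    | succ k ih =>
      rw [pow_succ, add_mul, one_mul]
      exact hmul _ _ _ _ (by simpa using SetLike.pow_mem_graded (A := N.gr U) k (hq.mem α)) ih
        (hq.mem α) (by rw [hRq]; exact he α)
  have hlist : ∀ (L : List (Idx r)) (J : Idx r → ℕ), listMonomial q L J ∈ N.gr U (listDeg idxDeg L J) ∧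
      R (listMonomial q L J) ∈ N.grInt U ((listDeg idxDeg L J : ℕ) + d) := by
    intro L J
    induction L with
    | nil =>
      refine ⟨SetLike.one_mem_graded (N.gr U), ?_⟩
      change R 1 ∈ _
      rw [hR1]; exact zero_mem _
    | cons α L ih =>
      have h1 : q α ^ J α ∈ N.gr U (J α * idxDeg α) := by
        simpa using SetLike.pow_mem_graded (A := N.gr U) (J α) (hq.mem α)
      exact ⟨gr_mul_mem h1 ih.1, hmul _ _ _ _ h1 (hpow α _) ih.1 ih.2⟩
  refine ⟨R, ⟨hrule, fun n f hf => ?_⟩, hRfn, hRq⟩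
  obtain ⟨c, rfl⟩ := hq.exists_expandDeg hf
  rw [expandDeg_apply, map_sum]
  refine Submodule.sum_mem _ fun J _ => ?_
  have h1 := hlist (idxList r) J.1.1
  rw [listDeg_idxList, ← monomialOf_eq, J.2] at h1
  have h2 := hmul 0 n _ _ (fn_mem U (c J)) (by rw [hRfn]; simpa using hδd (c J)) h1.1 h1.2
  simpa using h2

end NManifold

lemma NManifold.IsCoordinates.eq_of_linear (hq : N.IsCoordinates U q) {c d : Fin (r j) → Smooth m U}
    (h : ∑ i, N.fn U (c i) * q ⟨j, i⟩ = ∑ i, N.fn U (d i) * q ⟨j, i⟩) : c = d := by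
  classical
  have key : ∀ c : Fin (r j) → Smooth m U, ∑ i, N.fn U (c i) * q ⟨j, i⟩ =
      expand (N.fn U) q (∑ i, Finsupp.single (MultiExp.single ⟨j, i⟩) (c i)) := by
    intro c
    rw [map_sum]
    exact sum_congr rfl fun i _ => (expand_single_single _ _ _ _).symm
  rw [key, key] at h
  have h1 := hq.bijective_self.1 h
  have hinj : ∀ i k : Fin (r j), MultiExp.single (r := r) ⟨j, i⟩ = MultiExp.single ⟨j, k⟩ → i = k := by
    intro i k hik
    have h2 := congrFun (congrArg Subtype.val hik) ⟨j, i⟩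
    by_contra hne
    have hne' : (⟨j, i⟩ : Idx r) ≠ ⟨j, k⟩ := fun h => hne (by simpa using h)
    simp [MultiExp.single, Pi.single_eq_of_ne hne'] at h2
  have key2 : ∀ (c : Fin (r j) → Smooth m U) k,
      (∑ i, Finsupp.single (MultiExp.single (r := r) ⟨j, i⟩) (c i)) (MultiExp.single ⟨j, k⟩) = c k := by
    intro c k
    rw [Finsupp.finsetSum_apply, sum_eq_single k]
    · simp
    · intro i _ hi
      exact Finsupp.single_eq_of_ne fun h => hi (hinj _ _ h).symm
    · simp
  funext k
  rw [← key2 c k, ← key2 d k, h1]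

/-- A system of pairs of frames of a graded bundle and frames of fibre-linear functions that
transform in the same way. -/
structure MatchingFrames (σ : Splitting N) (V : GradedBundle.{u, w} m M r) where
  rel : ∀ W : Opens M, Frame V W → (Idx r → N.O W) → Prop
  isLinFrame : ∀ {W b y}, rel W b y → σ.IsLinFrame W y
  res : ∀ {U W : Opens M} (h : U ≤ W) {b y}, rel W b y → rel U (b.res h) fun α => N.res h (y α)
  exists_rel : ∀ (U : Opens M), ∀ x ∈ U, ∃ W ≤ U, x ∈ W ∧ ∃ b y, rel W b y
  transform : ∀ {W b y b' y'}, rel W b y → rel W b' y' → ∀ j i,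
    y' ⟨j, i⟩ = ∑ k, N.fn W (V.pair (b'.θ ⟨j, i⟩) (b.e ⟨j, k⟩)) * y ⟨j, k⟩

namespace MatchingFrames

variable (F : MatchingFrames σ V)

/-- The fibre-linear function of a covector field over the domain of a frame. -/
def lin (b : Frame V W) (y : Idx r → N.O W) (j : Fin p) : V.Covec j W →ₗ[ℝ] N.O W where
  toFun θ := ∑ i, N.fn W (V.pair θ (b.e ⟨j, i⟩)) * y ⟨j, i⟩
  map_add' θ θ' := by
    rw [← sum_add_distrib]
    refine sum_congr rfl fun i _ => ?_
    rw [← add_mul, ← map_add]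
    rfl
  map_smul' c θ := by
    rw [RingHom.id_apply, smul_sum]
    refine sum_congr rfl fun i _ => ?_
    rw [← smul_mul_assoc, ← map_smul]
    rfl

lemma lin_apply (b : Frame V W) (y : Idx r → N.O W) (j : Fin p) (θ : V.Covec j W) : lin b y j θ =
    ∑ i, N.fn W (V.pair θ (b.e ⟨j, i⟩)) * y ⟨j, i⟩ := rfl

lemma res_lin (h : U ≤ W) (b : Frame V W) (y : Idx r → N.O W) (j : Fin p) (θ : V.Covec j W) :
    N.res h (lin b y j θ) = lin (b.res h) (fun α => N.res h (y α)) j (Covec.res h θ) := by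
  simp only [lin_apply, map_sum, map_mul, res_fn]
  rfl

variable {F}

lemma lin_injective {b : Frame V W} {y : Idx r → N.O W} (hy : F.rel W b y) (j : Fin p) :
    Injective (lin b y j) := by
  intro θ θ' h
  have h1 := (F.isLinFrame hy).isCoordinates.eq_of_linear h
  rw [b.covec_eq θ, b.covec_eq θ']
  refine sum_congr rfl fun i _ => ?_
  rw [congrFun h1 i]

lemma lin_mem {b : Frame V W} {y : Idx r → N.O W} (hy : F.rel W b y) (j : Fin p) (θ : V.Covec j W) :
    lin b y j θ ∈ σ.linFun j W := by
  rw [lin_apply]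
  exact Splitting.sum_mem_linFun _ fun i =>
    Splitting.fn_mul_mem_linFun _ ((F.isLinFrame hy).mem ⟨j, i⟩)

lemma lin_eq {b b' : Frame V W} {y y' : Idx r → N.O W} (hy : F.rel W b y) (hy' : F.rel W b' y')
    (j : Fin p) : lin b y j = lin b' y' j := by
  ext θ
  rw [lin_apply, lin_apply]
  simp only [F.transform hy hy', mul_sum, ← mul_assoc, ← map_mul]
  rw [sum_comm]
  refine sum_congr rfl fun k _ => ?_
  rw [← sum_mul, ← map_sum]
  congr 2
  refine Smooth.ext fun x => ?_
  change _ = ContMDiffMap.evalRingHom (I := 𝓡 m) (I' := 𝓘(ℝ, ℝ)) (n := ∞) x _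
  rw [map_sum]
  have h1 := b'.sum_smul j x (b.e ⟨j, k⟩ x : V.E j x)
  rw [pair_apply, ← h1, map_sum]
  refine sum_congr rfl fun i _ => ?_
  rw [map_smul, map_mul, mul_comm]
  rfl

lemma exists_lin_eq {b : Frame V W} {y : Idx r → N.O W} (hy : F.rel W b y) {f : N.O W}
    (hf : f ∈ σ.linFun j W) : ∃ θ, lin b y j θ = f := by
  obtain ⟨c, hc⟩ := (F.isLinFrame hy).span W le_rfl j f hf
  refine ⟨∑ i, Covec.mul (c i) (b.θ ⟨j, i⟩), ?_⟩
  rw [lin_apply, hc]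
  refine sum_congr rfl fun i _ => ?_
  rw [N.res_self]
  congr 2
  refine Smooth.ext fun x => ?_
  rw [pair_apply, covec_sum_apply]
  simp [b.dual]

variable (F)

lemma exists_coord (j : Fin p) (U : Opens M) (θ : V.Covec j U) : ∃ f ∈ N.gr U ((j : ℕ) + 1),
    ∀ W (h : W ≤ U) b y, F.rel W b y → N.res h f = lin b y j (Covec.res h θ) := by
  have hB := F.exists_rel U
  choose! W hW hxW h using hB
  choose b y hby using h
  classical
  let f : ∀ x, N.O (W x) := fun x => if hx : x ∈ U then
    lin (b x hx) (y x hx) j (Covec.res (hW x hx) θ) else 0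
  have hf : ∀ x (hx : x ∈ U), f x = lin (b x hx) (y x hx) j (Covec.res (hW x hx) θ) :=
    fun x hx => by simp [f, hx]
  obtain ⟨g, hg, hg'⟩ := exists_glue (N := N) (U := U) (n := j + 1) W hW hxW f (by
    intro x hx
    rw [hf x hx]
    exact (lin_mem (hby x hx) j _).1) (by
    intro x hx z hz
    rw [hf x hx, hf z hz, res_lin, res_lin]
    rw [lin_eq (F.res inf_le_left (hby x hx)) (F.res inf_le_right (hby z hz))]
    rfl)
  refine ⟨g, hg, fun W' h' b₀ y₀ h₀ => ?_⟩
  refine ext_locally fun x hx => ⟨W' ⊓ W x, inf_le_left, ⟨hx, hxW x (h' hx)⟩, ?_⟩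
  have h1 := congrArg (N.res (inf_le_right : W' ⊓ W x ≤ W x)) (hg' x (h' hx))
  rw [hf x (h' hx), res_lin, N.res_res] at h1
  rw [N.res_res, h1, res_lin, lin_eq (F.res inf_le_right (hby x (h' hx))) (F.res inf_le_left h₀)]
  rfl

lemma coord_unique {θ : V.Covec j U} {f g : N.O U}
    (hf : ∀ W (h : W ≤ U) b y, F.rel W b y → N.res h f = lin b y j (Covec.res h θ))
    (hg : ∀ W (h : W ≤ U) b y, F.rel W b y → N.res h g = lin b y j (Covec.res h θ)) : f = g := by
  refine ext_locally fun x hx => ?_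
  obtain ⟨W, hW, hxW, b, y, h⟩ := F.exists_rel U x hx
  exact ⟨W, hW, hxW, (hf W hW b y h).trans (hg W hW b y h).symm⟩

/-- The identification given by matching frames. -/
def coord (j : Fin p) (U : Opens M) : V.Covec j U →ₗ[ℝ] N.O U where
  toFun θ := (F.exists_coord j U θ).choose
  map_add' θ θ' := by
    refine F.coord_unique (F.exists_coord j U _).choose_spec.2 fun W h b y hr => ?_
    rw [map_add, map_add, map_add, (F.exists_coord j U θ).choose_spec.2 W h b y hr,
      (F.exists_coord j U θ').choose_spec.2 W h b y hr]
  map_smul' c θ := by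
    refine F.coord_unique (F.exists_coord j U _).choose_spec.2 fun W h b y hr => ?_
    rw [map_smul, map_smul, RingHom.id_apply, map_smul,
      (F.exists_coord j U θ).choose_spec.2 W h b y hr]

lemma coord_mem_gr (θ : V.Covec j U) : F.coord j U θ ∈
    N.gr U ((j : ℕ) + 1) := (F.exists_coord j U θ).choose_spec.1

lemma res_coord_eq (θ : V.Covec j U) (h : W ≤ U) {b : Frame V W} {y : Idx r → N.O W}
    (hr : F.rel W b y) : N.res h (F.coord j U θ) = lin b y j (Covec.res h θ) :=
  (F.exists_coord j U θ).choose_spec.2 W h b y hr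

lemma coord_injective (j : Fin p) (U : Opens M) : Injective (F.coord j U) := by
  intro θ θ' h
  refine Covec.ext fun x z => ?_
  obtain ⟨W, hW, hxW, b, y, hr⟩ := F.exists_rel U x x.2
  have h2 := F.res_coord_eq θ hW hr
  rw [h, F.res_coord_eq θ' hW hr] at h2
  have h3 := lin_injective hr j h2
  exact (congrArg (fun η : V.Covec j W => η.1 ⟨x, hxW⟩ z) h3).symm

lemma coord_mem_lin (θ : V.Covec j U) : F.coord j U θ ∈ σ.linFun j U := by
  refine Splitting.mem_linFun_of_locally (F.coord_mem_gr θ) fun x hx => ?_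
  obtain ⟨W, hW, hxW, b, y, hr⟩ := F.exists_rel U x hx
  refine ⟨W, hW, hxW, ?_⟩
  rw [F.res_coord_eq θ hW hr]
  exact lin_mem hr j _

lemma exists_coord_eq (hf : f ∈ σ.linFun j U) : ∃ θ, F.coord j U θ = f := by
  have hB : ∀ x ∈ U, ∃ W, ∃ _ : W ≤ U, x ∈ W ∧ ∃ η : V.Covec j W,
      ∀ W' (h' : W' ≤ W) b y (hU : W' ≤ U), F.rel W' b y →
        N.res hU f = lin b y j (Covec.res h' η) := by
    intro x hx
    obtain ⟨W, hW, hxW, b, y, hr⟩ := F.exists_rel U x hx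
    obtain ⟨η, hη⟩ := exists_lin_eq hr (Splitting.res_mem_linFun hW hf)
    refine ⟨W, hW, hxW, η, fun W' h' b' y' hU hr' => ?_⟩
    rw [← lin_eq (F.res h' hr) hr', ← res_lin, hη, N.res_res]
  choose W hW hxW η hη using hB
  have hcompat : ∀ x hx y hy (z : M) (hzx : z ∈ W x hx) (hzy : z ∈ W y hy),
      (η x hx).1 ⟨z, hzx⟩ = (η y hy).1 ⟨z, hzy⟩ := by
    intro x hx y hy z hzx hzy
    obtain ⟨W', hW', hzW', b', y', hr'⟩ :=
      F.exists_rel (W x hx ⊓ W y hy) z ⟨hzx, hzy⟩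
    have h1 := hη x hx W' (hW'.trans inf_le_left) b' y'
      ((hW'.trans inf_le_left).trans (hW x hx)) hr'
    have h2 := hη y hy W' (hW'.trans inf_le_right) b' y'
      ((hW'.trans inf_le_right).trans (hW y hy)) hr'
    have h3 := lin_injective hr' j (h1.symm.trans h2)
    exact congrArg (fun η : V.Covec j W' => η.1 ⟨z, hzW'⟩) h3
  let θ : V.Covec j U := ⟨fun x => (η x x.2).1 ⟨x, hxW x x.2⟩,
    mem_covec_of_locally fun x hx => ⟨W x hx, hxW x hx, η x hx,
      fun y hy hy' => hcompat _ _ _ _ _ _ _⟩⟩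
  refine ⟨θ, F.coord_unique (θ := θ) (fun W h b y hr => F.res_coord_eq θ h hr)
    fun W' h' b' y' hr' => ?_⟩
  refine ext_locally fun x hx => ⟨W' ⊓ W x (h' hx), inf_le_left, ⟨hx, hxW x (h' hx)⟩, ?_⟩
  rw [N.res_res, res_lin, hη x (h' hx) (W' ⊓ W x (h' hx)) inf_le_right _ _ _
    (F.res inf_le_left hr')]
  congr 1
  exact Covec.ext fun y z => congrArg (fun l : V.E j y →ₗ[ℝ] ℝ => l z)
    (hcompat x (h' hx) y (h' y.2.1) y y.2.2 (hxW y (h' y.2.1)))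

/-- Matching frames give an identification. -/
def identification : Identification σ V where
  coord := F.coord
  injective := F.coord_injective
  range j U := Set.Subset.antisymm (by rintro _ ⟨θ, rfl⟩; exact F.coord_mem_lin θ)
    fun _ hf => F.exists_coord_eq hf
  natural j U U' h θ θ' hθ := by
    refine F.coord_unique (θ := θ') (fun W h b y hr => F.res_coord_eq θ' h hr)
      fun W h' b y hr => ?_
    rw [N.res_res, F.res_coord_eq θ (h'.trans h) hr]
    congr 1
    exact Covec.ext fun y z =>
      congrArg (fun l => l z) (hθ ⟨y, h' y.2⟩).symm
  linear j U f θ θ' hθ := by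
    refine F.coord_unique (θ := θ') (fun W h b y hr => F.res_coord_eq θ' h hr)
      fun W h' b y hr => ?_
    rw [map_mul, res_fn, F.res_coord_eq θ h' hr, lin_apply, lin_apply, mul_sum]
    refine sum_congr rfl fun i _ => ?_
    rw [← mul_assoc, ← map_mul]
    congr 2
    refine Smooth.ext fun x => ?_
    have := hθ ⟨x, h' x.2⟩
    change f ⟨x, h' x.2⟩ * θ.1 ⟨x, h' x.2⟩ _ = θ'.1 ⟨x, h' x.2⟩ _
    rw [this]
    rfl

end MatchingFrames

variable (N σ) in
/-- A cover of `M` by domains of frames of fibre-linear functions. -/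
structure FrameCover where
  W : M → Opens M
  mem : ∀ x, x ∈ W x
  y : ∀ a, Idx r → N.O (W a)
  isLinFrame : ∀ a, σ.IsLinFrame (W a) (y a)

lemma nonempty_frameCover : Nonempty (FrameCover N σ) := by
  choose W hW y hy using Splitting.exists_isLinFrame σ
  exact ⟨⟨W, hW, y, hy⟩⟩

namespace FrameCover

variable (C : FrameCover N σ)

lemma exists_change (a a' : M) : ∃ G : ∀ j : Fin p, Fin (r j) → Fin (r j) →
    Smooth m (C.W a ⊓ C.W a'), ∀ j i, N.res inf_le_right (C.y a' ⟨j, i⟩) = ∑ k,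
    N.fn _ (G j i k) * N.res inf_le_left (C.y a ⟨j, k⟩) := by
  have h : ∀ j i, ∃ c : Fin (r j) → Smooth m (C.W a ⊓ C.W a'),
      N.res inf_le_right (C.y a' ⟨j, i⟩) =
        ∑ k, N.fn _ (c k) * N.res inf_le_left (C.y a ⟨j, k⟩) := fun j i =>
    (C.isLinFrame a).span _ inf_le_left j _
      (Splitting.res_mem_linFun inf_le_right ((C.isLinFrame a').mem ⟨j, i⟩))
  choose G hG using h
  exact ⟨G, hG⟩

/-- The transition matrices of a cover by frames. -/
def change (a a' : M) (j : Fin p) (i k : Fin (r j)) : Smooth m (C.W a ⊓ C.W a') :=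
  (C.exists_change a a').choose j i k

lemma change_spec (a a' : M) (h : W ≤ C.W a) (h' : W ≤ C.W a') (j : Fin p) (i : Fin (r j)) :
    N.res h' (C.y a' ⟨j, i⟩) = ∑ k,
    N.fn _ (Smooth.res (le_inf h h') (C.change a a' j i k)) * N.res h (C.y a ⟨j, k⟩) := by
  have := congrArg (N.res (le_inf h h')) ((C.exists_change a a').choose_spec j i)
  simp only [N.res_res, map_sum, map_mul, res_fn] at this
  exact this

lemma change_self (a : M) (j : Fin p) (i k : Fin (r j)) (hx : x ∈ C.W a) :
    C.change a a j i k ⟨x, hx, hx⟩ = if i = k then 1 else 0 := by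
  have h1 := C.change_spec a a le_rfl le_rfl j i
  have h2 : N.res le_rfl (C.y a ⟨j, i⟩) =
      ∑ k, N.fn _ (if i = k then 1 else 0) * N.res le_rfl (C.y a ⟨j, k⟩) := by
    rw [sum_eq_single i] <;> simp +contextual [eq_comm]
  have h3 := congrFun (((C.isLinFrame a).res le_rfl).isCoordinates.eq_of_linear (h1.symm.trans h2)) k
  have h4 := congrArg (fun f => f ⟨x, hx⟩) h3
  simp only [Smooth.res_apply] at h4
  rw [h4]
  split_ifs <;> rfl

lemma change_comp (a a' a'' : M) (j : Fin p) (i k : Fin (r j)) (hx : x ∈ C.W a) (hx' : x ∈ C.W a')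
    (hx'' : x ∈ C.W a'') : ∑ l,
    C.change a' a'' j i l ⟨x, hx', hx''⟩ * C.change a a' j l k ⟨x, hx, hx'⟩ =
    C.change a a'' j i k ⟨x, hx, hx''⟩ := by
  let W := C.W a ⊓ C.W a' ⊓ C.W a''
  have h : W ≤ C.W a := inf_le_left.trans inf_le_left
  have h' : W ≤ C.W a' := inf_le_left.trans inf_le_right
  have h'' : W ≤ C.W a'' := inf_le_right
  have h1 := C.change_spec a' a'' h' h'' j i
  rw [C.change_spec a a'' h h''] at h1
  simp only [C.change_spec a a' h h', mul_sum, ← mul_assoc, ← map_mul] at h1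
  rw [sum_comm] at h1
  simp only [← sum_mul, ← map_sum] at h1
  have h3 := congrFun (((C.isLinFrame a).res h).isCoordinates.eq_of_linear h1) k
  have h4 := congrArg (ContMDiffMap.evalRingHom (I := 𝓡 m) (I' := 𝓘(ℝ, ℝ)) (n := ∞)
    (⟨x, ⟨hx, hx'⟩, hx''⟩ : W)) h3
  rw [map_sum] at h4
  exact h4.symm

/-- The coordinate changes of the bundle. -/
def coordChange (j : Fin p) (a a' : M) (x : M) : (𝓔 j) →L[ℝ] (𝓔 j) :=
  ∑ i, ∑ k, extZero (C.change a a' j i k) x •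
    (EuclideanSpace.proj k : _ →L[ℝ] ℝ).smulRight (EuclideanSpace.single i (1 : ℝ))

lemma coordChange_apply (j : Fin p) (a a' : M) (hx : x ∈ C.W a) (hx' : x ∈ C.W a') (v : (𝓔 j))
    (i : Fin (r j)) : C.coordChange j a a' x v i = ∑ k, C.change a a' j i k ⟨x, hx, hx'⟩ * v k := by
  have hxx : x ∈ C.W a ⊓ C.W a' := ⟨hx, hx'⟩
  simp only [coordChange, sum_apply, WithLp.ofLp_sum, Finset.sum_apply]
  rw [sum_eq_single i]
  · simp [extZero_of_mem _ hxx]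
  · intro b _ hb
    simp [hb.symm]
  · simp

lemma contMDiffOn_coordChange (j : Fin p) (a a' : M) :
    ContMDiffOn (𝓡 m) 𝓘(ℝ, (𝓔 j) →L[ℝ] (𝓔 j)) ∞ (C.coordChange j a a') (C.W a ∩ C.W a') := by
  intro x hx
  refine ContMDiffAt.contMDiffWithinAt ?_
  have : ContMDiffAt (𝓡 m)
      𝓘(ℝ, (𝓔 j) →L[ℝ] (𝓔 j)) ∞
      (fun x => ∑ i, ∑ k, extZero (C.change a a' j i k) x •
        (EuclideanSpace.proj k : _ →L[ℝ] ℝ).smulRight (EuclideanSpace.single i (1 : ℝ))) x :=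
    ContMDiffAt.sum fun i _ => ContMDiffAt.sum fun k _ =>
      ((C.change a a' j i k).contMDiffAt hx).smul contMDiffAt_const
  exact this

/-- The vector bundle in degree `-(j + 1)`. -/
def core (j : Fin p) : VectorBundleCore ℝ M (𝓔 j) M where
  baseSet a := C.W a
  isOpen_baseSet a := (C.W a).isOpen
  indexAt x := x
  mem_baseSet_at := C.mem
  coordChange := C.coordChange j
  coordChange_self a x hx v := by
    ext i
    rw [C.coordChange_apply j a a hx hx]
    simp [C.change_self a j i _ hx]
  continuousOn_coordChange a a' := (C.contMDiffOn_coordChange j a a').continuousOn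
  coordChange_comp a a' a'' x hx v := by
    obtain ⟨⟨hx, hx'⟩, hx''⟩ := hx
    ext i
    rw [C.coordChange_apply j a' a'' hx' hx'', C.coordChange_apply j a a'' hx hx'']
    simp only [C.coordChange_apply j a a' hx hx', ← C.change_comp a a' a'' j i _ hx hx' hx'',
      mul_sum, sum_mul]
    rw [sum_comm]
    simp only [mul_assoc]

lemma core_isContMDiff (j : Fin p) : (C.core j).IsContMDiff (𝓡 m) ∞ :=
  ⟨fun a a' => C.contMDiffOn_coordChange j a a'⟩

/-- The graded bundle given by a cover by frames of fibre-linear functions. -/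
def bundle : GradedBundle.{u, 0} m M r where
  E j := (C.core j).Fiber
  instAddCommGroup j x := inferInstance
  instModule j x := inferInstance
  instTopFiber j x := inferInstance
  instTop j := inferInstance
  instFiberBundle j := inferInstance
  instVectorBundle j := inferInstance
  instSmooth j := by
    have := C.core_isContMDiff j
    infer_instance

/-- The trivialization over the domain of a frame. -/
def triv (a : M) (j : Fin p) :
    Trivialization (𝓔 j) (π (𝓔 j) (C.bundle.E j)) := (C.core j).localTriv a

instance (a : M) (j : Fin p) : MemTrivializationAtlas (C.triv a j) :=
  ⟨⟨a, rfl⟩⟩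

lemma triv_change (j : Fin p) (a a' : M) (hx : x ∈ C.W a) (hx' : x ∈ C.W a') (z : C.bundle.E j x)
    (i : Fin (r j)) : (C.triv a' j ⟨x, z⟩).2 i = ∑ k,
    C.change a a' j i k ⟨x, hx, hx'⟩ * (C.triv a j ⟨x, z⟩).2 k := by
  rw [← C.coordChange_apply j a a' hx hx']
  exact congrArg (fun v : (𝓔 j) => v i)
    ((C.core j).coordChange_comp x a a' x ⟨⟨C.mem x, hx⟩, hx'⟩ z).symm

/-- The frames of the bundle that match the given frames of fibre-linear functions. -/
def matching : MatchingFrames σ C.bundle where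
  rel W b y := ∃ (a : M) (h : W ≤ C.W a), (y = fun α => N.res h (C.y a α)) ∧
    ∀ (α : Idx r) (x : W) z, (b.θ α).1 x z = (C.triv a α.1 ⟨x, z⟩).2 α.2
  isLinFrame := by
    rintro W b y ⟨a, h, rfl, -⟩
    exact (C.isLinFrame a).res h
  res := by
    rintro U W h b y ⟨a, h', rfl, hb⟩
    refine ⟨a, h.trans h', ?_, fun α x z => hb α ⟨x, h x.2⟩ z⟩
    simp only [N.res_res]
  exists_rel U x hx := by
    obtain ⟨W, hW, hxW, b, hb⟩ := exists_frame_of_trivializations C.bundle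
      (fun j => C.triv x j) (U := U ⊓ C.W x) ⟨hx, C.mem x⟩ (fun j => C.mem x)
    exact ⟨W, hW.trans inf_le_left, hxW, b, _, x, hW.trans inf_le_right, rfl,
      fun α y z => (hb α y z).2⟩
  transform := by
    rintro W b y b' y' ⟨a, h, rfl, hb⟩ ⟨a', h', rfl, hb'⟩ j i
    refine (C.change_spec a a' h h' j i).trans ?_
    refine sum_congr rfl fun k _ => ?_
    congr 2
    refine Smooth.ext fun x => ?_
    rw [pair_apply, hb', C.triv_change j a a' (h x.2) (h' x.2)]
    simp only [← hb ⟨j, _⟩, b.dual]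
    rw [Smooth.res_apply]
    simp

end FrameCover

lemma exists_bundle (N : NManifold.{u, v} m M r) (σ : Splitting N) : ∃ V :
    GradedBundle.{u, 0} m M r, Nonempty (Identification σ V) := by
  obtain ⟨C⟩ := nonempty_frameCover (σ := σ)
  exact ⟨C.bundle, ⟨C.matching.identification⟩⟩

namespace NManifold

variable (N)

/-- The algebra of the linear endomorphisms of the structure sheaf. -/
def operators : Subalgebra ℝ (∀ U, Module.End ℝ (N.O U)) where
  carrier := {T | ∀ U W (h : U ≤ W) (f : N.O W), N.res h (T W f) = T U (N.res h f)}
  mul_mem' hS hT U W h f := by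
    simp only [Pi.mul_apply, Module.End.mul_apply, hS U W h, hT U W h]
  add_mem' hS hT U W h f := by
    simp [hS U W h, hT U W h]
  algebraMap_mem' c U W h f := by
    simp [Module.algebraMap_end_apply]

/-- The linear endomorphisms of the structure sheaf. -/
def Ops : Type (max u v) := N.operators

instance : Ring N.Ops := inferInstanceAs (Ring N.operators)

instance : Algebra ℝ N.Ops := inferInstanceAs (Algebra ℝ N.operators)

/-- The action of an operator on the functions over `U`. -/
def Ops.app {N : NManifold.{u, v} m M r} (T : N.Ops) (U : Opens M) : N.O U →ₗ[ℝ] N.O U := T.1 U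

variable {N}

lemma res_operator (T : N.Ops) (h : U ≤ W) (f : N.O W) : N.res h (T.app W f) =
    T.app U (N.res h f) := T.2 U W h f

@[simp] lemma operator_mul_apply (S T : N.Ops) (U : Opens M) (f : N.O U) : (S * T).app U f =
    S.app U (T.app U f) := rfl

@[simp] lemma operator_add_apply (S T : N.Ops) (U : Opens M) (f : N.O U) : (S + T).app U f =
    S.app U f + T.app U f := rfl

@[simp] lemma operator_sub_apply (S T : N.Ops) (U : Opens M) (f : N.O U) : (S - T).app U f =
    S.app U f - T.app U f := rfl

@[simp] lemma operator_smul_apply (c : ℝ) (T : N.Ops) (U : Opens M) (f : N.O U) : (c • T).app U f =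
    c • T.app U f := rfl

@[simp] lemma operator_zero_apply (U : Opens M) (f : N.O U) : (0 : N.Ops).app U f = 0 := rfl

lemma operator_ext {S T : N.Ops} (h : ∀ U f, S.app U f = T.app U f) : S = T :=
  Subtype.ext (funext fun U => LinearMap.ext (h U))

variable (N) in
/-- The operators of degree `d`. -/
def operatorsDeg (d : ℤ) : Submodule ℝ N.Ops where
  carrier := {T | ∀ U (n : ℕ), ∀ f ∈ N.gr U n, T.app U f ∈ N.grInt U (n + d)}
  add_mem' hS hT U n f hf := add_mem (hS U n f hf) (hT U n f hf)
  zero_mem' _ _ _ _ := zero_mem _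
  smul_mem' c _ hT U n f hf := smul_mem _ c (hT U n f hf)

lemma operator_apply_mem {T : N.Ops} (hT : T ∈ N.operatorsDeg d) {n : ℤ} (hf : f ∈ N.grInt U n) :
    T.app U f ∈ N.grInt U (n + d) := by
  rcases mem_grInt_cases hf with rfl | ⟨k, rfl, hf⟩
  · rw [map_zero]; exact zero_mem _
  · exact hT U k f hf

lemma operator_mul_mem {d e : ℤ} {S T : N.Ops} (hS : S ∈ N.operatorsDeg d)
    (hT : T ∈ N.operatorsDeg e) : S * T ∈ N.operatorsDeg (d + e) := fun U n f hf =>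
  mem_grInt_of_eq (operator_apply_mem hS (hT U n f hf)) (by ring)

lemma operator_twist {d : ℤ} {T : N.Ops} (hT : T ∈ N.operatorsDeg d) (e : ℤ) (f : N.O U) :
    T.app U (N.twist U e f) = (-1 : ℝ) ^ (d * e) • N.twist U e (T.app U f) := by
  induction f using induction_homogeneous with
  | h0 => simp
  | hadd f g hf hg => simp only [map_add, hf, hg, smul_add]
  | hom n f hf =>
    rw [twist_of_mem e hf, twist_of_mem_grInt e (hT U n f hf), map_smul, smul_smul,
      mul_add, zpow_add₀ (by norm_num), mul_left_comm, mul_comm d e, neg_one_zpow_mul_self,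
      mul_one]

lemma twist_twist_add (d e : ℤ) (f : N.O U) : N.twist U d (N.twist U e f) =
    N.twist U (d + e) f := by
  rw [twist, twist, scale_scale]
  congr 2
  funext n
  rw [add_mul, zpow_add₀ (by norm_num)]

variable (N) in
/-- Differential operators of order at most one and degree `d`, acting from the right: sums of right
derivations and multiplications. -/
def firstOrder (d : ℤ) : Submodule ℝ N.Ops where
  carrier := {T | T ∈ N.operatorsDeg d ∧ ∀ U (f g : N.O U),
    T.app U (f * g) = f * T.app U g + (T.app U f - f * T.app U 1) * N.twist U d g}
  add_mem' := by
    rintro S T ⟨hS, hS'⟩ ⟨hT, hT'⟩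
    refine ⟨add_mem hS hT, fun U f g => ?_⟩
    simp only [operator_add_apply, hS', hT', mul_add, add_mul, sub_mul]
    abel
  zero_mem' := ⟨zero_mem _, fun U f g => by simp⟩
  smul_mem' := by
    rintro c T ⟨hT, hT'⟩
    refine ⟨smul_mem _ c hT, fun U f g => ?_⟩
    simp only [operator_smul_apply, hT', smul_add, mul_smul_comm, ← smul_sub, smul_mul_assoc]

/-- The graded commutator of operators of degrees `a` and `b`. -/
def gradedComm {E : Type*} [Ring E] [Algebra ℝ E] (a b : ℤ) (A B : E) : E :=
  A * B - (-1 : ℝ) ^ (a * b) • (B * A)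

section

variable {E : Type*} [Ring E] [Algebra ℝ E] (a b : ℤ)

lemma gradedComm_zero_left (B : E) : gradedComm a b 0 B = 0 := by simp [gradedComm]

lemma gradedComm_zero_right (A : E) : gradedComm a b A 0 = 0 := by simp [gradedComm]

lemma gradedComm_sub_left (A A' B : E) : gradedComm a b (A - A') B =
    gradedComm a b A B - gradedComm a b A' B := by
  simp only [gradedComm, sub_mul, mul_sub, smul_sub]; abel

lemma gradedComm_sub_right (A B B' : E) : gradedComm a b A (B - B') =
    gradedComm a b A B - gradedComm a b A B' := by
  simp only [gradedComm, sub_mul, mul_sub, smul_sub]; abel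

end

lemma gradedComm_mem_operatorsDeg {a b : ℤ} {A B : N.Ops} (hA : A ∈ N.operatorsDeg a)
    (hB : B ∈ N.operatorsDeg b) : gradedComm a b A B ∈ N.operatorsDeg (a + b) := by
  intro U n f hf
  have h1 := operator_mul_mem hA hB U n f hf
  have h2 := operator_mul_mem hB hA U n f hf
  rw [add_comm b a] at h2
  exact Submodule.sub_mem _ h1 (smul_mem _ _ h2)

lemma gradedComm_mem_firstOrder {a b : ℤ} {A B : N.Ops} (hA : A ∈ N.firstOrder a)
    (hB : B ∈ N.firstOrder b) : gradedComm a b A B ∈ N.firstOrder (a + b) := by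
  obtain ⟨hA, hA'⟩ := hA
  obtain ⟨hB, hB'⟩ := hB
  refine ⟨gradedComm_mem_operatorsDeg hA hB, ?_⟩
  intro U f g
  set s : ℝ := (-1 : ℝ) ^ (a * b) with hs
  have hss : s * s = 1 := neg_one_zpow_mul_self _
  have hAt : ∀ g, A.app U (N.twist U b g) = s • N.twist U b (A.app U g) := operator_twist hA b
  have hBt : ∀ g, B.app U (N.twist U a g) = s • N.twist U a (B.app U g) := fun g => by
    rw [operator_twist hB a, mul_comm b a]
  have h1a : N.twist U a 1 = 1 := by rw [← map_one (N.fn U), twist_fn]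
  have h1b : N.twist U b 1 = 1 := by rw [← map_one (N.fn U), twist_fn]
  have hA1 : N.twist U b (A.app U 1) = s • A.app U 1 := by
    have := hAt 1
    rw [h1b] at this
    conv_rhs => rw [this, smul_smul, hss, one_smul]
  have hB1 : N.twist U a (B.app U 1) = s • B.app U 1 := by
    have := hBt 1
    rw [h1a] at this
    conv_rhs => rw [this, smul_smul, hss, one_smul]
  have hab : N.twist U a (N.twist U b g) = N.twist U (a + b) g := twist_twist_add a b g
  have hba : N.twist U b (N.twist U a g) = N.twist U (a + b) g := by
    rw [twist_twist_add, add_comm]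
  have key : ∀ {a b : ℤ} {A B : N.Ops}, (∀ U (f g : N.O U),
      A.app U (f * g) = f * A.app U g + (A.app U f - f * A.app U 1) * N.twist U a g) →
      (∀ U (f g : N.O U),
      B.app U (f * g) = f * B.app U g + (B.app U f - f * B.app U 1) * N.twist U b g) →
      A.app U (B.app U (f * g)) = f * A.app U (B.app U g) + (A.app U f - f * A.app U 1) * N.twist U a (B.app U g)
        + ((B.app U f - f * B.app U 1) * A.app U (N.twist U b g) +
          (A.app U (B.app U f) - (f * A.app U (B.app U 1) + (A.app U f - f * A.app U 1) *
            N.twist U a (B.app U 1)) - (B.app U f - f * B.app U 1) * A.app U 1) *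
          N.twist U a (N.twist U b g)) := by
    intro a b A B hA' hB'
    rw [hB' U f g, map_add, hA' U f, hA' U (_ - _), map_sub, hA' U f (B.app U 1)]
  simp only [gradedComm, operator_sub_apply, operator_smul_apply, operator_mul_apply]
  rw [key hA' hB', key hB' hA', hAt, hBt, hA1, hB1, hab, hba, ← hs]
  generalize N.twist U a (B.app U g) = x1
  generalize N.twist U b (A.app U g) = x2
  generalize N.twist U (a + b) g = x3
  generalize A.app U (B.app U g) = x4
  generalize B.app U (A.app U g) = x5
  generalize A.app U (B.app U f) = x6
  generalize B.app U (A.app U f) = x7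
  generalize A.app U (B.app U 1) = x8
  generalize B.app U (A.app U 1) = x9
  generalize A.app U f = y1
  generalize B.app U f = y2
  generalize A.app U 1 = y3
  generalize B.app U 1 = y4
  simp only [smul_add, smul_sub, add_mul, mul_sub, sub_mul, mul_smul_comm,
    smul_mul_assoc, smul_smul, hss, one_smul, mul_assoc]
  abel

lemma mem_firstOrder_of_isRightDer {T : N.Ops} (hT : ∀ U, IsRightDer U d (T.app U)) : T ∈
    N.firstOrder d :=
  ⟨fun U n f hf => (hT U).degree n f hf, fun U f g => by
    rw [(hT U).rule, (hT U).map_one, mul_zero, sub_zero]⟩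

lemma isRightDer_of_mem_firstOrder {T : N.Ops} (hT : T ∈ N.firstOrder d) (h1 : T.app U 1 = 0) :
    IsRightDer U d (T.app U) :=
  ⟨fun f g => by rw [hT.2, h1, mul_zero, sub_zero], fun n f hf => hT.1 U n f hf⟩

variable (N) in
def mulOp : 𝒞 →ₗ[ℝ] N.Ops where
  toFun f := ⟨fun U => LinearMap.mulLeft ℝ (N.fn U (globRes U f)), fun U W h g => by
    simp only [LinearMap.mulLeft_apply, map_mul, res_fn, res_globRes]⟩
  map_add' f g := operator_ext fun U h => by
    change N.fn U (globRes U f + globRes U g) * h = N.fn U (globRes U f) * h + N.fn U _ * h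
    rw [map_add, add_mul]
  map_smul' c f := operator_ext fun U h => by
    change N.fn U (c • globRes U f) * h = c • (N.fn U (globRes U f) * h)
    rw [map_smul, smul_mul_assoc]

@[simp] lemma mulOp_apply (f : 𝒞) (U : Opens M) (g : N.O U) : (N.mulOp f).app U g =
    N.fn U (globRes U f) * g := rfl

lemma fn_mul_comm (f : Smooth m U) (g : N.O U) : N.fn U f * g = g * N.fn U f := by
  induction g using induction_homogeneous with
  | h0 => simp
  | hadd g h hg hh => rw [mul_add, add_mul, hg, hh]
  | hom n g hg => simpa [SignComm] using signComm (fn_mem U f) hg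

lemma mulOp_mem_firstOrder (f : 𝒞) : N.mulOp f ∈ N.firstOrder 0 := by
  refine ⟨fun U n g hg => ?_, fun U g h => ?_⟩
  · rw [add_zero, grInt_natCast]
    exact fn_mul_mem _ hg
  · rw [mulOp_apply, mulOp_apply, mulOp_apply, mulOp_apply, mul_one, fn_mul_comm _ g, sub_self,
      zero_mul, add_zero, ← mul_assoc, ← mul_assoc, fn_mul_comm _ g]

lemma IsRightDer.res_eq (h : U ≤ W) {d : ℤ} {q : Idx r → N.O W} (hq : N.IsCoordinates W q)
    {R : N.O W →ₗ[ℝ] N.O W} {R' : N.O U →ₗ[ℝ] N.O U} (hR : IsRightDer W d R)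
    (hR' : IsRightDer U d R') (hfn : ∀ f, N.res h (R (N.fn W f)) = R' (N.fn U (Smooth.res h f)))
    (hc : ∀ α, N.res h (R (q α)) = R' (N.res h (q α))) (f : N.O W) : N.res h (R f) =
    R' (N.res h f) := by
  have hf : f ∈ Algebra.adjoin ℝ (Set.range (N.fn W) ∪ Set.range q) := by
    rw [hq.adjoin_eq_top]; trivial
  induction hf using Algebra.adjoin_induction with
  | mem f hf =>
    rcases hf with ⟨f, rfl⟩ | ⟨α, rfl⟩
    · rw [hfn, res_fn]
    · exact hc α
  | algebraMap c =>
    rw [Algebra.algebraMap_eq_smul_one, map_smul, map_smul, map_smul, map_smul, hR.map_one,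
      _root_.map_one, hR'.map_one, map_zero]
  | add f g _ _ hf hg => simp only [map_add, hf, hg]
  | mul f g _ _ hf hg =>
    rw [hR.rule, map_mul, hR'.rule, map_add, map_mul, map_mul, hf, hg, res_twist]

lemma IsCoordinates.exists_eq_fn_add {q : Idx r → N.O U} (hq : N.IsCoordinates U q) (f : N.O U) :
    ∃ (g : Smooth m U) (c : Idx r → N.O U), f = N.fn U g + ∑ α, c α * q α := by
  have hf : f ∈ Algebra.adjoin ℝ (Set.range (N.fn U) ∪ Set.range q) := by
    rw [hq.adjoin_eq_top]; trivial
  induction hf using Algebra.adjoin_induction with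
  | mem f hf =>
    rcases hf with ⟨f, rfl⟩ | ⟨α, rfl⟩
    · exact ⟨f, 0, by simp⟩
    · classical
      exact ⟨0, Pi.single α 1, by simp [Pi.single_apply]⟩
  | algebraMap c => exact ⟨algebraMap ℝ _ c, 0, by simp⟩
  | add f f' _ _ hf hf' =>
    obtain ⟨g, c, rfl⟩ := hf
    obtain ⟨g', c', rfl⟩ := hf'
    refine ⟨g + g', c + c', ?_⟩
    simp only [map_add, Pi.add_apply, add_mul, sum_add_distrib]
    abel
  | mul f f' _ _ hf hf' =>
    obtain ⟨g, c, rfl⟩ := hf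
    obtain ⟨g', c', hc'⟩ := hf'
    refine ⟨g * g', fun α => N.fn U g' * c α + (N.fn U g + ∑ α, c α * q α) * c' α, ?_⟩
    rw [hc', mul_add]
    simp only [add_mul _ _ (q _), sum_add_distrib, mul_assoc, ← mul_sum, map_mul]
    rw [← add_assoc, add_mul, ← fn_mul_comm g' (∑ α, _)]

lemma IsRightDer.fn_mul {R : N.O U →ₗ[ℝ] N.O U} (hR : IsRightDer U d R)
    (hfn : ∀ f, R (N.fn U f) = 0) (f : Smooth m U) (g : N.O U) : R (N.fn U f * g) =
    N.fn U f * R g := by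
  rw [hR.rule, hfn, zero_mul, add_zero]

lemma body_eq_zero_of_locally
    (h : ∀ x ∈ U, ∃ (W : Opens M) (hW : W ≤ U), x ∈ W ∧ N.body W (N.res hW f) = 0) : N.body U f =
    0 := by
  refine Smooth.ext fun x => ?_
  obtain ⟨W, hW, hxW, h0⟩ := h x x.2
  rw [← res_body] at h0
  exact congrArg (fun g : Smooth m W => g ⟨x, hxW⟩) h0

end NManifold

namespace GradedBundle

lemma ofFun_mem (V : GradedBundle.{u, w} m M r) (f : 𝒞) : V.ofFun f ∈ V.gr 0 :=
  ⟨fun h => absurd rfl h, fun _ _ => rfl⟩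

lemma ofSect_mem (V : GradedBundle.{u, w} m M r) (j : Fin p) (X : V.Sect j) : V.ofSect j X ∈
    V.gr (-((j : ℤ) + 1)) := by
  refine ⟨fun _ => rfl, fun k hk => ?_⟩
  have : k ≠ j := by rintro rfl; exact hk rfl
  exact Pi.single_eq_of_ne this X

lemma mem_gr_cases {v : V.Sec} (hv : v ∈ V.gr d) : v = 0 ∨ (d = 0 ∧ ∃ f, v = V.ofFun f) ∨
    ∃ (j : Fin p) (X : V.Sect j), d = -((j : ℤ) + 1) ∧ v = V.ofSect j X := by
  obtain ⟨h1, h2⟩ := hv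
  by_cases hd : d = 0
  · refine Or.inr (Or.inl ⟨hd, v.1, Prod.ext rfl (funext fun j => h2 j ?_)⟩)
    rw [hd]
    have : (0 : ℤ) ≤ (j : ℕ) := Int.natCast_nonneg _
    omega
  · by_cases hj : ∃ j : Fin p, d = -((j : ℤ) + 1)
    · obtain ⟨j, hj⟩ := hj
      refine Or.inr (Or.inr ⟨j, v.2 j, hj, Prod.ext (h1 hd) (funext fun k => ?_)⟩)
      by_cases hk : k = j
      · subst hk
        exact (Pi.single_eq_same k (v.2 k)).symm
      · refine (h2 k fun h => hk ?_).trans (Pi.single_eq_of_ne hk (v.2 j)).symm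
        rw [hj] at h
        exact Fin.ext (by omega)
    · push Not at hj
      exact Or.inl (Prod.ext (h1 hd) (funext fun k => h2 k (hj k)))

lemma pair_add (θ : V.Covec j U) (X Y : V.Sect j) : V.pair θ (X + Y) = V.pair θ X + V.pair θ Y :=
  Smooth.ext fun x => (θ.1 x).map_add (X x) (Y x)

lemma pair_smul (θ : V.Covec j U) (c : ℝ) (X : V.Sect j) : V.pair θ (c • X) = c • V.pair θ X :=
  Smooth.ext fun x => (θ.1 x).map_smul c (X x)

@[simp] lemma pair_zero (θ : V.Covec j U) : V.pair θ 0 = 0 :=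
  Smooth.ext fun x => (θ.1 x).map_zero

lemma _root_.GradedGeometry.Frame.pair_eq_sum (b : Frame V U) (θ : V.Covec j U) (X : V.Sect j) :
    V.pair θ X = ∑ i, V.pair θ (b.e ⟨j, i⟩) * V.pair (b.θ ⟨j, i⟩) X := by
  refine Smooth.ext fun x => ?_
  change _ = ContMDiffMap.evalRingHom (I := 𝓡 m) (I' := 𝓘(ℝ, ℝ)) (n := ∞) x _
  rw [map_sum, pair_apply]
  conv_lhs => rw [← b.sum_smul j x (X x)]
  rw [map_sum]
  refine sum_congr rfl fun i _ => ?_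
  rw [map_smul, map_mul, mul_comm]
  rfl

end GradedBundle

namespace NManifold

lemma isRightDer_of_frames {T : N.Ops} (hd : T ∈ N.operatorsDeg d)
    (hT : ∀ U, Frame V U → IsRightDer U d (T.app U)) (U : Opens M) : IsRightDer U d (T.app U) := by
  refine ⟨fun f g => ?_, fun n f hf => hd U n f hf⟩
  refine ext_locally fun x hx => ?_
  obtain ⟨W, hW, hxW, ⟨b⟩⟩ := exists_frame V hx
  refine ⟨W, hW, hxW, ?_⟩
  rw [res_operator, map_mul, (hT W b).rule, map_add, map_mul, map_mul, res_operator, res_operator,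
    res_twist]

lemma exists_operator_of_frames (d : ℤ) (R : ∀ U, Frame V U → (N.O U →ₗ[ℝ] N.O U))
    (hR : ∀ U b, IsRightDer U d (R U b)) (hc : ∀ U W (h : U ≤ W) (b : Frame V W) (b' : Frame V U) f,
      N.res h (R W b f) = R U b' (N.res h f)) : ∃ T : N.Ops, (∀ U, IsRightDer U d (T.app U)) ∧
    ∀ U b, T.app U = R U b := by
  obtain ⟨S, hS, hres, hdeg⟩ := exists_glue_operator (N := N) (N' := N)
    (B := fun U => Nonempty (Frame V U)) (fun U x hx => exists_frame V hx)
    (fun U W h ⟨b⟩ => ⟨b.res h⟩) (fun U hU => R U hU.some) d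
    (fun U W h hW f => hc U W h _ _ f) fun U hU n f hf => (hR U hU.some).degree n f hf
  have hSR : ∀ U b, S U = R U b := by
    intro U b
    rw [hS U ⟨b⟩]
    ext f
    simpa [N.res_self] using hc U U le_rfl (Nonempty.some ⟨b⟩) b f
  exact ⟨⟨S, hres⟩, isRightDer_of_frames (V := V) hdeg fun U b => by
    change IsRightDer U d (S U)
    rw [hSR U b]
    exact hR U b, hSR⟩

end NManifold

namespace Identification

variable (ι)

lemma operator_ext_coord {S T : N.Ops} (hS : ∀ U, IsRightDer U d (S.app U))
    (hT : ∀ U, IsRightDer U d (T.app U)) (hfn : ∀ U f, S.app U (N.fn U f) = T.app U (N.fn U f))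
    (hc : ∀ U j (θ : V.Covec j U), S.app U (ι.coord j U θ) = T.app U (ι.coord j U θ)) : S = T := by
  refine operator_ext fun U f => ext_locally fun x hx => ?_
  obtain ⟨W, hW, hxW, ⟨b⟩⟩ := exists_frame V hx
  refine ⟨W, hW, hxW, ?_⟩
  rw [res_operator, res_operator,
    IsRightDer.ext (ι.isCoordinates b) (hS W) (hT W) (hfn W) fun α => hc W _ _]

lemma exists_contraction (j : Fin p) (X : V.Sect j) : ∃ T : N.Ops,
    (∀ U, IsRightDer U (-((j : ℤ) + 1)) (T.app U)) ∧ (∀ U f, T.app U (N.fn U f) = 0) ∧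
    ∀ U k (θ : V.Covec k U), T.app U (ι.coord k U θ) =
    N.fn U (V.pair θ ((Pi.single j X : ∀ k, V.Sect k) k)) := by
  set Y : ∀ k, V.Sect k := Pi.single j X with hY
  have hloc : ∀ U (b : Frame V U), ∃ R : N.O U →ₗ[ℝ] N.O U, IsRightDer U (-((j : ℤ) + 1)) R ∧
      (∀ f, R (N.fn U f) = 0) ∧ ∀ k (θ : V.Covec k U),
        R (ι.coord k U θ) = N.fn U (V.pair θ (Y k)) := by
    intro U b
    obtain ⟨R, hR, h1, h2⟩ := exists_isRightDer (ι.isCoordinates b) (-((j : ℤ) + 1)) 0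
      (fun _ _ => by simp) (fun _ => zero_mem _) (fun α => N.fn U (V.pair (b.θ α) (Y α.1))) (by
        intro α
        by_cases hα : α.1 = j
        · refine mem_grInt_of_eq (fn_mem_grInt U _) ?_
          rw [idxDeg, hα]
          push_cast
          ring
        · rw [hY, Pi.single_eq_of_ne hα, pair_zero, map_zero]
          exact zero_mem _)
    refine ⟨R, hR, h1, fun k θ => ?_⟩
    rw [ι.coord_eq_sum b, map_sum, b.pair_eq_sum θ (Y k), map_sum]
    refine sum_congr rfl fun i _ => ?_
    rw [hR.fn_mul h1, h2, map_mul]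
  choose R hR h1 h2 using hloc
  obtain ⟨T, hT, hTR⟩ := exists_operator_of_frames _ R hR (by
    intro U W h b b' f
    refine (hR W b).res_eq h (ι.isCoordinates b) (hR U b') (fun f => ?_) (fun α => ?_) f
    · rw [h1, h1, map_zero]
    · rw [ι.res_frameCoord, frameCoord, frameCoord, h2, h2, res_fn]
      rfl)
  refine ⟨T, hT, fun U f => ?_, fun U k θ => ?_⟩
  · refine ext_locally fun x hx => ?_
    obtain ⟨W, hW, hxW, ⟨b⟩⟩ := exists_frame V hx
    refine ⟨W, hW, hxW, ?_⟩
    rw [res_operator, hTR W b, res_fn, h1, map_zero]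
  · refine ext_locally fun x hx => ?_
    obtain ⟨W, hW, hxW, ⟨b⟩⟩ := exists_frame V hx
    refine ⟨W, hW, hxW, ?_⟩
    rw [res_operator, hTR W b, ι.res_coord, h2, res_fn]
    rfl

/-- The contraction with a section: the right derivation that maps linear functions to their values
on the section. -/
def contraction (j : Fin p) : V.Sect j →ₗ[ℝ] N.Ops where
  toFun X := (ι.exists_contraction j X).choose
  map_add' X Y := by
    obtain ⟨h1, h2, h3⟩ := (ι.exists_contraction j X).choose_spec
    obtain ⟨h1', h2', h3'⟩ := (ι.exists_contraction j Y).choose_spec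
    obtain ⟨h1'', h2'', h3''⟩ := (ι.exists_contraction j (X + Y)).choose_spec
    refine ι.operator_ext_coord h1'' (fun U => ⟨fun f g => ?_, fun n f hf =>
      add_mem ((h1 U).degree n f hf) ((h1' U).degree n f hf)⟩) (fun U f => ?_) fun U k θ => ?_
    · simp only [operator_add_apply, (h1 U).rule, (h1' U).rule, mul_add, add_mul]
      abel
    · rw [h2'', operator_add_apply, h2, h2', add_zero]
    · rw [h3'', operator_add_apply, h3, h3', ← map_add, ← pair_add,
        Pi.single_add]
      rfl
  map_smul' c X := by
    obtain ⟨h1, h2, h3⟩ := (ι.exists_contraction j X).choose_spec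
    obtain ⟨h1'', h2'', h3''⟩ := (ι.exists_contraction j (c • X)).choose_spec
    refine ι.operator_ext_coord h1'' (fun U => ⟨fun f g => ?_, fun n f hf =>
      smul_mem _ _ ((h1 U).degree n f hf)⟩) (fun U f => ?_) fun U k θ => ?_
    · simp only [RingHom.id_apply, operator_smul_apply, (h1 U).rule, smul_add, mul_smul_comm,
        smul_mul_assoc]
    · rw [h2'', RingHom.id_apply, operator_smul_apply, h2, smul_zero]
    · rw [h3'', RingHom.id_apply, operator_smul_apply, h3, ← map_smul, ← pair_smul,
        Pi.single_smul]
      rfl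

lemma isRightDer_contraction (j : Fin p) (X : V.Sect j) (U : Opens M) :
    IsRightDer U (-((j : ℤ) + 1)) ((ι.contraction j X).app U) :=
  (ι.exists_contraction j X).choose_spec.1 U

@[simp] lemma contraction_fn (j : Fin p) (X : V.Sect j) (U : Opens M) (f : Smooth m U) :
    (ι.contraction j X).app U (N.fn U f) = 0 :=
  (ι.exists_contraction j X).choose_spec.2.1 U f

lemma contraction_coord (j : Fin p) (X : V.Sect j) (U : Opens M) (k : Fin p) (θ : V.Covec k U) :
    (ι.contraction j X).app U (ι.coord k U θ) =
    N.fn U (V.pair θ ((Pi.single j X : ∀ k, V.Sect k) k)) :=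
  (ι.exists_contraction j X).choose_spec.2.2 U k θ

lemma contraction_mem (j : Fin p) (X : V.Sect j) : ι.contraction j X ∈
    N.firstOrder (-((j : ℤ) + 1)) :=
  mem_firstOrder_of_isRightDer (ι.isRightDer_contraction j X)

/-- The operator of an element of `V_•`: functions act by multiplication, sections by
contraction. -/
def operator : V.Sec →ₗ[ℝ] N.Ops :=
  N.mulOp.comp (LinearMap.fst ℝ _ _) +
    ∑ j, (ι.contraction j).comp ((LinearMap.proj j).comp (LinearMap.snd ℝ _ _))

lemma operator_apply (v : V.Sec) : ι.operator v = N.mulOp v.1 + ∑ j, ι.contraction j (v.2 j) := by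
  simp [operator]

@[simp] lemma operator_ofFun (f : 𝒞) : ι.operator (V.ofFun f) = N.mulOp f := by
  rw [operator_apply]
  simp only [ofFun, Pi.zero_apply, map_zero, sum_const_zero]
  exact add_zero _

@[simp] lemma operator_ofSect (j : Fin p) (X : V.Sect j) : ι.operator (V.ofSect j X) =
    ι.contraction j X := by
  rw [operator_apply, sum_eq_single j]
  · change N.mulOp 0 + ι.contraction j ((Pi.single j X : ∀ k, V.Sect k) j) = _
    rw [map_zero, Pi.single_eq_same]
    exact zero_add _
  · intro k _ hk
    change ι.contraction k ((Pi.single j X : ∀ k, V.Sect k) k) = _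
    rw [Pi.single_eq_of_ne hk, map_zero]
  · exact fun h => absurd (mem_univ j) h

lemma operator_mem {v : V.Sec} (hv : v ∈ V.gr d) : ι.operator v ∈ N.firstOrder d := by
  rcases mem_gr_cases hv with rfl | ⟨rfl, f, rfl⟩ | ⟨j, X, rfl, rfl⟩
  · rw [map_zero]; exact zero_mem _
  · rw [operator_ofFun]; exact mulOp_mem_firstOrder f
  · rw [operator_ofSect]; exact ι.contraction_mem j X

lemma gradedComm_operator {d e : ℤ} {v w : V.Sec} (hv : v ∈ V.gr d) (hw : w ∈ V.gr e) :
    gradedComm d e (ι.operator v) (ι.operator w) = 0 := by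
  rcases mem_gr_cases hv with rfl | ⟨rfl, f, rfl⟩ | ⟨j, X, rfl, rfl⟩
  · rw [map_zero, gradedComm_zero_left]
  · rcases mem_gr_cases hw with rfl | ⟨rfl, g, rfl⟩ | ⟨k, Y, rfl, rfl⟩
    · rw [map_zero, gradedComm_zero_right]
    · refine operator_ext fun U h => ?_
      simp [gradedComm, ← mul_assoc, fn_mul_comm (globRes U f)]
    · refine operator_ext fun U h => ?_
      simp [gradedComm, (ι.isRightDer_contraction k Y U).fn_mul (ι.contraction_fn k Y U)]
  · rcases mem_gr_cases hw with rfl | ⟨rfl, g, rfl⟩ | ⟨k, Y, rfl, rfl⟩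
    · rw [map_zero, gradedComm_zero_right]
    · refine operator_ext fun U h => ?_
      simp [gradedComm, (ι.isRightDer_contraction j X U).fn_mul (ι.contraction_fn j X U)]
    · rw [operator_ofSect, operator_ofSect]
      have h1 : ∀ j (X : V.Sect j) U, (ι.contraction j X).app U 1 = 0 := fun j X U =>
        (ι.isRightDer_contraction j X U).map_one
      refine ι.operator_ext_coord (d := -((j : ℤ) + 1) + -((k : ℤ) + 1)) (fun U =>
        isRightDer_of_mem_firstOrder (gradedComm_mem_firstOrder (ι.contraction_mem j X)
          (ι.contraction_mem k Y)) ?_) (fun U => ⟨by simp, fun _ _ _ => zero_mem _⟩) ?_ ?_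
      · simp [gradedComm, h1]
      · simp [gradedComm]
      · simp [gradedComm, contraction_coord]

/-- The operators that have a symbol. -/
def symbolic : Submodule ℝ N.Ops where
  carrier := {T | ∀ U j (f : Smooth m U) (θ : V.Covec j U),
    N.body U (T.app U (N.fn U f * ι.coord j U θ)) = f * N.body U (T.app U (ι.coord j U θ))}
  add_mem' hS hT U j f θ := by
    rw [operator_add_apply, operator_add_apply, map_add, map_add, hS U j f θ, hT U j f θ, mul_add]
  zero_mem' U j f θ := by simp
  smul_mem' c T hT U j f θ := by
    rw [operator_smul_apply, operator_smul_apply, map_smul, map_smul, hT U j f θ, mul_smul_comm]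

lemma body_coord (θ : V.Covec j U) : N.body U (ι.coord j U θ) = 0 :=
  body_of_mem (ι.coord_mem θ) (Nat.succ_ne_zero _)

lemma firstOrder_le_symbolic (d : ℤ) : N.firstOrder d ≤ ι.symbolic := by
  intro T hT U j f θ
  rw [hT.2, map_add, body_mul, body_mul, body_fn, body_of_mem (twist_mem d (ι.coord_mem θ))
    (Nat.succ_ne_zero _), mul_zero, add_zero]

lemma exists_symbol (T : ι.symbolic) : ∃ v : V.Sec, (∀ U, globRes U v.1 = N.body U (T.1.app U 1)) ∧
    ∀ U j (θ : V.Covec j U), V.pair θ (v.2 j) = N.body U (T.1.app U (ι.coord j U θ)) := by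
  have h := fun j => exists_sect (V := V) (j := j)
    (fun U => (N.body U).comp ((T.1.app U).comp (ι.coord j U)))
    (fun {U W} h θ => by
      simp only [LinearMap.comp_apply, res_body, res_operator, ι.res_coord])
    (fun U f θ => by
      simp only [LinearMap.comp_apply, ι.coord_mul]
      exact T.2 U j f θ)
  choose Z hZ using h
  let g := N.body ⊤ (T.1.app ⊤ 1)
  refine ⟨(⟨fun x => g ⟨x, trivial⟩, fun x => ?_⟩, Z), fun U => ?_, fun U j θ => hZ j U θ⟩
  · refine (g.contMDiffAt (Opens.mem_top x)).congr_of_eventuallyEq (Filter.Eventually.of_forall ?_)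
    intro y
    exact (extZero_of_mem g (Opens.mem_top y)).symm
  · have h1 := res_body (le_top : U ≤ ⊤) (T.1.app ⊤ 1)
    have h2 : N.res (le_top : U ≤ ⊤) 1 = 1 := map_one _
    rw [res_operator, h2] at h1
    exact (Smooth.ext fun x => rfl).trans h1

lemma sec_ext {v w : V.Sec} (h1 : ∀ U, globRes (m := m) U v.1 = globRes U w.1)
    (h2 : ∀ U j (θ : V.Covec j U), V.pair θ (v.2 j) = V.pair θ (w.2 j)) : v = w := by
  refine Prod.ext (ContMDiffMap.ext fun x => ?_) (funext fun j => ?_)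
  · exact congrArg (fun f : Smooth m (⊤ : Opens M) => f ⟨x, trivial⟩) (h1 ⊤)
  · exact sect_ext_of_covec fun U θ x => congrArg (fun f : Smooth m U => f x) (h2 U j θ)

lemma globRes_add (U : Opens M) (f g : 𝒞) : globRes U (f + g) = globRes U f + globRes U g := rfl

lemma globRes_smul (U : Opens M) (c : ℝ) (f : 𝒞) : globRes U (c • f) = c • globRes U f := rfl

lemma exists_symbolMap : ∃ Z : N.Ops →ₗ[ℝ] V.Sec, ∀ T ∈ ι.symbolic,
    (∀ U, globRes U (Z T).1 = N.body U (T.app U 1)) ∧ ∀ U j (θ : V.Covec j U),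
    V.pair θ ((Z T).2 j) = N.body U (T.app U (ι.coord j U θ)) := by
  choose Z h1 h2 using ι.exists_symbol
  let Z' : ι.symbolic →ₗ[ℝ] V.Sec :=
    { toFun := Z
      map_add' S T := by
        refine sec_ext (fun U => ?_) fun U j θ => ?_
        · change _ = globRes U ((Z S).1 + (Z T).1)
          rw [globRes_add, h1, h1, h1, ← map_add]
          rfl
        · change _ = V.pair θ ((Z S).2 j + (Z T).2 j)
          rw [pair_add, h2, h2, h2, ← map_add]
          rfl
      map_smul' c T := by
        refine sec_ext (fun U => ?_) fun U j θ => ?_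
        · change _ = globRes U (c • (Z T).1)
          rw [globRes_smul, h1, h1, ← map_smul]
          rfl
        · change _ = V.pair θ (c • (Z T).2 j)
          rw [pair_smul, h2, h2, ← map_smul]
          rfl }
  obtain ⟨Z'', hZ''⟩ := Z'.exists_extend
  refine ⟨Z'', fun T hT => ?_⟩
  have : Z'' T = Z ⟨T, hT⟩ := congrArg (fun L => L ⟨T, hT⟩) hZ''
  rw [this]
  exact ⟨h1 ⟨T, hT⟩, h2 ⟨T, hT⟩⟩

/-- The symbol: the element of `V_•` given by the values, on the body, of an operator on linear
functions and on `1`. -/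
def symbol : N.Ops →ₗ[ℝ] V.Sec := ι.exists_symbolMap.choose

lemma globRes_symbol {T : N.Ops} (hT : T ∈ ι.symbolic) (U : Opens M) : globRes U (ι.symbol T).1 =
    N.body U (T.app U 1) := (ι.exists_symbolMap.choose_spec T hT).1 U

lemma pair_symbol {T : N.Ops} (hT : T ∈ ι.symbolic) (θ : V.Covec j U) :
    V.pair θ ((ι.symbol T).2 j) = N.body U (T.app U (ι.coord j U θ)) :=
  (ι.exists_symbolMap.choose_spec T hT).2 U j θ

lemma symbol_eq {T : N.Ops} (hT : T ∈ ι.symbolic) {v : V.Sec}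
    (h1 : ∀ U, N.body U (T.app U 1) = globRes U v.1)
    (h2 : ∀ U j (θ : V.Covec j U), N.body U (T.app U (ι.coord j U θ)) = V.pair θ (v.2 j)) :
    ι.symbol T = v :=
  sec_ext (fun U => (ι.globRes_symbol hT U).trans (h1 U))
    fun U j θ => (ι.pair_symbol hT θ).trans (h2 U j θ)

lemma symbol_operator_of_mem {v : V.Sec} (hv : v ∈ V.gr d) : ι.symbol (ι.operator v) = v := by
  rcases mem_gr_cases hv with rfl | ⟨rfl, f, rfl⟩ | ⟨j, X, rfl, rfl⟩
  · rw [map_zero, map_zero]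
  · rw [operator_ofFun]
    refine ι.symbol_eq (ι.firstOrder_le_symbolic _ (mulOp_mem_firstOrder f)) (fun U => ?_)
      fun U j θ => ?_
    · rw [mulOp_apply, mul_one, body_fn]; rfl
    · rw [mulOp_apply, body_mul, ι.body_coord, mul_zero]
      exact (pair_zero θ).symm
  · rw [operator_ofSect]
    refine ι.symbol_eq (ι.firstOrder_le_symbolic _ (ι.contraction_mem j X)) (fun U => ?_)
      fun U k θ => ?_
    · rw [(ι.isRightDer_contraction j X U).map_one, map_zero]; rfl
    · rw [contraction_coord, body_fn]; rfl

lemma symbol_mem {T : N.Ops} (hT : T ∈ N.firstOrder d) : ι.symbol T ∈ V.gr d := by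
  have hs := ι.firstOrder_le_symbolic d hT
  refine ⟨fun hd => ?_, fun j hd => ?_⟩
  · have h1 := ι.globRes_symbol hs ⊤
    have h2 : (1 : N.O ⊤) ∈ N.grInt ⊤ 0 := by
      rw [← map_one (N.fn ⊤)]; exact fn_mem_grInt _ _
    rw [body_of_mem_grInt (operator_apply_mem hT.1 h2) (by simpa using hd)] at h1
    ext x
    exact congrArg (fun f : Smooth m (⊤ : Opens M) => f ⟨x, trivial⟩) h1
  · refine sect_ext_of_covec fun U θ x => ?_
    have h1 := ι.pair_symbol hs θ
    rw [body_of_mem_grInt (hT.1 U _ _ (ι.coord_mem θ)) (by push_cast; omega)] at h1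
    rw [← pair_apply, h1]
    exact ((θ.1 x).map_zero).symm

lemma body_apply_eq_zero {T : N.Ops} (hT : T ∈ N.firstOrder d) (h0 : ι.symbol T = 0)
    (hf : N.body U f = 0) : N.body U (T.app U f) = 0 := by
  have hs := ι.firstOrder_le_symbolic d hT
  refine body_eq_zero_of_locally fun x hx => ?_
  obtain ⟨W, hW, hxW, ⟨b⟩⟩ := exists_frame V hx
  refine ⟨W, hW, hxW, ?_⟩
  obtain ⟨g, c, hg⟩ := (ι.isCoordinates b).exists_eq_fn_add (N.res hW f)
  have hq : ∀ α, N.body W (ι.frameCoord b α) = 0 := fun α => ι.body_coord _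
  have hg0 : g = 0 := by
    have := congrArg (N.body W) hg
    rw [← res_body, hf, map_zero, map_add, body_fn, map_sum] at this
    simpa [hq] using this.symm
  rw [res_operator, hg, hg0, map_zero, zero_add, map_sum, map_sum]
  refine sum_eq_zero fun α _ => ?_
  have h1 := ι.pair_symbol hs (b.θ α)
  rw [h0] at h1
  have h2 : N.body W (T.app W (ι.frameCoord b α)) = 0 := h1.symm.trans (pair_zero _)
  rw [hT.2, map_add, body_mul, body_mul, h2, mul_zero, zero_add,
    body_of_mem (twist_mem d (ι.frameCoord_mem b α)) (Nat.succ_ne_zero _), mul_zero]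

lemma symbol_gradedComm_eq_zero {a b : ℤ} {A B : N.Ops} (hA : A ∈ N.firstOrder a)
    (hB : B ∈ N.firstOrder b) (hA0 : ι.symbol A = 0) (hB0 : ι.symbol B = 0) :
    ι.symbol (gradedComm a b A B) = 0 := by
  have h1 : ∀ {a : ℤ} {A : N.Ops}, A ∈ N.firstOrder a → ι.symbol A = 0 →
      (∀ U, N.body U (A.app U 1) = 0) ∧ ∀ U j (θ : V.Covec j U),
        N.body U (A.app U (ι.coord j U θ)) = 0 := by
    intro a A hA h0
    have hs := ι.firstOrder_le_symbolic a hA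
    refine ⟨fun U => ?_, fun U j θ => ?_⟩
    · rw [← ι.globRes_symbol hs, h0]; rfl
    · rw [← ι.pair_symbol hs, h0]
      exact pair_zero _
  refine ι.symbol_eq (ι.firstOrder_le_symbolic _ (gradedComm_mem_firstOrder hA hB)) (fun U => ?_)
    fun U j θ => ?_
  · simp only [gradedComm, operator_sub_apply, operator_smul_apply, operator_mul_apply, map_sub,
      map_smul]
    rw [ι.body_apply_eq_zero hA hA0 ((h1 hB hB0).1 U), ι.body_apply_eq_zero hB hB0 ((h1 hA hA0).1 U),
      smul_zero, sub_zero]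
    rfl
  · simp only [gradedComm, operator_sub_apply, operator_smul_apply, operator_mul_apply, map_sub,
      map_smul]
    rw [ι.body_apply_eq_zero hA hA0 ((h1 hB hB0).2 U j θ),
      ι.body_apply_eq_zero hB hB0 ((h1 hA hA0).2 U j θ), smul_zero, sub_zero]
    exact (pair_zero _).symm

lemma symbol_gradedComm {a b : ℤ} {A B : N.Ops} (hA : A ∈ N.firstOrder a)
    (hB : B ∈ N.firstOrder b) : ι.symbol (gradedComm a b A B) =
    ι.symbol (gradedComm a b (ι.operator (ι.symbol A)) B) + ι.symbol
    (gradedComm a b A (ι.operator (ι.symbol B))) := by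
  have hA' := ι.operator_mem (ι.symbol_mem hA)
  have hB' := ι.operator_mem (ι.symbol_mem hB)
  have h0 : ∀ {a : ℤ} {A : N.Ops}, A ∈ N.firstOrder a →
      ι.symbol (A - ι.operator (ι.symbol A)) = 0 := by
    intro a A hA
    rw [map_sub, ι.symbol_operator_of_mem (ι.symbol_mem hA), sub_self]
  have h1 := ι.symbol_gradedComm_eq_zero (Submodule.sub_mem _ hA hA') (Submodule.sub_mem _ hB hB')
    (h0 hA) (h0 hB)
  rw [gradedComm_sub_left, gradedComm_sub_right, gradedComm_sub_right,
    ι.gradedComm_operator (ι.symbol_mem hA) (ι.symbol_mem hB), sub_zero, map_sub, map_sub] at h1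
  rw [sub_sub, sub_eq_zero] at h1
  rw [h1, add_comm]

end Identification

lemma neg_one_zpow_add (a b : ℤ) : (-1 : ℝ) ^ (a + b) = (-1 : ℝ) ^ a * (-1 : ℝ) ^ b :=
  zpow_add₀ (by norm_num) a b

lemma neg_one_zpow_sq (a : ℤ) : (-1 : ℝ) ^ a * (-1 : ℝ) ^ a = 1 :=
  neg_one_zpow_mul_self a

section GradedComm

variable {E : Type*} [Ring E] [Algebra ℝ E]

lemma gradedComm_add_left (a b : ℤ) (A A' B : E) : gradedComm a b (A + A') B =
    gradedComm a b A B + gradedComm a b A' B := by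
  simp only [gradedComm, add_mul, mul_add, smul_add]; abel

lemma gradedComm_smul_left (a b : ℤ) (c : ℝ) (A B : E) : gradedComm a b (c • A) B =
    c • gradedComm a b A B := by
  simp only [gradedComm, smul_sub, smul_mul_assoc, mul_smul_comm, smul_comm c]

lemma gradedComm_comm (a b : ℤ) (A B : E) : gradedComm a b A B =
    -((-1 : ℝ) ^ (a * b) • gradedComm b a B A) := by
  simp only [gradedComm, smul_sub, smul_smul, mul_comm b a, neg_one_zpow_sq, one_smul, neg_sub]

lemma gradedComm_gradedComm (a b d : ℤ) (A B C : E) : gradedComm (a + b) d (gradedComm a b A B) C =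
    gradedComm a (b + d) A (gradedComm b d B C) + (-1 : ℝ) ^ (b * d) • gradedComm (a + d) b
    (gradedComm a d A C) B := by
  have h1 : (-1 : ℝ) ^ (d * b) = (-1 : ℝ) ^ (b * d) := by rw [mul_comm]
  have h2 := neg_one_zpow_sq (b * d)
  simp only [gradedComm, add_mul, mul_add, neg_one_zpow_add, h1]
  generalize (-1 : ℝ) ^ (a * d) = x
  generalize (-1 : ℝ) ^ (b * d) = y at *
  generalize (-1 : ℝ) ^ (a * b) = z
  have h3 : ∀ t : ℝ, y * (y * t) = t := fun t => by rw [← mul_assoc, h2, one_mul]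
  simp only [sub_mul, mul_sub, smul_sub, smul_mul_assoc, mul_smul_comm, smul_smul, mul_assoc, h3,
    mul_comm x y, mul_comm z x, mul_comm z y]
  module

lemma gradedComm_mul_left (a b d : ℤ) (A B C : E) : gradedComm (a + b) d (A * B) C =
    A * gradedComm b d B C + (-1 : ℝ) ^ (b * d) • (gradedComm a d A C * B) := by
  simp only [gradedComm, add_mul, neg_one_zpow_add, smul_sub, sub_mul, mul_sub, smul_mul_assoc,
    mul_smul_comm, smul_smul, mul_assoc, mul_comm ((-1 : ℝ) ^ (b * d))]
  abel

end GradedComm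

/-- The data for higher derived brackets: operators with a projection to an abelian algebra of
operators of elements of `S`. -/
structure VoronovData (E S : Type*) [Ring E] [Algebra ℝ E] [AddCommGroup S] [Module ℝ S] where
  L : ℤ → Submodule ℝ E
  gr : ℤ → Submodule ℝ S
  I : S →ₗ[ℝ] E
  Z : E →ₗ[ℝ] S
  ad : S →ₗ[ℝ] E →ₗ[ℝ] E
  comm_mem : ∀ {a b A B}, A ∈ L a → B ∈ L b → gradedComm a b A B ∈ L (a + b)
  I_mem : ∀ {d v}, v ∈ gr d → I v ∈ L d
  Z_mem : ∀ {a A}, A ∈ L a → Z A ∈ gr a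
  abelian : ∀ {d e v w}, v ∈ gr d → w ∈ gr e → gradedComm d e (I v) (I w) = 0
  law : ∀ {a b A B}, A ∈ L a → B ∈ L b → Z (gradedComm a b A B) =
    Z (gradedComm a b (I (Z A)) B) + Z (gradedComm a b A (I (Z B)))
  ad_apply : ∀ {a d v A}, v ∈ gr d → A ∈ L a → ad v A = gradedComm a d A (I v)

namespace VoronovData

variable {E S : Type*} [Ring E] [Algebra ℝ E] [AddCommGroup S] [Module ℝ S] (Φ : VoronovData E S)

/-- Iterated commutators of an operator of degree `t` with the operators of elements of given
degrees. -/
def adList : ℤ → List (S × ℤ) → E → E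
  | _, [], T => T
  | t, x :: l, T => adList (t + x.2) l (gradedComm t x.2 T (Φ.I x.1))

@[simp] lemma adList_nil (t : ℤ) (T : E) : Φ.adList t [] T = T := rfl

@[simp] lemma adList_cons (t : ℤ) (x : S × ℤ) (l : List (S × ℤ)) (T : E) : Φ.adList t (x :: l) T =
    Φ.adList (t + x.2) l (gradedComm t x.2 T (Φ.I x.1)) := rfl

def deg (l : List (S × ℤ)) : ℤ := (l.map Prod.snd).sum

@[simp] lemma deg_nil : deg ([] : List (S × ℤ)) = 0 := rfl

@[simp] lemma deg_cons (x : S × ℤ) (l : List (S × ℤ)) : deg (x :: l) = x.2 + deg l := by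
  simp [deg]

lemma adList_add (t : ℤ) (l : List (S × ℤ)) (T T' : E) : Φ.adList t l (T + T') =
    Φ.adList t l T + Φ.adList t l T' := by
  induction l generalizing t T T' with
  | nil => rfl
  | cons x l ih => rw [adList_cons, gradedComm_add_left, ih]; rfl

lemma adList_smul (t : ℤ) (l : List (S × ℤ)) (c : ℝ) (T : E) : Φ.adList t l (c • T) =
    c • Φ.adList t l T := by
  induction l generalizing t T with
  | nil => rfl
  | cons x l ih => rw [adList_cons, gradedComm_smul_left, ih]; rfl

lemma adList_zero (t : ℤ) (l : List (S × ℤ)) : Φ.adList t l 0 = 0 := by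
  simpa using Φ.adList_smul t l 0 0

lemma adList_mem {t : ℤ} {l : List (S × ℤ)} {T : E} (hT : T ∈ Φ.L t)
    (hl : ∀ x ∈ l, x.1 ∈ Φ.gr x.2) : Φ.adList t l T ∈ Φ.L (t + deg l) := by
  induction l generalizing t T with
  | nil => simpa using hT
  | cons x l ih =>
    rw [deg_cons, ← add_assoc]
    exact ih (Φ.comm_mem hT (Φ.I_mem (hl x mem_cons_self)))
      fun y hy => hl y (mem_cons_of_mem _ hy)

lemma gradedComm_swap {t d e : ℤ} {v w : S} (T : E) (hv : v ∈ Φ.gr d) (hw : w ∈ Φ.gr e) :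
    gradedComm (t + d) e (gradedComm t d T (Φ.I v)) (Φ.I w) =
    (-1 : ℝ) ^ (d * e) • gradedComm (t + e) d (gradedComm t e T (Φ.I w)) (Φ.I v) := by
  rw [gradedComm_gradedComm, Φ.abelian hv hw, gradedComm_zero_right, zero_add]

lemma adList_cons_eq {t : ℤ} {x : S × ℤ} {l : List (S × ℤ)} (T : E) (hx : x.1 ∈ Φ.gr x.2)
    (hl : ∀ y ∈ l, y.1 ∈ Φ.gr y.2) : Φ.adList t (x :: l) T =
    (-1 : ℝ) ^ (x.2 * deg l) • gradedComm (t + deg l) x.2 (Φ.adList t l T) (Φ.I x.1) := by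
  induction l generalizing t T with
  | nil => simp
  | cons y l ih =>
    rw [adList_cons, adList_cons, Φ.gradedComm_swap T hx (hl y mem_cons_self), adList_smul]
    have := ih (t := t + y.2) (gradedComm t y.2 T (Φ.I y.1))
      fun z hz => hl z (mem_cons_of_mem _ hz)
    rw [adList_cons] at this
    rw [add_right_comm, this, smul_smul, ← neg_one_zpow_add, deg_cons, ← mul_add, add_assoc,
      adList_cons]

/-- The terms of the expansion of an iterated commutator of `[A, B]`. -/
def expansion : ℤ → ℤ → List (S × ℤ) → E → E → S
  | a, b, [], A, B => Φ.Z (gradedComm a b A (Φ.I (Φ.Z B)))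
  | a, b, x :: l, A, B => expansion a (b + x.2) l A (gradedComm b x.2 B (Φ.I x.1)) +
      (-1 : ℝ) ^ (b * x.2) • expansion (a + x.2) b l (gradedComm a x.2 A (Φ.I x.1)) B

lemma Z_adList_gradedComm {a b : ℤ} {A B : E} (hA : A ∈ Φ.L a) (hB : B ∈ Φ.L b) {l : List (S × ℤ)}
    (hl : ∀ y ∈ l, y.1 ∈ Φ.gr y.2) : Φ.Z (Φ.adList (a + b) l (gradedComm a b A B)) =
    Φ.expansion a b l A B - (-1 : ℝ) ^ (a * b) • Φ.expansion b a l B A := by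
  induction l generalizing a b A B with
  | nil =>
    rw [adList_nil, Φ.law hA hB, gradedComm_comm a b (Φ.I _), map_neg, map_smul, expansion,
      expansion, neg_add_eq_sub]
  | cons x l ih =>
    have hx := Φ.I_mem (hl x mem_cons_self)
    have hl' : ∀ y ∈ l, y.1 ∈ Φ.gr y.2 := fun y hy => hl y (mem_cons_of_mem _ hy)
    rw [adList_cons, gradedComm_gradedComm, adList_add, adList_smul, map_add, map_smul]
    have h1 := ih hA (Φ.comm_mem hB hx) hl'
    have h2 := ih (Φ.comm_mem hA hx) hB hl'
    rw [← add_assoc] at h1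
    rw [add_right_comm] at h2
    rw [h1, h2, expansion, expansion]
    have h3 : (-1 : ℝ) ^ (b * x.2) * (-1 : ℝ) ^ ((a + x.2) * b) = (-1 : ℝ) ^ (a * b) := by
      rw [add_mul, neg_one_zpow_add, mul_comm x.2, mul_left_comm, neg_one_zpow_sq, mul_one]
    rw [smul_sub, smul_smul, h3, smul_add, smul_smul, mul_add, neg_one_zpow_add]
    abel

lemma expansion_self {D : E} (hD : D ∈ Φ.L 1) {l : List (S × ℤ)} (hl : ∀ y ∈ l, y.1 ∈ Φ.gr y.2) :
    Φ.expansion 1 1 l D D = Φ.Z (Φ.adList 2 l (D * D)) := by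
  have h1 := Φ.Z_adList_gradedComm hD hD hl
  have h2 : gradedComm 1 1 D D = (2 : ℝ) • (D * D) := by
    simp [gradedComm, two_smul]
  rw [h2, adList_smul, map_smul, mul_one, zpow_one, neg_one_smul, sub_neg_eq_add,
    ← two_smul ℝ (Φ.expansion 1 1 l D D), show (1 : ℤ) + 1 = 2 from rfl] at h1
  exact (smul_right_injective S (two_ne_zero' ℝ) h1).symm

/-- The elements of a finite sequence that are selected by `c`. -/
def select {T : Type*} {n : ℕ} (c : Fin n → Bool) (x : Fin n → T) : List T :=
  ((finRange n).filter fun i => c i).map x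

lemma select_succ {T : Type*} (c : Fin (n + 1) → Bool) (x : Fin (n + 1) → T) : select c x =
    (if c 0 then [x 0] else []) ++ select (Fin.tail c) (Fin.tail x) := by
  rw [select, List.finRange_succ, List.filter_cons]
  have : ((List.map Fin.succ (finRange n)).filter fun i => c i).map x =
      select (Fin.tail c) (Fin.tail x) := by
    rw [List.filter_map, List.map_map]
    rfl
  split_ifs with h
  · rw [List.map_cons, this]; rfl
  · rw [this]; rfl

lemma mem_select {T : Type*} {c : Fin n → Bool} {x : Fin n → T} {y : T} (h : y ∈ select c x) : ∃ i,
    x i = y := by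
  obtain ⟨i, -, hi⟩ := List.mem_map.1 h
  exact ⟨i, hi⟩

/-- The Koszul sign of moving the selected elements to the front. -/
def selectSign {n : ℕ} (c : Fin n → Bool) (d : Fin n → ℤ) : ℝ :=
  ∏ i, ∏ j, if c i = false ∧ c j = true ∧ i < j then (-1 : ℝ) ^ (d i * d j) else 1

lemma prod_neg_one_zpow {κ : Type*} (s : Finset κ) (e : κ → ℤ) : ∏ i ∈ s, (-1 : ℝ) ^ e i =
    (-1 : ℝ) ^ ∑ i ∈ s, e i := by
  classical
  induction s using Finset.induction_on with
  | empty => simp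
  | insert a s ha ih => rw [Finset.prod_insert ha, sum_insert ha, ih, neg_one_zpow_add]

lemma deg_select {n : ℕ} (c : Fin n → Bool) (x : Fin n → S × ℤ) : deg (select c x) = ∑ i,
    if c i then (x i).2 else 0 := by
  induction n with
  | zero => rfl
  | succ n ih =>
    rw [select_succ, Fin.sum_univ_succ]
    have := ih (Fin.tail c) (Fin.tail x)
    split_ifs with h
    · rw [List.singleton_append, deg_cons, this]; rfl
    · rw [List.nil_append, this, zero_add]; rfl

lemma selectSign_succ (c : Fin (n + 1) → Bool) (x : Fin (n + 1) → S × ℤ) :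
    selectSign c (fun i => (x i).2) =
    (if c 0 then 1 else (-1 : ℝ) ^ ((x 0).2 * deg (select (Fin.tail c) (Fin.tail x)))) *
    selectSign (Fin.tail c) (fun i => (Fin.tail x i).2) := by
  rw [selectSign, Fin.prod_univ_succ]
  congr 1
  · rw [Fin.prod_univ_succ, if_neg (by simp), one_mul]
    by_cases h : c 0 = true
    · simp [h]
    · rw [if_neg h, deg_select, mul_sum, ← prod_neg_one_zpow]
      refine prod_congr rfl fun j _ => ?_
      by_cases hj : c j.succ = true
      · simp [Fin.tail, h, hj]
      · simp [Fin.tail, hj]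
  · refine prod_congr rfl fun i _ => ?_
    rw [Fin.prod_univ_succ, if_neg (by simp), one_mul]
    refine prod_congr rfl fun j _ => ?_
    simp only [Fin.succ_lt_succ_iff]
    rfl

/-- The term of the expansion with a given selection of the inner elements. -/
def expansionTerm {n : ℕ} (a b : ℤ) (x : Fin n → S × ℤ) (A B : E) (c : Fin n → Bool) : S :=
  ((-1 : ℝ) ^ (b * deg (select (fun i => !c i) x)) *
    (-1 : ℝ) ^ (deg (select c x) * deg (select (fun i => !c i) x)) *
      selectSign c fun i => (x i).2) •
    Φ.Z (gradedComm (a + deg (select (fun i => !c i) x)) (b + deg (select c x))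
      (Φ.adList a (select (fun i => !c i) x) A) (Φ.I (Φ.Z (Φ.adList b (select c x) B))))

lemma expansion_eq_sum {n : ℕ} (a b : ℤ) (x : Fin n → S × ℤ) (A B : E) :
    Φ.expansion a b (ofFn x) A B = ∑ c, Φ.expansionTerm a b x A B c := by
  induction n generalizing a b A B with
  | zero =>
    rw [Fintype.sum_unique]
    simp [expansion, expansionTerm, select, selectSign]
  | succ n ih =>
    rw [ofFn_succ, expansion]
    change Φ.expansion a _ (ofFn (Fin.tail x)) A _ +
      _ • Φ.expansion _ b (ofFn (Fin.tail x)) _ B = _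
    rw [ih, ih, ← (Fin.consEquiv fun _ => Bool).sum_comp, Fintype.sum_prod_type, Fintype.sum_bool,
      smul_sum]
    have htail : ∀ (ε : Bool) (c : Fin n → Bool),
        Fin.tail (fun i => !(Fin.consEquiv (fun _ => Bool)) (ε, c) i) = fun i => !c i :=
      fun ε c => rfl
    have htail' : ∀ (ε : Bool) (c : Fin n → Bool),
        Fin.tail ((Fin.consEquiv (fun _ => Bool)) (ε, c)) = c := fun ε c => rfl
    have h0 : ∀ (ε : Bool) (c : Fin n → Bool), (Fin.consEquiv (fun _ => Bool)) (ε, c) 0 = ε :=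
      fun ε c => rfl
    congr 1
    · refine sum_congr rfl fun c _ => ?_
      rw [expansionTerm, expansionTerm, selectSign_succ]
      simp only [select_succ, htail, htail', h0, Bool.not_true, Bool.false_eq_true, if_false, if_true,
        List.nil_append, List.singleton_append, deg_cons, adList_cons, one_mul]
      rw [← add_assoc, add_mul, add_mul, neg_one_zpow_add, neg_one_zpow_add]
      congr 1
      ring
    · refine sum_congr rfl fun c _ => ?_
      rw [expansionTerm, expansionTerm, selectSign_succ, smul_smul]
      simp only [select_succ, htail, htail', h0, Bool.not_false, Bool.false_eq_true, if_false, if_true,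
        List.nil_append, List.singleton_append, deg_cons, adList_cons]
      rw [← add_assoc, mul_add, mul_add, neg_one_zpow_add, neg_one_zpow_add,
        mul_comm (x 0).2]
      have := neg_one_zpow_sq (deg (select c (Fin.tail x)) * (x 0).2)
      congr 1
      linear_combination ((-1 : ℝ) ^ (b * (x 0).2) *
        (-1 : ℝ) ^ (b * deg (select (fun i => !c i) (Fin.tail x))) *
        (-1 : ℝ) ^ (deg (select c (Fin.tail x)) * deg (select (fun i => !c i) (Fin.tail x))) *
        selectSign c fun i => (Fin.tail x i).2) * (-this)

/-- Iterated commutators, as multilinear maps. -/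
def iterated : ∀ n : ℕ, E →ₗ[ℝ] MultilinearMap ℝ (fun _ : Fin n => S) E
  | 0 => LinearMap.mk (AddHom.mk (fun T => MultilinearMap.constOfIsEmpty ℝ _ T)
      fun _ _ => rfl) fun _ _ => rfl
  | n + 1 => (multilinearCurryLeftEquiv ℝ (fun _ : Fin (n + 1) => S) E).symm.toLinearMap.comp
      ((LinearMap.compRight ℝ (iterated n)).comp Φ.ad.flip)

lemma iterated_succ (T : E) (v : Fin (n + 1) → S) : Φ.iterated (n + 1) T v =
    Φ.iterated n (Φ.ad (v 0) T) (Fin.tail v) := rfl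

lemma iterated_eq {n : ℕ} {t : ℤ} {T : E} (hT : T ∈ Φ.L t) {v : Fin n → S} {d : Fin n → ℤ}
    (hv : ∀ i, v i ∈ Φ.gr (d i)) : Φ.iterated n T v = Φ.adList t (ofFn fun i => (v i, d i)) T := by
  induction n generalizing t T with
  | zero => rfl
  | succ n ih =>
    rw [iterated_succ, Φ.ad_apply (hv 0) hT, ofFn_succ, adList_cons]
    exact ih (Φ.comm_mem hT (Φ.I_mem (hv 0))) fun i => hv i.succ

lemma iterated_swap {n : ℕ} {t : ℤ} {T : E} (hT : T ∈ Φ.L t) {v : Fin n → S} {d : Fin n → ℤ}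
    (hv : ∀ i, v i ∈ Φ.gr (d i)) (i j : Fin n) (hij : (i : ℕ) + 1 = j) :
    Φ.iterated n T (v ∘ Equiv.swap i j) = (-1 : ℝ) ^ (d i * d j) • Φ.iterated n T v := by
  induction n generalizing t T with
  | zero => exact i.elim0
  | succ n ih =>
    induction i using Fin.cases with
    | zero =>
      obtain ⟨n, rfl⟩ : ∃ k, n = k + 1 := ⟨n - 1, by have := j.2; simp at hij; omega⟩
      obtain rfl : j = 1 := Fin.ext (by simpa using hij.symm)
      have h0 : (v ∘ Equiv.swap (0 : Fin (n + 2)) 1) 0 = v 1 := by simp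
      have h1 : Fin.tail (v ∘ Equiv.swap (0 : Fin (n + 2)) 1) 0 = v 0 := by
        simp [Fin.tail]
      have h2 : Fin.tail (Fin.tail (v ∘ Equiv.swap (0 : Fin (n + 2)) 1)) =
          Fin.tail (Fin.tail v) := by
        funext k
        simp only [Fin.tail, Function.comp_apply]
        rw [Equiv.swap_apply_of_ne_of_ne (Fin.succ_ne_zero _)]
        intro h
        exact Fin.succ_ne_zero k (Fin.succ_injective _ h)
      rw [iterated_succ, iterated_succ, iterated_succ, iterated_succ, h0, h1, h2,
        Φ.ad_apply (hv 1) hT, Φ.ad_apply (hv 0) hT,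
        Φ.ad_apply (hv 0) (Φ.comm_mem hT (Φ.I_mem (hv 1))),
        Φ.gradedComm_swap T (hv 1) (hv 0), map_smul, mul_comm (d 0)]
      have h3 : Fin.tail v 0 = v 1 := rfl
      rw [h3, Φ.ad_apply (hv 1) (Φ.comm_mem hT (Φ.I_mem (hv 0)))]
      rfl
    | succ i =>
      have hj0 : j ≠ 0 := fun h => by
        have h' := congrArg Fin.val h
        simp only [Fin.val_succ, Fin.val_zero] at hij h'
        omega
      obtain ⟨j, rfl⟩ := Fin.eq_succ_of_ne_zero hj0
      have h0 : (v ∘ Equiv.swap i.succ j.succ) 0 = v 0 := by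
        rw [Function.comp_apply, Equiv.swap_apply_of_ne_of_ne (Fin.succ_ne_zero _).symm
          (Fin.succ_ne_zero _).symm]
      have h1 : Fin.tail (v ∘ Equiv.swap i.succ j.succ) = Fin.tail v ∘ Equiv.swap i j := by
        funext k
        simp only [Fin.tail, Function.comp_apply]
        rw [(Fin.succ_injective n).swap_apply]
      rw [iterated_succ, iterated_succ, h0, h1, Φ.ad_apply (hv 0) hT]
      exact ih (Φ.comm_mem hT (Φ.I_mem (hv 0))) (fun k => hv k.succ) i j (by simpa using hij)

/-- The higher derived brackets of `T`. -/
def bracket (T : E) (n : ℕ) : MultilinearMap ℝ (fun _ : Fin n => S) S :=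
  Φ.Z.compMultilinearMap (Φ.iterated n T)

lemma bracket_eq {t : ℤ} {T : E} (hT : T ∈ Φ.L t) {v : Fin n → S} {d : Fin n → ℤ}
    (hv : ∀ i, v i ∈ Φ.gr (d i)) : Φ.bracket T n v =
    Φ.Z (Φ.adList t (ofFn fun i => (v i, d i)) T) := by
  rw [← Φ.iterated_eq hT hv]; rfl

lemma bracket_mem {t : ℤ} {T : E} (hT : T ∈ Φ.L t) {v : Fin n → S} {d : Fin n → ℤ}
    (hv : ∀ i, v i ∈ Φ.gr (d i)) : Φ.bracket T n v ∈ Φ.gr (t + ∑ i, d i) := by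
  rw [Φ.bracket_eq hT hv]
  have h1 : deg (ofFn fun i => (v i, d i)) = ∑ i, d i := by
    rw [deg, List.map_ofFn, List.sum_ofFn]
    rfl
  rw [← h1]
  refine Φ.Z_mem (Φ.adList_mem hT fun x hx => ?_)
  obtain ⟨i, rfl⟩ := (mem_ofFn' _ _).1 hx
  exact hv i

lemma ofFn_orderEmbOfFin {T : Type*} (s : Finset (Fin n)) (x : Fin n → T) :
    ofFn (fun i => x (s.orderEmbOfFin rfl i)) = select (fun i => decide (i ∈ s)) x := by
  have h1 : ofFn (s.orderEmbOfFin rfl) = s.sort := by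
    refine List.ext_getElem (by simp) fun i h1 h2 => ?_
    rw [List.getElem_ofFn, Finset.orderEmbOfFin_apply]
    rfl
  have h2 : (finRange n).filter (fun i => decide (i ∈ s)) = s.sort := by
    have h3 : ((finRange n).filter (fun i => decide (i ∈ s))).toFinset = s := by
      ext i; simp
    have h4 : ((finRange n).filter (fun i => decide (i ∈ s))).Nodup :=
      (List.nodup_finRange n).filter _
    have h5 := (List.toFinset_sort (· ≤ ·) h4).2
      ((List.pairwise_le_finRange n).filter _)
    rw [← h5, h3]
  change ofFn (x ∘ s.orderEmbOfFin rfl) = _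
  rw [← List.map_ofFn, h1, select, ← h2]

lemma koszul_smul (d : Fin n → ℤ) (s : Finset (Fin n)) (y : S) : koszul d s • y =
    selectSign (fun i => decide (i ∈ s)) d • y := by
  have h1 : ((koszul d s : ℤ) : ℝ) = selectSign (fun i => decide (i ∈ s)) d := by
    rw [koszul, selectSign, Finset.prod_filter, Finset.prod_product, Units.coe_prod, Int.cast_prod,
      ← prod_subset (subset_univ sᶜ)]
    · refine prod_congr rfl fun i hi => ?_
      rw [Units.coe_prod, Int.cast_prod, ← prod_subset (subset_univ s)]
      · refine prod_congr rfl fun j hj => ?_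
        rw [mem_compl] at hi
        simp only [hi, hj, decide_true, decide_false, true_and]
        split_ifs
        · exact Int.cast_negOnePow ℝ _
        · simp
      · intro j _ hj
        simp [hj]
    · intro i _ hi
      rw [mem_compl, not_not] at hi
      simp [hi]
  rw [Units.smul_def, ← Int.cast_smul_eq_zsmul ℝ, h1]

lemma sum_bracket_bracket {D : E} (hD : D ∈ Φ.L 1) (hZ : Φ.Z D = 0) {v : Fin n → S} {d : Fin n → ℤ}
    (hv : ∀ i, v i ∈ Φ.gr (d i)) : ∑ s ∈
    (Finset.univ : Finset (Finset (Fin n))).filter (fun s => s.Nonempty),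
    koszul d s • Φ.bracket D (sᶜ.card + 1)
      (Matrix.vecCons (Φ.bracket D s.card (fun i => v (s.orderEmbOfFin rfl i)))
      (fun i => v (sᶜ.orderEmbOfFin rfl i))) =
    Φ.Z (Φ.adList 2 (ofFn fun i => (v i, d i)) (D * D)) := by
  classical
  have hl : ∀ y ∈ ofFn (fun i => (v i, d i)), y.1 ∈ Φ.gr y.2 := by
    intro x hx
    obtain ⟨i, rfl⟩ := (mem_ofFn' _ _).1 hx
    exact hv i
  rw [← Φ.expansion_self hD hl, expansion_eq_sum]
  have hbij : Bijective fun (s : Finset (Fin n)) (i : Fin n) => decide (i ∈ s) := by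
    refine ⟨fun s t h => ?_, fun c => ⟨Finset.univ.filter fun i => c i, by ext; simp⟩⟩
    ext i
    simpa using congrFun h i
  rw [← hbij.sum_comp, Finset.sum_filter]
  refine sum_congr rfl fun s _ => ?_
  set x : Fin n → S × ℤ := fun i => (v i, d i) with hx
  have hsel : ∀ c, ∀ y ∈ select c x, y.1 ∈ Φ.gr y.2 := fun c y hy => by
    obtain ⟨i, rfl⟩ := mem_select hy
    exact hv i
  set c : Fin n → Bool := fun i => decide (i ∈ s) with hc
  have hc' : (fun i => !c i) = fun i => decide (i ∈ sᶜ) := by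
    funext i
    simp [hc]
  have hin : Φ.bracket D s.card (fun i => v (s.orderEmbOfFin rfl i)) =
      Φ.Z (Φ.adList 1 (select c x) D) := by
    rw [Φ.bracket_eq hD (d := fun i => d (s.orderEmbOfFin rfl i)) fun i => hv _,
      ← ofFn_orderEmbOfFin s x]
  split_ifs with hs
  · rw [hin, koszul_smul]
    have hz := Φ.Z_mem (Φ.adList_mem hD (hsel c))
    rw [Φ.bracket_eq hD (d := Matrix.vecCons (1 + deg (select c x))
      fun i => d (sᶜ.orderEmbOfFin rfl i)) (Fin.cases hz fun i => hv _), ofFn_succ]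
    have hout : (ofFn fun i : Fin sᶜ.card => (Matrix.vecCons (Φ.Z (Φ.adList 1 (select c x) D))
        (fun i => v (sᶜ.orderEmbOfFin rfl i)) i.succ, Matrix.vecCons (1 + deg (select c x))
          (fun i => d (sᶜ.orderEmbOfFin rfl i)) i.succ)) = select (fun i => !c i) x := by
      rw [hc', ← ofFn_orderEmbOfFin sᶜ x]
      rfl
    rw [hout, expansionTerm]
    have := Φ.adList_cons_eq (x := (Φ.Z (Φ.adList 1 (select c x) D), 1 + deg (select c x)))
      (l := select (fun i => !c i) x) (t := 1) D hz (hsel _)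
    simp only [Matrix.cons_val_zero]
    rw [this, map_smul, smul_smul]
    congr 1
    rw [add_mul, neg_one_zpow_add]
    ring
  · rw [Finset.not_nonempty_iff_eq_empty] at hs
    have hnil : select c x = [] := by
      simp [select, hc, hs]
    rw [expansionTerm, hnil, adList_nil, hZ, map_zero, gradedComm_zero_right, map_zero,
      smul_zero]

end VoronovData

namespace GradedBundle

variable (V) in
def mulFunₗ (f : 𝒞) : V.Sec →ₗ[ℝ] V.Sec where
  toFun := V.mulFun f
  map_add' v w := by
    refine Prod.ext (mul_add f v.1 w.1) (funext fun j => ContMDiffSection.ext fun x => ?_)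
    exact smul_add (f x) (v.2 j x) (w.2 j x)
  map_smul' c v := by
    refine Prod.ext (mul_smul_comm c f v.1) (funext fun j => ContMDiffSection.ext fun x => ?_)
    exact smul_comm (f x) c (v.2 j x)

@[simp] lemma mulFunₗ_apply (f : 𝒞) (v : V.Sec) : V.mulFunₗ f v = V.mulFun f v :=
  rfl

lemma mulFun_mem {v : V.Sec} (hv : v ∈ V.gr d) (f : 𝒞) : V.mulFun f v ∈ V.gr d := by
  refine ⟨fun h => ?_, fun j h => ContMDiffSection.ext fun x => ?_⟩
  · change f * v.1 = 0
    rw [hv.1 h, mul_zero]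
  · change f x • v.2 j x = 0
    rw [hv.2 j h]
    exact smul_zero (f x)

def _root_.GradedGeometry.smulSect (f : 𝒞) (X : V.Sect j) : V.Sect j :=
  ⟨fun x => f x • X x, f.contMDiff.smul_section X.contMDiff⟩

lemma mulFun_ofSect (f : 𝒞) (X : V.Sect j) : V.mulFun f (V.ofSect j X) =
    V.ofSect j (smulSect f X) := by
  refine Prod.ext (mul_zero f) (funext fun k => ContMDiffSection.ext fun x => ?_)
  change f x • (Pi.single j X : ∀ k, V.Sect k) k x =
    (Pi.single j (smulSect f X) : ∀ k, V.Sect k) k x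
  by_cases hk : k = j
  · subst hk
    rw [Pi.single_eq_same, Pi.single_eq_same]
    rfl
  · rw [Pi.single_eq_of_ne hk, Pi.single_eq_of_ne hk]
    exact smul_zero (f x)

lemma mulFun_ofFun (f g : 𝒞) : V.mulFun f (V.ofFun g) = V.ofFun (f * g) := by
  refine Prod.ext rfl (funext fun k => ContMDiffSection.ext fun x => ?_)
  exact smul_zero (f x)

def component (v : V.Sec) : Option (Fin p) → V.Sec
  | none => V.ofFun v.1
  | some j => V.ofSect j (v.2 j)

def componentDeg : Option (Fin p) → ℤ
  | none => 0
  | some j => -((j : ℤ) + 1)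

lemma component_mem (v : V.Sec) (k : Option (Fin p)) : component v k ∈ V.gr (componentDeg k) := by
  cases k with
  | none => exact V.ofFun_mem _
  | some j => exact V.ofSect_mem j _

lemma sum_component (v : V.Sec) : ∑ k, component v k = v := by
  rw [Fintype.sum_option]
  refine Prod.ext ?_ ?_
  · rw [Prod.fst_add, Prod.fst_sum]
    simp [component, ofFun, ofSect]
  · rw [Prod.snd_add, Prod.snd_sum]
    change 0 + ∑ j, Pi.single j (v.2 j) = v.2
    rw [zero_add, Finset.univ_sum_single]

lemma multilinear_ext {F : Type*} [AddCommGroup F] [Module ℝ F]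
    {A B : MultilinearMap ℝ (fun _ : Fin n => V.Sec) F}
    (h : ∀ (d : Fin n → ℤ) (v : Fin n → V.Sec), (∀ i, v i ∈ V.gr (d i)) → A v = B v) : A = B := by
  ext v
  have hv : v = fun i => ∑ k, component (v i) k := funext fun i => (sum_component (v i)).symm
  rw [hv, A.map_sum, B.map_sum]
  exact sum_congr rfl fun c _ =>
    h (fun i => componentDeg (c i)) _ fun i => component_mem _ _

variable (V) in
def oddPart : V.Sec →ₗ[ℝ] V.Sec where
  toFun v := (0, fun j => if Odd ((j : ℕ) + 1) then v.2 j else 0)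
  map_add' v w := by
    refine Prod.ext (add_zero 0).symm (funext fun j => ?_)
    change (if _ then v.2 j + w.2 j else 0) = (if _ then v.2 j else 0) + if _ then w.2 j else 0
    split_ifs
    · rfl
    · exact (add_zero 0).symm
  map_smul' c v := by
    refine Prod.ext (smul_zero c).symm (funext fun j => ?_)
    change (if _ then c • v.2 j else 0) = c • if _ then v.2 j else 0
    split_ifs
    · rfl
    · exact (smul_zero c).symm

lemma oddPart_ofFun (f : 𝒞) : V.oddPart (V.ofFun f) = 0 :=
  Prod.ext rfl (funext fun _ => ite_self _)

lemma oddPart_ofSect (X : V.Sect j) : V.oddPart (V.ofSect j X) =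
    if Odd ((j : ℕ) + 1) then V.ofSect j X else 0 := by
  refine Prod.ext ?_ (funext fun k => ?_)
  · split_ifs <;> rfl
  · change (if Odd ((k : ℕ) + 1) then (Pi.single j X : ∀ k, V.Sect k) k else 0) = _
    by_cases hk : k = j
    · subst hk
      split_ifs <;> rfl
    · rw [Pi.single_eq_of_ne hk, ite_self]
      split_ifs
      · exact (Pi.single_eq_of_ne hk X).symm
      · rfl

end GradedBundle

namespace NManifold

variable (N) in
def parity : N.Ops := ⟨fun U => N.twist U 1, fun _ _ h f => res_twist h 1 f⟩

lemma parity_mul_mul {a : ℤ} {T : N.Ops} (hT : T ∈ N.operatorsDeg a) : N.parity * T * N.parity =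
    (-1 : ℝ) ^ a • T := by
  refine operator_ext fun U f => ?_
  change N.twist U 1 (T.app U (N.twist U 1 f)) = _
  rw [operator_twist hT, map_smul, twist_twist, mul_one]
  rfl

end NManifold

namespace Identification

variable (ι)

/-- The graded commutator with the operator of an element of `V_•`. -/
def adOp : V.Sec →ₗ[ℝ] N.Ops →ₗ[ℝ] N.Ops :=
  LinearMap.mk₂ ℝ (fun v T => T * ι.operator v - (ι.operator (v - V.oddPart v) * T +
      ι.operator (V.oddPart v) * (N.parity * T * N.parity)))
    (fun v w T => by simp only [map_add, map_sub, mul_add, add_mul, sub_mul]; abel)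
    (fun c v T => by
      simp only [map_smul, map_sub, mul_smul_comm, smul_mul_assoc, smul_sub, smul_add, sub_mul])
    (fun v S T => by simp only [mul_add, add_mul]; abel)
    (fun c v T => by simp only [mul_smul_comm, smul_mul_assoc, smul_sub, smul_add])

lemma adOp_apply {a d : ℤ} {v : V.Sec} {T : N.Ops} (hv : v ∈ V.gr d) (hT : T ∈ N.firstOrder a) :
    ι.adOp v T = gradedComm a d T (ι.operator v) := by
  change T * ι.operator v - (ι.operator (v - V.oddPart v) * T +
      ι.operator (V.oddPart v) * (N.parity * T * N.parity)) = _
  rw [parity_mul_mul hT.1, gradedComm]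
  rcases mem_gr_cases hv with rfl | ⟨rfl, f, rfl⟩ | ⟨j, X, rfl, rfl⟩
  · simp only [map_zero, sub_zero, zero_mul, add_zero, smul_zero]
  · rw [oddPart_ofFun, sub_zero, map_zero, zero_mul, add_zero, mul_zero, zpow_zero,
      one_smul]
  · rw [oddPart_ofSect]
    congr 1
    have h1 : (-1 : ℝ) ^ (a * -((j : ℤ) + 1)) = ((-1 : ℝ) ^ ((j : ℕ) + 1)) ^ a := by
      rw [← zpow_natCast, ← zpow_mul, mul_comm a, neg_mul, zpow_neg, ← inv_zpow, inv_neg, inv_one]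
      push_cast
      rfl
    rw [h1]
    split_ifs with h
    · rw [sub_self, map_zero, zero_mul, zero_add, mul_smul_comm, h.neg_one_pow]
    · rw [Nat.not_odd_iff_even] at h
      rw [sub_zero, map_zero, zero_mul, add_zero, h.neg_one_pow, one_zpow, one_smul]

/-- The data for the derived brackets. -/
def voronov : VoronovData N.Ops V.Sec where
  L := N.firstOrder
  gr := V.gr
  I := ι.operator
  Z := ι.symbol
  ad := ι.adOp
  comm_mem := gradedComm_mem_firstOrder
  I_mem := ι.operator_mem
  Z_mem := ι.symbol_mem
  abelian := ι.gradedComm_operator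
  law := ι.symbol_gradedComm
  ad_apply := ι.adOp_apply

end Identification

/-- The axioms of an `L_∞[1]`-algebroid, except for the Jacobi identities. -/
structure PreAlgebroid (V : GradedBundle.{u, w} m M r) where
  a : ∀ n : ℕ, MultilinearMap ℝ (fun _ : Fin n => V.Sec) V.Sec
  degree : ∀ (n : ℕ) (d : Fin n → ℤ) (v : Fin n → V.Sec), (∀ i, v i ∈ V.gr (d i)) →
    a n v ∈ V.gr ((∑ i, d i) + 1)
  symm : ∀ (n : ℕ) (d : Fin n → ℤ) (v : Fin n → V.Sec), (∀ i, v i ∈ V.gr (d i)) →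
    ∀ i j : Fin n, (i : ℕ) + 1 = j →
      a n (v ∘ Equiv.swap i j) = Int.negOnePow (d i * d j) • a n v
  linear : ∀ (n : ℕ) (v : Fin n → V.Sec) (i : Fin n) (f : 𝒞), n ≠ 2 →
    a n (update v i (V.mulFun f (v i))) = V.mulFun f (a n v)
  leibniz : ∀ (X Y : V.Sec) (f : 𝒞),
    a 2 ![X, V.mulFun f Y] = V.mulFun (a 2 ![X, V.ofFun f]).1 Y + V.mulFun f (a 2 ![X, Y])
  bracket_fun : ∀ (d : ℤ) (X : V.Sec) (f : 𝒞), X ∈ V.gr d → d ≠ -1 →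
    a 2 ![X, V.ofFun f] = 0
  fun_arg : ∀ (n : ℕ) (v : Fin n → V.Sec) (i : Fin n), n ≠ 2 → v i ∈ V.gr 0 → a n v = 0
  fun_val : ∀ (n : ℕ) (v : Fin n → V.Sec), n ≠ 2 → (a n v).1 = 0

def LInftyAlgebroid.toPre (A : LInftyAlgebroid V) : PreAlgebroid V :=
  ⟨A.a, A.degree, A.symm, A.linear, A.leibniz, A.bracket_fun, A.fun_arg, A.fun_val⟩

lemma negOnePow_smul {S : Type*} [AddCommGroup S] [Module ℝ S] (n : ℤ) (y : S) :
    Int.negOnePow n • y = (-1 : ℝ) ^ n • y := by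
  rw [Units.smul_def, ← Int.cast_smul_eq_zsmul ℝ, Int.cast_negOnePow]

lemma gradedComm_mul_right {E : Type*} [Ring E] [Algebra ℝ E] (a b d : ℤ) (A B C : E) :
    gradedComm a (b + d) A (B * C) =
    gradedComm a b A B * C + (-1 : ℝ) ^ (a * b) • (B * gradedComm a d A C) := by
  simp only [gradedComm, mul_add, neg_one_zpow_add, smul_sub, sub_mul, mul_sub, smul_mul_assoc,
    mul_smul_comm, smul_smul, mul_assoc]
  abel

namespace VoronovData

variable {E S : Type*} [Ring E] [Algebra ℝ E] [AddCommGroup S] [Module ℝ S] (Φ : VoronovData E S)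

lemma adList_append (t : ℤ) (l l' : List (S × ℤ)) (T : E) : Φ.adList t (l ++ l') T =
    Φ.adList (t + deg l) l' (Φ.adList t l T) := by
  induction l generalizing t T with
  | nil => simp
  | cons x l ih => rw [List.cons_append, adList_cons, ih, deg_cons, add_assoc]; rfl

lemma adList_append_cons (t : ℤ) {l l' : List (S × ℤ)} {x : S × ℤ} (T : E) (hx : x.1 ∈ Φ.gr x.2)
    (hl : ∀ y ∈ l, y.1 ∈ Φ.gr y.2) : Φ.adList t (l ++ x :: l') T =
    (-1 : ℝ) ^ (x.2 * deg l) • Φ.adList t (x :: (l ++ l')) T := by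
  have h1 := Φ.adList_cons_eq (t := t) T hx hl
  have h2 : Φ.adList t (l ++ x :: l') T = Φ.adList (t + deg l + x.2) l'
      (gradedComm (t + deg l) x.2 (Φ.adList t l T) (Φ.I x.1)) := by
    rw [adList_append, adList_cons]
  have h3 : Φ.adList t (x :: (l ++ l')) T = Φ.adList (t + deg l + x.2) l'
      (Φ.adList t (x :: l) T) := by
    rw [← List.cons_append, adList_append, deg_cons, add_right_comm, add_assoc]
  rw [h3, h1, adList_smul, smul_smul, neg_one_zpow_sq, one_smul, h2]

lemma adList_mul_right {t e : ℤ} {l : List (S × ℤ)} (T : E) {W : E}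
    (hW : ∀ y ∈ l, gradedComm e y.2 W (Φ.I y.1) = 0) : Φ.adList (t + e) l (T * W) =
    (-1 : ℝ) ^ (e * deg l) • (Φ.adList t l T * W) := by
  induction l generalizing t T with
  | nil => simp
  | cons y l ih =>
    rw [adList_cons, gradedComm_mul_left, hW y mem_cons_self, mul_zero, zero_add, adList_smul,
      add_right_comm, ih _ fun z hz => hW z (mem_cons_of_mem _ hz), smul_smul,
      ← neg_one_zpow_add, ← mul_add, deg_cons]
    rfl

lemma adList_mul_left {t : ℤ} {l : List (S × ℤ)} (T : E) {W : E}
    (hW : ∀ y ∈ l, gradedComm 0 y.2 W (Φ.I y.1) = 0) : Φ.adList t l (W * T) =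
    W * Φ.adList t l T := by
  induction l generalizing t T with
  | nil => simp
  | cons y l ih =>
    have h1 := gradedComm_mul_left 0 t y.2 W T (Φ.I y.1)
    rw [hW y mem_cons_self, zero_mul, smul_zero, add_zero, zero_add] at h1
    rw [adList_cons, h1, ih _ fun z hz => hW z (mem_cons_of_mem _ hz), adList_cons]

end VoronovData

namespace Identification

variable (ι)

lemma contraction_smulSect (f : 𝒞) (X : V.Sect j) : ι.contraction j (smulSect f X) =
    N.mulOp f * ι.contraction j X := by
  have hX := ι.isRightDer_contraction j X
  refine ι.operator_ext_coord (ι.isRightDer_contraction j _) (fun U => ⟨fun g h => ?_,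
    fun n g hg => ?_⟩) (fun U g => ?_) fun U k θ => ?_
  · rw [operator_mul_apply, operator_mul_apply, operator_mul_apply, (hX U).rule, mulOp_apply,
      mulOp_apply, mulOp_apply, mul_add, ← mul_assoc, fn_mul_comm _ g, mul_assoc, mul_assoc]
  · have := grInt_mul_mem (fn_mem_grInt U (globRes U f)) ((hX U).degree n g hg)
    rwa [zero_add] at this
  · rw [operator_mul_apply, contraction_fn, contraction_fn, map_zero]
  · rw [operator_mul_apply, contraction_coord, contraction_coord, mulOp_apply, ← map_mul]
    congr 1
    by_cases hk : k = j
    · subst hk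
      rw [Pi.single_eq_same, Pi.single_eq_same]
      refine Smooth.ext fun x => ?_
      exact (θ.1 x).map_smul (f x) (X x)
    · rw [Pi.single_eq_of_ne hk, Pi.single_eq_of_ne hk, pair_zero, mul_zero]

lemma operator_mulFun {v : V.Sec} (hv : v ∈ V.gr d) (f : 𝒞) : ι.operator (V.mulFun f v) =
    N.mulOp f * ι.operator v := by
  rcases mem_gr_cases hv with rfl | ⟨rfl, g, rfl⟩ | ⟨j, X, rfl, rfl⟩
  · rw [← mulFunₗ_apply, map_zero, map_zero, mul_zero]
  · rw [mulFun_ofFun, operator_ofFun, operator_ofFun]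
    refine operator_ext fun U h => ?_
    rw [operator_mul_apply, mulOp_apply, mulOp_apply, mulOp_apply, globRes_mul, map_mul, mul_assoc]
  · rw [mulFun_ofSect, operator_ofSect, operator_ofSect, contraction_smulSect]

lemma mulOp_mul_mem {T : N.Ops} (hT : T ∈ N.firstOrder d) (f : 𝒞) : N.mulOp f * T ∈
    N.firstOrder d := by
  refine ⟨?_, fun U g h => ?_⟩
  · have := operator_mul_mem (mulOp_mem_firstOrder (N := N) f).1 hT.1
    rwa [zero_add] at this
  · rw [operator_mul_apply, operator_mul_apply, operator_mul_apply, operator_mul_apply, hT.2,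
      mulOp_apply, mulOp_apply, mulOp_apply, mulOp_apply, mul_add, ← mul_assoc,
      fn_mul_comm _ g, mul_assoc, ← mul_assoc (N.fn U _), mul_sub, ← mul_assoc (N.fn U _) g,
      fn_mul_comm _ g, mul_assoc g]

lemma symbol_mulOp_mul {T : N.Ops} (hT : T ∈ N.firstOrder d) (f : 𝒞) : ι.symbol (N.mulOp f * T) =
    V.mulFun f (ι.symbol T) := by
  have hs := ι.firstOrder_le_symbolic d hT
  refine ι.symbol_eq (ι.firstOrder_le_symbolic d (mulOp_mul_mem hT f)) (fun U => ?_)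
    fun U j θ => ?_
  · rw [operator_mul_apply, mulOp_apply, body_mul, body_fn, ← ι.globRes_symbol hs]
    rfl
  · rw [operator_mul_apply, mulOp_apply, body_mul, body_fn, ← ι.pair_symbol hs]
    refine Smooth.ext fun x => ?_
    exact ((θ.1 x).map_smul (f x) ((ι.symbol T).2 j x)).symm

variable {D : N.Ops} (hD : ∀ U, IsRightDer U 1 (D.app U))

include hD

lemma derivation_mem : D ∈ N.firstOrder 1 := mem_firstOrder_of_isRightDer hD

lemma mul_derivation_fn (f : Smooth m U) (g : N.O U) : D.app U (N.fn U f) * N.twist U 1 g =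
    g * D.app U (N.fn U f) := by
  have h1 : D.app U (N.fn U f) ∈ N.grInt U 1 := by
    have := (hD U).degree 0 _ (fn_mem U f)
    simpa using this
  induction g using induction_homogeneous with
  | h0 => simp
  | hadd g h hg hh => rw [map_add, mul_add, hg, hh, add_mul]
  | hom n g hg =>
    have hg' : g ∈ N.grInt U n := by simpa using hg
    rw [twist_of_mem 1 hg, mul_smul_comm, mul_comm_grInt h1 hg', smul_smul, neg_one_zpow_sq,
      one_smul]

lemma gradedComm_mulOp_apply (f : 𝒞) (U : Opens M) (g : N.O U) :
    (gradedComm 1 0 D (N.mulOp f)).app U g = g * D.app U (N.fn U (globRes U f)) := by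
  rw [gradedComm, operator_sub_apply, operator_smul_apply, operator_mul_apply, operator_mul_apply,
    mulOp_apply, mulOp_apply, (hD U).rule, mul_derivation_fn hD, mul_zero, zpow_zero, one_smul,
    add_sub_cancel_left]

lemma gradedComm_mulOp_contraction_apply (f : 𝒞) (X : V.Sect j) (U : Opens M) (g : N.O U) :
    (gradedComm 1 (-((j : ℤ) + 1)) (gradedComm 1 0 D (N.mulOp f)) (ι.contraction j X)).app U g =
    -((-1 : ℝ) ^ ((j : ℤ) + 1) •
      (g * (ι.contraction j X).app U (D.app U (N.fn U (globRes U f))))) := by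
  have h1 : D.app U (N.fn U (globRes U f)) ∈ N.grInt U 1 := by
    have := (hD U).degree 0 _ (fn_mem U (globRes U f))
    simpa using this
  have hs : (-1 : ℝ) ^ (-((j : ℤ) + 1) * 1) = (-1 : ℝ) ^ ((j : ℤ) + 1) := by
    rw [mul_one, zpow_neg, ← inv_zpow, inv_neg, inv_one]
  rw [gradedComm, operator_sub_apply, operator_smul_apply, operator_mul_apply, operator_mul_apply,
    gradedComm_mulOp_apply hD, gradedComm_mulOp_apply hD, (ι.isRightDer_contraction j X U).rule,
    twist_of_mem_grInt _ h1, mul_comm (1 : ℤ), hs, smul_add, mul_smul_comm, smul_smul,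
    neg_one_zpow_sq, one_smul]
  abel

omit hD in
lemma eq_mulOp {T : N.Ops} (hT : T ∈ N.firstOrder 0) (h : ∀ U g, T.app U g = g * T.app U 1) : T =
    N.mulOp (ι.symbol T).1 := by
  refine operator_ext fun U g => ?_
  have h1 : T.app U 1 ∈ N.gr U 0 := by
    have h2 : (1 : N.O U) ∈ N.gr U 0 := SetLike.one_mem_graded (N.gr U)
    have := hT.1 U 0 1 h2
    rwa [Nat.cast_zero, add_zero, ← Nat.cast_zero, grInt_natCast] at this
  rw [h, mulOp_apply, ι.globRes_symbol (ι.firstOrder_le_symbolic 0 hT), fn_body, comp_of_mem h1]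
  obtain ⟨c, hc⟩ := exists_fn_eq h1
  rw [← hc, fn_mul_comm]

omit hD in
lemma eq_zero_of_neg (hd : d < 0) {T : N.Ops} (hT : T ∈ N.firstOrder d)
    (h : ∀ U g, T.app U g = g * T.app U 1) : T = 0 := by
  refine operator_ext fun U g => ?_
  have h2 : (1 : N.O U) ∈ N.gr U 0 := SetLike.one_mem_graded (N.gr U)
  have h1 := hT.1 U 0 1 h2
  rw [grInt_of_neg U (by simpa using hd), Submodule.mem_bot] at h1
  rw [h, h1, mul_zero]
  rfl

lemma gradedComm_mulOp_mulOp (f g : 𝒞) : gradedComm 1 0 (gradedComm 1 0 D (N.mulOp f)) (N.mulOp g) =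
    0 := by
  refine operator_ext fun U h => ?_
  have h1 := gradedComm_mulOp_apply hD f U
  generalize gradedComm 1 0 D (N.mulOp f) = T at h1 ⊢
  rw [gradedComm, operator_sub_apply, operator_smul_apply, operator_mul_apply, operator_mul_apply,
    h1, mulOp_apply, mulOp_apply, h1, mul_zero, zpow_zero, one_smul, mul_assoc, sub_self]
  rfl

lemma exists_gradedComm_contraction_eq_mulOp (f : 𝒞) (X : V.Sect j) : ∃ g,
    gradedComm 1 (-((j : ℤ) + 1)) (gradedComm 1 0 D (N.mulOp f)) (ι.contraction j X) = N.mulOp g ∧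
    (-((j : ℤ) + 1) ≠ -1 → g = 0) := by
  have h0 : gradedComm 1 0 D (N.mulOp f) ∈ N.firstOrder (1 + 0) :=
    gradedComm_mem_firstOrder (derivation_mem hD) (mulOp_mem_firstOrder f)
  rw [add_zero] at h0
  have hT : gradedComm 1 (-((j : ℤ) + 1)) (gradedComm 1 0 D (N.mulOp f)) (ι.contraction j X) ∈
      N.firstOrder (1 + -((j : ℤ) + 1)) :=
    gradedComm_mem_firstOrder h0 (ι.contraction_mem j X)
  have hmul := ι.gradedComm_mulOp_contraction_apply hD f X
  generalize gradedComm 1 (-((j : ℤ) + 1)) (gradedComm 1 0 D (N.mulOp f))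
    (ι.contraction j X) = T at hT hmul ⊢
  have hmul' : ∀ U g, T.app U g = g * T.app U 1 := fun U g => by
    rw [hmul, hmul U 1, one_mul, mul_neg, mul_smul_comm]
  by_cases hj : (j : ℕ) = 0
  · have h1 : (1 : ℤ) + -((j : ℤ) + 1) = 0 := by rw [hj]; norm_num
    rw [h1] at hT
    exact ⟨_, ι.eq_mulOp hT hmul', fun h => absurd (by omega) h⟩
  · have h1 : (1 : ℤ) + -((j : ℤ) + 1) < 0 := by omega
    exact ⟨0, by rw [map_zero]; exact eq_zero_of_neg h1 hT hmul', fun _ => rfl⟩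

lemma exists_gradedComm_eq_mulOp (f : 𝒞) {e : ℤ} {w : V.Sec} (hw : w ∈ V.gr e) : ∃ g,
    gradedComm 1 e (gradedComm 1 0 D (N.mulOp f)) (ι.operator w) = N.mulOp g ∧
    (e ≠ -1 → g = 0) := by
  rcases mem_gr_cases hw with rfl | ⟨rfl, g, rfl⟩ | ⟨j, X, rfl, rfl⟩
  · refine ⟨0, ?_, fun _ => rfl⟩
    rw [map_zero, map_zero, gradedComm_zero_right]
  · refine ⟨0, ?_, fun _ => rfl⟩
    rw [operator_ofFun, map_zero, gradedComm_mulOp_mulOp hD]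
  · rw [operator_ofSect]
    exact ι.exists_gradedComm_contraction_eq_mulOp hD f X

omit hD in
lemma symbol_eq_zero_of_body {T : N.Ops} (h : ∀ U g, N.body U (T.app U g) = 0) : ι.symbol T =
    0 := by
  refine ι.symbol_eq (fun U j f θ => ?_) (fun U => ?_) fun U j θ => ?_
  · rw [h, h, mul_zero]
  · rw [h]; rfl
  · rw [h]
    exact (pair_zero _).symm

lemma body_gradedComm_mulOp (f : 𝒞) (U : Opens M) (g : N.O U) :
    N.body U ((gradedComm 1 0 D (N.mulOp f)).app U g) = 0 := by
  have h1 : D.app U (N.fn U (globRes U f)) ∈ N.grInt U 1 := by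
    have := (hD U).degree 0 _ (fn_mem U (globRes U f))
    simpa using this
  rw [gradedComm_mulOp_apply hD, body_mul, body_of_mem_grInt h1 one_ne_zero, mul_zero]

lemma adList_fun_eq_zero (f : 𝒞) {l : List (V.Sec × ℤ)} (hl : ∀ y ∈ l, y.1 ∈ V.gr y.2)
    (hn : 2 ≤ l.length) : ι.voronov.adList 1 ((V.ofFun f, 0) :: l) D = 0 := by
  match l, hn with
  | x :: y :: l, _ =>
    rw [VoronovData.adList_cons, VoronovData.adList_cons, VoronovData.adList_cons]
    obtain ⟨g, hg, -⟩ := ι.exists_gradedComm_eq_mulOp hD f (hl x mem_cons_self)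
    change ι.voronov.adList _ l (gradedComm (1 + 0 + x.2) y.2 (gradedComm (1 + 0) x.2 (gradedComm 1 0 D
      (ι.operator (V.ofFun f))) (ι.operator x.1)) (ι.operator y.1)) = 0
    rw [add_zero, operator_ofFun, hg]
    have h1 := ι.gradedComm_operator (V.ofFun_mem g)
      (hl y (mem_cons_of_mem _ mem_cons_self))
    rw [operator_ofFun] at h1
    have h2 : gradedComm (1 + x.2) y.2 (N.mulOp g) (ι.operator y.1) = 0 := by
      by_cases hx : x.2 = -1
      · rw [hx, show (1 : ℤ) + -1 = 0 from rfl, h1]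
      · obtain ⟨g', hg', h0⟩ := ι.exists_gradedComm_eq_mulOp hD f (hl x mem_cons_self)
        rw [← hg, hg', h0 hx, map_zero, gradedComm_zero_left]
    rw [h2, VoronovData.adList_zero]

lemma symbol_adList_fun (f : 𝒞) {l : List (V.Sec × ℤ)} (hl : ∀ y ∈ l, y.1 ∈ V.gr y.2)
    (hn : l.length ≠ 1) (T : N.Ops) : ι.symbol (ι.voronov.adList 1 ((V.ofFun f, 0) :: l) D * T) =
    0 := by
  match l, hn with
  | [], _ =>
    refine ι.symbol_eq_zero_of_body fun U g => ?_
    rw [VoronovData.adList_cons, VoronovData.adList_nil]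
    change N.body U ((gradedComm 1 0 D (ι.operator (V.ofFun f)) * T).app U g) = 0
    rw [operator_ofFun, operator_mul_apply, body_gradedComm_mulOp hD]
  | x :: y :: l, _ =>
    rw [ι.adList_fun_eq_zero hD f hl (by simp), zero_mul, map_zero]

lemma symbol_adList_mulFun (f : 𝒞) {v : V.Sec} (hv : v ∈ V.gr d) {l : List (V.Sec × ℤ)}
    (hl : ∀ y ∈ l, y.1 ∈ V.gr y.2) : ι.symbol (ι.voronov.adList 1 ((V.mulFun f v, d) :: l) D) =
    V.mulFun f (ι.symbol (ι.voronov.adList 1 ((v, d) :: l) D)) + (-1 : ℝ) ^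
    (d * VoronovData.deg l) • ι.symbol
    (ι.voronov.adList 1 ((V.ofFun f, 0) :: l) D * ι.operator v) := by
  have hD' := derivation_mem hD
  have h1 := gradedComm_mul_right 1 0 d D (N.mulOp f) (ι.operator v)
  rw [zero_add, mul_zero, zpow_zero, one_smul, ← ι.operator_mulFun hv] at h1
  have h2 : ∀ y ∈ l, gradedComm 0 y.2 (N.mulOp f) (ι.operator y.1) = 0 := fun y hy => by
    rw [← ι.operator_ofFun]
    exact ι.gradedComm_operator (V.ofFun_mem f) (hl y hy)
  have h3 : ∀ y ∈ l, gradedComm d y.2 (ι.operator v) (ι.operator y.1) = 0 := fun y hy =>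
    ι.gradedComm_operator hv (hl y hy)
  have h4 : ι.voronov.adList 1 ((V.mulFun f v, d) :: l) D =
      (-1 : ℝ) ^ (d * VoronovData.deg l) •
        (ι.voronov.adList 1 ((V.ofFun f, 0) :: l) D * ι.operator v) +
      N.mulOp f * ι.voronov.adList 1 ((v, d) :: l) D := by
    rw [VoronovData.adList_cons]
    change ι.voronov.adList (1 + d) l (gradedComm 1 d D (ι.operator (V.mulFun f v))) = _
    rw [h1, VoronovData.adList_add, ι.voronov.adList_mul_right _ h3, ι.voronov.adList_mul_left _ h2,
      VoronovData.adList_cons, VoronovData.adList_cons, add_zero]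
    congr 4
    exact congrArg _ (ι.operator_ofFun f).symm
  have h5 : ι.voronov.adList 1 ((v, d) :: l) D ∈ N.firstOrder (1 + VoronovData.deg ((v, d) :: l)) := by
    refine ι.voronov.adList_mem hD' fun y hy => ?_
    rcases List.mem_cons.1 hy with rfl | hy
    · exact hv
    · exact hl y hy
  rw [h4, map_add, map_smul, ι.symbol_mulOp_mul h5, add_comm]

end Identification

lemma exists_ofFn_update_eq {T : Type*} (x : Fin n → T) (i : Fin n) : ∃ l l' : List T,
    l.length + l'.length + 1 = n ∧ (∀ y ∈ l, ∃ k, x k = y) ∧ (∀ y ∈ l', ∃ k, x k = y) ∧ ∀ y,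
    ofFn (update x i y) = l ++ y :: l' := by
  refine ⟨(ofFn x).take i, (ofFn x).drop (i + 1), ?_, fun y hy => ?_, fun y hy => ?_,
    fun y => ?_⟩
  · simp only [List.length_take, List.length_drop, List.length_ofFn]
    have := i.2
    omega
  · exact (mem_ofFn' _ _).1 (List.mem_of_mem_take hy)
  · exact (mem_ofFn' _ _).1 (List.mem_of_mem_drop hy)
  · have h1 : ofFn (update x i y) = (ofFn x).set i y := by
      refine List.ext_getElem (by simp) fun k h1 h2 => ?_
      rw [List.getElem_ofFn, List.getElem_set, Function.update_apply, List.getElem_ofFn]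
      simp only [Fin.ext_iff, eq_comm]
    rw [h1, List.set_eq_take_append_cons_drop, if_pos (by simp)]

namespace GradedBundle

lemma sec_induction {P : V.Sec → Prop} (hadd : ∀ v w, P v → P w → P (v + w))
    (hom : ∀ (d : ℤ), ∀ v ∈ V.gr d, P v) (v : V.Sec) : P v := by
  rw [← sum_component v]
  exact sum_induction _ _ hadd (hom 0 0 (zero_mem _)) fun k _ => hom _ _ (component_mem v k)

variable (V) in
def funPart : V.Sec →ₗ[ℝ] V.Sec where
  toFun v := V.ofFun v.1
  map_add' _ _ := Prod.ext rfl (add_zero 0).symm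
  map_smul' c _ := Prod.ext rfl (smul_zero c).symm

lemma funPart_of_mem {v : V.Sec} (hv : v ∈ V.gr 0) : V.funPart v = v :=
  Prod.ext rfl (funext fun j => (hv.2 j (by omega)).symm)

end GradedBundle

namespace Identification

variable (ι) {D : N.Ops} (hD : ∀ U, IsRightDer U 1 (D.app U))

include hD

lemma exists_bracket_update {d : Fin n → ℤ} {x : Fin n → V.Sec} (hx : ∀ i, x i ∈ V.gr (d i))
    (i : Fin n) : ∃ (s : ℝ) (l : List (V.Sec × ℤ)), l.length + 1 = n ∧ (∀ y ∈ l, y.1 ∈ V.gr y.2) ∧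
    ∀ y ∈ V.gr (d i), ι.voronov.bracket D n (update x i y) =
    s • ι.symbol (ι.voronov.adList 1 ((y, d i) :: l) D) := by
  obtain ⟨l, l', hl, hm, hm', h⟩ := exists_ofFn_update_eq (fun k => (x k, d k)) i
  have hl1 : ∀ y ∈ l, y.1 ∈ V.gr y.2 := fun y hy => by
    obtain ⟨k, rfl⟩ := hm y hy
    exact hx k
  have hl2 : ∀ y ∈ l', y.1 ∈ V.gr y.2 := fun y hy => by
    obtain ⟨k, rfl⟩ := hm' y hy
    exact hx k
  refine ⟨(-1 : ℝ) ^ (d i * VoronovData.deg l), l ++ l', by simpa using hl, fun y hy => ?_,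
    fun y hy => ?_⟩
  · rcases List.mem_append.1 hy with hy | hy
    · exact hl1 y hy
    · exact hl2 y hy
  · have h1 : (fun k => (update x i y k, d k)) =
        update (fun k => (x k, d k)) i (y, d i) := by
      funext k
      by_cases hk : k = i
      · subst hk
        simp
      · simp [hk]
    rw [ι.voronov.bracket_eq (derivation_mem hD) (d := d) (fun k => ?_), h1, h,
      ι.voronov.adList_append_cons (x := (y, d i)) 1 D hy hl1, map_smul]
    · rfl
    · by_cases hk : k = i
      · subst hk
        rw [update_self]
        exact hy
      · rw [update_of_ne hk]
        exact hx k

lemma symbol_derivation : ι.symbol D = 0 := by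
  rcases mem_gr_cases (ι.symbol_mem (derivation_mem hD)) with
    h | ⟨h, -⟩ | ⟨j, -, h, -⟩
  · exact h
  · omega
  · omega

lemma bracket_two {d e : ℤ} {X Y : V.Sec} (hX : X ∈ V.gr d) (hY : Y ∈ V.gr e) :
    ι.voronov.bracket D 2 ![X, Y] =
    (-1 : ℝ) ^ (e * d) • ι.symbol (ι.voronov.adList 1 [(Y, e), (X, d)] D) := by
  have hv : ∀ i, (![X, Y] : Fin 2 → V.Sec) i ∈ V.gr ((![d, e] : Fin 2 → ℤ) i) := by
    intro i
    fin_cases i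
    · exact hX
    · exact hY
  rw [ι.voronov.bracket_eq (derivation_mem hD) hv]
  have h1 : (ofFn fun i : Fin 2 => ((![X, Y] : Fin 2 → V.Sec) i, (![d, e] : Fin 2 → ℤ) i)) =
      [(X, d)] ++ (Y, e) :: [] := rfl
  rw [h1, ι.voronov.adList_append_cons (x := (Y, e)) 1 D hY (fun y hy => by
    obtain rfl := List.mem_singleton.1 hy
    exact hX), map_smul]
  have h2 : VoronovData.deg [(X, d)] = d := by simp [VoronovData.deg]
  rw [h2]
  rfl

lemma exists_bracket_fun {X : V.Sec} (hX : X ∈ V.gr d) (f : 𝒞) : ∃ g,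
    ι.voronov.adList 1 [(V.ofFun f, 0), (X, d)] D = N.mulOp g ∧
    ι.voronov.bracket D 2 ![X, V.ofFun f] = V.ofFun g ∧ (d ≠ -1 → g = 0) := by
  obtain ⟨g, hg, h0⟩ := ι.exists_gradedComm_eq_mulOp hD f hX
  have h1 : ι.voronov.adList 1 [(V.ofFun f, 0), (X, d)] D = N.mulOp g := by
    rw [VoronovData.adList_cons, VoronovData.adList_cons, VoronovData.adList_nil]
    change gradedComm (1 + 0) d (gradedComm 1 0 D (ι.operator (V.ofFun f))) (ι.operator X) = _
    rw [add_zero, operator_ofFun, hg]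
  refine ⟨g, h1, ?_, h0⟩
  rw [ι.bracket_two hD hX (V.ofFun_mem f), h1, zero_mul, zpow_zero, one_smul, ← ι.operator_ofFun,
    ι.symbol_operator_of_mem (V.ofFun_mem g)]

lemma bracket_leibniz (X Y : V.Sec) (f : 𝒞) : ι.voronov.bracket D 2 ![X, V.mulFun f Y] =
    V.mulFun (ι.voronov.bracket D 2 ![X, V.ofFun f]).1 Y + V.mulFun f
    (ι.voronov.bracket D 2 ![X, Y]) := by
  have hadd : ∀ X X' Y, ι.voronov.bracket D 2 ![X + X', Y] =
      ι.voronov.bracket D 2 ![X, Y] + ι.voronov.bracket D 2 ![X', Y] := fun X X' Y =>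
    (ι.voronov.bracket D 2).cons_add ![Y] X X'
  have hadd' : ∀ X Y Y', ι.voronov.bracket D 2 ![X, Y + Y'] =
      ι.voronov.bracket D 2 ![X, Y] + ι.voronov.bracket D 2 ![X, Y'] := fun X Y Y' => by
    have := (ι.voronov.bracket D 2).map_update_add ![X, 0] 1 Y Y'
    have h : ∀ Z, update (![X, 0] : Fin 2 → V.Sec) 1 Z = ![X, Z] := fun Z => by
      funext i
      fin_cases i <;> rfl
    simpa only [h] using this
  induction X using sec_induction with
  | hadd X X' h h' =>
    rw [hadd, hadd, hadd, h, h', Prod.fst_add]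
    have h1 : ∀ a b : 𝒞, V.mulFun (a + b) Y = V.mulFun a Y + V.mulFun b Y :=
      fun a b => Prod.ext (add_mul a b Y.1)
        (funext fun j => ContMDiffSection.ext fun x => add_smul (a x) (b x) (Y.2 j x))
    have h2 := (V.mulFunₗ f).map_add (ι.voronov.bracket D 2 ![X, Y])
      (ι.voronov.bracket D 2 ![X', Y])
    simp only [mulFunₗ_apply] at h2
    rw [h1, h2]
    abel
  | hom d X hX =>
    induction Y using sec_induction with
    | hadd Y Y' h h' =>
      have h1 := fun g => (V.mulFunₗ g).map_add
      simp only [mulFunₗ_apply] at h1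
      rw [h1, hadd', h, h', hadd', h1, h1]
      abel
    | hom e Y hY =>
      have hl : ∀ y ∈ [(X, d)], y.1 ∈ V.gr y.2 := by simpa using hX
      obtain ⟨g, hg, hg', -⟩ := ι.exists_bracket_fun hD hX f
      rw [hg', ι.bracket_two hD hX (mulFun_mem hY f),
        ι.symbol_adList_mulFun hD f hY hl, hg, ι.symbol_mulOp_mul (ι.operator_mem hY),
        ι.symbol_operator_of_mem hY, smul_add, smul_smul, ι.bracket_two hD hX hY]
      have h1 : VoronovData.deg [(X, d)] = d := by simp [VoronovData.deg]
      have h2 := (V.mulFunₗ f).map_smul ((-1 : ℝ) ^ (e * d))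
        (ι.symbol (ι.voronov.adList 1 [(Y, e), (X, d)] D))
      simp only [mulFunₗ_apply] at h2
      rw [h1, neg_one_zpow_sq, one_smul, h2, add_comm]
      rfl

lemma bracket_update_funPart (hn : n ≠ 2) (x : Fin n → V.Sec) (i : Fin n) (f : 𝒞) :
    ι.voronov.bracket D n (update x i (V.ofFun f)) = 0 := by
  have h1 : (ι.voronov.bracket D n).compLinearMap
      (update (fun _ => LinearMap.id) i V.funPart) = 0 := by
    refine multilinear_ext fun d y hy => ?_
    have h2 : (fun k => (update (fun _ => LinearMap.id) i V.funPart :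
        Fin n → V.Sec →ₗ[ℝ] V.Sec) k (y k)) = update y i (V.ofFun (y i).1) := by
      funext k
      by_cases hk : k = i
      · subst hk
        rw [update_self, update_self]
        rfl
      · rw [update_of_ne hk, update_of_ne hk]
        rfl
    rw [MultilinearMap.compLinearMap_apply, h2]
    obtain ⟨s, l, hl, hm, h⟩ := ι.exists_bracket_update hD
      (d := update d i 0) (x := update y i 0) (fun k => by
        by_cases hk : k = i
        · subst hk
          rw [update_self, update_self]
          exact (V.gr 0).zero_mem
        · rw [update_of_ne hk, update_of_ne hk]
          exact hy k) i
    rw [update_self] at h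
    have h3 := h _ (V.ofFun_mem (y i).1)
    rw [Function.update_idem] at h3
    have h4 := ι.symbol_adList_fun hD (y i).1 hm (by omega) 1
    rw [mul_one] at h4
    rw [h3, h4, smul_zero]
    rfl
  have h2 := DFunLike.congr_fun h1 (update x i (V.ofFun f))
  rw [MultilinearMap.compLinearMap_apply] at h2
  change _ = 0 at h2
  rw [← h2]
  congr 1
  funext k
  by_cases hk : k = i
  · subst hk
    rw [update_self, update_self]
    rfl
  · rw [update_of_ne hk, update_of_ne hk]
    rfl

lemma symbol_gradedComm_contraction_fst (X : V.Sect j) :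
    (ι.symbol (gradedComm 1 (-((j : ℤ) + 1)) D (ι.contraction j X))).1 = 0 := by
  have hT := gradedComm_mem_firstOrder (derivation_mem hD) (ι.contraction_mem j X)
  have h := ι.globRes_symbol (ι.firstOrder_le_symbolic _ hT) ⊤
  rw [gradedComm, operator_sub_apply, operator_smul_apply, operator_mul_apply, operator_mul_apply,
    (hD ⊤).map_one, (ι.isRightDer_contraction j X ⊤).map_one, map_zero, map_zero, smul_zero,
    sub_zero, map_zero] at h
  ext x
  exact DFunLike.congr_fun h (⟨x, trivial⟩ : (⊤ : Opens M))

lemma bracket_fst (hn : n ≠ 2) (x : Fin n → V.Sec) : (ι.voronov.bracket D n x).1 = 0 := by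
  have h1 : (LinearMap.fst ℝ 𝒞 (∀ j : Fin p, V.Sect j)).compMultilinearMap
      (ι.voronov.bracket D n) = 0 := by
    refine multilinear_ext fun d y hy => ?_
    change (ι.voronov.bracket D n y).1 = 0
    by_cases h0 : ∃ i, y i ∈ V.gr 0
    · obtain ⟨i, hi⟩ := h0
      have h2 := ι.bracket_update_funPart hD hn y i (y i).1
      rw [← Function.update_eq_self i y, ← funPart_of_mem hi]
      exact congrArg Prod.fst h2
    · push Not at h0
      have h2 : ∀ i, ∃ (j : Fin p) (X : V.Sect j), d i = -((j : ℤ) + 1) ∧ y i = V.ofSect j X := by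
        intro i
        rcases mem_gr_cases (hy i) with h | ⟨-, f, h⟩ | h
        · exact absurd (h ▸ (V.gr 0).zero_mem) (h0 i)
        · exact absurd (h ▸ V.ofFun_mem f) (h0 i)
        · exact h
      by_cases hs : 1 + ∑ i, d i = 0
      · have h3 : ∑ i, d i ≤ ∑ i : Fin n, (-1 : ℤ) := sum_le_sum fun i _ => by
          obtain ⟨j, -, h, -⟩ := h2 i
          omega
        rw [sum_const, card_univ, Fintype.card_fin, nsmul_eq_mul] at h3
        have h4 : n ≠ 0 := by
          rintro rfl
          simp at hs
        obtain rfl : n = 1 := by omega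
        obtain ⟨j, X, h, h'⟩ := h2 0
        rw [ι.voronov.bracket_eq (derivation_mem hD) hy, ofFn_succ, List.ofFn_zero,
          VoronovData.adList_cons, VoronovData.adList_nil, h, h']
        have h5 := ι.symbol_gradedComm_contraction_fst hD X
        rw [← ι.operator_ofSect] at h5
        exact h5
      · exact (ι.voronov.bracket_mem (derivation_mem hD) hy).1 hs
  exact DFunLike.congr_fun h1 x

lemma bracket_linear (hn : n ≠ 2) (x : Fin n → V.Sec) (i : Fin n) (f : 𝒞) :
    ι.voronov.bracket D n (update x i (V.mulFun f (x i))) =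
    V.mulFun f (ι.voronov.bracket D n x) := by
  have hx : ∀ y : Fin n → V.Sec, (fun k => (update (fun _ => LinearMap.id) i
      (V.mulFunₗ f) : Fin n → V.Sec →ₗ[ℝ] V.Sec) k (y k)) =
        update y i (V.mulFun f (y i)) := fun y => by
    funext k
    by_cases hk : k = i
    · subst hk
      rw [update_self, update_self]
      rfl
    · rw [update_of_ne hk, update_of_ne hk]
      rfl
  have h1 : (ι.voronov.bracket D n).compLinearMap
      (update (fun _ => LinearMap.id) i (V.mulFunₗ f)) =
        (V.mulFunₗ f).compMultilinearMap (ι.voronov.bracket D n) := by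
    refine multilinear_ext fun d y hy => ?_
    rw [MultilinearMap.compLinearMap_apply, hx]
    change _ = V.mulFun f (ι.voronov.bracket D n y)
    obtain ⟨s, l, hl, hm, h⟩ := ι.exists_bracket_update hD hy i
    have h2 := h _ (hy i)
    rw [Function.update_eq_self] at h2
    have h3 := ι.symbol_adList_fun hD f hm (by omega) (ι.operator (y i))
    have h4 := (V.mulFunₗ f).map_smul s (ι.symbol (ι.voronov.adList 1 ((y i, d i) :: l) D))
    simp only [mulFunₗ_apply] at h4
    rw [h _ (mulFun_mem (hy i) f), h2, ι.symbol_adList_mulFun hD f (hy i) hm, h3,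
      smul_zero, add_zero, h4]
  have h2 := DFunLike.congr_fun h1 x
  rw [MultilinearMap.compLinearMap_apply, hx] at h2
  exact h2

/-- The higher derived brackets of a derivation of degree `1`. -/
def derived : PreAlgebroid V where
  a n := ι.voronov.bracket D n
  degree n d x hx := by
    have := ι.voronov.bracket_mem (derivation_mem hD) hx
    rwa [add_comm] at this
  symm n d x hx i j hij := by
    rw [negOnePow_smul]
    change ι.voronov.Z _ = _ • ι.voronov.Z _
    rw [ι.voronov.iterated_swap (derivation_mem hD) hx i j hij, map_smul]
  linear n x i f hn := ι.bracket_linear hD hn x i f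
  leibniz := ι.bracket_leibniz hD
  bracket_fun d X f hX hd := by
    obtain ⟨g, -, h, h0⟩ := ι.exists_bracket_fun hD hX f
    rw [h, h0 hd]
    rfl
  fun_arg n x i hn hi := by
    rw [← Function.update_eq_self i x, ← funPart_of_mem hi]
    exact ι.bracket_update_funPart hD hn x i (x i).1
  fun_val n x hn := ι.bracket_fst hD hn x

/-- The higher derived brackets of a derivation of degree `1` and square zero. -/
def derivedAlgebroid (h2 : D * D = 0) : LInftyAlgebroid V where
  __ := ι.derived hD
  jacobi n d x hx := by
    have := ι.voronov.sum_bracket_bracket (derivation_mem hD) (ι.symbol_derivation hD) hx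
    rw [h2, VoronovData.adList_zero, map_zero] at this
    exact this

end Identification

/-- Generators `q` of an algebra over `F : R → A`, with left partial derivatives `J` and with the
evaluation `ε` at the zero section. -/
structure Partials (R : Type*) (A : Type*) [CommRing R] [Algebra ℝ R] [Ring A] [Algebra ℝ A]
    (κ : Type*) [DecidableEq κ] where
  F : R →ₐ[ℝ] A
  q : κ → A
  d : κ → ℕ
  J : κ → A →ₗ[ℝ] A
  ε : A →ₗ[ℝ] R
  comm : ∀ a b, q a * q b = (-1 : ℝ) ^ (d a * d b) • (q b * q a)
  F_mul : ∀ f a, F f * q a = q a * F f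
  J_F : ∀ a f, J a (F f) = 0
  J_q : ∀ a b x, J a (q b * x) =
    (if a = b then x else 0) + (-1 : ℝ) ^ (d a * d b) • (q b * J a x)
  ε_F : ∀ f, ε (F f) = f
  ε_q : ∀ a x, ε (q a * x) = 0
  adjoin : Algebra.adjoin ℝ (Set.range F ∪ Set.range q) = ⊤

namespace Partials

variable {R : Type*} {A : Type*} [CommRing R] [Algebra ℝ R] [Ring A] [Algebra ℝ A] {κ : Type*} [DecidableEq κ] (P : Partials R A κ)

lemma F_injective : Injective P.F := fun f g h => by
  rw [← P.ε_F f, h, P.ε_F]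

/-- The homogeneous polynomials of degree `n` in the generators. -/
def poly : ℕ → Submodule ℝ A
  | 0 => LinearMap.range P.F.toLinearMap
  | n + 1 => span ℝ {y | ∃ a, ∃ x ∈ poly n, y = P.q a * x}

lemma q_mul_mem (a : κ) {x : A} (hx : x ∈ P.poly n) : P.q a * x ∈ P.poly (n + 1) :=
  subset_span ⟨a, x, hx, rfl⟩

lemma poly_succ_induction {φ : A → Prop} (h0 : φ 0) (hadd : ∀ x y, φ x → φ y → φ (x + y))
    (hq : ∀ (c : ℝ) a, ∀ x ∈ P.poly n, φ (P.q a * (c • x))) {x : A} (hx : x ∈ P.poly (n + 1)) :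
    φ x := by
  have h : ∀ c : ℝ, φ (c • x) := by
    induction hx using span_induction with
    | mem y hy =>
      obtain ⟨a, z, hz, rfl⟩ := hy
      intro c
      rw [← mul_smul_comm]
      exact hq c a z hz
    | zero => intro c; rwa [smul_zero]
    | add y z _ _ hy hz => intro c; rw [smul_add]; exact hadd _ _ (hy c) (hz c)
    | smul t y _ hy => intro c; rw [smul_smul]; exact hy _
  simpa using h 1

lemma J_mem {n : ℕ} (a : κ) {x : A} (hx : x ∈ P.poly (n + 1)) : P.J a x ∈ P.poly n := by
  induction n generalizing x with
  | zero =>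
    refine P.poly_succ_induction (φ := fun x => P.J a x ∈ P.poly 0)
      (by rw [map_zero]; exact zero_mem _)
      (fun x y hx hy => by rw [map_add]; exact add_mem hx hy) (fun c b y hy => ?_) hx
    obtain ⟨f, rfl⟩ := hy
    have h1 : P.J a (c • P.F f) = 0 := by rw [map_smul, J_F, smul_zero]
    rw [J_q, AlgHom.toLinearMap_apply, h1, mul_zero, smul_zero, add_zero]
    split_ifs
    · exact smul_mem _ _ ⟨f, rfl⟩
    · exact zero_mem _
  | succ n ih =>
    refine P.poly_succ_induction (φ := fun x => P.J a x ∈ P.poly (n + 1))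
      (by rw [map_zero]; exact zero_mem _)
      (fun x y hx hy => by rw [map_add]; exact add_mem hx hy) (fun c b y hy => ?_) hx
    rw [J_q]
    refine add_mem ?_ (smul_mem _ _ (P.q_mul_mem b (ih (smul_mem _ c hy))))
    split_ifs
    · exact smul_mem _ _ hy
    · exact zero_mem _

lemma J_of_mem_zero (a : κ) {x : A} (hx : x ∈ P.poly 0) : P.J a x = 0 := by
  obtain ⟨f, rfl⟩ := hx
  exact P.J_F a f

lemma ε_of_mem {x : A} (hx : x ∈ P.poly (n + 1)) : P.ε x = 0 :=
  P.poly_succ_induction (φ := fun x => P.ε x = 0) (map_zero _) (fun x y hx hy => by rw [map_add, hx, hy, add_zero])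
    (fun _ _ _ _ => P.ε_q _ _) hx

lemma sum_q_mul_J [Fintype κ] {n : ℕ} {x : A} (hx : x ∈ P.poly n) : ∑ a, P.q a * P.J a x =
    (n : ℝ) • x := by
  induction n generalizing x with
  | zero =>
    rw [Nat.cast_zero, zero_smul]
    exact sum_eq_zero fun a _ => by rw [P.J_of_mem_zero a hx, mul_zero]
  | succ n ih =>
    refine P.poly_succ_induction
      (φ := fun x => ∑ a, P.q a * P.J a x = ((n + 1 : ℕ) : ℝ) • x) (by simp) (fun x y hx hy => ?_) (fun c b y hy => ?_) hx
    · simp only [map_add, mul_add, sum_add_distrib, smul_add] at hx hy ⊢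
      rw [hx, hy]
    · have hy' := ih (smul_mem _ c hy)
      have h1 : ∀ a, P.q a * P.J a (P.q b * (c • y)) =
          (if a = b then P.q b * (c • y) else 0) + P.q b * (P.q a * P.J a (c • y)) := by
        intro a
        rw [J_q, mul_add, mul_smul_comm, ← mul_assoc (P.q a) (P.q b), P.comm a b, smul_mul_assoc,
          smul_smul, ← pow_add, ← two_mul, pow_mul, neg_one_sq, one_pow, one_smul, mul_assoc]
        congr 1
        split_ifs with h
        · rw [h]
        · rw [mul_zero]
      rw [sum_congr rfl fun a _ => h1 a, sum_add_distrib, Finset.sum_ite_eq',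
        if_pos (mem_univ b), ← mul_sum, hy', Nat.cast_succ, add_smul,
        one_smul, add_comm, mul_smul_comm (n : ℝ)]

lemma F_mul_mem {n : ℕ} (f : R) {x : A} (hx : x ∈ P.poly n) : P.F f * x ∈ P.poly n := by
  induction n generalizing x with
  | zero =>
    obtain ⟨g, rfl⟩ := hx
    exact ⟨f * g, map_mul P.F f g⟩
  | succ n ih =>
    refine P.poly_succ_induction (φ := fun x => P.F f * x ∈ P.poly (n + 1))
      (by rw [mul_zero]; exact zero_mem _)
      (fun x y hx hy => by rw [mul_add]; exact add_mem hx hy) (fun c b y hy => ?_) hx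
    rw [← mul_assoc, F_mul, mul_assoc]
    exact P.q_mul_mem b (ih (smul_mem _ c hy))

lemma iSup_poly : ⨆ n, P.poly n = ⊤ := by
  have hF : ∀ f, ∀ x ∈ ⨆ n, P.poly n, P.F f * x ∈ ⨆ n, P.poly n := fun f x hx => by
    induction hx using Submodule.iSup_induction' with
    | mem n y hy => exact mem_iSup_of_mem n (P.F_mul_mem f hy)
    | zero => rw [mul_zero]; exact zero_mem _
    | add y z _ _ hy hz => rw [mul_add]; exact add_mem hy hz
  have hq : ∀ a, ∀ x ∈ ⨆ n, P.poly n, P.q a * x ∈ ⨆ n, P.poly n := fun a x hx => by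
    induction hx using Submodule.iSup_induction' with
    | mem n y hy => exact mem_iSup_of_mem (n + 1) (P.q_mul_mem a hy)
    | zero => rw [mul_zero]; exact zero_mem _
    | add y z _ _ hy hz => rw [mul_add]; exact add_mem hy hz
  refine eq_top_iff.2 fun y hy0 => ?_
  clear hy0
  have hy : y ∈ Algebra.adjoin ℝ (Set.range P.F ∪ Set.range P.q) := P.adjoin ▸ Algebra.mem_top
  have h : ∀ x ∈ ⨆ n, P.poly n, y * x ∈ ⨆ n, P.poly n := by
    induction hy using Algebra.adjoin_induction with
    | mem z hz =>
      rcases hz with ⟨f, rfl⟩ | ⟨a, rfl⟩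
      · exact hF f
      · exact hq a
    | algebraMap c =>
      intro x hx
      rw [← Algebra.smul_def]
      exact smul_mem _ _ hx
    | add a b _ _ ha hb => intro x hx; rw [add_mul]; exact add_mem (ha x hx) (hb x hx)
    | mul a b _ _ ha hb => intro x hx; rw [mul_assoc]; exact ha _ (hb x hx)
  have := h 1 (mem_iSup_of_mem 0 ⟨1, map_one P.F⟩)
  rwa [mul_one] at this

/-- Iterated derivatives; the derivative of index `α 0` is taken first. -/
def iter : ∀ n : ℕ, (Fin n → κ) → A →ₗ[ℝ] A
  | 0, _ => LinearMap.id
  | n + 1, α => (iter n (Fin.tail α)).comp (P.J (α 0))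

lemma iter_succ (α : Fin (n + 1) → κ) (x : A) : P.iter (n + 1) α x =
    P.iter n (Fin.tail α) (P.J (α 0) x) := rfl

lemma ε_iter_of_mem {k n : ℕ} (h : k ≠ n) (α : Fin k → κ) {x : A} (hx : x ∈ P.poly n) :
    P.ε (P.iter k α x) = 0 := by
  induction k generalizing n x with
  | zero =>
    obtain ⟨n, rfl⟩ := Nat.exists_eq_succ_of_ne_zero h.symm
    exact P.ε_of_mem hx
  | succ k ih =>
    rw [iter_succ]
    match n with
    | 0 => rw [P.J_of_mem_zero _ hx, map_zero, map_zero]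
    | n + 1 => exact ih (by omega) _ (P.J_mem _ hx)

variable [Fintype κ]

/-- The homogeneous polynomial with given coefficients. -/
def form (n : ℕ) (C : (Fin n → κ) → R) : A :=
  ∑ α : Fin n → κ, P.F (C α) * (ofFn fun i => P.q (α i)).prod

lemma form_zero (C : (Fin 0 → κ) → R) : P.form 0 C = P.F (C Fin.elim0) := by
  rw [form, Fintype.sum_unique, List.ofFn_zero, List.prod_nil, mul_one]
  rfl

lemma form_succ (C : (Fin (n + 1) → κ) → R) : P.form (n + 1) C = ∑ a,
    P.q a * P.form n fun α => C (Fin.cons a α) := by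
  rw [form, ← (Fin.consEquiv fun _ => κ).sum_comp, Fintype.sum_prod_type]
  refine sum_congr rfl fun a _ => ?_
  rw [form, mul_sum]
  refine sum_congr rfl fun α _ => ?_
  rw [← mul_assoc, ← P.F_mul, mul_assoc, ofFn_succ, List.prod_cons]
  rfl

lemma form_mem (n : ℕ) (C : (Fin n → κ) → R) : P.form n C ∈ P.poly n := by
  induction n with
  | zero => rw [form_zero]; exact ⟨_, rfl⟩
  | succ n ih =>
    rw [form_succ]
    exact Submodule.sum_mem _ fun a _ => P.q_mul_mem a (ih _)

lemma form_smul (n : ℕ) (c : ℝ) (C : (Fin n → κ) → R) : P.form n (fun α => c • C α) =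
    c • P.form n C := by
  rw [form, form, smul_sum]
  exact sum_congr rfl fun α _ => by rw [map_smul, smul_mul_assoc]

/-- The homogeneous part of degree `n` of the Taylor expansion, up to the factor `n!`. -/
def taylor (n : ℕ) (x : A) : A := P.form n fun α => P.ε (P.iter n α x)

lemma taylor_succ (n : ℕ) (x : A) : P.taylor (n + 1) x = ∑ a, P.q a * P.taylor n (P.J a x) := by
  rw [taylor, form_succ]
  rfl

lemma taylor_add (n : ℕ) (x y : A) : P.taylor n (x + y) = P.taylor n x + P.taylor n y := by
  simp only [taylor, form, map_add, add_mul, sum_add_distrib]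

lemma taylor_of_mem {n : ℕ} {x : A} (hx : x ∈ P.poly n) (k : ℕ) : P.taylor k x = if k =
    n then (k.factorial : ℝ) • x else 0 := by
  induction k generalizing n x with
  | zero =>
    rw [taylor, form_zero]
    change P.F (P.ε x) = _
    match n with
    | 0 =>
      obtain ⟨f, rfl⟩ := hx
      rw [AlgHom.toLinearMap_apply, ε_F, if_pos rfl, Nat.factorial_zero, Nat.cast_one, one_smul]
    | n + 1 => rw [P.ε_of_mem hx, map_zero, if_neg (Nat.succ_ne_zero n).symm]
  | succ k ih =>
    rw [taylor_succ]
    match n with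
    | 0 =>
      rw [if_neg (Nat.succ_ne_zero k)]
      refine sum_eq_zero fun a _ => ?_
      rw [P.J_of_mem_zero a hx, ih (zero_mem (P.poly k)), if_pos rfl, smul_zero, mul_zero]
    | n + 1 =>
      rw [sum_congr rfl fun a _ => by rw [ih (P.J_mem a hx)]]
      by_cases h : k = n
      · subst h
        simp only [if_pos, mul_smul_comm]
        rw [← smul_sum, P.sum_q_mul_J hx, smul_smul, Nat.factorial_succ, Nat.cast_mul,
          mul_comm (k.factorial : ℝ)]
      · rw [if_neg (by omega)]
        simp only [if_neg h, mul_zero, sum_const_zero]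

lemma exists_taylor (x : A) : ∃ n₀, ∀ n ≥ n₀, x = ∑ k ∈ Finset.range n,
    (k.factorial : ℝ)⁻¹ • P.taylor k x := by
  have hx : x ∈ ⨆ n, P.poly n := P.iSup_poly ▸ Submodule.mem_top
  induction hx using Submodule.iSup_induction' with
  | mem n y hy =>
    refine ⟨n + 1, fun l hl => ?_⟩
    rw [sum_eq_single n (fun k _ hk => by rw [P.taylor_of_mem hy, if_neg hk, smul_zero])
      (fun h => absurd (Finset.mem_range.2 hl) h), P.taylor_of_mem hy, if_pos rfl, smul_smul,
      inv_mul_cancel₀ (Nat.cast_ne_zero.2 n.factorial_ne_zero), one_smul]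
  | zero =>
    refine ⟨0, fun n _ => (sum_eq_zero fun k _ => ?_).symm⟩
    rw [P.taylor_of_mem (zero_mem (P.poly k)), if_pos rfl, smul_zero, smul_zero]
  | add y z _ _ hy hz =>
    obtain ⟨a, ha⟩ := hy
    obtain ⟨b, hb⟩ := hz
    refine ⟨max a b, fun n hn => ?_⟩
    simp only [taylor_add, smul_add, sum_add_distrib]
    rw [← ha n (le_trans (le_max_left _ _) hn), ← hb n (le_trans (le_max_right _ _) hn)]

lemma eq_zero_of_ε_iter {x : A} (h : ∀ n (α : Fin n → κ), P.ε (P.iter n α x) = 0) : x = 0 := by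
  obtain ⟨n, hn⟩ := P.exists_taylor x
  rw [hn n le_rfl]
  refine sum_eq_zero fun k _ => ?_
  rw [taylor, form, sum_eq_zero fun α _ => by rw [h, map_zero, zero_mul], smul_zero]

lemma eq_sum_taylor {x : A} (s : Finset ℕ) (h : ∀ n ∉ s, ∀ α : Fin n → κ, P.ε (P.iter n α x) = 0) :
    x = ∑ k ∈ s, (k.factorial : ℝ)⁻¹ • P.taylor k x := by
  obtain ⟨n, hn⟩ := P.exists_taylor x
  have h0 : ∀ k ∉ s, (k.factorial : ℝ)⁻¹ • P.taylor k x = 0 := fun k hk => by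
    rw [taylor, form, sum_eq_zero fun α _ => by rw [h k hk, map_zero, zero_mul], smul_zero]
  obtain ⟨l, hl⟩ := s.exists_nat_subset_range
  conv_lhs => rw [hn (max n l) (le_max_left _ _)]
  refine (Finset.sum_subset (hl.trans (Finset.range_mono (le_max_right _ _))) fun k _ hk =>
    h0 k hk).symm

/-- Graded symmetry of coefficients. -/
def IsSymm {n : ℕ} (C : (Fin n → κ) → R) : Prop :=
  ∀ (α : Fin n → κ) (i j : Fin n), (i : ℕ) + 1 = j →
    C (α ∘ Equiv.swap i j) = (-1 : ℝ) ^ (P.d (α i) * P.d (α j)) • C α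

variable {P}

lemma IsSymm.cons {C : (Fin (n + 1) → κ) → R} (hC : P.IsSymm C) (a : κ) :
    P.IsSymm fun α => C (Fin.cons a α) := by
  intro α i j hij
  have h1 := hC (Fin.cons a α) i.succ j.succ (by simpa using hij)
  rw [Fin.cons_succ, Fin.cons_succ] at h1
  rw [← h1]
  refine congrArg C (funext fun k => ?_)
  refine Fin.cases ?_ (fun k => ?_) k
  · rw [Fin.cons_zero, Function.comp_apply, Equiv.swap_apply_of_ne_of_ne
      (Fin.succ_ne_zero _).symm (Fin.succ_ne_zero _).symm, Fin.cons_zero]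
  · rw [Fin.cons_succ, Function.comp_apply, Function.comp_apply,
      ← (Fin.succ_injective n).map_swap, Fin.cons_succ]

lemma IsSymm.swap {C : (Fin (n + 2) → κ) → R} (hC : P.IsSymm C) (a b : κ) (α : Fin n → κ) :
    C (Fin.cons a (Fin.cons b α)) = (-1 : ℝ) ^ (P.d a * P.d b) • C (Fin.cons b (Fin.cons a α)) := by
  have h1 := hC (Fin.cons b (Fin.cons a α)) 0 1 rfl
  have h2 : (Fin.cons b (Fin.cons a α) : Fin (n + 2) → κ) ∘ Equiv.swap 0 1 =
      Fin.cons a (Fin.cons b α) := by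
    funext k
    refine Fin.cases ?_ (fun k => Fin.cases ?_ (fun k => ?_) k) k
    · rw [Function.comp_apply, Equiv.swap_apply_left]; rfl
    · rw [Function.comp_apply, Fin.succ_zero_eq_one, Equiv.swap_apply_right]; rfl
    · rw [Function.comp_apply, Equiv.swap_apply_of_ne_of_ne (Fin.succ_ne_zero _)
        (fun h => Fin.succ_ne_zero k (Fin.succ_injective _ (h.trans Fin.succ_zero_eq_one.symm)))]
      rfl
  rw [h2] at h1
  rw [h1, mul_comm]
  rfl

lemma IsSymm.J_form {n : ℕ} {C : (Fin (n + 1) → κ) → R} (hC : P.IsSymm C) (b : κ) :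
    P.J b (P.form (n + 1) C) = ((n : ℝ) + 1) • P.form n fun α => C (Fin.cons b α) := by
  induction n with
  | zero =>
    rw [form_succ, map_sum, sum_eq_single b]
    · rw [J_q, if_pos rfl, form_zero, J_F, mul_zero, smul_zero, add_zero]
      simp
    · intro a _ hab
      rw [J_q, if_neg (Ne.symm hab), form_zero, J_F, mul_zero, smul_zero, add_zero]
    · exact fun h => absurd (mem_univ b) h
  | succ n ih =>
    rw [form_succ, map_sum]
    have h1 : ∀ a, P.J b (P.q a * P.form (n + 1) fun α => C (Fin.cons a α)) =
        (if b = a then P.form (n + 1) fun α => C (Fin.cons a α) else 0) +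
          ((n : ℝ) + 1) • (P.q a * P.form n fun α => C (Fin.cons b (Fin.cons a α))) := by
      intro a
      have h2 : (fun α : Fin n → κ => C (Fin.cons b (Fin.cons a α))) =
          fun α => (-1 : ℝ) ^ (P.d b * P.d a) • C (Fin.cons a (Fin.cons b α)) :=
        funext fun α => hC.swap b a α
      rw [J_q, ih (hC.cons a), h2, form_smul, mul_smul_comm, mul_smul_comm, smul_comm]
    rw [sum_congr rfl fun a _ => h1 a, sum_add_distrib, Finset.sum_ite_eq,
      if_pos (mem_univ b), ← smul_sum,
      ← form_succ (C := fun α => C (Fin.cons b α)), Nat.cast_succ,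
      add_smul ((n : ℝ) + 1) 1, one_smul, add_comm]

lemma IsSymm.iter_form {n : ℕ} {C : (Fin n → κ) → R} (hC : P.IsSymm C) (α : Fin n → κ) :
    P.ε (P.iter n α (P.form n C)) = (n.factorial : ℝ) • C α := by
  induction n with
  | zero =>
    rw [form_zero]
    change P.ε (P.F _) = _
    rw [ε_F, Nat.factorial_zero, Nat.cast_one, one_smul]
    congr 1
    exact Subsingleton.elim _ _
  | succ n ih =>
    rw [iter_succ, hC.J_form, map_smul, map_smul, ih (hC.cons _), smul_smul, Nat.factorial_succ,
      Nat.cast_mul, Nat.cast_succ, Fin.cons_self_tail]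

lemma ε_iter_sum_form {s : Finset ℕ} (t : ℕ → ℝ) {C : ∀ n, (Fin n → κ) → R}
    (hC : ∀ n ∈ s, P.IsSymm (C n)) (n : ℕ) (α : Fin n → κ) :
    P.ε (P.iter n α (∑ k ∈ s, t k • P.form k (C k))) = if n ∈
    s then (t n * n.factorial) • C n α else 0 := by
  have h1 : ∀ k, k ≠ n → P.ε (P.iter n α (t k • P.form k (C k))) = 0 := fun k hk => by
    rw [map_smul, map_smul, P.ε_iter_of_mem hk.symm α (P.form_mem k _), smul_zero]
  rw [map_sum, map_sum]
  split_ifs with hn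
  · rw [sum_eq_single n (fun k _ hk => h1 k hk) fun h => absurd hn h, map_smul, map_smul,
      (hC n hn).iter_form, smul_smul]
  · exact sum_eq_zero fun k hk => h1 k fun h => hn (h ▸ hk)

lemma eq_of_sum_form_eq {s : Finset ℕ} {t : ℕ → ℝ} (ht : ∀ n ∈ s, t n ≠ 0)
    {C C' : ∀ n, (Fin n → κ) → R} (hC : ∀ n ∈ s, P.IsSymm (C n)) (hC' : ∀ n ∈ s, P.IsSymm (C' n))
    (h : ∑ k ∈ s, t k • P.form k (C k) = ∑ k ∈ s, t k • P.form k (C' k)) (hn : n ∈ s) : C n =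
    C' n := by
  funext α
  have h1 := ε_iter_sum_form t hC n α
  rw [h, ε_iter_sum_form t hC', if_pos hn, if_pos hn] at h1
  exact (smul_right_injective R
    (mul_ne_zero (ht n hn) (Nat.cast_ne_zero.2 n.factorial_ne_zero)) h1).symm

end Partials

lemma NManifold.twist_neg (d : ℤ) (f : N.O U) : N.twist U (-d) f = N.twist U d f := by
  have h : ∀ n : ℕ, (-1 : ℝ) ^ (-d * n) = (-1 : ℝ) ^ (d * n) := fun n => by
    rw [neg_mul, zpow_neg, ← inv_zpow, inv_neg, inv_one]
  rw [twist, twist]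
  simp only [h]

lemma NManifold.twist_mem_grInt (d : ℤ) {n : ℤ} (hf : f ∈ N.grInt U n) : N.twist U d f ∈
    N.grInt U n := by
  rw [twist_of_mem_grInt d hf]
  exact smul_mem _ _ hf

lemma Frame.pair_dual (b : Frame V U) (α β : Idx r) :
    V.pair (b.θ β) ((Pi.single α.1 (b.e α) : ∀ k, V.Sect k) β.1) = if α = β then 1 else 0 := by
  obtain ⟨j, i⟩ := α
  obtain ⟨k, l⟩ := β
  refine Smooth.ext fun x => ?_
  by_cases hk : k = j
  · subst hk
    rw [Pi.single_eq_same]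
    refine (b.dual k l i x).trans ?_
    by_cases h : l = i
    · subst h
      rw [if_pos rfl, if_pos rfl]
      rfl
    · rw [if_neg h, if_neg fun h' => h (by simpa using h'.symm)]
      rfl
  · rw [Pi.single_eq_of_ne hk, pair_zero,
      if_neg fun h => hk (congrArg Sigma.fst h).symm]

lemma Frame.vec_mem (b : Frame V U) (α : Idx r) : b.vec α ∈ V.gr (-(idxDeg α : ℤ)) := by
  have := V.ofSect_mem α.1 (b.e α)
  rw [idxDeg]
  push_cast
  exact this

namespace Identification

variable (ι) {U : Opens M} (b : Frame V U)

lemma contraction_frameCoord (α β : Idx r) : (ι.contraction α.1 (b.e α)).app U (ι.frameCoord b β) =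
    if α = β then 1 else 0 := by
  rw [frameCoord, contraction_coord, b.pair_dual]
  split_ifs <;> simp

/-- The partial derivatives with respect to the coordinates of a frame. -/
def partials : Partials (Smooth m U) (N.O U) (Idx r) where
  F := N.fn U
  q := ι.frameCoord b
  d := idxDeg
  J α := (N.twist U (idxDeg α)).comp ((ι.contraction α.1 (b.e α)).app U)
  ε := N.body U
  comm α β := signComm (ι.frameCoord_mem b α) (ι.frameCoord_mem b β)
  F_mul f α := fn_mul_comm f _
  J_F α f := by rw [LinearMap.comp_apply, contraction_fn, map_zero]
  J_q α β x := by
    have h1 := ι.isRightDer_contraction α.1 (b.e α) U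
    have h2 : ((α.1 : ℤ) + 1) = (idxDeg α : ℤ) := by rw [idxDeg]; push_cast; rfl
    rw [LinearMap.comp_apply, LinearMap.comp_apply, h1.rule, map_add, twist_mul, h2,
      twist_neg, ι.contraction_frameCoord, twist_of_mem _ (ι.frameCoord_mem b β), add_comm,
      smul_mul_assoc, ← Nat.cast_mul, zpow_natCast]
    congr 1
    split_ifs
    · rw [one_mul, twist_twist]
    · rw [zero_mul, map_zero]
  ε_F f := body_fn f
  ε_q α x := by
    rw [body_mul]
    have : N.body U (ι.frameCoord b α) = 0 := ι.body_coord _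
    rw [this, zero_mul]
  adjoin := (ι.isCoordinates b).adjoin_eq_top

lemma partials_J (α : Idx r) (x : N.O U) : (ι.partials b).J α x =
    N.twist U (idxDeg α) ((ι.contraction α.1 (b.e α)).app U x) := rfl

lemma partials_J_mem {n : ℤ} {x : N.O U} (hx : x ∈ N.grInt U n) (α : Idx r) : (ι.partials b).J α x ∈
    N.grInt U (n - idxDeg α) := by
  have h1 := operator_apply_mem (ι.contraction_mem α.1 (b.e α)).1 hx
  refine twist_mem_grInt _ (mem_grInt_of_eq h1 ?_)
  rw [idxDeg]
  push_cast
  ring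

lemma ε_iter_eq_zero {n : ℕ} (α : Fin n → Idx r) {k : ℤ} {x : N.O U} (hx : x ∈ N.grInt U k)
    (hk : k ≠ ∑ i, (idxDeg (α i) : ℤ)) : N.body U ((ι.partials b).iter n α x) = 0 := by
  induction n generalizing k x with
  | zero => exact body_of_mem_grInt hx (by simpa using hk)
  | succ n ih =>
    rw [Partials.iter_succ]
    refine ih _ (ι.partials_J_mem b hx _) fun h => hk ?_
    rw [Fin.sum_univ_succ]
    change k - _ = ∑ i : Fin n, (idxDeg (α i.succ) : ℤ) at h
    omega

lemma body_adList_apply {n : ℕ} (α : Fin n → Idx r) {t k : ℤ} {T : N.Ops} (hT : T ∈ N.firstOrder t)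
    {g : N.O U} (hg : g ∈ N.grInt U k)
    (hTg : ∀ a : Idx r, T.app U ((ι.contraction a.1 (b.e a)).app U g) = 0)
    (hgg : ∀ a c : Idx r, (ι.contraction c.1 (b.e c)).app U ((ι.contraction a.1 (b.e a)).app U g) =
      0) :
    N.body U ((ι.voronov.adList t (ofFn fun i => (b.vec (α i), -(idxDeg (α i) : ℤ))) T).app U g) =
    (∏ i, -(-1 : ℝ) ^ ((idxDeg (α i) : ℤ) * (k + 1))) • N.body U
    ((ι.partials b).iter n α (T.app U g)) := by
  induction n generalizing t T with
  | zero => rw [Fin.prod_univ_zero, one_smul]; rfl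
  | succ n ih =>
    have hI : ι.operator (b.vec (α 0)) = ι.contraction (α 0).1 (b.e (α 0)) := ι.operator_ofSect _ _
    have hm := ι.voronov.comm_mem hT (ι.voronov.I_mem (b.vec_mem (α 0)))
    have happ : ∀ x, (gradedComm t (-(idxDeg (α 0) : ℤ)) T (ι.operator (b.vec (α 0)))).app U x =
        T.app U ((ι.contraction (α 0).1 (b.e (α 0))).app U x) -
          (-1 : ℝ) ^ (t * -(idxDeg (α 0) : ℤ)) •
            (ι.contraction (α 0).1 (b.e (α 0))).app U (T.app U x) := fun x => by
      rw [gradedComm, operator_sub_apply, operator_smul_apply, operator_mul_apply,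
        operator_mul_apply, hI]
    rw [ofFn_succ, VoronovData.adList_cons]
    have h1 := ih (fun i => α i.succ) hm fun a => by
      refine (happ _).trans ?_
      rw [hgg, map_zero, hTg, map_zero, smul_zero, sub_zero]
    refine h1.trans ?_
    have h2 : (gradedComm t (-(idxDeg (α 0) : ℤ)) T (ι.operator (b.vec (α 0)))).app U g =
        (-(-1 : ℝ) ^ ((idxDeg (α 0) : ℤ) * (k + 1))) • (ι.partials b).J (α 0) (T.app U g) := by
      have h3 := operator_apply_mem hT.1 hg
      have h4 := ι.partials_J_mem b h3 (α 0)
      have h5 : (ι.contraction (α 0).1 (b.e (α 0))).app U (T.app U g) =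
          N.twist U (idxDeg (α 0)) ((ι.partials b).J (α 0) (T.app U g)) := by
        rw [partials_J, twist_twist]
      rw [happ, hTg, zero_sub, h5, twist_of_mem_grInt _ h4, smul_smul, ← neg_one_zpow_add, neg_smul]
      congr 2
      generalize (idxDeg (α 0) : ℤ) = d
      have h6 : t * -d + d * (k + t - d) = d * (k + 1) + -(d * (d + 1)) := by ring
      rw [h6, neg_one_zpow_add, (Int.even_mul_succ_self d).neg.neg_one_zpow, mul_one]
    have h7 : (gradedComm t (-(idxDeg (α 0) : ℤ)) T (ι.voronov.I (b.vec (α 0)))).app U g = _ := h2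
    rw [h7, map_smul, map_smul, smul_smul, Fin.prod_univ_succ, mul_comm, Partials.iter_succ]
    rfl

variable {D : N.Ops} (hD : ∀ U, IsRightDer U 1 (D.app U))

lemma prod_neg_sign (d : Fin n → ℤ) {e : ℤ} (h : ∑ i, d i = e) : ∏ i, -(-1 : ℝ) ^ (d i * e) =
    (-1 : ℝ) ^ n * (-1 : ℝ) ^ e := by
  have h1 : ∀ i, -(-1 : ℝ) ^ (d i * e) = (-1) * (-1 : ℝ) ^ (d i * e) := fun i => by ring
  simp only [h1]
  rw [Finset.prod_mul_distrib, Finset.prod_const, card_univ, Fintype.card_fin,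
    VoronovData.prod_neg_one_zpow, ← sum_mul, h]
  congr 1
  have : e * e = e + e * (e - 1) := by ring
  rw [this, neg_one_zpow_add, (Int.even_mul_pred_self e).neg_one_zpow, mul_one]

include hD

lemma body_iter_derivation (α : Fin n → Idx r) (β : Idx r) :
    N.body U ((ι.partials b).iter n α (D.app U (ι.frameCoord b β))) =
    ((-1 : ℝ) ^ n * (-1 : ℝ) ^ (idxDeg β + 1)) • V.pair (b.θ β)
    ((ι.voronov.bracket D n fun i => b.vec (α i)).2 β.1) := by
  have hg : ι.frameCoord b β ∈ N.grInt U (idxDeg β : ℤ) := by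
    rw [grInt_natCast]
    exact ι.frameCoord_mem b β
  have hone : ∀ a : Idx r, (ι.contraction a.1 (b.e a)).app U 1 = 0 := fun a =>
    (ι.isRightDer_contraction a.1 (b.e a) U).map_one
  have hD' := derivation_mem hD
  have h1 := ι.body_adList_apply b α hD' hg (fun a => by
      rw [ι.contraction_frameCoord]
      split_ifs
      · exact (hD U).map_one
      · exact map_zero _) fun a c => by
      rw [ι.contraction_frameCoord]
      split_ifs
      · exact hone c
      · exact map_zero _
  have h2 : N.body U ((ι.voronov.adList 1 (ofFn fun i => (b.vec (α i),
      -(idxDeg (α i) : ℤ))) D).app U (ι.frameCoord b β)) = V.pair (b.θ β)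
        ((ι.voronov.bracket D n fun i => b.vec (α i)).2 β.1) := by
    rw [ι.voronov.bracket_eq hD' fun i => b.vec_mem (α i)]
    refine (ι.pair_symbol (ι.firstOrder_le_symbolic _
      (ι.voronov.adList_mem hD' fun y hy => ?_)) _).symm
    obtain ⟨i, rfl⟩ := (mem_ofFn' _ _).1 hy
    exact b.vec_mem (α i)
  rw [← h2, h1]
  by_cases h : ∑ i, (idxDeg (α i) : ℤ) = (idxDeg β : ℤ) + 1
  · rw [prod_neg_sign _ h, smul_smul, ← Nat.cast_succ, zpow_natCast]
    have h3 : ((-1 : ℝ) ^ n * (-1) ^ (idxDeg β + 1)) * ((-1) ^ n * (-1) ^ (idxDeg β + 1)) = 1 := by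
      rw [mul_mul_mul_comm, ← pow_add, ← pow_add, ← two_mul, ← two_mul, pow_mul, pow_mul]
      simp
    rw [h3, one_smul]
  · rw [ι.ε_iter_eq_zero b α (operator_apply_mem (derivation_mem hD).1 hg) (Ne.symm h), smul_zero, smul_zero]

lemma derivation_frameCoord (β : Idx r) : D.app U (ι.frameCoord b β) = ∑ n ∈ Finset.Icc 1 (p + 1),
    ((-1 : ℝ) ^ n * (-1 : ℝ) ^ (idxDeg β + 1) / n.factorial) • (ι.partials b).form n fun α =>
    V.pair (b.θ β) ((ι.voronov.bracket D n fun i => b.vec (α i)).2 β.1) := by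
  have hg : ι.frameCoord b β ∈ N.grInt U (idxDeg β : ℤ) := by
    rw [grInt_natCast]
    exact ι.frameCoord_mem b β
  have h1 := (ι.partials b).eq_sum_taylor (x := D.app U (ι.frameCoord b β))
    (Finset.Icc 1 (p + 1)) fun n hn α => ?_
  · rw [h1]
    refine sum_congr rfl fun n _ => ?_
    rw [Partials.taylor]
    have h2 := ι.body_iter_derivation b hD (n := n) (β := β)
    have h3 : (fun α => (ι.partials b).ε ((ι.partials b).iter n α
        (D.app U (ι.frameCoord b β)))) = fun α => ((-1 : ℝ) ^ n * (-1 : ℝ) ^ (idxDeg β + 1)) •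
          V.pair (b.θ β) ((ι.voronov.bracket D n fun i => b.vec (α i)).2 β.1) := funext h2
    rw [h3, Partials.form_smul, smul_smul]
    congr 1
    ring
  · refine ι.ε_iter_eq_zero b α (operator_apply_mem (derivation_mem hD).1 hg) fun h => hn ?_
    have h2 : ∑ i : Fin n, (1 : ℤ) ≤ ∑ i, (idxDeg (α i) : ℤ) := sum_le_sum fun i _ => by
      rw [idxDeg]
      push_cast
      omega
    rw [sum_const, card_univ, Fintype.card_fin, nsmul_eq_mul, mul_one, ← h] at h2
    have h3 : idxDeg β ≤ p := by
      rw [idxDeg]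
      exact β.1.2
    refine Finset.mem_Icc.2 ⟨?_, by omega⟩
    by_contra hn0
    obtain rfl : n = 0 := by omega
    simp at h
    omega

lemma body_J_derivation_fn (a : Idx r) (f : 𝒞) :
    N.body U ((ι.partials b).J a (D.app U (N.fn U (globRes U f)))) =
    globRes U (ι.voronov.bracket D 2 ![b.vec a, V.ofFun f]).1 := by
  have hf : N.fn U (globRes U f) ∈ N.grInt U 0 := fn_mem_grInt U _
  have h1 : (1 : N.O U) ∈ N.grInt U 0 := by
    have := fn_mem_grInt (N := N) U 1
    rwa [map_one] at this
  have hone : ∀ a : Idx r, (ι.contraction a.1 (b.e a)).app U 1 = 0 := fun a =>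
    (ι.isRightDer_contraction a.1 (b.e a) U).map_one
  have hD' := derivation_mem hD
  have h0 : gradedComm 1 0 D (ι.operator (V.ofFun f)) ∈ N.firstOrder (1 + 0) :=
    ι.voronov.comm_mem hD' (ι.voronov.I_mem (V.ofFun_mem f))
  have h2 := ι.body_adList_apply b (fun _ : Fin 1 => a) h0 h1
    (fun c => by rw [hone, map_zero]) fun c c' => by rw [hone, map_zero]
  have h3 : (gradedComm 1 0 D (ι.operator (V.ofFun f))).app U 1 =
      D.app U (N.fn U (globRes U f)) := by
    rw [operator_ofFun, gradedComm_mulOp_apply hD, one_mul]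
  have h4 := b.vec_mem a
  have h5 : ∀ y ∈ [(V.ofFun f, (0 : ℤ)), (b.vec a, -(idxDeg a : ℤ))], y.1 ∈ V.gr y.2 := by
    intro y hy
    rcases List.mem_cons.1 hy with rfl | hy
    · exact V.ofFun_mem f
    · obtain rfl := List.mem_singleton.1 hy
      exact h4
  rw [ι.bracket_two hD h4 (V.ofFun_mem f), zero_mul, zpow_zero, one_smul,
    ι.globRes_symbol (ι.firstOrder_le_symbolic _ (ι.voronov.adList_mem hD' h5)),
    VoronovData.adList_cons]
  refine Eq.trans ?_ h2.symm
  rw [h3, Fin.prod_univ_one]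
  change _ = _ • N.body U ((ι.partials b).J a _)
  by_cases h : idxDeg a = 1
  · rw [h, Nat.cast_one, one_mul, zero_add, zpow_one, neg_neg, one_smul]
  · have h6 := ι.partials_J_mem b (operator_apply_mem (derivation_mem hD).1 hf) a
    rw [body_of_mem_grInt h6 (by omega), smul_zero]

lemma derivation_fn (f : 𝒞) : D.app U (N.fn U (globRes U f)) = ∑ a,
    N.fn U (globRes U (ι.voronov.bracket D 2 ![b.vec a, V.ofFun f]).1) * ι.frameCoord b a := by
  have hf : N.fn U (globRes U f) ∈ N.grInt U 0 := fn_mem_grInt U _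
  have h1 := (ι.partials b).eq_sum_taylor (x := D.app U (N.fn U (globRes U f))) {1}
    fun n hn α => ?_
  · rw [h1, Finset.sum_singleton, Nat.factorial_one, Nat.cast_one, inv_one, one_smul,
      Partials.taylor_succ]
    refine sum_congr rfl fun a _ => ?_
    rw [Partials.taylor, Partials.form_zero]
    change _ * N.fn U (N.body U _) = _
    rw [← ι.body_J_derivation_fn b hD, fn_mul_comm]
    rfl
  · refine ι.ε_iter_eq_zero b α (operator_apply_mem (derivation_mem hD).1 hf) fun h => hn ?_
    have h2 : ∑ i : Fin n, (1 : ℤ) ≤ ∑ i, (idxDeg (α i) : ℤ) := sum_le_sum fun i _ => by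
      rw [idxDeg]
      push_cast
      omega
    rw [sum_const, card_univ, Fintype.card_fin, nsmul_eq_mul, mul_one, ← h] at h2
    refine Finset.mem_singleton.2 ?_
    by_contra hn0
    obtain rfl : n = 0 := by omega
    simp at h

end Identification

lemma multilinear_eq_zero_of_span {S F : Type*} [AddCommGroup S] [Module ℝ S] [AddCommGroup F]
    [Module ℝ F] {B : Set S} (hB : span ℝ B = ⊤) {n : ℕ}
    {φ : MultilinearMap ℝ (fun _ : Fin n => S) F} (h : ∀ v, (∀ i, v i ∈ B) → φ v = 0) : φ = 0 := by
  induction n with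
  | zero => exact MultilinearMap.ext fun v => h v fun i => i.elim0
  | succ n ih =>
    have h1 : ∀ x, φ.curryLeft x = 0 := fun x => by
      have hx : x ∈ span ℝ B := hB ▸ Submodule.mem_top
      induction hx using span_induction with
      | mem y hy => exact ih fun v hv => h _ (Fin.cases hy hv)
      | zero => exact map_zero _
      | add y z _ _ hy hz => rw [map_add, hy, hz, add_zero]
      | smul c y _ hy => rw [map_smul, hy, smul_zero]
    refine MultilinearMap.ext fun v => ?_
    have := DFunLike.congr_fun (h1 (v 0)) (Fin.tail v)
    rw [MultilinearMap.curryLeft_apply, Fin.cons_self_tail] at this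
    exact this

namespace GradedBundle

variable (V) in
def ev (x : M) : V.Sec →ₗ[ℝ] ℝ × (∀ j, V.E j x) where
  toFun v := (v.1 x, fun j => v.2 j x)
  map_add' _ _ := rfl
  map_smul' _ _ := rfl

lemma ev_mulFun (x : M) (f : 𝒞) (v : V.Sec) : V.ev x (V.mulFun f v) = f x • V.ev x v := rfl

lemma eq_of_ev {v w : V.Sec} (h : ∀ x, V.ev x v = V.ev x w) : v = w := by
  refine Prod.ext (ContMDiffMap.ext fun x => congrArg Prod.fst (h x))
    (funext fun j => ContMDiffSection.ext fun x => ?_)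
  exact congrFun (congrArg Prod.snd (h x)) j

/-- The functions, the elements of a frame, and the multiples of functions that vanish at `x`. -/
def spanningSet (b : Frame V U) (x : M) : Set V.Sec :=
  {y | (∃ f, y = V.ofFun f) ∨ (∃ α, y = b.vec α) ∨ ∃ (g : 𝒞) (z : V.Sec), g x = 0 ∧
    y = V.mulFun g z}

lemma span_spanningSet (b : Frame V U) {x : M} (hx : x ∈ U) : span ℝ (spanningSet b x) = ⊤ := by
  refine eq_top_iff.2 fun y _ => ?_
  rw [← sum_component y]
  refine Submodule.sum_mem _ fun k _ => ?_
  match k with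
  | none => exact subset_span (Or.inl ⟨_, rfl⟩)
  | some j =>
    obtain ⟨χ, hχ, W, -, hxW, hW⟩ := exists_bump (m := m) U hx
    have h1 : component y (some j) = V.mulFun (1 - χ) (V.ofSect j (y.2 j)) +
        ∑ i, V.mulFun (cutoff χ hχ (V.pair (b.θ ⟨j, i⟩) (y.2 j))) (b.vec ⟨j, i⟩) := by
      refine eq_of_ev fun z => ?_
      change V.ev z (V.ofSect j (y.2 j)) = _
      rw [map_add, map_sum]
      simp only [ev_mulFun]
      by_cases hz : z ∈ U
      · have h2 : ∀ i, cutoff χ hχ (V.pair (b.θ ⟨j, i⟩) (y.2 j)) z =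
            χ z * (b.θ ⟨j, i⟩).1 ⟨z, hz⟩ (y.2 j z) := fun i =>
          cutoff_apply χ hχ (V.pair (b.θ ⟨j, i⟩) (y.2 j)) ⟨z, hz⟩
        have h3 : ∑ i, (b.θ ⟨j, i⟩).1 ⟨z, hz⟩ (y.2 j z) • V.ev z (b.vec ⟨j, i⟩) =
            V.ev z (V.ofSect j (y.2 j)) := by
          refine Prod.ext ?_ (funext fun k => ?_)
          · rw [Prod.fst_sum]
            exact sum_eq_zero fun i _ => smul_zero _
          · rw [Prod.snd_sum, Finset.sum_apply]
            change ∑ i, (b.θ ⟨j, i⟩).1 ⟨z, hz⟩ (y.2 j z) • (Pi.single j (b.e ⟨j, i⟩) : ∀ k, V.Sect k) k z =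
              (Pi.single j (y.2 j) : ∀ k, V.Sect k) k z
            by_cases hk : k = j
            · subst hk
              simp only [Pi.single_eq_same]
              exact b.sum_smul k ⟨z, hz⟩ (y.2 k z)
            · simp only [Pi.single_eq_of_ne hk]
              exact sum_eq_zero fun i _ => smul_zero _
        simp only [h2, mul_smul]
        rw [← smul_sum, h3, ← add_smul]
        change _ = (1 - χ z + χ z) • _
        rw [sub_add_cancel, one_smul]
      · have h2 : χ z = 0 := image_eq_zero_of_notMem_tsupport fun h => hz (hχ h)
        have h3 : ∀ i, cutoff χ hχ (V.pair (b.θ ⟨j, i⟩) (y.2 j)) z = 0 := fun i => by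
          change χ z * _ = 0
          rw [h2, zero_mul]
        simp only [h3, zero_smul, sum_const_zero, add_zero]
        change _ = (1 - χ z) • _
        rw [h2, sub_zero, one_smul]
    rw [h1]
    refine add_mem (subset_span (Or.inr (Or.inr ⟨_, _, ?_, rfl⟩)))
      (Submodule.sum_mem _ fun i _ => ?_)
    · change 1 - χ x = 0
      rw [hW x hxW, sub_self]
    · set c := cutoff χ hχ (V.pair (b.θ ⟨j, i⟩) (y.2 j))
      have h2 : V.mulFun c (b.vec ⟨j, i⟩) = V.mulFun (c - c x • 1) (b.vec ⟨j, i⟩) +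
          c x • b.vec ⟨j, i⟩ := by
        refine eq_of_ev fun z => ?_
        rw [map_add, ev_mulFun, ev_mulFun, map_smul, ← add_smul]
        change _ = (c z - c x * 1 + c x) • _
        rw [mul_one, sub_add_cancel]
      rw [h2]
      refine add_mem (subset_span (Or.inr (Or.inr ⟨_, _, ?_, rfl⟩)))
        (smul_mem _ _ (subset_span (Or.inr (Or.inl ⟨_, rfl⟩))))
      change c x - c x * 1 = 0
      rw [mul_one, sub_self]

end GradedBundle

namespace PreAlgebroid

variable (A A' : PreAlgebroid V)

def br : V.Sec →ₗ[ℝ] V.Sec →ₗ[ℝ] V.Sec :=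
  LinearMap.mk₂ ℝ (fun X Y => A.a 2 ![X, Y])
    (fun X X' Y => (A.a 2).cons_add ![Y] X X') (fun c X Y => (A.a 2).cons_smul ![Y] c X)
    (fun X Y Y' => (A.a 2).curryLeft X |>.cons_add ![] Y Y')
    (fun c X Y => (A.a 2).curryLeft X |>.cons_smul ![] c Y)

lemma br_apply (X Y : V.Sec) : A.br X Y = A.a 2 ![X, Y] := rfl

lemma br_mem {d e : ℤ} {X Y : V.Sec} (hX : X ∈ V.gr d) (hY : Y ∈ V.gr e) : A.br X Y ∈
    V.gr (d + e + 1) := by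
  have := A.degree 2 ![d, e] ![X, Y] fun i => by fin_cases i <;> assumption
  rw [Fin.sum_univ_two] at this
  exact this

lemma br_swap {d e : ℤ} {X Y : V.Sec} (hX : X ∈ V.gr d) (hY : Y ∈ V.gr e) : A.br Y X =
    (-1 : ℝ) ^ (d * e) • A.br X Y := by
  have := A.symm 2 ![d, e] ![X, Y] (fun i => by fin_cases i <;> assumption) 0 1 rfl
  rw [negOnePow_smul] at this
  have h : (![X, Y] : Fin 2 → V.Sec) ∘ Equiv.swap 0 1 = ![Y, X] := by
    funext i
    fin_cases i <;> rfl
  rw [h] at this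
  exact this

lemma br_mulFun (X Y : V.Sec) (f : 𝒞) : A.br X (V.mulFun f Y) =
    V.mulFun (A.br X (V.ofFun f)).1 Y + V.mulFun f (A.br X Y) := A.leibniz X Y f

lemma br_fun_fun (f g : 𝒞) : A.br (V.ofFun f) (V.ofFun g) = 0 :=
  A.bracket_fun 0 _ g (V.ofFun_mem f) (by norm_num)

lemma br_fun_mem (X : V.Sec) (f : 𝒞) : A.br X (V.ofFun f) ∈ V.gr 0 := by
  induction X using sec_induction with
  | hadd X Y hX hY => rw [map_add, LinearMap.add_apply]; exact add_mem hX hY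
  | hom d X hX =>
    by_cases hd : d = -1
    · subst hd
      exact A.br_mem hX (V.ofFun_mem f)
    · rw [br_apply, A.bracket_fun d X f hX hd]
      exact zero_mem _

lemma br_mulFun_fun (X : V.Sec) (f g : 𝒞) : A.br (V.mulFun g X) (V.ofFun f) =
    V.mulFun g (A.br X (V.ofFun f)) := by
  have h := fun g => (V.mulFunₗ g).map_add
  simp only [mulFunₗ_apply] at h
  induction X using sec_induction with
  | hadd X Y hX hY =>
    rw [h, map_add, LinearMap.add_apply, hX, hY, map_add, LinearMap.add_apply, h]
  | hom d X hX =>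
    rw [A.br_swap (V.ofFun_mem f) (mulFun_mem hX g), zero_mul, zpow_zero, one_smul, br_mulFun,
      br_fun_fun, A.br_swap (V.ofFun_mem f) hX, zero_mul, zpow_zero, one_smul]
    refine (congrArg₂ (· + ·) ?_ rfl).trans (zero_add _)
    exact eq_of_ev fun x => by rw [ev_mulFun, map_zero]; exact zero_smul ℝ (V.ev x X)

variable {A A'} {U : Opens M} (b : Frame V U) {x : M}

include b

lemma br_fun_eq_at (hx : x ∈ U)
    (h : ∀ α f, (A.br (b.vec α) (V.ofFun f)).1 x = (A'.br (b.vec α) (V.ofFun f)).1 x) (X : V.Sec)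
    (f : 𝒞) : (A.br X (V.ofFun f)).1 x = (A'.br X (V.ofFun f)).1 x := by
  have hX : X ∈ span ℝ (spanningSet b x) := span_spanningSet b hx ▸ Submodule.mem_top
  induction hX using span_induction with
  | mem y hy =>
    rcases hy with ⟨g, rfl⟩ | ⟨α, rfl⟩ | ⟨g, z, hg, rfl⟩
    · rw [br_fun_fun, br_fun_fun]
    · exact h α f
    · rw [br_mulFun_fun, br_mulFun_fun]
      change g x * _ = g x * _
      rw [hg, zero_mul, zero_mul]
  | zero => rw [map_zero, map_zero]
  | add y z _ _ hy hz =>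
    rw [map_add, map_add]
    exact congrArg₂ (· + ·) hy hz
  | smul c y _ hy =>
    rw [map_smul, map_smul]
    exact congrArg (c * ·) hy

lemma br_eq_at (hx : x ∈ U)
    (h : ∀ α f, (A.br (b.vec α) (V.ofFun f)).1 x = (A'.br (b.vec α) (V.ofFun f)).1 x)
    (h' : ∀ α β, V.ev x (A.br (b.vec α) (b.vec β)) = V.ev x (A'.br (b.vec α) (b.vec β)))
    (X Y : V.Sec) : V.ev x (A.br X Y) = V.ev x (A'.br X Y) := by
  have h1 := br_fun_eq_at b hx h
  have h2 : ∀ X f, V.ev x (A.br X (V.ofFun f)) = V.ev x (A'.br X (V.ofFun f)) := fun X f => by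
    have e1 := funPart_of_mem (A.br_fun_mem X f)
    have e2 := funPart_of_mem (A'.br_fun_mem X f)
    rw [← e1, ← e2]
    exact Prod.ext (h1 X f) rfl
  have h3 : ∀ X z (g : 𝒞), g x = 0 →
      V.ev x (A.br X (V.mulFun g z)) = V.ev x (A'.br X (V.mulFun g z)) := fun X z g hg => by
    rw [br_mulFun, br_mulFun, map_add, map_add, ev_mulFun, ev_mulFun, ev_mulFun, ev_mulFun, hg,
      zero_smul, zero_smul, h1]
  have h4 : ∀ X β, V.ev x (A.br X (b.vec β)) = V.ev x (A'.br X (b.vec β)) := fun X β => by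
    have hX : X ∈ span ℝ (spanningSet b x) := span_spanningSet b hx ▸ Submodule.mem_top
    have hβ : b.vec β ∈ V.gr _ := V.ofSect_mem _ _
    induction hX using span_induction with
    | mem y hy =>
      rcases hy with ⟨g, rfl⟩ | ⟨α, rfl⟩ | ⟨g, z, hg, rfl⟩
      · rw [A.br_swap hβ (V.ofFun_mem g), A'.br_swap hβ (V.ofFun_mem g), map_smul, map_smul, h2]
      · exact h' α β
      · induction z using sec_induction with
        | hadd z z' hz hz' =>
          have h5 := (V.mulFunₗ g).map_add z z'
          simp only [mulFunₗ_apply] at h5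
          rw [h5, map_add, map_add, LinearMap.add_apply, LinearMap.add_apply, map_add, map_add, hz,
            hz']
        | hom d z hz =>
          rw [A.br_swap hβ (mulFun_mem hz g), A'.br_swap hβ (mulFun_mem hz g), map_smul, map_smul,
            h3 _ _ _ hg]
    | zero => rw [map_zero, map_zero]
    | add y z _ _ hy hz =>
      rw [map_add, map_add, LinearMap.add_apply, LinearMap.add_apply, map_add, map_add, hy, hz]
    | smul c y _ hy =>
      rw [map_smul, map_smul, LinearMap.smul_apply, LinearMap.smul_apply, map_smul, map_smul, hy]
  have hY : Y ∈ span ℝ (spanningSet b x) := span_spanningSet b hx ▸ Submodule.mem_top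
  induction hY using span_induction with
  | mem y hy =>
    rcases hy with ⟨g, rfl⟩ | ⟨α, rfl⟩ | ⟨g, z, hg, rfl⟩
    · exact h2 X g
    · exact h4 X α
    · exact h3 X z g hg
  | zero => rw [map_zero, map_zero, map_zero, map_zero]
  | add y z _ _ hy hz => rw [map_add, map_add, map_add, map_add, hy, hz]
  | smul c y _ hy => rw [map_smul, map_smul, map_smul, map_smul, hy]

omit b in
lemma fst_apply_of_neg (A : PreAlgebroid V) {d : Fin n → ℤ} {v : Fin n → V.Sec}
    (hv : ∀ i, v i ∈ V.gr (d i)) (hd : ∀ i, d i < 0) : (A.a n v).1 = 0 := by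
  by_cases hn : n = 2
  · subst hn
    refine (A.degree 2 d v hv).1 ?_
    rw [Fin.sum_univ_two]
    have := hd 0
    have := hd 1
    omega
  · exact A.fun_val n v hn

lemma eq_at (hx : x ∈ U)
    (h : ∀ α f, (A.br (b.vec α) (V.ofFun f)).1 x = (A'.br (b.vec α) (V.ofFun f)).1 x)
    (h' : ∀ n (α : Fin n → Idx r) j, (A.a n fun i => b.vec (α i)).2 j x =
      (A'.a n fun i => b.vec (α i)).2 j x) (n : ℕ) (v : Fin n → V.Sec) : V.ev x (A.a n v) =
    V.ev x (A'.a n v) := by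
  have h1 : ∀ n (α : Fin n → Idx r), V.ev x (A.a n fun i => b.vec (α i)) =
      V.ev x (A'.a n fun i => b.vec (α i)) := fun n α => by
    refine Prod.ext ?_ (funext fun j => h' n α j)
    have hd : ∀ i, -(((α i).1 : ℤ) + 1) < 0 := fun i => by omega
    have e1 := A.fst_apply_of_neg (v := fun i => b.vec (α i))
      (fun i => V.ofSect_mem (α i).1 (b.e (α i))) hd
    have e2 := A'.fst_apply_of_neg (v := fun i => b.vec (α i))
      (fun i => V.ofSect_mem (α i).1 (b.e (α i))) hd
    change (A.a n fun i => b.vec (α i)).1 x = (A'.a n fun i => b.vec (α i)).1 x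
    rw [e1, e2]
  have hvec : ∀ Y Z : V.Sec, (![Y, Z] : Fin 2 → V.Sec) = ![Y, Z] := fun _ _ => rfl
  by_cases hn : n = 2
  · subst hn
    have hv : v = ![v 0, v 1] := by
      funext i
      fin_cases i <;> rfl
    rw [hv]
    refine br_eq_at b hx h (fun α β => ?_) (v 0) (v 1)
    have := h1 2 ![α, β]
    have hα : (fun i => b.vec ((![α, β] : Fin 2 → Idx r) i)) = ![b.vec α, b.vec β] := by
      funext i
      fin_cases i <;> rfl
    rw [hα] at this
    exact this
  · have h2 : (V.ev x).compMultilinearMap (A.a n) - (V.ev x).compMultilinearMap (A'.a n) = 0 := by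
      refine multilinear_eq_zero_of_span (span_spanningSet b hx) fun v hv => ?_
      change V.ev x (A.a n v) - V.ev x (A'.a n v) = 0
      by_cases hf : ∃ i f, v i = V.ofFun f
      · obtain ⟨i, f, hi⟩ := hf
        have hi' : v i ∈ V.gr 0 := hi ▸ V.ofFun_mem f
        rw [A.fun_arg n v i hn hi', A'.fun_arg n v i hn hi', sub_self]
      · by_cases hz : ∃ (i : Fin n) (g : 𝒞) (z : V.Sec), g x = 0 ∧
            v i = V.mulFun g z
        · obtain ⟨i, g, z, hg, hi⟩ := hz
          have e : ∀ B : PreAlgebroid V, V.ev x (B.a n v) = 0 := fun B => by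
            have h3 := B.linear n (update v i z) i g hn
            rw [update_self, Function.update_idem, ← hi, Function.update_eq_self] at h3
            rw [h3, ev_mulFun, hg, zero_smul]
          rw [e, e, sub_self]
        · push Not at hf hz
          have h3 : ∀ i, ∃ α, v i = b.vec α := fun i => by
            rcases hv i with ⟨f, hi⟩ | hi | ⟨g, z, hg, hi⟩
            · exact absurd hi (hf i f)
            · exact hi
            · exact absurd hi (hz i g z hg)
          choose α hα using h3
          obtain rfl : v = fun i => b.vec (α i) := funext hα
          rw [h1, sub_self]
    have := DFunLike.congr_fun h2 v
    exact sub_eq_zero.1 this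

end PreAlgebroid

lemma Partials.eq_of_sum_F_mul_eq {R A κ : Type*} [CommRing R] [Algebra ℝ R] [Ring A] [Algebra ℝ A]
    [DecidableEq κ] [Fintype κ] (P : Partials R A κ) {c c' : κ → R}
    (h : ∑ a, P.F (c a) * P.q a = ∑ a, P.F (c' a) * P.q a) : c = c' := by
  have h1 : ∀ (c : κ → R) b, P.J b (∑ a, P.F (c a) * P.q a) = P.F (c b) := fun c b => by
    rw [map_sum, sum_eq_single b]
    · rw [P.F_mul, P.J_q, P.J_F, if_pos rfl, mul_zero, smul_zero, add_zero]
    · intro a _ hab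
      rw [P.F_mul, P.J_q, P.J_F, if_neg (Ne.symm hab), mul_zero, smul_zero, add_zero]
    · exact fun h => absurd (mem_univ b) h
  funext b
  exact P.F_injective (by rw [← h1, h, h1])

lemma derivation_eq_of_eqOn {δ : 𝒞 →ₗ[ℝ] 𝒞} (hδ : ∀ f g, δ (f * g) = f * δ g + δ f * g) {f g : 𝒞}
    (h : ∀ y ∈ W, f y = g y) (hx : x ∈ W) : δ f x = δ g x := by
  obtain ⟨χ, hχ, W', -, hxW, hW⟩ := exists_bump (m := m) W hx
  have h1 : χ * (f - g) = 0 := by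
    ext y
    change χ y * (f y - g y) = 0
    by_cases hy : y ∈ W
    · rw [h y hy, sub_self, mul_zero]
    · rw [image_eq_zero_of_notMem_tsupport fun h => hy (hχ h), zero_mul]
  have h2 := DFunLike.congr_fun (hδ χ (f - g)) x
  rw [h1, map_zero] at h2
  change (0 : ℝ) = χ x * δ (f - g) x + δ χ x * (f x - g x) at h2
  rw [hW x hxW, h x hx, sub_self, mul_zero, add_zero, one_mul, map_sub] at h2
  exact (sub_eq_zero.1 h2.symm)

lemma exists_local_derivation (δ : 𝒞 →ₗ[ℝ] 𝒞) (hδ : ∀ f g, δ (f * g) = f * δ g + δ f * g)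
    (U : Opens M) : ∃ δ' : Smooth m U →ₗ[ℝ] Smooth m U, (∀ f g, δ' (f * g) = f * δ' g + δ' f * g) ∧
    ∀ f, δ' (globRes U f) = globRes U (δ f) := by
  have hex : ∀ (f : Smooth m U) (x : U), ∃ F : 𝒞, ∃ W : Opens M, (x : M) ∈ W ∧
      ∀ (y : M) (hy : y ∈ U), y ∈ W → F y = f ⟨y, hy⟩ := fun f x => by
    obtain ⟨F, W, hW, hxW, h⟩ := exists_global f x.2
    exact ⟨F, W, hxW, fun y hy hyW => (DFunLike.congr_fun h ⟨y, hyW⟩).symm⟩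
  choose F W hxW hF using hex
  have key : ∀ (f : Smooth m U) (x : U) (G : 𝒞) (W' : Opens M), (x : M) ∈ W' →
      (∀ (y : M) (hy : y ∈ U), y ∈ W' → G y = f ⟨y, hy⟩) → δ (F f x) x = δ G x := by
    intro f x G W' hx hG
    refine derivation_eq_of_eqOn hδ (W := U ⊓ W f x ⊓ W') (fun y hy => ?_) ⟨⟨x.2, hxW f x⟩, hx⟩
    rw [hF f x y hy.1.1 hy.1.2, hG y hy.1.1 hy.2]
  have hsm : ∀ f : Smooth m U, ContMDiff (𝓡 m) 𝓘(ℝ, ℝ) ∞ fun x : U => δ (F f x) x := by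
    intro f
    refine contMDiff_of_locally fun x hx => ⟨W f ⟨x, hx⟩, hxW f _,
      globRes _ (δ (F f ⟨x, hx⟩)), fun y hy hy' => ?_⟩
    exact key f ⟨y, hy'⟩ _ _ hy (hF f ⟨x, hx⟩)
  refine ⟨⟨⟨fun f => ⟨_, hsm f⟩, fun f g => Smooth.ext fun x => ?_⟩, fun c f =>
    Smooth.ext fun x => ?_⟩, fun f g => Smooth.ext fun x => ?_, fun f => Smooth.ext fun x => ?_⟩
  · change δ (F (f + g) x) x = δ (F f x) x + δ (F g x) x
    rw [key (f + g) x (F f x + F g x) (W f x ⊓ W g x) ⟨hxW f x, hxW g x⟩, map_add]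
    · rfl
    · intro y hy hyW
      change F f x y + F g x y = f ⟨y, hy⟩ + g ⟨y, hy⟩
      rw [hF f x y hy hyW.1, hF g x y hy hyW.2]
  · change δ (F (c • f) x) x = c * δ (F f x) x
    rw [key (c • f) x (c • F f x) (W f x) (hxW f x), map_smul]
    · rfl
    · intro y hy hyW
      change c * F f x y = c * f ⟨y, hy⟩
      rw [hF f x y hy hyW]
  · change δ (F (f * g) x) x = f x * δ (F g x) x + δ (F f x) x * g x
    rw [key (f * g) x (F f x * F g x) (W f x ⊓ W g x) ⟨hxW f x, hxW g x⟩, hδ]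
    · change F f x x * _ + _ * F g x x = _
      rw [hF f x x x.2 (hxW f x), hF g x x x.2 (hxW g x)]
    · intro y hy hyW
      change F f x y * F g x y = f ⟨y, hy⟩ * g ⟨y, hy⟩
      rw [hF f x y hy hyW.1, hF g x y hy hyW.2]
  · exact key (globRes U f) x f ⊤ trivial fun y hy _ => rfl

lemma NManifold.IsRightDer.res_fn_eq (h : U ≤ W) {R : N.O W →ₗ[ℝ] N.O W} (hR : IsRightDer W d R)
    {f g : Smooth m W} (hfg : Smooth.res h f = Smooth.res h g) : N.res h (R (N.fn W f)) =
    N.res h (R (N.fn W g)) := by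
  refine ext_locally fun x hx => ?_
  obtain ⟨χ, hχ, W', hW', hxW, hW1⟩ := exists_bump (m := m) U hx
  refine ⟨W', hW', hxW, ?_⟩
  rw [N.res_res, N.res_res, ← sub_eq_zero, ← map_sub, ← map_sub, ← map_sub]
  have h1 : globRes W χ * (f - g) = 0 := Smooth.ext fun y => by
    change χ y * (f y - g y) = 0
    by_cases hy : (y : M) ∈ U
    · have := DFunLike.congr_fun hfg ⟨y, hy⟩
      change f y = g y at this
      rw [this, sub_self, mul_zero]
    · rw [image_eq_zero_of_notMem_tsupport fun h => hy (hχ h), zero_mul]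
  have h2 := congrArg (N.res (hW'.trans h)) (hR.rule (N.fn W (globRes W χ)) (N.fn W (f - g)))
  have h3 : Smooth.res (hW'.trans h) (globRes W χ) = 1 := Smooth.ext fun y => hW1 y y.2
  have h4 : Smooth.res (hW'.trans h) (f - g) = 0 := Smooth.ext fun y => by
    have := DFunLike.congr_fun hfg ⟨y, hW' y.2⟩
    change f _ - g _ = 0
    exact sub_eq_zero.2 this
  rw [← map_mul, h1, map_zero, map_zero, map_zero, map_add, map_mul, map_mul, res_twist, res_fn,
    res_fn, h3, h4, map_zero, map_zero, mul_zero, add_zero, _root_.map_one, one_mul] at h2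
  exact h2.symm

lemma NManifold.IsRightDer.res_eq_of_global (h : U ≤ W) {q : Idx r → N.O W}
    (hq : N.IsCoordinates W q) {R : N.O W →ₗ[ℝ] N.O W} {R' : N.O U →ₗ[ℝ] N.O U}
    (hR : IsRightDer W d R) (hR' : IsRightDer U d R')
    (hfn : ∀ f, N.res h (R (N.fn W (globRes W f))) = R' (N.fn U (globRes U f)))
    (hc : ∀ α, N.res h (R (q α)) = R' (N.res h (q α))) (f : N.O W) : N.res h (R f) =
    R' (N.res h f) := by
  refine hR.res_eq h hq hR' (fun f => ext_locally fun x hx => ?_) hc f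
  obtain ⟨F, W', hW', hxW, hF⟩ := exists_global (Smooth.res h f) hx
  refine ⟨W', hW', hxW, ?_⟩
  have h1 := hR.res_fn_eq (hW'.trans h) (f := f) (g := globRes W F) hF
  have h2 := hR'.res_fn_eq hW' (f := Smooth.res h f) (g := globRes U F) hF
  rw [N.res_res, h1, h2, ← hfn, N.res_res]

namespace PreAlgebroid

variable (A : PreAlgebroid V)

lemma br_fun_mul (X : V.Sec) (f g : 𝒞) : (A.br X (V.ofFun (f * g))).1 =
    f * (A.br X (V.ofFun g)).1 + (A.br X (V.ofFun f)).1 * g := by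
  rw [← mulFun_ofFun, br_mulFun, add_comm]
  rfl

lemma apply_vec_eq_zero (b : Frame V U) (hn : n ∉ Finset.Icc 1 (p + 1)) (α : Fin n → Idx r) :
    A.a n (fun i => b.vec (α i)) = 0 := by
  have h1 := A.degree n _ _ fun i => b.vec_mem (α i)
  have h2 : ∑ i : Fin n, (-(idxDeg (α i) : ℤ)) ≤ ∑ i : Fin n, (-1 : ℤ) :=
    sum_le_sum fun i _ => by
      rw [idxDeg]
      push_cast
      omega
  rw [sum_const, card_univ, Fintype.card_fin, nsmul_eq_mul] at h2
  rw [Finset.mem_Icc] at hn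
  have h3 : n = 0 ∨ p + 1 < n := by omega
  rcases mem_gr_cases h1 with h | ⟨h, -⟩ | ⟨j, -, h, -⟩
  · exact h
  · rcases h3 with rfl | h3
    · simp at h
    · omega
  · have := j.2
    rcases h3 with rfl | h3
    · simp at h
      omega
    · omega

/-- The coefficients of the brackets in a frame. -/
def coeff (b : Frame V U) (β : Idx r) (n : ℕ) (α : Fin n → Idx r) : Smooth m U :=
  V.pair (b.θ β) ((A.a n fun i => b.vec (α i)).2 β.1)

lemma isSymm_coeff (ι : Identification σ V) (b : Frame V U) (β : Idx r) (n : ℕ) :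
    (ι.partials b).IsSymm (A.coeff b β n) := by
  intro α i j hij
  have h := A.symm n _ _ (fun i => b.vec_mem (α i)) i j hij
  have h1 : (fun k => b.vec (α k)) ∘ Equiv.swap i j = fun k => b.vec ((α ∘ Equiv.swap i j) k) := rfl
  rw [negOnePow_smul, h1, neg_mul_neg, ← Nat.cast_mul, zpow_natCast] at h
  rw [coeff, h]
  exact pair_smul _ _ _

lemma eq_of_coeff {A A' : PreAlgebroid V} (b : Frame V U) {α : Fin n → Idx r}
    (h : ∀ β, A.coeff b β n α = A'.coeff b β n α) (hx : x ∈ U) (j : Fin p) :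
    (A.a n fun i => b.vec (α i)).2 j x = (A'.a n fun i => b.vec (α i)).2 j x := by
  rw [← b.sum_smul j ⟨x, hx⟩ ((A.a n fun i => b.vec (α i)).2 j x),
    ← b.sum_smul j ⟨x, hx⟩ ((A'.a n fun i => b.vec (α i)).2 j x)]
  refine sum_congr rfl fun i _ => ?_
  congr 1
  exact DFunLike.congr_fun (h ⟨j, i⟩) ⟨x, hx⟩

lemma eq_of_a {A A' : PreAlgebroid V} (h : ∀ n v, A.a n v = A'.a n v) : A = A' := by
  have : A.a = A'.a := funext fun n => MultilinearMap.ext (h n)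
  cases A
  cases A'
  cases this
  rfl

end PreAlgebroid

namespace Identification

variable (ι) (A : PreAlgebroid V)

lemma res_form (h : U ≤ W) (b : Frame V W) (n : ℕ) (C : (Fin n → Idx r) → Smooth m W) :
    N.res h ((ι.partials b).form n C) =
    (ι.partials (b.res h)).form n fun α => Smooth.res h (C α) := by
  rw [Partials.form, Partials.form, map_sum]
  refine sum_congr rfl fun α _ => ?_
  rw [map_mul]
  change N.res h (N.fn W _) * N.res h (ofFn fun i => ι.frameCoord b (α i)).prod =
    N.fn U _ * (ofFn fun i => ι.frameCoord (b.res h) (α i)).prod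
  rw [res_fn, map_list_prod, List.map_ofFn]
  congr 3
  funext i
  exact ι.res_frameCoord h b (α i)

/-- The value on a coordinate of the derivation with given brackets. -/
def model (b : Frame V U) (β : Idx r) : N.O U :=
  ∑ n ∈ Finset.Icc 1 (p + 1), ((-1 : ℝ) ^ n * (-1 : ℝ) ^ (idxDeg β + 1) / n.factorial) •
    (ι.partials b).form n (A.coeff b β n)

/-- The value on a function of the derivation with given brackets. -/
def modelFn (b : Frame V U) (f : 𝒞) : N.O U :=
  ∑ a, N.fn U (globRes U (A.br (b.vec a) (V.ofFun f)).1) * ι.frameCoord b a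

lemma res_model (h : U ≤ W) (b : Frame V W) (β : Idx r) : N.res h (ι.model A b β) =
    ι.model A (b.res h) β := by
  rw [model, model, map_sum]
  refine sum_congr rfl fun n _ => ?_
  rw [map_smul, res_form]
  rfl

lemma res_modelFn (h : U ≤ W) (b : Frame V W) (f : 𝒞) : N.res h (ι.modelFn A b f) =
    ι.modelFn A (b.res h) f := by
  rw [modelFn, modelFn, map_sum]
  refine sum_congr rfl fun a _ => ?_
  rw [map_mul, res_fn, res_frameCoord]
  rfl

/-- The right derivation `R` is given by the brackets `A` in the frame `b`. -/
structure IsModel {U : Opens M} (b : Frame V U) (R : N.O U →ₗ[ℝ] N.O U) : Prop where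
  der : IsRightDer U 1 R
  fn : ∀ f, R (N.fn U (globRes U f)) = ι.modelFn A b f
  coord : ∀ β, R (ι.frameCoord b β) = ι.model A b β

variable {ι A}

lemma IsModel.res_eq (h : U ≤ W) {b : Frame V W} {R : N.O W →ₗ[ℝ] N.O W} (hR : ι.IsModel A b R)
    {R' : N.O U →ₗ[ℝ] N.O U} (hR' : ι.IsModel A (b.res h) R') (f : N.O W) : N.res h (R f) =
    R' (N.res h f) :=
  hR.der.res_eq_of_global h (ι.isCoordinates b) hR'.der
    (fun f => by rw [hR.fn, hR'.fn, res_modelFn])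
    (fun β => by rw [hR.coord, ι.res_frameCoord, hR'.coord, res_model]) f

variable (ι A)

lemma exists_isModel (b : Frame V U) : ∃ R, ι.IsModel A b R := by
  have h1 : ∀ a : Idx r, ∃ δ : Smooth m U →ₗ[ℝ] Smooth m U,
      (∀ f g, δ (f * g) = f * δ g + δ f * g) ∧
      (∀ f, δ (globRes U f) = globRes U (A.br (b.vec a) (V.ofFun f)).1) ∧
      (idxDeg a ≠ 1 → δ = 0) := fun a => by
    by_cases ha : idxDeg a = 1
    · obtain ⟨δ, hδ, hδ'⟩ := exists_local_derivation
        (⟨⟨fun f => (A.br (b.vec a) (V.ofFun f)).1, fun f g => by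
            change (A.br (b.vec a) (V.ofFun (f + g))).1 = _
            have : V.ofFun (f + g) = V.ofFun f + V.ofFun g := Prod.ext rfl (add_zero 0).symm
            rw [this, map_add]
            rfl⟩, fun c f => by
            change (A.br (b.vec a) (V.ofFun (c • f))).1 = _
            have : V.ofFun (c • f) = c • V.ofFun f := Prod.ext rfl (smul_zero c).symm
            rw [this, map_smul]
            rfl⟩ : 𝒞 →ₗ[ℝ] 𝒞) (A.br_fun_mul (b.vec a)) U
      exact ⟨δ, hδ, hδ', fun h => absurd ha h⟩
    · refine ⟨0, fun f g => by simp, fun f => ?_, fun _ => rfl⟩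
      have := A.bracket_fun _ _ f (b.vec_mem a) (by omega)
      rw [PreAlgebroid.br_apply, this]
      rfl
  choose δ hδ hδ' hδ0 using h1
  have hsum : ∀ f, ∑ a, N.fn U (δ a f) * ι.frameCoord b a ∈ N.grInt U 1 := fun f => by
    refine Submodule.sum_mem _ fun a _ => ?_
    by_cases ha : idxDeg a = 1
    · have h2 := ι.frameCoord_mem b a
      rw [ha] at h2
      have h3 := fn_mul_mem (δ a f) h2
      rw [← grInt_natCast] at h3
      exact h3
    · rw [hδ0 a ha, LinearMap.zero_apply, map_zero, zero_mul]
      exact zero_mem _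
  have hword : ∀ n (α : Fin n → Idx r), (ofFn fun i => ι.frameCoord b (α i)).prod ∈
      N.gr U (∑ i, idxDeg (α i)) := fun n => by
    induction n with
    | zero => intro α; exact SetLike.one_mem_graded (N.gr U)
    | succ n ih =>
      intro α
      rw [ofFn_succ, List.prod_cons, Fin.sum_univ_succ]
      exact gr_mul_mem (ι.frameCoord_mem b _) (ih fun i => α i.succ)
  have hcoord : ∀ β, ι.model A b β ∈ N.grInt U (idxDeg β + 1) := fun β => by
    refine Submodule.sum_mem _ fun n _ => smul_mem _ _ (Submodule.sum_mem _ fun α _ => ?_)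
    by_cases h : ∑ i, idxDeg (α i) = idxDeg β + 1
    · have h2 := fn_mul_mem (A.coeff b β n α) (hword n α)
      rw [h, ← grInt_natCast, Nat.cast_succ] at h2
      exact h2
    · have h2 := (A.degree n _ _ fun i => b.vec_mem (α i)).2 β.1 fun h' => h ?_
      · have h3 : A.coeff b β n α = 0 := by
          rw [PreAlgebroid.coeff, h2]
          exact pair_zero _
        rw [h3, map_zero, zero_mul]
        exact zero_mem _
      · rw [Finset.sum_neg_distrib, ← Nat.cast_sum] at h'
        have h3 : idxDeg β = (β.1 : ℕ) + 1 := rfl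
        omega
  obtain ⟨R, hR, hfn, hc⟩ := exists_isRightDer (ι.isCoordinates b) 1
    (⟨⟨fun f => ∑ a, N.fn U (δ a f) * ι.frameCoord b a, fun f g => by
        simp only [map_add, add_mul, sum_add_distrib]⟩, fun c f => by
        simp only [map_smul, smul_mul_assoc, smul_sum]; rfl⟩ : Smooth m U →ₗ[ℝ] N.O U)
    (fun f g => by
      change ∑ a, _ = N.fn U f * ∑ a, _ + (∑ a, _) * N.fn U g
      rw [mul_sum, sum_mul, ← sum_add_distrib]
      refine sum_congr rfl fun a _ => ?_
      rw [hδ, map_add, map_mul, map_mul, add_mul, mul_assoc, mul_assoc, mul_assoc, fn_mul_comm g])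
    hsum (ι.model A b) hcoord
  refine ⟨R, hR, fun f => ?_, hc⟩
  rw [hfn]
  change ∑ a, N.fn U (δ a (globRes U f)) * _ = _
  simp only [hδ']
  rfl

variable {ι A}

lemma IsModel.ev_bracket {D : N.Ops} (hD : ∀ U, IsRightDer U 1 (D.app U)) {b : Frame V U}
    (h : ι.IsModel A b (D.app U)) (hx : x ∈ U) (n : ℕ) (v : Fin n → V.Sec) :
    V.ev x (ι.voronov.bracket D n v) = V.ev x (A.a n v) := by
  refine PreAlgebroid.eq_at (A := ι.derived hD) (A' := A) b hx (fun a f => ?_)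
    (fun n α j => ?_) n v
  · have h1 := (ι.derivation_fn b hD f).symm.trans (h.fn f)
    have h2 := congrFun ((ι.partials b).eq_of_sum_F_mul_eq h1) a
    exact DFunLike.congr_fun h2 ⟨x, hx⟩
  · by_cases hn : n ∈ Finset.Icc 1 (p + 1)
    · refine PreAlgebroid.eq_of_coeff b (fun β => ?_) hx j
      have h1 := (ι.derivation_frameCoord b hD β).symm.trans (h.coord β)
      have h2 := Partials.eq_of_sum_form_eq (P := ι.partials b)
        (C := (ι.derived hD).coeff b β) (C' := A.coeff b β) (fun n _ => ?_)
        (fun n _ => (ι.derived hD).isSymm_coeff ι b β n) (fun n _ => A.isSymm_coeff ι b β n) h1 hn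
      · exact congrFun h2 α
      · exact div_ne_zero (mul_ne_zero (pow_ne_zero _ (by norm_num)) (pow_ne_zero _ (by norm_num)))
          (Nat.cast_ne_zero.2 n.factorial_ne_zero)
    · rw [(ι.derived hD).apply_vec_eq_zero b hn, A.apply_vec_eq_zero b hn]

lemma isModel_of_ev {D : N.Ops} (hD : ∀ U, IsRightDer U 1 (D.app U)) (b : Frame V U)
    (h : ∀ x ∈ U, ∀ n (v : Fin n → V.Sec), V.ev x (ι.voronov.bracket D n v) = V.ev x (A.a n v)) :
    ι.IsModel A b (D.app U) := by
  refine ⟨hD U, fun f => ?_, fun β => ?_⟩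
  · rw [ι.derivation_fn b hD]
    refine sum_congr rfl fun a _ => ?_
    congr 2
    exact Smooth.ext fun x => congrArg Prod.fst (h x x.2 2 ![b.vec a, V.ofFun f])
  · rw [ι.derivation_frameCoord b hD]
    refine sum_congr rfl fun n _ => ?_
    congr 2
    funext α
    refine Smooth.ext fun x => ?_
    have := congrFun (congrArg Prod.snd (h x x.2 n fun i => b.vec (α i))) β.1
    exact congrArg ((b.θ β).1 x) this

end Identification

lemma NManifold.exists_cutoff_operator (χ : 𝒞) (hχ : tsupport χ ⊆ W) (d : ℤ)
    (R : ∀ U, U ≤ W → (N.O U →ₗ[ℝ] N.O U)) (hR : ∀ U hU, IsRightDer U d (R U hU))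
    (hc : ∀ U U' (h : U ≤ U') (hU' : U' ≤ W) f, N.res h (R U' hU' f) =
      R U (h.trans hU') (N.res h f)) : ∃ T : N.Ops, (∀ U, IsRightDer U d (T.app U)) ∧ ∀ U hU f,
    T.app U f = N.fn U (globRes U χ) * R U hU f := by
  classical
  let K : Opens M := ⟨(tsupport χ)ᶜ, (isClosed_tsupport χ).isOpen_compl⟩
  have hK : ∀ {U : Opens M}, U ≤ K → globRes (m := m) U χ = 0 := fun {U} hU =>
    Smooth.ext fun y => image_eq_zero_of_notMem_tsupport (f := χ) (hU y.2)
  let T : ∀ U, N.O U →ₗ[ℝ] N.O U := fun U => if h : U ≤ W then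
    (LinearMap.mulLeft ℝ (N.fn U (globRes U χ))).comp (R U h) else 0
  have hTW : ∀ U (hU : U ≤ W) f, T U f = N.fn U (globRes U χ) * R U hU f := fun U hU f => by
    simp only [T, dif_pos hU]
    rfl
  have hTK : ∀ U, U ≤ K → ∀ f, T U f = 0 := fun U hU f => by
    by_cases h : U ≤ W
    · rw [hTW U h, hK hU, map_zero, zero_mul]
    · simp only [T, dif_neg h]
      rfl
  have hder : ∀ U, (U ≤ W ∨ U ≤ K) → IsRightDer U d (T U) := by
    rintro U (hU | hU)
    · refine ⟨fun f g => ?_, fun n f hf => ?_⟩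
      · rw [hTW U hU, hTW U hU, hTW U hU, (hR U hU).rule, mul_add, ← mul_assoc, fn_mul_comm _ f,
          mul_assoc, mul_assoc]
      · have := grInt_mul_mem (fn_mem_grInt U (globRes U χ)) ((hR U hU).degree n f hf)
        rw [zero_add] at this
        rwa [hTW U hU]
    · refine ⟨fun f g => ?_, fun n f hf => ?_⟩
      · rw [hTK U hU, hTK U hU, hTK U hU, mul_zero, zero_mul, add_zero]
      · rw [hTK U hU]
        exact zero_mem _
  have hB : ∀ (U : Opens M), ∀ x ∈ U, ∃ U' ≤ U, x ∈ U' ∧ (U' ≤ W ∨ U' ≤ K) := fun U x hx => by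
    by_cases h : x ∈ W
    · exact ⟨U ⊓ W, inf_le_left, ⟨hx, h⟩, Or.inl inf_le_right⟩
    · exact ⟨U ⊓ K, inf_le_left, ⟨hx, fun h' => h (hχ h')⟩, Or.inr inf_le_right⟩
  obtain ⟨S, hS, hres, hdeg⟩ := exists_glue_operator (N := N) (N' := N)
    (B := fun U => U ≤ W ∨ U ≤ K) hB (fun U U' h => Or.imp h.trans h.trans) (fun U _ => T U) d
    (fun U U' h hU' f => by
      rcases hU' with hU' | hU'
      · rw [hTW U' hU', hTW U (h.trans hU'), map_mul, res_fn, hc U U' h hU', res_globRes]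
      · rw [hTK U' hU', hTK U (h.trans hU'), map_zero])
    fun U hU n f hf => (hder U hU).degree n f hf
  refine ⟨⟨S, hres⟩, fun U => ⟨fun f g => ?_, fun n f hf => hdeg U n f hf⟩, fun U hU f => ?_⟩
  · refine ext_locally fun x hx => ?_
    obtain ⟨U', hU', hxU, hBU⟩ := hB U x hx
    refine ⟨U', hU', hxU, ?_⟩
    change N.res hU' (S U (f * g)) = N.res hU' (f * S U g + S U f * _)
    rw [hres, map_mul (N.res hU'), hS U' hBU, (hder U' hBU).rule, map_add (N.res hU'),
      map_mul (N.res hU'), map_mul (N.res hU'), hres, hres, res_twist, hS U' hBU]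
  · change S U f = _
    rw [hS U (Or.inl hU), hTW U hU]

namespace Identification

variable {A : PreAlgebroid V}

lemma IsModel.res_eq_of_frames (h : U ≤ W) {b : Frame V W} {b' : Frame V U} {R : N.O W →ₗ[ℝ] N.O W}
    {R' : N.O U →ₗ[ℝ] N.O U} (hR : ι.IsModel A b R) (hR' : ι.IsModel A b' R') (f : N.O W) :
    N.res h (R f) = R' (N.res h f) := by
  choose S hS using fun (U' : Opens M) (hU' : U' ≤ W) => ι.exists_isModel A (b.res hU')
  have hSc : ∀ U₁ U₂ (h₁ : U₁ ≤ U₂) (h₂ : U₂ ≤ W) f,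
      N.res h₁ (S U₂ h₂ f) = S U₁ (h₁.trans h₂) (N.res h₁ f) := fun U₁ U₂ h₁ h₂ f =>
    (hS U₂ h₂).res_eq h₁ (hS U₁ _) f
  rw [hR.res_eq h (hS U h)]
  generalize N.res h f = g
  refine ext_locally fun x hx => ?_
  obtain ⟨χ, hχ, W', hW', hxW, hW1⟩ := exists_bump (m := m) W (h hx)
  have hUW : U ⊓ W' ≤ U := inf_le_left
  obtain ⟨T, hT, hTS⟩ := exists_cutoff_operator χ hχ 1 S (fun U' hU' => (hS U' hU').der) hSc
  have hTS' : ∀ U' (hU' : U' ≤ W'), T.app U' = S U' (hU'.trans hW') := fun U' hU' => by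
    refine LinearMap.ext fun f => ?_
    have : globRes (m := m) U' χ = 1 := Smooth.ext fun y => hW1 y (hU' y.2)
    rw [hTS U' (hU'.trans hW'), this, map_one, one_mul]
  have hm : ι.IsModel A (b.res hW') (T.app W') := hTS' W' le_rfl ▸ hS W' hW'
  have hm' : ι.IsModel A (b'.res hUW) (T.app (U ⊓ W')) :=
    isModel_of_ev hT _ fun y hy n v => hm.ev_bracket hT hy.2 n v
  refine ⟨U ⊓ W', hUW, ⟨hx, hxW⟩, ?_⟩
  rw [hSc _ _ hUW h, hR'.res_eq hUW hm', hTS' _ inf_le_right]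

variable (ι A)

lemma exists_derived_eq : ∃ (D : N.Ops) (hD : ∀ U, IsRightDer U 1 (D.app U)), ι.derived hD = A := by
  choose R hR using fun (U : Opens M) (b : Frame V U) => ι.exists_isModel A b
  obtain ⟨D, hD, hDR⟩ := exists_operator_of_frames (V := V) 1 R (fun U b => (hR U b).der)
    fun U W h b b' f => (hR W b).res_eq_of_frames h (hR U b') f
  refine ⟨D, hD, PreAlgebroid.eq_of_a fun n v => eq_of_ev fun x => ?_⟩
  obtain ⟨U, -, hx, ⟨b⟩⟩ := exists_frame V (U := ⊤) (x := x) trivial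
  have h : ι.IsModel A b (D.app U) := hDR U b ▸ hR U b
  exact h.ev_bracket hD hx n v

lemma derived_injective {D D' : N.Ops} (hD : ∀ U, IsRightDer U 1 (D.app U))
    (hD' : ∀ U, IsRightDer U 1 (D'.app U)) (h : ι.derived hD = ι.derived hD') : D = D' := by
  refine operator_ext fun U f => ext_locally fun x hx => ?_
  obtain ⟨W, hW, hxW, ⟨b⟩⟩ := exists_frame V hx
  refine ⟨W, hW, hxW, ?_⟩
  have h1 : ι.IsModel (ι.derived hD) b (D.app W) := isModel_of_ev hD b fun _ _ _ _ => rfl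
  have h2 : ι.IsModel (ι.derived hD) b (D'.app W) := isModel_of_ev hD' b fun _ _ _ _ => by
    rw [h]
    rfl
  rw [res_operator, res_operator]
  have := h1.res_eq_of_frames le_rfl h2 (N.res hW f)
  rwa [N.res_self, N.res_self] at this

lemma mul_self_eq_zero {D : N.Ops} (hD : ∀ U, IsRightDer U 1 (D.app U))
    (h : ∀ n (d : Fin n → ℤ) (x : Fin n → V.Sec), (∀ i, x i ∈ V.gr (d i)) →
      ι.symbol (ι.voronov.adList 2 (ofFn fun i => (x i, d i)) (D * D)) = 0) : D * D = 0 := by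
  have hDD : ∀ U, IsRightDer U 2 ((D * D).app U) := fun U => by
    have h1 := gradedComm_mem_firstOrder (derivation_mem hD) (derivation_mem hD)
    have h2 : gradedComm 1 1 D D = (2 : ℝ) • (D * D) := by
      simp [gradedComm, two_smul]
    rw [h2] at h1
    have h3 := smul_mem _ (2 : ℝ)⁻¹ h1
    rw [smul_smul, inv_mul_cancel₀ two_ne_zero, one_smul] at h3
    refine isRightDer_of_mem_firstOrder h3 ?_
    rw [operator_mul_apply, (hD U).map_one, map_zero]
  have hDD' : D * D ∈ N.firstOrder 2 := mem_firstOrder_of_isRightDer hDD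
  have hzero : ∀ U, IsRightDer U 2 (0 : N.O U →ₗ[ℝ] N.O U) := fun U =>
    ⟨fun f g => by simp, fun n f _ => zero_mem _⟩
  have hsum : ∀ {c : ℝ} {κ : Type} {s : Finset κ} {e : κ → ℤ} {U : Opens M} {f : Smooth m U},
      (∏ i ∈ s, -(-1 : ℝ) ^ e i) • f = 0 → f = 0 := fun {c κ s e U f} hf => by
    have h1 : ∏ i ∈ s, -(-1 : ℝ) ^ e i ≠ 0 := Finset.prod_ne_zero_iff.2 fun i _ =>
      neg_ne_zero.2 (zpow_ne_zero _ (by norm_num))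
    exact (smul_eq_zero.1 hf).resolve_left h1
  refine operator_ext fun U f => ext_locally fun x hx => ?_
  obtain ⟨W, hW, hxW, ⟨b⟩⟩ := exists_frame V hx
  refine ⟨W, hW, hxW, ?_⟩
  rw [res_operator]
  change (D * D).app W _ = N.res hW 0
  have hone : ∀ a : Idx r, (ι.contraction a.1 (b.e a)).app W 1 = 0 := fun a =>
    (ι.isRightDer_contraction a.1 (b.e a) W).map_one
  have h1 := (hDD W).res_eq_of_global (le_refl W) (ι.isCoordinates b) (hzero W) (fun g => ?_)
    (fun β => ?_) (N.res hW f)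
  · rw [map_zero, ← N.res_self W ((D * D).app W _), h1]
    rfl
  · rw [N.res_self]
    refine (ι.partials b).eq_zero_of_ε_iter fun n α => ?_
    have hg : (1 : N.O W) ∈ N.grInt W 0 := by
      have := fn_mem_grInt (N := N) W 1
      rwa [map_one] at this
    have h0 : gradedComm 2 0 (D * D) (ι.operator (V.ofFun g)) ∈ N.firstOrder (2 + 0) :=
      ι.voronov.comm_mem hDD' (ι.voronov.I_mem (V.ofFun_mem g))
    have h2 := ι.body_adList_apply b α h0 hg (fun c => by rw [hone, map_zero])
      fun c c' => by rw [hone, map_zero]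
    have h3 : ∀ T : N.Ops, T.app W 1 = 0 → (gradedComm 2 0 T (ι.operator (V.ofFun g))).app W 1 =
        T.app W (N.fn W (globRes W g)) := fun T hT => by
      rw [operator_ofFun, gradedComm, operator_sub_apply, operator_smul_apply, operator_mul_apply,
        operator_mul_apply, hT, map_zero, smul_zero, sub_zero, mulOp_apply, mul_one]
    have hv : ∀ i, (Fin.cons (V.ofFun g) (fun i => b.vec (α i)) : Fin (n + 1) → V.Sec) i ∈
        V.gr ((Fin.cons 0 fun i => -(idxDeg (α i) : ℤ) : Fin (n + 1) → ℤ) i) :=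
      Fin.cases (V.ofFun_mem g) fun i => b.vec_mem (α i)
    have h4 := h (n + 1) _ _ hv
    have h5 : (ofFn fun i => ((Fin.cons (V.ofFun g) (fun i => b.vec (α i)) :
        Fin (n + 1) → V.Sec) i, (Fin.cons 0 fun i => -(idxDeg (α i) : ℤ) : Fin (n + 1) → ℤ) i)) =
        (V.ofFun g, 0) :: ofFn fun i => (b.vec (α i), -(idxDeg (α i) : ℤ)) := by
      rw [ofFn_succ]
      rfl
    rw [h5, VoronovData.adList_cons] at h4
    have h6 := ι.globRes_symbol (ι.firstOrder_le_symbolic _ (ι.voronov.adList_mem h0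
      (l := ofFn fun i => (b.vec (α i), -(idxDeg (α i) : ℤ))) fun y hy => by
        obtain ⟨i, rfl⟩ := (mem_ofFn' _ _).1 hy
        exact b.vec_mem (α i))) W
    rw [h2, h3 _ (hDD W).map_one] at h6
    have h7 : ι.symbol (ι.voronov.adList (2 + 0) (ofFn fun i => (b.vec (α i),
      -(idxDeg (α i) : ℤ))) (gradedComm 2 0 (D * D) (ι.operator (V.ofFun g)))) = 0 := h4
    rw [h7] at h6
    exact hsum (c := 0) h6.symm
  · rw [N.res_self]
    refine (ι.partials b).eq_zero_of_ε_iter fun n α => ?_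
    have hg : ι.frameCoord b β ∈ N.grInt W (idxDeg β : ℤ) := by
      rw [grInt_natCast]
      exact ι.frameCoord_mem b β
    have h2 := ι.body_adList_apply b α hDD' hg (fun a => by
        rw [ι.contraction_frameCoord]
        split_ifs
        · exact (hDD W).map_one
        · exact map_zero _) fun a c => by
        rw [ι.contraction_frameCoord]
        split_ifs
        · exact hone c
        · exact map_zero _
    have h4 := h n _ _ fun i => b.vec_mem (α i)
    have h6 := ι.pair_symbol (ι.firstOrder_le_symbolic _ (ι.voronov.adList_mem hDD'
      (l := ofFn fun i => (b.vec (α i), -(idxDeg (α i) : ℤ))) fun y hy => by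
        obtain ⟨i, rfl⟩ := (mem_ofFn' _ _).1 hy
        exact b.vec_mem (α i))) (b.θ β)
    have h8 : N.body W ((ι.voronov.adList 2 (ofFn fun i => (b.vec (α i),
      -(idxDeg (α i) : ℤ))) (D * D)).app W (ι.coord β.1 W (b.θ β))) = _ := h2
    rw [h4, h8] at h6
    exact hsum (c := 0) (h6.symm.trans (pair_zero _))

end Identification

open MeasureTheory

lemma contDiff_integral_param {P : Type*} [NormedAddCommGroup P] [NormedSpace ℝ P] {h : P × ℝ → ℝ}
    (hh : ContDiff ℝ ∞ h) : ContDiff ℝ ∞ fun y => ∫ t in (0 : ℝ)..1, h (y, t) := by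
  let β : ContDiffBump (0 : ℝ) := ⟨2, 3, by norm_num, by norm_num⟩
  let f : ℝ → ℝ := (Set.Ioc (0 : ℝ) 1).indicator 1
  let g : P → ℝ → ℝ := fun y s => β s * h (y, -s)
  have hf : LocallyIntegrable f volume := by
    refine Integrable.locallyIntegrable ?_
    rw [integrable_indicator_iff measurableSet_Ioc]
    exact (integrableOn_const (by simp) (by simp))
  have hg : ContDiff ℝ ∞ ↿g := by
    have h1 : ContDiff ℝ ∞ fun q : P × ℝ => β q.2 := β.contDiff.comp contDiff_snd
    exact h1.mul (hh.comp (contDiff_fst.prodMk contDiff_snd.neg))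
  have key := contDiffOn_convolution_right_with_param (μ := volume) (n := ⊤) (s := Set.univ)
    (ContinuousLinearMap.lsmul ℝ ℝ) isOpen_univ (isCompact_closedBall (0 : ℝ) 3)
    (g := g) (fun y s _ hs => by
      have : β s = 0 := β.zero_of_le_dist (le_of_lt (by simpa using hs))
      simp [g, this]) hf hg.contDiffOn
  rw [Set.univ_prod_univ, contDiffOn_univ] at key
  have h2 := key.comp (contDiff_id.prodMk (contDiff_const (c := (0 : ℝ))))
  convert h2 using 1
  funext y
  simp only [Function.comp_apply, id, convolution, ContinuousLinearMap.lsmul_apply, zero_sub,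
    smul_eq_mul]
  rw [intervalIntegral.integral_of_le zero_le_one, ← integral_indicator measurableSet_Ioc]
  refine integral_congr_ae (Filter.Eventually.of_forall fun t => ?_)
  by_cases ht : t ∈ Set.Ioc (0 : ℝ) 1
  · have h1 : β (-t) = 1 := β.one_of_mem_closedBall (by
      rw [Metric.mem_closedBall, dist_zero_right, norm_neg, Real.norm_eq_abs, abs_of_pos ht.1]
      exact ht.2.trans one_le_two)
    simp [f, g, Set.indicator_of_mem ht, h1]
  · simp [f, Set.indicator_of_notMem ht]

lemma exists_eq_add_sum_mul {m : ℕ} {f : EuclideanSpace ℝ (Fin m) → ℝ} (hf : ContDiff ℝ ∞ f)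
    (c : EuclideanSpace ℝ (Fin m)) : ∃ G : Fin m → EuclideanSpace ℝ (Fin m) → ℝ,
    (∀ i, ContDiff ℝ ∞ (G i)) ∧ (∀ i, G i c = fderiv ℝ f c (EuclideanSpace.single i 1)) ∧ ∀ z, f z =
    f c + ∑ i, (z i - c i) * G i z := by
  have hdf : ContDiff ℝ ∞ (fderiv ℝ f) := hf.fderiv_right (by simp)
  refine ⟨fun i z => ∫ t in (0 : ℝ)..1, fderiv ℝ f (c + t • (z - c)) (EuclideanSpace.single i 1),
    fun i => ?_, fun i => ?_, fun z => ?_⟩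
  · refine contDiff_integral_param (h := fun q : EuclideanSpace ℝ (Fin m) × ℝ =>
      fderiv ℝ f (c + q.2 • (q.1 - c)) (EuclideanSpace.single i 1)) ?_
    exact (hdf.comp (contDiff_const.add (contDiff_snd.smul
      (contDiff_fst.sub contDiff_const)))).clm_apply contDiff_const
  · simp
  · have hline : ∀ t : ℝ, HasDerivAt (fun t : ℝ => f (c + t • (z - c)))
        (fderiv ℝ f (c + t • (z - c)) (z - c)) t := fun t => by
      have h2 : HasDerivAt (fun t : ℝ => c + t • (z - c)) (z - c) t := by
        simpa using ((hasDerivAt_id t).smul_const (z - c)).const_add c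
      exact ((hf.differentiable (by simp)).differentiableAt.hasFDerivAt).comp_hasDerivAt t h2
    have hcont : ∀ v, Continuous fun t : ℝ => fderiv ℝ f (c + t • (z - c)) v := fun v =>
      (hdf.continuous.comp (by fun_prop)).clm_apply continuous_const
    have h3 := intervalIntegral.integral_eq_sub_of_hasDerivAt (a := 0) (b := 1)
      (fun t _ => hline t) ((hcont _).intervalIntegrable _ _)
    simp only [one_smul, zero_smul, add_zero, add_sub_cancel] at h3
    rw [← sub_eq_iff_eq_add', ← h3]
    have h4 : z - c = ∑ i, (z i - c i) • EuclideanSpace.single i (1 : ℝ) := by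
      ext k
      simp [Finset.sum_apply, Pi.single_apply]
    simp only [← intervalIntegral.integral_const_mul]
    rw [← intervalIntegral.integral_finsetSum
      (f := fun i t => (z i - c i) * fderiv ℝ f (c + t • (z - c)) (EuclideanSpace.single i 1))
      fun i _ => (continuous_const.mul (hcont _)).intervalIntegrable _ _]
    congr 1
    funext t
    refine (congrArg _ h4).trans ?_
    simp [map_sum, map_smul]

lemma contMDiffMap_sum_apply {E H X κ : Type*} [NormedAddCommGroup E] [NormedSpace ℝ E]
    [TopologicalSpace H] {I : ModelWithCorners ℝ E H} [TopologicalSpace X] [ChartedSpace H X]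
    (s : Finset κ) (f : κ → C^∞⟮I, X; ℝ⟯) (x : X) : (∑ i ∈ s, f i) x = ∑ i ∈ s, f i x := by
  classical
  induction s using Finset.induction_on with
  | empty => rfl
  | insert a s ha ih =>
    rw [sum_insert ha, sum_insert ha, ← ih]
    rfl

lemma mfderiv_apply_eq (F : 𝒞) (x : M) (v : TangentSpace (𝓡 m) x) :
    (mfderiv (𝓡 m) 𝓘(ℝ, ℝ) F x v : ℝ) =
    fderiv ℝ (F ∘ (extChartAt (𝓡 m) x).symm) (extChartAt (𝓡 m) x x) v := by
  have h : MDifferentiableAt (𝓡 m) 𝓘(ℝ, ℝ) F x := F.contMDiff.mdifferentiableAt (by simp)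
  have h1 := congrArg (fun L => L v) h.mfderiv
  refine h1.trans ?_
  simp only [modelWithCornersSelf_coe, Set.range_id, fderivWithin_univ]
  rfl

lemma exists_chart_functions (x : M) : ∃ (c : Fin m → 𝒞) (W : Opens M), x ∈ W ∧ (W : Set M) ⊆
    (chartAt (EuclideanSpace ℝ (Fin m)) x).source ∧ ∀ y ∈ W, ∀ i, c i y =
    extChartAt (𝓡 m) x y i := by
  let U : Opens M := ⟨_, (chartAt (EuclideanSpace ℝ (Fin m)) x).open_source⟩
  have hx : x ∈ U := mem_chart_source _ x
  let f : Fin m → Smooth m U := fun i => ⟨fun y => extChartAt (𝓡 m) x y i, fun y => by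
    have h1 : ContMDiffAt (𝓡 m) 𝓘(ℝ, EuclideanSpace ℝ (Fin m)) ∞ (extChartAt (𝓡 m) x) y :=
      contMDiffAt_extChartAt' y.2
    have h2 : ContMDiff 𝓘(ℝ, EuclideanSpace ℝ (Fin m)) 𝓘(ℝ, ℝ) ∞
        fun z : EuclideanSpace ℝ (Fin m) => z i :=
      (contDiff_euclidean.1 contDiff_id i).contMDiff
    exact (h2.contMDiffAt.comp _ h1).comp y contMDiff_subtype_val.contMDiffAt⟩
  obtain ⟨W, hWU, hxW, hW⟩ := exists_common_open
    (P := fun i W => ∃ (hW : W ≤ U) (F : 𝒞), Smooth.res hW (f i) = globRes W F) hx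
    (fun i W W' h h' => by
      obtain ⟨hW, F, hF⟩ := h'
      exact ⟨h.trans hW, F, Smooth.ext fun y => DFunLike.congr_fun hF ⟨y, h y.2⟩⟩)
    fun i => by
      obtain ⟨F, W, hW, hxW, hF⟩ := exists_global (f i) hx
      exact ⟨W, hW, hxW, hW, F, hF⟩
  choose hW' c hc using hW
  exact ⟨c, W, hxW, hWU, fun y hy i => (DFunLike.congr_fun (hc i) ⟨y, hy⟩).symm⟩

lemma mfderiv_chart_function {c : Fin m → 𝒞} (hc : ∀ y ∈ W, ∀ i, c i y = extChartAt (𝓡 m) x y i)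
    (hW : (W : Set M) ⊆ (chartAt (EuclideanSpace ℝ (Fin m)) x).source) {y : M} (hy : y ∈ W)
    (v : TangentSpace (𝓡 m) y) (i : Fin m) : (mfderiv (𝓡 m) 𝓘(ℝ, ℝ) (c i) y v : ℝ) =
    (trivializationAt (EuclideanSpace ℝ (Fin m)) (TangentSpace (𝓡 m)) x
      (⟨y, v⟩ : TangentBundle (𝓡 m) M)).2 i := by
  rw [mfderiv_apply_eq, TangentBundle.trivializationAt_apply]
  simp only [modelWithCornersSelf_coe, Set.range_id, fderivWithin_univ]
  let L : EuclideanSpace ℝ (Fin m) →L[ℝ] ℝ := EuclideanSpace.proj i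
  have hcont : ContinuousAt (extChartAt (𝓡 m) y).symm (extChartAt (𝓡 m) y y) :=
    continuousAt_extChartAt_symm y
  have h1 : (c i ∘ (extChartAt (𝓡 m) y).symm) =ᶠ[nhds (extChartAt (𝓡 m) y y)]
      (L ∘ (extChartAt (𝓡 m) x ∘ (extChartAt (𝓡 m) y).symm)) := by
    have := hcont.preimage_mem_nhds (W.isOpen.mem_nhds (by rwa [extChartAt_to_inv]))
    filter_upwards [this] with z hz
    exact hc _ hz i
  have h2 : DifferentiableAt ℝ (extChartAt (𝓡 m) x ∘ (extChartAt (𝓡 m) y).symm)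
      (extChartAt (𝓡 m) y y) := by
    have h3 : ContMDiffAt (𝓡 m) 𝓘(ℝ, EuclideanSpace ℝ (Fin m)) ∞ (extChartAt (𝓡 m) x)
        ((extChartAt (𝓡 m) y).symm (extChartAt (𝓡 m) y y)) := by
      rw [extChartAt_to_inv]
      exact contMDiffAt_extChartAt' (hW hy)
    have h4 : ContMDiffAt 𝓘(ℝ, EuclideanSpace ℝ (Fin m)) (𝓡 m) ∞ (extChartAt (𝓡 m) y).symm
        (extChartAt (𝓡 m) y y) :=
      (contMDiffOn_extChartAt_symm y).contMDiffAt (extChartAt_target_mem_nhds y)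
    exact (h3.comp _ h4).contDiffAt.differentiableAt (by simp)
  rw [h1.fderiv_eq, (L.hasFDerivAt.comp _ h2.hasFDerivAt).fderiv]
  rfl

lemma tangent_ext {v w : TangentSpace (𝓡 m) x}
    (h : ∀ F : 𝒞, (mfderiv (𝓡 m) 𝓘(ℝ, ℝ) F x v : ℝ) = mfderiv (𝓡 m) 𝓘(ℝ, ℝ) F x w) : v = w := by
  obtain ⟨c, W, hx, hW, hc⟩ := exists_chart_functions (m := m) x
  let e := trivializationAt (EuclideanSpace ℝ (Fin m)) (TangentSpace (𝓡 m) (M := M)) x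
  have hs : ∀ v : TangentSpace (𝓡 m) x, (⟨x, v⟩ : TangentBundle (𝓡 m) M) ∈ e.source := fun v => by
    rw [e.mem_source]
    exact mem_baseSet_trivializationAt _ _ x
  have h1 : e (⟨x, v⟩ : TangentBundle (𝓡 m) M) = e (⟨x, w⟩ : TangentBundle (𝓡 m) M) := by
    refine Prod.ext ((e.coe_fst (hs v)).trans (e.coe_fst (hs w)).symm) (PiLp.ext fun i => ?_)
    exact (mfderiv_chart_function hc hW hx v i).symm.trans
      ((h (c i)).trans (mfderiv_chart_function hc hW hx w i))
  exact TotalSpace.mk_inj.1 (e.injOn (hs v) (hs w) h1)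

lemma contMDiff_vectorField {v : ∀ x : M, TangentSpace (𝓡 m) x}
    (h : ∀ F : 𝒞, ContMDiff (𝓡 m) 𝓘(ℝ, ℝ) ∞ fun x => (mfderiv (𝓡 m) 𝓘(ℝ, ℝ) F x (v x) : ℝ)) :
    ContMDiff (𝓡 m) (𝓡 m).tangent ∞ fun x => (⟨x, v x⟩ : TangentBundle (𝓡 m) M) := by
  intro x
  obtain ⟨c, W, hx, hW, hc⟩ := exists_chart_functions (m := m) x
  refine (contMDiffAt_section x).2 ?_
  have h1 : ContMDiffAt (𝓡 m) 𝓘(ℝ, Fin m → ℝ) ∞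
      (fun y => fun i => (mfderiv (𝓡 m) 𝓘(ℝ, ℝ) (c i) y (v y) : ℝ)) x :=
    contMDiffAt_pi_space.2 fun i => h (c i) x
  have h2 := ((EuclideanSpace.equiv (Fin m) ℝ).symm.contDiff.contMDiff (n := ∞)).contMDiffAt.comp x h1
  refine h2.congr_of_eventuallyEq ?_
  filter_upwards [W.isOpen.mem_nhds hx] with y hy
  ext i
  exact (mfderiv_chart_function hc hW hy (v y) i).symm

lemma exists_tangent_of_derivation {δ : 𝒞 →ₗ[ℝ] 𝒞} (hδ : ∀ f g, δ (f * g) = f * δ g + δ f * g)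
    (x : M) : ∃ v : TangentSpace (𝓡 m) x, ∀ F : 𝒞, (mfderiv (𝓡 m) 𝓘(ℝ, ℝ) F x v : ℝ) = δ F x := by
  obtain ⟨c, W, hx, hW, hc⟩ := exists_chart_functions (m := m) x
  have h1 : δ 1 = 0 := by
    have := hδ 1 1
    simpa using this
  refine ⟨(∑ i, δ (c i) x • EuclideanSpace.single i (1 : ℝ) : EuclideanSpace ℝ (Fin m)),
    fun F => (mfderiv_apply_eq F x _).trans ?_⟩
  set φ := extChartAt (𝓡 m) x with hφ
  obtain ⟨ε, hε, hball⟩ := Metric.mem_nhds_iff.1 (extChartAt_target_mem_nhds (I := 𝓡 m) x)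
  let β : ContDiffBump (φ x) := ⟨ε / 4, ε / 2, by positivity, by linarith⟩
  have hβ : tsupport β ⊆ φ.target := by
    rw [β.tsupport_eq]
    exact (Metric.closedBall_subset_ball (by change ε / 2 < ε; linarith)).trans hball
  have hf : ContDiff ℝ ∞ fun z => β z * F (φ.symm z) := by
    rw [contDiff_iff_contDiffAt]
    intro z
    by_cases hz : z ∈ tsupport β
    · have h2 : ContMDiffAt 𝓘(ℝ, EuclideanSpace ℝ (Fin m)) (𝓡 m) ∞ φ.symm z :=
        (contMDiffOn_extChartAt_symm x).contMDiffAt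
          ((isOpen_extChartAt_target (I := 𝓡 m) x).mem_nhds (hβ hz))
      exact β.contDiff.contDiffAt.mul (F.contMDiff.contMDiffAt.comp z h2).contDiffAt
    · refine (contDiffAt_const (c := (0 : ℝ))).congr_of_eventuallyEq ?_
      filter_upwards [(isClosed_tsupport β).isOpen_compl.mem_nhds hz] with y hy
      rw [image_eq_zero_of_notMem_tsupport hy, zero_mul]
  obtain ⟨G, hG, hGc, hGz⟩ := exists_eq_add_sum_mul hf (φ x)
  have hβ1 : ∀ᶠ z in nhds (φ x), β z = 1 := β.eventuallyEq_one
  have hev : (fun z => β z * F (φ.symm z)) =ᶠ[nhds (φ x)] (F ∘ φ.symm) := by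
    filter_upwards [hβ1] with z hz
    rw [hz, one_mul]
    rfl
  rw [hev.fderiv_eq] at hGc
  let U : Opens M := ⟨_, (chartAt (EuclideanSpace ℝ (Fin m)) x).open_source⟩
  have hxU : x ∈ U := mem_chart_source _ x
  let g : Fin m → Smooth m U := fun i => ⟨fun y => G i (φ y), fun y => by
    have h1 : ContMDiffAt (𝓡 m) 𝓘(ℝ, EuclideanSpace ℝ (Fin m)) ∞ φ y :=
      contMDiffAt_extChartAt' y.2
    exact ((hG i).contMDiff.contMDiffAt.comp _ h1).comp y contMDiff_subtype_val.contMDiffAt⟩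
  have hex : ∀ i, ∃ H : 𝒞, ∀ᶠ y in nhds x, H y = G i (φ y) := fun i => by
    obtain ⟨H, W', hW', hxW', hH⟩ := exists_global (g i) hxU
    refine ⟨H, ?_⟩
    filter_upwards [W'.isOpen.mem_nhds hxW'] with y hy
    exact (DFunLike.congr_fun hH ⟨y, hy⟩).symm
  choose H hH using hex
  have hFH : ∀ᶠ y in nhds x, F y =
      (F x • (1 : 𝒞) + ∑ i, (c i - c i x • (1 : 𝒞)) * H i) y := by
    have h2 := (continuousAt_extChartAt (I := 𝓡 m) x).eventually hβ1
    filter_upwards [h2, W.isOpen.mem_nhds hx, Filter.eventually_all.2 hH,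
      U.isOpen.mem_nhds hxU] with y hy hyW hyH hyU
    have h3 := hGz (φ y)
    rw [hy, one_mul, φ.left_inv (by rw [hφ, extChartAt_source]; exact hyU), hβ1.self_of_nhds,
      one_mul, hφ, extChartAt_to_inv, ← hφ] at h3
    rw [h3]
    have h4 : (∑ i, (c i - c i x • (1 : 𝒞)) * H i) y =
        ∑ i, (c i y - c i x * 1) * H i y := by
      rw [contMDiffMap_sum_apply]
      rfl
    change _ = F x * 1 + (∑ i, (c i - c i x • (1 : 𝒞)) * H i) y
    rw [h4, mul_one]
    congr 1
    refine sum_congr rfl fun i _ => ?_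
    rw [hyH, mul_one, hc y hyW, hc x hx]
  obtain ⟨W', hW', hW'o, hxW'⟩ := mem_nhds_iff.1 hFH
  rw [derivation_eq_of_eqOn hδ (W := ⟨W', hW'o⟩) (fun y hy => hW' hy) hxW', map_add, map_smul, h1,
    smul_zero, zero_add, map_sum, map_sum]
  rw [contMDiffMap_sum_apply]
  refine sum_congr rfl fun i _ => ?_
  rw [map_smul, ← hGc, hδ, map_sub, map_smul, h1, smul_zero, sub_zero]
  change δ (c i) x * _ = (c i x - c i x * 1) * δ (H i) x + δ (c i) x * H i x
  rw [mul_one, sub_self, zero_mul, zero_add, (hH i).self_of_nhds]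

lemma Anchor.ext_of_deriv {ρ ρ' : Anchor V}
    (h : ∀ (j : Fin p) (X : V.Sect j) f, ρ.deriv X f = ρ'.deriv X f) : ρ = ρ' := by
  have h1 : ρ.map = ρ'.map := by
    funext j x
    refine LinearMap.ext fun y => tangent_ext fun F => ?_
    obtain ⟨X, hX⟩ := exists_sect_apply_eq y
    rw [← hX]
    exact DFunLike.congr_fun (h j X F) x
  cases ρ
  cases ρ'
  cases h1
  rfl

namespace PreAlgebroid

variable (A : PreAlgebroid V)

lemma br_fun_apply (b : Frame V U) (hx : x ∈ U) (X : V.Sec) (f : 𝒞) : (A.br X (V.ofFun f)).1 x =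
    ∑ α, (b.θ α).1 ⟨x, hx⟩ (X.2 α.1 x) * (A.br (b.vec α) (V.ofFun f)).1 x := by
  classical
  let L : V.Sec →ₗ[ℝ] ℝ := (LinearMap.fst ℝ ℝ _ ∘ₗ V.ev x) ∘ₗ A.br.flip (V.ofFun f)
  let L' : V.Sec →ₗ[ℝ] ℝ := ∑ α : Idx r, (A.br (b.vec α) (V.ofFun f)).1 x •
    ((b.θ α).1 ⟨x, hx⟩ ∘ₗ LinearMap.proj α.1 ∘ₗ LinearMap.snd ℝ ℝ _ ∘ₗ V.ev x)
  have hL' : ∀ X, L' X =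
      ∑ α, (b.θ α).1 ⟨x, hx⟩ (X.2 α.1 x) * (A.br (b.vec α) (V.ofFun f)).1 x := fun X => by
    simp only [L', LinearMap.sum_apply]
    exact sum_congr rfl fun α _ => mul_comm _ _
  have h1 : L = L' := by
    refine LinearMap.ext_on (span_spanningSet b hx) ?_
    rintro _ (⟨g, rfl⟩ | ⟨α, rfl⟩ | ⟨g, z, hg, rfl⟩)
    · rw [hL']
      change (A.br (V.ofFun g) (V.ofFun f)).1 x = _
      rw [br_fun_fun]
      exact (sum_eq_zero fun α _ => by
        rw [show (b.θ α).1 ⟨x, hx⟩ ((V.ofFun g).2 α.1 x) = 0 from map_zero _, zero_mul]).symm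
    · rw [hL', sum_eq_single α]
      · have h2 := DFunLike.congr_fun (b.pair_dual α α) ⟨x, hx⟩
        rw [if_pos rfl] at h2
        exact ((congrArg (· * _) h2).trans (one_mul _)).symm
      · intro β _ hβ
        have h2 := DFunLike.congr_fun (b.pair_dual α β) ⟨x, hx⟩
        rw [if_neg hβ.symm] at h2
        exact (congrArg (· * _) h2).trans (zero_mul _)
      · exact fun h => absurd (mem_univ _) h
    · rw [hL']
      change (A.br (V.mulFun g z) (V.ofFun f)).1 x = _
      rw [br_mulFun_fun]
      change g x * _ = _
      rw [hg, zero_mul]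
      refine (sum_eq_zero fun α _ => ?_).symm
      change (b.θ α).1 ⟨x, hx⟩ (g x • z.2 α.1 x) * _ = 0
      rw [hg, zero_smul, map_zero, zero_mul]
  have h2 := LinearMap.congr_fun h1 X
  rw [hL'] at h2
  exact h2

lemma exists_anchor : ∃ ρ : Anchor V, ∀ (j : Fin p) (X : V.Sect j) (f : 𝒞),
    A.a 2 ![V.ofSect j X, V.ofFun f] = V.ofFun (ρ.deriv X f) := by
  classical
  let δ : V.Sec → 𝒞 →ₗ[ℝ] 𝒞 := fun X =>
    LinearMap.fst ℝ _ _ ∘ₗ A.br X ∘ₗ LinearMap.inl ℝ _ _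
  have hδ : ∀ X f g, δ X (f * g) = f * δ X g + δ X f * g := fun X => A.br_fun_mul X
  choose v hv using fun X x => exists_tangent_of_derivation (hδ X) x
  choose W _ hxW b using fun x : M => exists_frame V (U := ⊤) (x := x) trivial
  let b' := fun x => (b x).some
  let mp : ∀ (j : Fin p) (x : M), V.E j x →ₗ[ℝ] TangentSpace (𝓡 m) x := fun j x =>
    ∑ i, (((b' x).θ ⟨j, i⟩).1 ⟨x, hxW x⟩).smulRight (v ((b' x).vec ⟨j, i⟩) x)
  have hmp : ∀ j (X : V.Sect j) x, mp j x (X x) = v (V.ofSect j X) x := by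
    intro j X x
    refine tangent_ext fun F => ?_
    rw [hv]
    change _ = (A.br (V.ofSect j X) (V.ofFun F)).1 x
    rw [A.br_fun_apply (b' x) (hxW x), Fintype.sum_sigma, sum_eq_single j]
    · let L : TangentSpace (𝓡 m) x →ₗ[ℝ] ℝ := (mfderiv (𝓡 m) 𝓘(ℝ, ℝ) F x).toLinearMap
      change L (mp j x (X x)) = _
      refine (congrArg L (LinearMap.sum_apply _ _ _)).trans ((map_sum L _ _).trans ?_)
      refine sum_congr rfl fun i _ => ?_
      rw [LinearMap.smulRight_apply, map_smul, smul_eq_mul]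
      have hL : L (v ((b' x).vec ⟨j, i⟩) x) = δ ((b' x).vec ⟨j, i⟩) F x := hv _ _ _
      have hX : (V.ofSect j X).2 j x = X x := by
        change (Pi.single j X : ∀ k, V.Sect k) j x = _
        rw [Pi.single_eq_same]
      rw [hL, hX]
      rfl
    · intro k _ hk
      refine sum_eq_zero fun i _ => ?_
      change ((b' x).θ ⟨k, i⟩).1 ⟨x, hxW x⟩ ((Pi.single j X : ∀ k, V.Sect k) k x) * _ = 0
      rw [Pi.single_eq_of_ne hk]
      exact (congrArg (· * _) (map_zero _)).trans (zero_mul _)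
    · simp
  have hfun : ∀ j (X : V.Sect j) f, A.a 2 ![V.ofSect j X, V.ofFun f] =
      V.ofFun (δ (V.ofSect j X) f) := fun j X f =>
    (V.funPart_of_mem (A.br_fun_mem (V.ofSect j X) f)).symm
  let ρ : Anchor V := ⟨mp, fun j X => ?_, fun j x hj => ?_⟩
  · refine ⟨ρ, fun j X f => ?_⟩
    rw [hfun]
    congr 1
    ext x
    change _ = (mfderiv (𝓡 m) 𝓘(ℝ, ℝ) f x (mp j x (X x)) : ℝ)
    rw [hmp, hv]
  · simp only [hmp]
    exact contMDiff_vectorField fun F => by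
      simp only [hv]
      exact (δ (V.ofSect j X) F).contMDiff
  · refine LinearMap.ext fun y => ?_
    obtain ⟨X, hX⟩ := exists_sect_apply_eq y
    rw [← hX, hmp, LinearMap.zero_apply]
    refine tangent_ext fun F => ?_
    rw [hv]
    have h1 : δ (V.ofSect j X) F = 0 := by
      have := A.bracket_fun (-((j : ℤ) + 1)) (V.ofSect j X) F (V.ofSect_mem j X) (by omega)
      exact congrArg Prod.fst this
    rw [h1, map_zero]
    rfl

end PreAlgebroid

namespace QStructure

@[ext]
lemma ext {Q Q' : QStructure N} (h : ∀ U f, Q.Q U f = Q'.Q U f) : Q = Q' := by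
  have h1 : Q.Q = Q'.Q := funext fun U => LinearMap.ext (h U)
  cases Q
  cases Q'
  cases h1
  rfl

def rightOp (Q : QStructure N) : N.Ops :=
  ⟨fun U => Q.Q U ∘ₗ N.twist U 1, fun U W h f => by
    simp only [LinearMap.comp_apply, Q.natural, res_twist]⟩

lemma rightOp_apply (Q : QStructure N) (U : Opens M) (f : N.O U) : Q.rightOp.app U f =
    Q.Q U (N.twist U 1 f) := rfl

lemma rightOp_of_mem (Q : QStructure N) (hf : f ∈ N.gr U n) : Q.rightOp.app U f =
    (-1 : ℝ) ^ n • Q.Q U f := by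
  rw [rightOp_apply, twist_of_mem 1 hf, one_mul, zpow_natCast, map_smul]

lemma isRightDer_rightOp (Q : QStructure N) (U : Opens M) : IsRightDer U 1 (Q.rightOp.app U) where
  rule f g := by
    induction f using induction_homogeneous with
    | h0 => simp
    | hadd a b ha hb => simp only [add_mul, map_add, ha, hb]; abel
    | hom n a ha =>
      simp only [rightOp_apply, twist_mul]
      rw [Q.derivation U n _ _ (twist_mem 1 ha), twist_of_mem 1 ha, one_mul, zpow_natCast,
        smul_mul_assoc, smul_smul, ← mul_pow, neg_one_mul, neg_neg, one_pow, one_smul, add_comm]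
  degree n f hf := by
    rw [Q.rightOp_of_mem hf, ← Nat.cast_succ, grInt_natCast]
    exact smul_mem _ _ (Q.degree U n f hf)

lemma rightOp_mul_self (Q : QStructure N) : Q.rightOp * Q.rightOp = 0 := by
  refine operator_ext fun U f => ?_
  induction f using induction_homogeneous with
  | h0 => rw [map_zero, map_zero]
  | hadd a b ha hb => rw [map_add, map_add, ha, hb]
  | hom n a ha =>
    rw [operator_mul_apply, Q.rightOp_of_mem ha, map_smul,
      Q.rightOp_of_mem (Q.degree U n a ha), Q.square, smul_zero, smul_zero]
    rfl

/-- The Q-structure defined by a right derivation of square zero. -/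
def ofRightDer {D : N.Ops} (hD : ∀ U, IsRightDer U 1 (D.app U)) (h2 : D * D = 0) :
    QStructure N where
  Q U := D.app U ∘ₗ N.twist U 1
  degree U n f hf := by
    have h := (hD U).degree n _ (twist_mem 1 hf)
    rwa [← Nat.cast_succ, grInt_natCast] at h
  derivation U n f g hf := by
    rw [LinearMap.comp_apply, LinearMap.comp_apply, LinearMap.comp_apply, twist_mul, (hD U).rule,
      twist_twist, twist_of_mem 1 hf, one_mul, zpow_natCast, smul_mul_assoc, add_comm]
  natural h f := by
    rw [LinearMap.comp_apply, LinearMap.comp_apply, res_operator, res_twist]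
  square U f := by
    have h : ∀ g, D.app U (D.app U g) = 0 := fun g => by
      rw [← operator_mul_apply, h2]
      rfl
    induction f using induction_homogeneous with
    | h0 => rw [map_zero, map_zero]
    | hadd a b ha hb => rw [map_add, map_add, ha, hb, add_zero]
    | hom n a ha =>
      have h1 := (hD U).degree n a ha
      rw [LinearMap.comp_apply, LinearMap.comp_apply, twist_of_mem 1 ha, map_smul, map_smul,
        twist_of_mem_grInt 1 h1, map_smul, map_smul, h, smul_zero, smul_zero]

lemma rightOp_ofRightDer {D : N.Ops} (hD : ∀ U, IsRightDer U 1 (D.app U)) (h2 : D * D = 0) :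
    (ofRightDer hD h2).rightOp = D :=
  operator_ext fun U f => congrArg (D.app U) (twist_twist 1 f)

lemma rightOp_injective {Q Q' : QStructure N} (h : Q.rightOp = Q'.rightOp) : Q = Q' :=
  QStructure.ext fun U f => by
    rw [← twist_twist 1 f, ← rightOp_apply, ← rightOp_apply, h]

end QStructure

lemma LInftyAlgebroid.toPre_injective {A A' : LInftyAlgebroid V} (h : A.toPre = A'.toPre) : A =
    A' := by
  cases A
  cases A'
  have := congrArg PreAlgebroid.a h
  simp only [LInftyAlgebroid.toPre] at this
  cases this
  rfl

namespace Identification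

variable (ι)

lemma derived_eq_iff {D : N.Ops} (hD : ∀ U, IsRightDer U 1 (D.app U)) (A : PreAlgebroid V) :
    ι.derived hD = A ↔ ∀ U (b : Frame V U), ι.IsModel A b (D.app U) := by
  refine ⟨fun h U b => isModel_of_ev hD b fun x _ n v => ?_, fun h =>
    PreAlgebroid.eq_of_a fun n v => eq_of_ev fun x => ?_⟩
  · rw [← h]
    rfl
  · obtain ⟨U, -, hx, ⟨b⟩⟩ := exists_frame V (Opens.mem_top x)
    exact (h U b).ev_bracket hD hx n v

lemma corresponds_iff (Q : QStructure N) (A : LInftyAlgebroid V) (ρ : Anchor V) :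
    Corresponds ι Q A ρ ↔ ι.derived Q.isRightDer_rightOp = A.toPre ∧
    ∀ (j : Fin p) (X : V.Sect j) (f : 𝒞), A.a 2 ![V.ofSect j X, V.ofFun f] =
    V.ofFun (ρ.deriv X f) := by
  rw [derived_eq_iff]
  have hfn : (∀ (j : Fin p) (X : V.Sect j) (f : 𝒞),
      A.a 2 ![V.ofSect j X, V.ofFun f] = V.ofFun (ρ.deriv X f)) → ∀ (U : Opens M) (b : Frame V U)
      (f : 𝒞), ι.modelFn A.toPre b f =
        ∑ α : Idx r, N.fn U (globRes U (ρ.deriv (b.e α) f)) * ι.coord α.1 U (b.θ α) := by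
    intro h U b f
    refine sum_congr rfl fun α _ => ?_
    have h1 := congrArg Prod.fst (h α.1 (b.e α) f)
    exact congrArg (fun g => N.fn U (globRes U g) * _) h1
  have hmod : ∀ (U : Opens M) (b : Frame V U) (β : Idx r),
      ι.model A.toPre b β = (-1 : ℝ) ^ idxDeg β •
        ∑ n ∈ Finset.Icc 1 (p + 1), ((-1 : ℝ) ^ (n - 1) / (n.factorial : ℝ)) •
        ∑ α : Fin n → Idx r,
          N.fn U (V.pair (b.θ β) ((A.a n (fun i => b.vec (α i))).2 β.1)) *
            (ofFn fun i => ι.coord (α i).1 U (b.θ (α i))).prod := by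
    intro U b β
    rw [smul_sum]
    refine sum_congr rfl fun n hn => ?_
    obtain ⟨k, rfl⟩ := Nat.exists_eq_add_of_le' (Finset.mem_Icc.1 hn).1
    rw [smul_smul]
    congr 1
    rw [Nat.add_sub_cancel]
    ring
  have hd : ∀ (U : Opens M) (b : Frame V U) (β : Idx r), Q.rightOp.app U (ι.frameCoord b β) =
      (-1 : ℝ) ^ idxDeg β • Q.Q U (ι.coord β.1 U (b.θ β)) := fun U b β =>
    Q.rightOp_of_mem (ι.frameCoord_mem b β)
  have hf : ∀ (U : Opens M) (f : Smooth m U), Q.rightOp.app U (N.fn U f) = Q.Q U (N.fn U f) :=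
    fun U f => by rw [Q.rightOp_apply, twist_fn]
  have hinj : ∀ (n : ℕ) (U : Opens M), Injective fun f : N.O U => (-1 : ℝ) ^ n • f :=
    fun n U => smul_right_injective _ (pow_ne_zero _ (by norm_num))
  constructor
  · intro h
    refine ⟨fun U b => ⟨Q.isRightDer_rightOp U, fun f => ?_, fun β => ?_⟩, h.bracket_fun⟩
    · rw [hf, hfn h.bracket_fun, h.on_functions]
    · rw [hd, hmod, h.on_coordinates]
  · rintro ⟨h, hρ⟩
    refine ⟨fun U b f => ?_, fun U b β => ?_, hρ⟩
    · rw [← hfn hρ, ← (h U b).fn, hf]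
    · refine hinj (idxDeg β) U ?_
      change (-1 : ℝ) ^ idxDeg β • _ = (-1 : ℝ) ^ idxDeg β • _
      rw [← hd, ← hmod, (h U b).coord]

lemma existsUnique_algebroid (Q : QStructure N) : ∃! Aρ : LInftyAlgebroid V × Anchor V,
    Corresponds ι Q Aρ.1 Aρ.2 := by
  obtain ⟨ρ, hρ⟩ := (ι.derived Q.isRightDer_rightOp).exists_anchor
  refine ⟨(ι.derivedAlgebroid Q.isRightDer_rightOp Q.rightOp_mul_self, ρ),
    (ι.corresponds_iff Q _ ρ).2 ⟨rfl, hρ⟩, ?_⟩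
  rintro ⟨A', ρ'⟩ h
  obtain ⟨h1, h2⟩ := (ι.corresponds_iff Q A' ρ').1 h
  have h3 : A' = ι.derivedAlgebroid Q.isRightDer_rightOp Q.rightOp_mul_self :=
    LInftyAlgebroid.toPre_injective h1.symm
  subst h3
  refine Prod.ext rfl (Anchor.ext_of_deriv fun j X f => ?_)
  exact congrArg Prod.fst ((h2 j X f).symm.trans (hρ j X f))

lemma existsUnique_qStructure (A : LInftyAlgebroid V) : ∃! Qρ : QStructure N × Anchor V,
    Corresponds ι Qρ.1 A Qρ.2 := by
  obtain ⟨D, hD, hDA⟩ := ι.exists_derived_eq A.toPre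
  obtain ⟨ρ, hρ⟩ := A.toPre.exists_anchor
  have ha : ∀ n, ι.voronov.bracket D n = A.a n := fun n => congrFun (congrArg PreAlgebroid.a hDA) n
  have h2 : D * D = 0 := ι.mul_self_eq_zero hD fun n d x hx => by
    have h := ι.voronov.sum_bracket_bracket (derivation_mem hD) (ι.symbol_derivation hD) hx
    simp only [ha] at h
    exact h.symm.trans (A.jacobi n d x hx)
  have hQ := QStructure.rightOp_ofRightDer hD h2
  have hder : ∀ {D' : N.Ops} (hD' : ∀ U, IsRightDer U 1 (D'.app U)), D' = D →
      ι.derived hD' = A.toPre := by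
    rintro _ hD' rfl
    exact hDA
  refine ⟨(QStructure.ofRightDer hD h2, ρ), (ι.corresponds_iff _ A ρ).2 ⟨hder _ hQ, hρ⟩, ?_⟩
  rintro ⟨Q', ρ'⟩ h
  obtain ⟨h1, h3⟩ := (ι.corresponds_iff Q' A ρ').1 h
  refine Prod.ext (QStructure.rightOp_injective ?_) (Anchor.ext_of_deriv fun j X f => ?_)
  · rw [hQ]
    exact ι.derived_injective _ hD (h1.trans hDA.symm)
  · exact congrArg Prod.fst ((h3 j X f).symm.trans (hρ j X f))

end Identification

/-- Morphisms over the identity of the body, given by the pullback of functions. -/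
structure NManifold.Hom (N : NManifold.{u, v} m M r) (N' : NManifold.{u, v'} m M r) where
  app : ∀ U, N.O U →ₐ[ℝ] N'.O U
  natural : ∀ {U W : Opens M} (h : W ≤ U) (f : N.O U), N'.res h (app U f) = app W (N.res h f)
  degree : ∀ (U : Opens M) (n : ℕ) (f : N.O U), f ∈ N.gr U n → app U f ∈ N'.gr U n
  fn : ∀ (U : Opens M) (f : Smooth m U), app U (N.fn U f) = N'.fn U f

lemma NManifold.Hom.mem_level (φ : N.Hom N') {k : ℕ} (hf : f ∈ N.level k U) : φ.app U f ∈
    N'.level k U := fun x hx => by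
  obtain ⟨W, h, hxW, hf⟩ := hf x hx
  have hle : N.generated k W ≤ (N'.generated k W).comap (φ.app W) := Algebra.adjoin_le (by
    rintro g ⟨i, hi, hg⟩
    exact Algebra.subset_adjoin ⟨i, hi, φ.degree W i g hg⟩)
  exact ⟨W, h, hxW, by rw [φ.natural h]; exact hle hf⟩

namespace SplitIso

def hom (φ : SplitIso σ σ') : N.Hom N' := ⟨fun U => φ.e U, φ.natural, φ.degree, φ.fn⟩

lemma symm_mem (φ : SplitIso σ σ') {f : N'.O U} (hf : f ∈ N'.gr U n) : (φ.e U).symm f ∈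
    N.gr U n := by
  have h : ∀ g, φ.e U (N.comp U n g) = N'.comp U n (φ.e U g) := fun g => by
    induction g using induction_homogeneous with
    | h0 => simp
    | hadd a b ha hb => simp only [map_add, ha, hb]
    | hom k a ha =>
      rcases eq_or_ne k n with rfl | hk
      · rw [comp_of_mem ha, comp_of_mem (φ.degree U k a ha)]
      · rw [comp_of_mem_ne ha hk, comp_of_mem_ne (φ.degree U k a ha) hk, map_zero]
  have h1 := h ((φ.e U).symm f)
  rw [AlgEquiv.apply_symm_apply, comp_of_mem hf] at h1
  rw [← h1, AlgEquiv.symm_apply_apply]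
  exact comp_mem n _

def symm (φ : SplitIso σ σ') : SplitIso σ' σ where
  e U := (φ.e U).symm
  natural h f := by
    rw [AlgEquiv.eq_symm_apply, ← φ.natural, AlgEquiv.apply_symm_apply]
  degree U n f hf := φ.symm_mem hf
  fn U f := by rw [AlgEquiv.symm_apply_eq, φ.fn]
  split j U f f' h := by
    rw [AlgEquiv.eq_symm_apply]
    exact (φ.split j U f' f (by rw [h, AlgEquiv.apply_symm_apply])).symm

lemma map_linFun (φ : SplitIso σ σ') (hf : f ∈ σ.linFun j U) : φ.e U f ∈ σ'.linFun j U := by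
  obtain ⟨hf, h, h0⟩ := hf
  refine ⟨φ.degree U _ f hf, φ.hom.mem_level h, Subtype.ext ?_⟩
  rw [φ.split j U ⟨f, h⟩ ⟨φ.e U f, φ.hom.mem_level h⟩ rfl, h0]
  exact map_zero (φ.e U)

end SplitIso

namespace BundleIso

def symm (Φ : BundleIso V V') : BundleIso V' V :=
  ⟨fun j x => (Φ.e j x).symm, Φ.smooth_symm, Φ.smooth⟩

def sect (Φ : BundleIso V V') (X : V.Sect j) : V'.Sect j :=
  ⟨fun x => Φ.e j x (X x), (Φ.smooth j).comp X.contMDiff⟩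

def push (Φ : BundleIso V V') (j : Fin p) (U : Opens M) : V.Covec j U →ₗ[ℝ] V'.Covec j U where
  toFun θ := ⟨fun x => θ.1 x ∘ₗ (Φ.e j x).symm.toLinearMap, fun X => θ.2 (Φ.symm.sect X)⟩
  map_add' _ _ := rfl
  map_smul' _ _ := rfl

lemma push_apply (Φ : BundleIso V V') (θ : V.Covec j U) (x : U) (y : V.E j x) :
    (Φ.push j U θ).1 x (Φ.e j x y) = θ.1 x y :=
  congrArg (θ.1 x) ((Φ.e j x).symm_apply_apply y)

lemma symm_push_push (Φ : BundleIso V V') (θ : V.Covec j U) : Φ.symm.push j U (Φ.push j U θ) =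
    θ := Covec.ext fun x y => Φ.push_apply θ x y

lemma eq_push (Φ : BundleIso V V') {θ : V.Covec j U} {θ' : V'.Covec j U}
    (h : ∀ (x : U) (y : V.E j x), θ'.1 x (Φ.e j x y) = θ.1 x y) : θ' =
    Φ.push j U θ := Covec.ext fun x y => by
  have := h x ((Φ.e j x).symm y)
  rwa [LinearEquiv.apply_symm_apply] at this

def frame (Φ : BundleIso V V') (b : Frame V U) : Frame V' U where
  e α := Φ.sect (b.e α)
  θ α := Φ.push α.1 U (b.θ α)
  dual j i i' x := (Φ.push_apply _ x _).trans (b.dual j i i' x)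

lemma ext {Φ Ψ : BundleIso V V'} (h : ∀ j x y, Φ.e j x y = Ψ.e j x y) : Φ = Ψ := by
  have : Φ.e = Ψ.e := funext fun j => funext fun x => LinearEquiv.ext (h j x)
  cases Φ
  cases Ψ
  cases this
  rfl

end BundleIso

lemma induces_iff {φ : SplitIso σ σ'} {Φ : BundleIso V V'} : Induces ι ι' φ Φ ↔ ∀ j U θ,
    φ.e U (ι.coord j U θ) = ι'.coord j U (Φ.push j U θ) :=
  ⟨fun h j U θ => h j U θ _ (Φ.push_apply θ), fun h j U θ θ' hθ => by
    rw [h, Φ.eq_push hθ]⟩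

lemma covec_separates {y z : V.E j x}
    (h : ∀ (U : Opens M) (θ : V.Covec j U) (hx : x ∈ U), θ.1 ⟨x, hx⟩ y = θ.1 ⟨x, hx⟩ z) : y =
    z := by
  obtain ⟨U, -, hx, ⟨b⟩⟩ := exists_frame V (Opens.mem_top x)
  rw [← b.sum_smul j ⟨x, hx⟩ y, ← b.sum_smul j ⟨x, hx⟩ z]
  exact sum_congr rfl fun i _ => by rw [h U _ hx]

lemma contMDiff_totalSpace_of_sections (F : ∀ x, V.E j x →ₗ[ℝ] V'.E j x)
    (h : ∀ X : V.Sect j, ContMDiff (𝓡 m) ((𝓡 m).prod 𝓘(ℝ, (𝓔 j))) ∞ fun x =>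
      (⟨x, F x (X x)⟩ : TotalSpace (𝓔 j) (V'.E j))) :
    ContMDiff ((𝓡 m).prod 𝓘(ℝ, (𝓔 j))) ((𝓡 m).prod 𝓘(ℝ, (𝓔 j))) ∞
    (fun y : TotalSpace (𝓔 j) (V.E j) => (⟨y.1, F y.1 y.2⟩ : TotalSpace (𝓔 j) (V'.E j))) := by
  intro y₀
  obtain ⟨W, -, hxW, b, hb⟩ := exists_frame_of_trivializations V
    (fun j => trivializationAt (𝓔 j) (V.E j) y₀.1) (Opens.mem_top y₀.1)
    fun j => mem_baseSet_trivializationAt _ _ y₀.1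
  let e := trivializationAt (𝓔 j) (V.E j) y₀.1
  let e' := trivializationAt (𝓔 j) (V'.E j) y₀.1
  have hproj : ContMDiff ((𝓡 m).prod 𝓘(ℝ, (𝓔 j))) (𝓡 m) ∞
      (π (𝓔 j) (V.E j)) := Bundle.contMDiff_proj _
  refine Bundle.contMDiffAt_totalSpace.2 ⟨hproj y₀, ?_⟩
  have hS : ContMDiffAt ((𝓡 m).prod 𝓘(ℝ, (𝓔 j)))
      𝓘(ℝ, (𝓔 j)) ∞
      (fun y : TotalSpace (𝓔 j) (V.E j) =>
        ∑ i, (e y).2 i • (e' ⟨y.1, F y.1 (b.e ⟨j, i⟩ y.1)⟩).2) y₀ := by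
    refine ContMDiffAt.sum fun i _ => ?_
    have h1 := ((EuclideanSpace.proj i : (𝓔 j) →L[ℝ] ℝ).contDiff
      |>.contMDiff.contMDiffAt).comp y₀ (Bundle.contMDiffAt_totalSpace.1
        (contMDiffAt_id (I := (𝓡 m).prod 𝓘(ℝ, (𝓔 j))) (x := y₀) (n := ∞))).2
    have h2 := (Bundle.contMDiffAt_totalSpace.1 (h (b.e ⟨j, i⟩) y₀.1)).2.comp y₀ (hproj y₀)
    exact h1.smul h2
  refine hS.congr_of_eventuallyEq ?_
  have hmem : ∀ᶠ y in nhds y₀, y.1 ∈ W ∧ y.1 ∈ e'.baseSet :=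
    (hproj.continuous.continuousAt.eventually (W.isOpen.mem_nhds hxW)).and
      (hproj.continuous.continuousAt.eventually
        (e'.open_baseSet.mem_nhds (mem_baseSet_trivializationAt _ _ y₀.1)))
  filter_upwards [hmem] with y hy
  have h1 : F y.1 y.2 = ∑ i, (e y).2 i • F y.1 (b.e ⟨j, i⟩ y.1) := by
    conv_lhs => rw [← b.sum_smul j ⟨y.1, hy.1⟩ y.2, map_sum]
    exact sum_congr rfl fun i _ => by rw [map_smul, (hb ⟨j, i⟩ ⟨y.1, hy.1⟩ y.2).2]
  have h2 : ∀ z : V'.E j y.1, (e' ⟨y.1, z⟩).2 = e'.linearEquivAt ℝ y.1 hy.2 z := fun _ => rfl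
  change (e' ⟨y.1, F y.1 y.2⟩).2 = _
  rw [h2, h1, map_sum]
  exact sum_congr rfl fun i _ => map_smul _ _ _

lemma exists_bundleMap (S : ∀ U, V'.Covec j U →ₗ[ℝ] V.Covec j U)
    (hres : ∀ {U W : Opens M} (h : U ≤ W) θ, S U (Covec.res h θ) = Covec.res h (S W θ))
    (hmul : ∀ U (f : Smooth m U) θ, S U (Covec.mul f θ) = Covec.mul f (S U θ)) : ∃ F : ∀ x,
    V.E j x →ₗ[ℝ] V'.E j x, (ContMDiff ((𝓡 m).prod 𝓘(ℝ, (𝓔 j))) ((𝓡 m).prod 𝓘(ℝ, (𝓔 j))) ∞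
      (fun y : TotalSpace (𝓔 j) (V.E j) => (⟨y.1, F y.1 y.2⟩ : TotalSpace (𝓔 j) (V'.E j)))) ∧
    ∀ U (θ : V'.Covec j U) (x : U) y, θ.1 x (F x y) = (S U θ).1 x y := by
  have hZ : ∀ X : V.Sect j, ∃ Z : V'.Sect j, ∀ U θ, V'.pair θ Z = V.pair (S U θ) X := fun X =>
    exists_sect (fun U =>
      { toFun := fun θ => V.pair (S U θ) X
        map_add' := fun θ η => by rw [map_add]; rfl
        map_smul' := fun c θ => by rw [map_smul]; rfl })
      (fun h θ => congrArg (fun η => V.pair η X) (hres h θ))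
      fun U f θ => congrArg (fun η => V.pair η X) (hmul U f θ)
  choose Z hZ using hZ
  choose X hX using fun (x : M) (y : V.E j x) => exists_sect_apply_eq y
  have key : ∀ (U : Opens M) (θ : V'.Covec j U) (x : U) (y : V.E j x),
      θ.1 x (Z (X x y) x) = (S U θ).1 x y := fun U θ x y =>
    (DFunLike.congr_fun (hZ (X x y) U θ) x).trans (congrArg ((S U θ).1 x) (hX x y))
  let F : ∀ x, V.E j x →ₗ[ℝ] V'.E j x := fun x =>
    { toFun := fun y => Z (X x y) x
      map_add' := fun y z => covec_separates fun U θ hx => by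
        rw [map_add, key U θ ⟨x, hx⟩, key U θ ⟨x, hx⟩, key U θ ⟨x, hx⟩, map_add]
      map_smul' := fun c y => covec_separates fun U θ hx => by
        rw [map_smul, key U θ ⟨x, hx⟩, key U θ ⟨x, hx⟩, map_smul, RingHom.id_apply] }
  refine ⟨F, contMDiff_totalSpace_of_sections F fun Y => ?_, key⟩
  have : ∀ x, F x (Y x) = Z Y x := fun x => covec_separates fun U θ hx =>
    (key U θ ⟨x, hx⟩ (Y x)).trans (DFunLike.congr_fun (hZ Y U θ) ⟨x, hx⟩).symm
  simp only [this]
  exact (Z Y).contMDiff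

lemma SplitIso.exists_covecMap (φ : SplitIso σ σ') (ι : Identification σ V)
    (ι' : Identification σ' V') (j : Fin p) : ∃ S : ∀ U, V.Covec j U →ₗ[ℝ] V'.Covec j U, ∀ U θ,
    φ.e U (ι.coord j U θ) = ι'.coord j U (S U θ) := by
  have h : ∀ U θ, ∃ θ', ι'.coord j U θ' = φ.e U (ι.coord j U θ) := fun U θ => by
    have h := φ.map_linFun (ι.coord_mem_linFun θ)
    rwa [← ι'.range] at h
  choose S hS using h
  exact ⟨fun U =>
    { toFun := S U
      map_add' := fun θ η => ι'.injective j U (by simp only [map_add, hS])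
      map_smul' := fun c θ => ι'.injective j U (by simp only [map_smul, hS, RingHom.id_apply]) },
    fun U θ => (hS U θ).symm⟩

lemma SplitIso.exists_bundleMap (φ : SplitIso σ σ') (ι : Identification σ V)
    (ι' : Identification σ' V') {S : ∀ U, V.Covec j U →ₗ[ℝ] V'.Covec j U}
    (hS : ∀ U θ, φ.e U (ι.coord j U θ) = ι'.coord j U (S U θ)) : ∃ F : ∀ x, V'.E j x →ₗ[ℝ] V.E j x,
    (ContMDiff ((𝓡 m).prod 𝓘(ℝ, (𝓔 j))) ((𝓡 m).prod 𝓘(ℝ, (𝓔 j))) ∞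
      (fun y : TotalSpace (𝓔 j) (V'.E j) => (⟨y.1, F y.1 y.2⟩ : TotalSpace (𝓔 j) (V.E j)))) ∧
    ∀ U (θ : V.Covec j U) (x : U) y, θ.1 x (F x y) = (S U θ).1 x y :=
  GradedGeometry.exists_bundleMap S
    (fun h θ => ι'.injective j _ (by
      rw [← hS, ← ι.res_coord, ← φ.natural, hS, ι'.res_coord]))
    fun U f θ => ι'.injective j _ (by
      rw [← hS, ι.coord_mul, map_mul, φ.fn, hS, ι'.coord_mul])

lemma existsUnique_bundleIso (ι : Identification σ V) (ι' : Identification σ' V')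
    (φ : SplitIso σ σ') : ∃! Φ : BundleIso V V', Induces ι ι' φ Φ := by
  choose S hS using φ.exists_covecMap ι ι'
  choose T hT using φ.symm.exists_covecMap ι' ι
  have hTS : ∀ j U θ, T j U (S j U θ) = θ := fun j U θ => ι.injective j U (by
    rw [← hT, ← hS]
    exact (φ.e U).symm_apply_apply _)
  have hST : ∀ j U θ, S j U (T j U θ) = θ := fun j U θ => ι'.injective j U (by
    rw [← hS, ← hT]
    exact (φ.e U).apply_symm_apply _)
  choose F hFs hF using fun j => φ.exists_bundleMap ι ι' (hS j)
  choose G hGs hG using fun j => φ.symm.exists_bundleMap ι' ι (hT j)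
  let Φ : BundleIso V V' := ⟨fun j x => LinearEquiv.ofLinearMap (G j x) (F j x)
    (LinearMap.ext fun y => covec_separates fun U θ hx =>
      (hG j U θ ⟨x, hx⟩ _).trans ((hF j U _ ⟨x, hx⟩ y).trans (by rw [hST]; rfl)))
    (LinearMap.ext fun y => covec_separates fun U θ hx =>
      (hF j U θ ⟨x, hx⟩ _).trans ((hG j U _ ⟨x, hx⟩ y).trans (by rw [hTS]; rfl))),
    hGs, hFs⟩
  refine ⟨Φ, induces_iff.2 fun j U θ => (hS j U θ).trans (congrArg _ (Φ.eq_push fun x y =>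
    (hG j U _ x y).trans (by rw [hTS]))), fun Ψ hΨ => BundleIso.ext fun j x y =>
    covec_separates fun U θ hx => ?_⟩
  have h := hΨ j U (T j U θ) _ (Ψ.push_apply _)
  rw [hS, hST] at h
  rw [ι'.injective j U h, Ψ.push_apply, ← ι'.injective j U h]
  exact (hG j U θ ⟨x, hx⟩ y).symm

lemma NManifold.Hom.ext_of_frames {φ ψ : N.Hom N'} (ι : Identification σ V)
    (h : ∀ j U θ, φ.app U (ι.coord j U θ) = ψ.app U (ι.coord j U θ)) (U : Opens M) (f : N.O U) :
    φ.app U f = ψ.app U f := ext_locally fun x hx => by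
  obtain ⟨W, hW, hxW, ⟨b⟩⟩ := exists_frame V hx
  refine ⟨W, hW, hxW, ?_⟩
  rw [φ.natural, ψ.natural]
  exact DFunLike.congr_fun (algHom_ext_of_coordinates (ι.isCoordinates b).bijective_self.2
    (fun f => (φ.fn W f).trans (ψ.fn W f).symm) fun α => h α.1 W (b.θ α)) _

lemma BundleIso.exists_algHom (Φ : BundleIso V V') (ι : Identification σ V)
    (ι' : Identification σ' V') (b : Frame V U) : ∃ T : N.O U →ₐ[ℝ] N'.O U,
    (∀ f, T (N.fn U f) = N'.fn U f) ∧ (∀ j θ, T (ι.coord j U θ) = ι'.coord j U (Φ.push j U θ)) ∧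
    ∀ n, ∀ f ∈ N.gr U n, T f ∈ N'.gr U n := by
  have hq' := ι'.frameCoord_mem (Φ.frame b)
  obtain ⟨T, hfn, hq⟩ := exists_algHom_of_coordinates (gradedCommuting (ι.frameCoord_mem b))
    (ι.isCoordinates b).bijective_self (gradedCommuting hq')
  refine ⟨T, hfn, fun j θ => ?_, fun n f hf => ?_⟩
  · rw [ι.coord_eq_sum b, ι'.coord_eq_sum (Φ.frame b), map_sum]
    refine sum_congr rfl fun i _ => ?_
    rw [map_mul, hfn, hq]
    congr 2
    exact Smooth.ext fun x => (Φ.push_apply θ x _).symm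
  · obtain ⟨c, rfl⟩ := (ι.isCoordinates b).exists_expandDeg hf
    have : T (N.expandDeg U (ι.frameCoord b) n c) =
        N'.expandDeg U (ι'.frameCoord (Φ.frame b)) n c := by
      rw [expandDeg_apply, expandDeg_apply, map_sum]
      refine sum_congr rfl fun J _ => ?_
      rw [map_mul, hfn]
      refine congrArg _ ((map_monomialOf (T : N.O U →+* N'.O U) _ _).trans ?_)
      exact congrArg (fun q => monomialOf q J.1.1) (funext hq)
    rw [this]
    exact expandDeg_mem hq' n c

lemma BundleIso.exists_hom (Φ : BundleIso V V') (ι : Identification σ V)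
    (ι' : Identification σ' V') : ∃ φ : N.Hom N', ∀ j U θ, φ.app U (ι.coord j U θ) =
    ι'.coord j U (Φ.push j U θ) := by
  choose T hfn hT hdeg using fun U (hU : Nonempty (Frame V U)) => Φ.exists_algHom ι ι' hU.some
  obtain ⟨S, hS, hres, hSd⟩ := exists_glue_operator (N := N) (N' := N')
    (B := fun U => Nonempty (Frame V U)) (fun U x hx => exists_frame V hx)
    (fun U W h ⟨b⟩ => ⟨b.res h⟩) (fun U hU => (T U hU).toLinearMap) 0
    (fun U W h ⟨b⟩ f => DFunLike.congr_fun (algHom_ext_of_coordinates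
      (φ := (N'.res h).comp (T W ⟨b⟩)) (ψ := (T U ⟨b.res h⟩).comp (N.res h))
      (ι.isCoordinates b).bijective_self.2
      (fun f => by
        rw [AlgHom.comp_apply, AlgHom.comp_apply, hfn, res_fn, res_fn, hfn])
      fun α => by
        rw [AlgHom.comp_apply, AlgHom.comp_apply, Identification.frameCoord, hT, ι.res_coord, hT,
          ι'.res_coord]
        rfl) f)
    fun U hU n f hf => by
      rw [add_zero, grInt_natCast]
      exact hdeg U hU n f hf
  have hloc : ∀ {U : Opens M} {f : N.O U} {g : N'.O U}, (∀ (W : Opens M) (h : W ≤ U)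
      (hW : Nonempty (Frame V W)), T W hW (N.res h f) = N'.res h g) → S U f = g :=
    fun {U f g} hfg => ext_locally fun x hx => by
      obtain ⟨W, h, hxW, b⟩ := exists_frame V hx
      refine ⟨W, h, hxW, ?_⟩
      rw [hres, hS W b]
      exact hfg W h b
  have hTS : ∀ {U W : Opens M} (h : W ≤ U) (hW : Nonempty (Frame V W)) (f : N.O U),
      T W hW (N.res h f) = N'.res h (S U f) := fun h hW f => by
    rw [hres, hS _ hW]
    rfl
  refine ⟨⟨fun U => AlgHom.ofLinearMap (S U) (hloc fun W h hW => by simp only [map_one])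
    fun f g => hloc fun W h hW => by simp only [map_mul, hTS], fun h f => hres _ _ h f,
    fun U n f hf => ?_, fun U f => hloc fun W h hW => ?_⟩, fun j U θ => hloc fun W h hW => ?_⟩
  · have := hSd U n f hf
    rwa [add_zero, grInt_natCast] at this
  · rw [res_fn, res_fn, hfn]
  · rw [ι.res_coord, hT, ι'.res_coord]
    rfl

lemma NManifold.Hom.map_splitting (φ : N.Hom N') {Φ : BundleIso V V'} {ι : Identification σ V}
    {ι' : Identification σ' V'}
    (hφ : ∀ j U θ, φ.app U (ι.coord j U θ) = ι'.coord j U (Φ.push j U θ)) (j : Fin p) (U : Opens M)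
    (f : N.level ((j : ℕ) + 1) U) : (σ'.s j U ⟨φ.app U f, φ.mem_level f.2⟩ : N'.O U) =
    φ.app U (σ.s j U f) := by
  refine ext_locally fun x hx => ?_
  obtain ⟨W₁, h₁, hx₁, hf⟩ := f.2 x hx
  obtain ⟨W, h, hxW, ⟨b⟩⟩ := exists_frame V hx₁
  have hf' := (ι.isCoordinates b).generated_le _ (N.res_generated _ h _ hf)
  rw [N.res_res] at hf'
  let A : N.level ((j : ℕ) + 1) W →ₐ[ℝ] N'.O W := (N'.level (j : ℕ) W).val.comp ((σ'.s j W).comp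
    (((φ.app W).comp (N.level ((j : ℕ) + 1) W).val).codRestrict _ fun g => φ.mem_level g.2))
  let B : N.level ((j : ℕ) + 1) W →ₐ[ℝ] N'.O W :=
    (φ.app W).comp ((N.level (j : ℕ) W).val.comp (σ.s j W))
  have hlow : ∀ g (hg : g ∈ N.level (j : ℕ) W),
      g ∈ (AlgHom.equalizer A B).map (N.level ((j : ℕ) + 1) W).val := fun g hg =>
    ⟨⟨g, level_mono (Nat.le_succ _) W hg⟩, (σ'.retract j W _ (φ.mem_level hg)).trans
      (congrArg (φ.app W) (σ.retract j W ⟨g, _⟩ hg).symm), rfl⟩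
  have hle : N.polynomials W (ι.frameCoord b) ((j : ℕ) + 1) ≤
      (AlgHom.equalizer A B).map (N.level ((j : ℕ) + 1) W).val := by
    refine Algebra.adjoin_le ?_
    rintro _ (⟨g, rfl⟩ | ⟨α, hα, rfl⟩)
    · exact hlow _ (fn_mem_level _ g)
    · rcases (Nat.lt_succ_iff.1 hα).lt_or_eq with hα | hα
      · exact hlow _ (NManifold.mem_level hα (ι.frameCoord_mem b α))
      · obtain ⟨k, i⟩ := α
        obtain rfl : k = j := Fin.ext hα
        obtain ⟨-, h1, h0⟩ := ι.coord_mem_linFun (b.θ ⟨k, i⟩)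
        obtain ⟨-, h1', h0'⟩ := ι'.coord_mem_linFun (Φ.push k W (b.θ ⟨k, i⟩))
        refine ⟨⟨_, h1⟩, ?_, rfl⟩
        change (σ'.s k W ⟨φ.app W (ι.coord k W _), φ.mem_level h1⟩ : N'.O W) =
          φ.app W (σ.s k W ⟨_, h1⟩)
        simp only [h0, hφ, h0']
        exact (map_zero (φ.app W)).symm
  obtain ⟨g, hg, hgf⟩ := hle hf'
  refine ⟨W, h.trans h₁, hxW, ?_⟩
  rw [← σ'.natural j (h.trans h₁) ⟨φ.app U f, φ.mem_level f.2⟩ ⟨φ.app W g, φ.mem_level g.2⟩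
    ((congrArg (φ.app W) hgf).trans (φ.natural _ _).symm), φ.natural, ← σ.natural j _ f g hgf]
  exact hg

lemma SplitIso.ext {φ ψ : SplitIso σ σ'} (h : ∀ U f, φ.e U f = ψ.e U f) : φ = ψ := by
  have : φ.e = ψ.e := funext fun U => AlgEquiv.ext (h U)
  cases φ
  cases ψ
  cases this
  rfl

/-- The composition of morphisms in opposite directions. -/
def NManifold.Hom.comp (ψ : N'.Hom N) (φ : N.Hom N') : N.Hom N :=
  ⟨fun U => (ψ.app U).comp (φ.app U), fun h f => (ψ.natural h _).trans
    (congrArg _ (φ.natural h f)), fun _ _ _ hf => ψ.degree _ _ _ (φ.degree _ _ _ hf),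
    fun _ f => (congrArg _ (φ.fn _ f)).trans (ψ.fn _ f)⟩

variable (N) in
def NManifold.Hom.id : N.Hom N :=
  ⟨fun _ => AlgHom.id ℝ _, fun _ _ => rfl, fun _ _ _ hf => hf, fun _ _ => rfl⟩

lemma existsUnique_splitIso (ι : Identification σ V) (ι' : Identification σ' V')
    (Φ : BundleIso V V') : ∃! φ : SplitIso σ σ', Induces ι ι' φ Φ := by
  obtain ⟨φ, hφ⟩ := Φ.exists_hom ι ι'
  obtain ⟨ψ, hψ⟩ := Φ.symm.exists_hom ι' ι
  have h1 := Hom.ext_of_frames (φ := φ.comp ψ) (ψ := Hom.id N') ι'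
    fun j U θ => ((congrArg _ (hψ j U θ)).trans (hφ j U _)).trans
      (congrArg _ (Φ.symm.symm_push_push θ))
  have h2 := Hom.ext_of_frames (φ := ψ.comp φ) (ψ := Hom.id N) ι
    fun j U θ => ((congrArg _ (hφ j U θ)).trans (hψ j U _)).trans
      (congrArg _ (Φ.symm_push_push θ))
  refine ⟨⟨fun U => AlgEquiv.ofAlgHom (φ.app U) (ψ.app U) (AlgHom.ext (h1 U)) (AlgHom.ext (h2 U)),
    φ.natural, φ.degree, φ.fn, fun j U f f' h => ?_⟩, induces_iff.2 hφ, fun χ hχ =>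
    SplitIso.ext (Hom.ext_of_frames (φ := χ.hom) ι fun j U θ =>
      (induces_iff.1 hχ j U θ).trans (hφ j U θ).symm)⟩
  refine Eq.trans ?_ (φ.map_splitting hφ j U f)
  congr 2
  exact Subtype.ext h

namespace BundleIso

variable (Φ : BundleIso V V')

/-- The induced linear map on sections. -/
def secMap : V.Sec →ₗ[ℝ] V'.Sec where
  toFun := Φ.onSec
  map_add' _ _ := Prod.ext rfl (funext fun j => ContMDiffSection.ext fun x => map_add (Φ.e j x) _ _)
  map_smul' c _ := Prod.ext rfl (funext fun j => ContMDiffSection.ext fun x =>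
    map_smul (Φ.e j x) c _)

lemma symm_secMap_secMap (v : V.Sec) : Φ.symm.secMap (Φ.secMap v) = v :=
  Prod.ext rfl (funext fun j => ContMDiffSection.ext fun x => (Φ.e j x).symm_apply_apply _)

lemma secMap_mem {v : V.Sec} (hv : v ∈ V.gr d) : Φ.secMap v ∈ V'.gr d :=
  ⟨hv.1, fun j h => ContMDiffSection.ext fun x => by
    change Φ.e j x (v.2 j x) = 0
    rw [hv.2 j h]
    exact map_zero (Φ.e j x)⟩

lemma secMap_mulFun (f : 𝒞) (v : V.Sec) : Φ.secMap (V.mulFun f v) = V'.mulFun f (Φ.secMap v) :=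
  Prod.ext rfl (funext fun j => ContMDiffSection.ext fun x => map_smul (Φ.e j x) _ _)

lemma secMap_ofFun (f : 𝒞) : Φ.secMap (V.ofFun f) = V'.ofFun f :=
  Prod.ext rfl (funext fun j => ContMDiffSection.ext fun x => map_zero (Φ.e j x))

lemma secMap_vec (b : Frame V U) (α : Idx r) : Φ.secMap (b.vec α) = (Φ.frame b).vec α := by
  refine Prod.ext rfl (funext fun j => ContMDiffSection.ext fun x => ?_)
  change Φ.e j x ((Pi.single α.1 (b.e α) : ∀ j, V.Sect j) j x) =
    (Pi.single α.1 (Φ.sect (b.e α)) : ∀ j, V'.Sect j) j x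
  by_cases h : j = α.1
  · subst h
    rw [Pi.single_eq_same, Pi.single_eq_same]
    rfl
  · rw [Pi.single_eq_of_ne h, Pi.single_eq_of_ne h]
    exact map_zero (Φ.e j x)

/-- The transport of brackets. -/
def pullback (A : PreAlgebroid V') : PreAlgebroid V where
  a n := Φ.symm.secMap.compMultilinearMap ((A.a n).compLinearMap fun _ => Φ.secMap)
  degree n d v hv := Φ.symm.secMap_mem (A.degree n d _ fun i => Φ.secMap_mem (hv i))
  symm n d v hv i j h := by
    have := congrArg Φ.symm.secMap (A.symm n d _ (fun i => Φ.secMap_mem (hv i)) i j h)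
    rw [negOnePow_smul, map_smul, ← negOnePow_smul] at this
    exact this
  linear n v i f hn := by
    have := congrArg Φ.symm.secMap (A.linear n (fun i => Φ.secMap (v i)) i f hn)
    rw [secMap_mulFun] at this
    refine Eq.trans (congrArg (fun x => Φ.symm.secMap (A.a n x)) (funext fun k => ?_)) this
    change Φ.secMap _ = _
    rcases eq_or_ne k i with rfl | hk
    · rw [update_self, update_self, secMap_mulFun]
    · rw [update_of_ne hk, update_of_ne hk]
  leibniz X Y f := by
    have h : ∀ X Y, (fun i => Φ.secMap ((![X, Y] : Fin 2 → V.Sec) i)) =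
        ![Φ.secMap X, Φ.secMap Y] := fun X Y => funext fun i => by fin_cases i <;> rfl
    change Φ.symm.secMap (A.a 2 fun i => Φ.secMap (![_, _] i)) =
      V.mulFun (Φ.symm.secMap (A.a 2 fun i => Φ.secMap (![_, _] i))).1 Y +
        V.mulFun f (Φ.symm.secMap (A.a 2 fun i => Φ.secMap (![_, _] i)))
    rw [h, h, h, secMap_mulFun, A.leibniz, map_add, secMap_mulFun, secMap_mulFun,
      symm_secMap_secMap, secMap_ofFun]
    rfl
  bracket_fun d X f hX hd := by
    have := A.bracket_fun d _ f (Φ.secMap_mem hX) hd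
    refine Eq.trans (congrArg Φ.symm.secMap (Eq.trans (congrArg (A.a 2) (funext fun i => ?_)) this))
      (map_zero _)
    fin_cases i
    · rfl
    · exact Φ.secMap_ofFun f
  fun_arg n v i hn hv :=
    (congrArg Φ.symm.secMap (A.fun_arg n _ i hn (Φ.secMap_mem hv))).trans (map_zero _)
  fun_val n v hn := A.fun_val n _ hn

end BundleIso

lemma Partials.map_form {κ R A R' A' : Type*} [DecidableEq κ] [Fintype κ] [CommRing R] [Algebra ℝ R]
    [Ring A] [Algebra ℝ A] [CommRing R'] [Algebra ℝ R'] [Ring A'] [Algebra ℝ A']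
    {P : Partials R A κ} {P' : Partials R' A' κ} (φ : A →ₐ[ℝ] A') (hq : ∀ a, φ (P.q a) = P'.q a)
    {C : (Fin n → κ) → R} {C' : (Fin n → κ) → R'} (hC : ∀ α, φ (P.F (C α)) = P'.F (C' α)) :
    φ (P.form n C) = P'.form n C' := by
  rw [form, form, map_sum]
  refine sum_congr rfl fun α _ => ?_
  rw [map_mul, hC, map_list_prod, List.map_ofFn]
  simp only [Function.comp_def, hq]

variable {φ : SplitIso σ σ'} {Φ : BundleIso V V'}

lemma Induces.frameCoord (h : Induces ι ι' φ Φ) (b : Frame V U) (α : Idx r) :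
    φ.e U (ι.frameCoord b α) = ι'.frameCoord (Φ.frame b) α := induces_iff.1 h α.1 U (b.θ α)

lemma Induces.model (h : Induces ι ι' φ Φ) (A : PreAlgebroid V') (b : Frame V U) (β : Idx r) :
    φ.e U (ι.model (Φ.pullback A) b β) = ι'.model A (Φ.frame b) β := by
  rw [Identification.model, Identification.model, map_sum]
  refine sum_congr rfl fun n _ => ?_
  rw [map_smul]
  congr 1
  refine Partials.map_form (P := ι.partials b) (P' := ι'.partials (Φ.frame b))
    (φ.e U : N.O U →ₐ[ℝ] N'.O U) (h.frameCoord b) fun α => (φ.fn U _).trans (congrArg _ ?_)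
  refine Smooth.ext fun x => ?_
  change (b.θ β).1 x ((Φ.e β.1 x).symm ((A.a n fun i => Φ.secMap (b.vec (α i))).2 β.1 x)) = _
  simp only [Φ.secMap_vec]
  rfl

lemma Induces.modelFn (h : Induces ι ι' φ Φ) (A : PreAlgebroid V') (b : Frame V U) (f : 𝒞) :
    φ.e U (ι.modelFn (Φ.pullback A) b f) = ι'.modelFn A (Φ.frame b) f := by
  rw [Identification.modelFn, Identification.modelFn, map_sum]
  refine sum_congr rfl fun α _ => ?_
  rw [map_mul, φ.fn, h.frameCoord]
  have : (fun i => Φ.secMap ((![b.vec α, V.ofFun f] : Fin 2 → V.Sec) i)) =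
      ![(Φ.frame b).vec α, V'.ofFun f] := funext fun i => by
    fin_cases i
    · exact Φ.secMap_vec b α
    · exact Φ.secMap_ofFun f
  exact congrArg (fun v => N'.fn U (globRes U (A.a 2 v).1) * _) this

lemma SplitIso.twist (φ : SplitIso σ σ') (d : ℤ) (f : N.O U) : φ.e U (N.twist U d f) =
    N'.twist U d (φ.e U f) := by
  induction f using induction_homogeneous with
  | h0 => simp
  | hadd a b ha hb => simp only [map_add, ha, hb]
  | hom n a ha => rw [twist_of_mem d ha, twist_of_mem d (φ.degree U n a ha), map_smul]

lemma Induces.isModel_iff (h : Induces ι ι' φ Φ) {A : PreAlgebroid V'} {b : Frame V U}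
    {R : N.O U →ₗ[ℝ] N.O U} {R' : N'.O U →ₗ[ℝ] N'.O U} (hR : IsRightDer U 1 R)
    (hR' : ι'.IsModel A (Φ.frame b) R') : ι.IsModel (Φ.pullback A) b R ↔ ∀ f, φ.e U (R f) =
    R' (φ.e U f) := by
  refine ⟨fun hR f => ?_, fun hφ => ⟨hR, fun f => (φ.e U).injective ?_, fun β =>
    (φ.e U).injective ?_⟩⟩
  · let R'' : N'.O U →ₗ[ℝ] N'.O U := (φ.e U).toLinearMap ∘ₗ R ∘ₗ (φ.e U).symm.toLinearMap
    have hR'' : ι'.IsModel A (Φ.frame b) R'' := by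
      refine ⟨⟨fun f g => ?_, fun n f hf => ?_⟩, fun f => ?_, fun β => ?_⟩
      · change φ.e U (R ((φ.e U).symm (f * g))) =
          f * φ.e U (R ((φ.e U).symm g)) + φ.e U (R ((φ.e U).symm f)) * _
        rw [map_mul, hR.der.rule, map_add, map_mul, map_mul, φ.twist, AlgEquiv.apply_symm_apply,
          AlgEquiv.apply_symm_apply]
      · have h1 := hR.der.degree n _ (φ.symm_mem hf)
        rw [← Nat.cast_succ, grInt_natCast] at h1 ⊢
        exact φ.degree U _ _ h1
      · change φ.e U (R ((φ.e U).symm (N'.fn U (globRes U f)))) = _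
        rw [← φ.fn, AlgEquiv.symm_apply_apply, hR.fn, h.modelFn]
      · change φ.e U (R ((φ.e U).symm (ι'.frameCoord (Φ.frame b) β))) = _
        rw [← h.frameCoord, AlgEquiv.symm_apply_apply, hR.coord, h.model]
    have h1 := hR''.res_eq le_rfl (b := Φ.frame b) (R' := R') hR' (φ.e U f)
    rw [N'.res_self, N'.res_self] at h1
    rw [← h1]
    exact congrArg (fun f => φ.e U (R f)) ((φ.e U).symm_apply_apply f).symm
  · rw [hφ, φ.fn, hR'.fn, h.modelFn]
  · rw [hφ, h.frameCoord, hR'.coord, h.model]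

lemma Induces.intertwines_iff (h : Induces ι ι' φ Φ) {Q : QStructure N} {Q' : QStructure N'}
    {A : LInftyAlgebroid V} {A' : LInftyAlgebroid V'} {ρ : Anchor V} {ρ' : Anchor V'}
    (hQ : Corresponds ι Q A ρ) (hQ' : Corresponds ι' Q' A' ρ') :
    (∀ (U : Opens M) (f : N.O U), φ.e U (Q.Q U f) = Q'.Q U (φ.e U f)) ↔
    ∀ (n : ℕ) (x : Fin n → V.Sec), Φ.onSec (A.a n x) = A'.a n fun i => Φ.onSec (x i) := by
  have hA := ((ι.corresponds_iff Q A ρ).1 hQ).1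
  have hA' := (ι'.derived_eq_iff _ _).1 ((ι'.corresponds_iff Q' A' ρ').1 hQ').1
  have hop : (∀ (U : Opens M) (f : N.O U), φ.e U (Q.Q U f) = Q'.Q U (φ.e U f)) ↔
      ∀ (U : Opens M) (f : N.O U), φ.e U (Q.rightOp.app U f) = Q'.rightOp.app U (φ.e U f) := by
    refine ⟨fun hφ U f => ?_, fun hφ U f => ?_⟩
    · rw [Q.rightOp_apply, Q'.rightOp_apply, hφ, φ.twist]
    · have := hφ U (N.twist U 1 f)
      rwa [φ.twist, Q.rightOp_apply, Q'.rightOp_apply, twist_twist, twist_twist] at this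
  have hbr : (∀ (n : ℕ) (x : Fin n → V.Sec), Φ.onSec (A.a n x) = A'.a n fun i => Φ.onSec (x i)) ↔
      A.toPre = Φ.pullback A'.toPre := by
    refine ⟨fun hΦ => PreAlgebroid.eq_of_a fun n v => ?_, fun hΦ n x => ?_⟩
    · exact (Φ.symm_secMap_secMap _).symm.trans (congrArg Φ.symm.secMap (hΦ n v))
    · have := congrArg (fun A => Φ.secMap (PreAlgebroid.a A n x)) hΦ
      exact this.trans (Φ.symm.symm_secMap_secMap _)
  rw [hop, hbr, ← hA, ι.derived_eq_iff]
  refine ⟨fun hφ U b => (h.isModel_iff (Q.isRightDer_rightOp U) (hA' U (Φ.frame b))).2 (hφ U),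
    fun hm U f => ext_locally fun x hx => ?_⟩
  obtain ⟨W, hW, hxW, ⟨b⟩⟩ := exists_frame V hx
  refine ⟨W, hW, hxW, ?_⟩
  rw [φ.natural, res_operator, res_operator, φ.natural]
  exact (h.isModel_iff (Q.isRightDer_rightOp W) (hA' W (Φ.frame b))).1 (hm W b) _

end

open GradedBundle

variable (r)

/-- A graded commutative algebra in which the monomials in `ξ` are linearly independent is found
among the endomorphisms of this space. -/
abbrev FreeOp : Type := Module.End ℝ ((Idx r → ℕ) →₀ ℝ)

variable {r}

/-- The lexicographic order of the indices. -/
def IdxLT (α β : Idx r) : Prop := α.1 < β.1 ∨ α.1 = β.1 ∧ (α.2 : ℕ) < β.2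

lemma idxLT_or {α β : Idx r} (h : α ≠ β) : IdxLT α β ∨ IdxLT β α := by
  obtain ⟨j, i⟩ := α
  obtain ⟨k, l⟩ := β
  rcases lt_trichotomy j k with h1 | rfl | h1
  · exact Or.inl (Or.inl h1)
  · have h2 : (i : ℕ) ≠ l := fun h' => h (by rw [Fin.ext h'])
    exact h2.lt_or_gt.imp (fun h => Or.inr ⟨rfl, h⟩) fun h => Or.inr ⟨rfl, h⟩
  · exact Or.inr (Or.inl h1)

lemma IdxLT.not_symm {α β : Idx r} (h : IdxLT α β) : ¬ IdxLT β α := by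
  rintro (h' | h') <;> rcases h with h | h <;> omega

lemma pairwise_idxList : (idxList r).Pairwise IdxLT := by
  rw [idxList, List.pairwise_flatMap]
  refine ⟨fun j _ => List.pairwise_map.2 ((List.pairwise_lt_finRange _).imp fun h =>
    Or.inr ⟨rfl, h⟩), (List.pairwise_lt_finRange _).imp fun h α hα β hβ => ?_⟩
  obtain ⟨i, -, rfl⟩ := List.mem_map.1 hα
  obtain ⟨i', -, rfl⟩ := List.mem_map.1 hβ
  exact Or.inl h

open Classical in
/-- The sum of the degrees of the coordinates before `α` in the monomial `J`. -/
def degBefore (α : Idx r) (J : Idx r → ℕ) : ℕ := ∑ β with IdxLT β α, J β * idxDeg β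

open Classical in
lemma degBefore_add_single (α β : Idx r) (J : Idx r → ℕ) : degBefore α (J + Pi.single β 1) =
    degBefore α J + if IdxLT β α then idxDeg β else 0 := by
  simp only [degBefore, Pi.add_apply, add_mul, sum_add_distrib]
  congr 1
  by_cases h : IdxLT β α
  · rw [if_pos h, sum_eq_single β]
    · simp
    · intro γ _ hγ
      simp [hγ]
    · simp [h]
  · rw [if_neg h]
    refine sum_eq_zero fun γ hγ => ?_
    have : γ ≠ β := fun h' => h (h' ▸ (Finset.mem_filter.1 hγ).2)
    simp [this]

def xi (α : Idx r) : FreeOp r := Finsupp.lsum ℝ fun J => LinearMap.toSpanSingleton ℝ _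
  (if Odd (idxDeg α) ∧ J α ≠ 0 then 0 else
    Finsupp.single (J + Pi.single α 1) ((-1 : ℝ) ^ (idxDeg α * degBefore α J)))

lemma xi_single (α : Idx r) (J : Idx r → ℕ) (c : ℝ) : xi α (Finsupp.single J c) =
    if Odd (idxDeg α) ∧ J α ≠ 0 then 0 else Finsupp.single (J + Pi.single α 1)
    (c * (-1 : ℝ) ^ (idxDeg α * degBefore α J)) := by
  rw [xi, Finsupp.lsum_single, LinearMap.toSpanSingleton_apply]
  split_ifs <;> simp

lemma xi_comm (α β : Idx r) : SignComm (idxDeg α) (idxDeg β) (xi α) (xi β) := by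
  have key : ∀ {α β : Idx r}, IdxLT α β → SignComm (idxDeg α) (idxDeg β) (xi α) (xi β) := by
    intro α β h
    have hne : α ≠ β := fun h' => h.not_symm (h' ▸ h)
    refine Finsupp.lhom_ext fun J c => ?_
    rw [Module.End.mul_apply, LinearMap.smul_apply, Module.End.mul_apply, xi_single, xi_single]
    by_cases h1 : Odd (idxDeg β) ∧ J β ≠ 0
    · rw [if_pos h1, map_zero]
      split_ifs with h2
      · rw [map_zero, smul_zero]
      · rw [xi_single, if_pos (by simpa [hne.symm] using h1), smul_zero]
    · rw [if_neg h1, xi_single]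
      by_cases h2 : Odd (idxDeg α) ∧ J α ≠ 0
      · rw [if_pos h2, if_pos (by simpa [hne] using h2), map_zero, smul_zero]
      · rw [if_neg h2, if_neg (by simpa [hne] using h2), xi_single,
          if_neg (by simpa [hne.symm] using h1), degBefore_add_single, degBefore_add_single,
          if_pos h, if_neg h.not_symm, add_right_comm, Finsupp.smul_single, add_zero, mul_add,
          pow_add, smul_eq_mul]
        congr 1
        have h3 : ((-1 : ℝ) ^ (idxDeg α * idxDeg β)) * (-1 : ℝ) ^ (idxDeg β * idxDeg α) = 1 := by
          rw [mul_comm (idxDeg β), ← mul_pow]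
          simp
        linear_combination (-(c * (-1 : ℝ) ^ (idxDeg β * degBefore β J) *
          (-1 : ℝ) ^ (idxDeg α * degBefore α J))) * h3
  by_cases h : α = β
  · subst h
    by_cases ho : Odd (idxDeg α)
    · have h1 : xi α * xi α = 0 := by
        refine Finsupp.lhom_ext fun J c => ?_
        rw [Module.End.mul_apply, xi_single]
        split_ifs
        · exact map_zero _
        · rw [xi_single, if_pos ⟨ho, by simp⟩]
          rfl
      rw [SignComm, h1, smul_zero]
    · rw [SignComm, (Nat.not_odd_iff_even.1 ho).mul_right _ |>.neg_one_pow, one_smul]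
  · exact (idxLT_or h).elim key fun h' => (key h').symm

lemma xi_pow_single {α : Idx r} {J : Idx r → ℕ} (hJ : ∀ β, IdxLT β α → J β = 0) (hα : J α = 0)
    {k : ℕ} (hk : Odd (idxDeg α) → k ≤ 1) : (xi α ^ k) (Finsupp.single J 1) =
    Finsupp.single (J + Pi.single α k) 1 := by
  induction k with
  | zero => simp
  | succ k ih =>
    have h1 : degBefore α (J + Pi.single α k) = 0 := by
      classical
      refine sum_eq_zero fun β hβ => ?_
      have h2 := (Finset.mem_filter.1 hβ).2
      have h3 : β ≠ α := fun h' => h2.not_symm (h' ▸ h2)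
      simp [hJ β h2, h3]
    rw [pow_succ', Module.End.mul_apply, ih fun h => (Nat.le_succ k).trans (hk h), xi_single, h1,
      if_neg, mul_zero, pow_zero, mul_one, add_assoc, ← Pi.single_add]
    rintro ⟨ho, h⟩
    have := hk ho
    simp only [Pi.add_apply, hα, Pi.single_eq_same, zero_add] at h
    omega

lemma monomialOf_xi_single (J : MultiExp r) : monomialOf xi J.1 (Finsupp.single 0 1) =
    Finsupp.single J.1 (1 : ℝ) := by
  classical
  rw [monomialOf_eq]
  have key : ∀ L : List (Idx r), L.Pairwise IdxLT → listMonomial xi L J.1 (Finsupp.single 0 1) =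
      Finsupp.single (fun β => if β ∈ L then J.1 β else 0) (1 : ℝ) := by
    intro L hL
    induction L with
    | nil => simp [listMonomial]; rfl
    | cons α L ih =>
      obtain ⟨h1, h2⟩ := List.pairwise_cons.1 hL
      have h3 : ∀ β ∈ L, β ≠ α := fun β hβ h' => (h1 β hβ).not_symm (h' ▸ h1 β hβ)
      have h4 := ih h2
      rw [listMonomial] at h4 ⊢
      rw [List.map_cons, List.prod_cons, Module.End.mul_apply, h4, xi_pow_single]
      · congr 1
        funext β
        by_cases hβ : β = α
        · subst hβ
          simpa using fun h => absurd rfl (h3 β h)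
        · simp [hβ]
      · intro β hβ
        exact if_neg fun h => (h1 β h).not_symm hβ
      · exact if_neg fun h => h3 α h rfl
      · exact J.2 α
  rw [key _ pairwise_idxList]
  congr 1
  funext β
  exact if_pos (mem_idxList β)

/-- The coefficient of a monomial. -/
def monCoeff (J : MultiExp r) : FreeOp r →ₗ[ℝ] ℝ :=
  Finsupp.lapply J.1 ∘ₗ LinearMap.applyₗ (Finsupp.single 0 1)

open Classical in
lemma monCoeff_monomialOf (J K : MultiExp r) : monCoeff J (monomialOf xi K.1) = if K =
    J then 1 else 0 := by
  change monomialOf xi K.1 (Finsupp.single 0 1) J.1 = _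
  rw [monomialOf_xi_single, Finsupp.single_apply]
  exact if_congr Subtype.ext_iff.symm rfl rfl

lemma monomialOf_mem_graded {A : Type*} [Ring A] [Algebra ℝ A] {gr : ℕ → Submodule ℝ A}
    [SetLike.GradedMonoid gr] {q : Idx r → A} (hq : ∀ α, q α ∈ gr (idxDeg α)) (J : Idx r → ℕ) :
    monomialOf q J ∈ gr (expDeg J) := by
  rw [← listDeg_idxList, monomialOf_eq]
  induction idxList r with
  | nil => exact SetLike.one_mem_graded gr
  | cons α L ih =>
    refine SetLike.mul_mem_graded ?_ ih
    have := SetLike.pow_mem_graded (A := gr) (J α) (hq α)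
    simpa using this

variable (V) in
/-- Families of functions of tuples of elements of the fibres. -/
def Fam (U : Opens M) : Type (max u w) := ∀ x : U, (∀ α : Idx r, V.E α.1 x) → FreeOp r

namespace Fam

instance (U : Opens M) : Ring (Fam V U) :=
  inferInstanceAs (Ring (∀ x : U, (∀ α : Idx r, V.E α.1 x) → FreeOp r))

instance (U : Opens M) : Algebra ℝ (Fam V U) :=
  inferInstanceAs (Algebra ℝ (∀ x : U, (∀ α : Idx r, V.E α.1 x) → FreeOp r))

def res (h : U ≤ W) : Fam V W →ₐ[ℝ] Fam V U where
  toFun f x := f ⟨x, h x.2⟩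
  map_one' := rfl
  map_mul' _ _ := rfl
  map_zero' := rfl
  map_add' _ _ := rfl
  commutes' _ := rfl

variable (V) in
def fn (U : Opens M) : Smooth m U →ₐ[ℝ] Fam V U where
  toFun f x _ := algebraMap ℝ _ (f x)
  map_one' := funext fun _ => funext fun _ => map_one _
  map_mul' _ _ := funext fun _ => funext fun _ => map_mul (algebraMap ℝ (FreeOp r)) _ _
  map_zero' := funext fun _ => funext fun _ => map_zero _
  map_add' _ _ := funext fun _ => funext fun _ => map_add (algebraMap ℝ (FreeOp r)) _ _
  commutes' _ := rfl

/-- The linear function of a covector field. -/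
def lin (j : Fin p) (U : Opens M) : V.Covec j U →ₗ[ℝ] Fam V U where
  toFun θ x e := ∑ i, θ.1 x (e ⟨j, i⟩) • xi ⟨j, i⟩
  map_add' θ η := funext fun x => funext fun e => by
    refine (sum_congr rfl fun i _ => ?_).trans sum_add_distrib
    exact add_smul _ _ (xi (⟨j, i⟩ : Idx r))
  map_smul' c θ := funext fun x => funext fun e => by
    refine (sum_congr rfl fun i _ => ?_).trans (smul_sum (r := c)).symm
    exact mul_smul _ _ (xi (⟨j, i⟩ : Idx r))

lemma lin_apply (θ : V.Covec j U) (x : U) (e : ∀ α : Idx r, V.E α.1 x) : lin j U θ x e = ∑ i,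
    θ.1 x (e ⟨j, i⟩) • xi (⟨j, i⟩ : Idx r) := rfl

lemma fn_mul_comm (f : Smooth m U) (g : Fam V U) : fn V U f * g = g * fn V U f :=
  funext fun x => funext fun e => Algebra.commutes (f x) (g x e)

lemma lin_mul (f : Smooth m U) (θ : V.Covec j U) : lin j U (Covec.mul f θ) =
    fn V U f * lin j U θ := by
  funext x e
  change _ = algebraMap ℝ (FreeOp r) (f x) * _
  rw [← Algebra.smul_def, lin_apply, lin_apply, smul_sum]
  exact sum_congr rfl fun i _ => mul_smul _ _ _

/-- The products of a smooth function and linear functions. -/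
inductive Word (U : Opens M) : ℕ → Fam V U → Prop
  | fn (f : Smooth m U) : Word U 0 (fn V U f)
  | mul (j : Fin p) (θ : V.Covec j U) (n : ℕ) (y : Fam V U) :
    Word U n y → Word U ((j : ℕ) + 1 + n) (lin j U θ * y)

lemma Word.fn_mul {n : ℕ} {y : Fam V U} (hy : Word U n y) (f : Smooth m U) :
    Word U n (Fam.fn V U f * y) := by
  induction hy with
  | fn g => exact map_mul (Fam.fn V U) f g ▸ Word.fn _
  | mul j θ n y hy ih =>
    rw [← mul_assoc, fn_mul_comm, mul_assoc]
    exact Word.mul j θ n _ ih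

lemma Word.prod {n k : ℕ} {y z : Fam V U} (hy : Word U n y) (hz : Word U k z) :
    Word U (n + k) (y * z) := by
  induction hy with
  | fn f => rw [zero_add]; exact hz.fn_mul f
  | mul j θ n y hy ih =>
    rw [mul_assoc, add_assoc]
    exact Word.mul j θ _ _ ih

lemma Word.res (h : U ≤ W) {n : ℕ} {y : Fam V W} (hy : Word W n y) : Word U n (Fam.res h y) := by
  induction hy with
  | fn f => exact Word.fn (Smooth.res h f)
  | mul j θ n y hy ih =>
    rw [map_mul]
    exact Word.mul j (Covec.res h θ) n _ ih

lemma Word.signComm {n k : ℕ} {y z : Fam V U} (hy : Word U n y) (hz : Word U k z) :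
    SignComm n k y z := by
  induction hy with
  | fn f => simpa [SignComm] using fn_mul_comm f z
  | mul j θ n y hy ih =>
    refine SignComm.mul_left ?_ ih
    clear ih
    induction hz with
    | fn f => simpa [SignComm] using (fn_mul_comm f _).symm
    | mul l η n y hy ih =>
      refine SignComm.mul_right ?_ ih
      funext x e
      change lin j U θ x e * lin l U η x e =
        (-1 : ℝ) ^ (((j : ℕ) + 1) * ((l : ℕ) + 1)) • (lin l U η x e * lin j U θ x e)
      simp only [lin_apply]
      rw [sum_mul_sum, sum_mul_sum, sum_comm, smul_sum]
      refine sum_congr rfl fun i _ => ?_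
      rw [smul_sum]
      refine sum_congr rfl fun i' _ => ?_
      rw [smul_mul_smul_comm, smul_mul_smul_comm, xi_comm, smul_comm, mul_comm (θ.1 x _)]
      rfl

lemma span_res (h : U ≤ W) {n : ℕ} {f : Fam V W} (hf : f ∈ span ℝ {y : Fam V W | Word W n y}) :
    Fam.res h f ∈ span ℝ {y : Fam V U | Word U n y} := by
  induction hf using span_induction with
  | mem y hy => exact subset_span (hy.res h)
  | zero => rw [map_zero]; exact zero_mem _
  | add a b _ _ ha hb => rw [map_add]; exact add_mem ha hb
  | smul c a _ ha => rw [map_smul]; exact smul_mem _ c ha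

/-- The families that are locally linear combinations of products of degree `n`. -/
def gr (U : Opens M) (n : ℕ) : Submodule ℝ (Fam V U) where
  carrier := {f | ∀ x ∈ U, ∃ (W : Opens M) (h : W ≤ U), x ∈ W ∧
    res h f ∈ span ℝ {y : Fam V W | Word W n y}}
  add_mem' {f g} hf hg x hx := by
    obtain ⟨W, h, hxW, hf⟩ := hf x hx
    obtain ⟨W', h', hxW', hg⟩ := hg x hx
    exact ⟨W ⊓ W', inf_le_left.trans h, ⟨hxW, hxW'⟩, add_mem (span_res inf_le_left hf)
      (span_res inf_le_right hg)⟩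
  zero_mem' x hx := ⟨U, le_rfl, hx, zero_mem _⟩
  smul_mem' c f hf x hx := by
    obtain ⟨W, h, hxW, hf⟩ := hf x hx
    exact ⟨W, h, hxW, smul_mem _ c hf⟩

lemma eq_of_word {f : Fam V U} (hf : f ∈ gr U n) {L L' : ∀ W : Opens M, Fam V W →ₗ[ℝ] Fam V W}
    (hL : ∀ W (h : W ≤ U), res h (L U f) = L W (res h f))
    (hL' : ∀ W (h : W ≤ U), res h (L' U f) = L' W (res h f))
    (hw : ∀ W y, Word W n y → L W y = L' W y) : L U f = L' U f := by
  funext x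
  obtain ⟨W, h, hxW, hf⟩ := hf x x.2
  have key : L W (res h f) = L' W (res h f) := LinearMap.eqOn_span (hw W) hf
  rw [← hL, ← hL'] at key
  exact congrFun key ⟨x, hxW⟩

lemma word_mem {y : Fam V U} (hy : Word U n y) : y ∈ gr U n :=
  fun _ hx => ⟨U, le_rfl, hx, subset_span hy⟩

lemma fn_mem (f : Smooth m U) : fn V U f ∈ gr U 0 := word_mem (Word.fn f)

lemma lin_mem (θ : V.Covec j U) : lin j U θ ∈ gr U ((j : ℕ) + 1) := by
  have h := Word.mul j θ 0 _ (Word.fn 1)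
  rw [map_one, mul_one] at h
  exact word_mem h

lemma res_mem (h : U ≤ W) {f : Fam V W} (hf : f ∈ gr W n) : res h f ∈ gr U n := fun x hx => by
  obtain ⟨W', h', hxW, hf⟩ := hf x (h hx)
  exact ⟨W' ⊓ U, inf_le_right, ⟨hxW, hx⟩, span_res inf_le_left hf⟩

lemma mem_of_locally {f : Fam V U}
    (h : ∀ x ∈ U, ∃ (W : Opens M) (h : W ≤ U), x ∈ W ∧ res h f ∈ gr W n) : f ∈
    gr U n := fun x hx => by
  obtain ⟨W, hW, hxW, hf⟩ := h x hx
  obtain ⟨W', h', hxW', hf⟩ := hf x hxW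
  exact ⟨W', h'.trans hW, hxW', hf⟩

lemma gr_signComm {n k : ℕ} {f g : Fam V U} (hf : f ∈ gr U n) (hg : g ∈ gr U k) :
    SignComm n k f g := by
  funext x
  obtain ⟨W, h, hxW, hf⟩ := hf x x.2
  obtain ⟨W', h', hxW', hg⟩ := hg x x.2
  have key : SignComm n k (res (inf_le_left.trans h : W ⊓ W' ≤ U) f)
      (res (inf_le_right.trans h' : W ⊓ W' ≤ U) g) := by
    have hf := span_res (inf_le_left : W ⊓ W' ≤ W) hf
    have hg := span_res (inf_le_right : W ⊓ W' ≤ W') hg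
    refine Submodule.span_induction₂ (p := fun a b _ _ => SignComm n k a b)
      (fun a b ha hb => Word.signComm ha hb) (fun _ _ => by simp [SignComm])
      (fun _ _ => by simp [SignComm]) (fun a b c _ _ _ h h' => ?_) (fun a b c _ _ _ h h' => ?_)
      (fun s a b _ _ h => ?_) (fun s a b _ _ h => ?_) hf hg
    · rw [SignComm, add_mul, mul_add, smul_add, h, h']
    · rw [SignComm, add_mul, mul_add, smul_add, h, h']
    · rw [SignComm, smul_mul_assoc, mul_smul_comm, smul_comm, h]
    · rw [SignComm, smul_mul_assoc, mul_smul_comm, smul_comm, h]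
  exact congrFun key ⟨x, hxW, hxW'⟩

instance (U : Opens M) : SetLike.GradedMonoid (gr (V := V) U) where
  one_mem := map_one (fn V U) ▸ fn_mem 1
  mul_mem n k f g hf hg x hx := by
    obtain ⟨W, h, hxW, hf⟩ := hf x hx
    obtain ⟨W', h', hxW', hg⟩ := hg x hx
    refine ⟨W ⊓ W', inf_le_left.trans h, ⟨hxW, hxW'⟩, ?_⟩
    have h1 := Submodule.mul_mem_mul (span_res (inf_le_left : W ⊓ W' ≤ W) hf)
      (span_res (inf_le_right : W ⊓ W' ≤ W') hg)
    rw [Submodule.span_mul_span] at h1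
    refine Submodule.span_mono ?_ h1
    rintro _ ⟨a, ha, b, hb, rfl⟩
    exact Word.prod ha hb

/-- The pullback along multiplication by scalars in the bundles. -/
def pullback (c : Fin p → ℝ) (U : Opens M) : Fam V U →ₐ[ℝ] Fam V U where
  toFun f x e := f x fun α => c α.1 • e α
  map_one' := rfl
  map_mul' _ _ := rfl
  map_zero' := rfl
  map_add' _ _ := rfl
  commutes' _ := rfl

lemma pullback_lin (c : Fin p → ℝ) (θ : V.Covec j U) : pullback c U (lin j U θ) =
    lin j U (c j • θ) := by
  funext x e
  change lin j U θ x (fun α => c α.1 • e α) = _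
  rw [lin_apply, lin_apply]
  refine sum_congr rfl fun i _ => ?_
  rw [map_smul]
  rfl

lemma Word.pullback (c : Fin p → ℝ) {n : ℕ} {y : Fam V U} (hy : Word U n y) :
    Word U n (Fam.pullback c U y) := by
  induction hy with
  | fn f => exact Word.fn f
  | mul j θ n y hy ih =>
    rw [map_mul, pullback_lin]
    exact Word.mul j _ n _ ih

lemma pullback_mem (c : Fin p → ℝ) {f : Fam V U} (hf : f ∈ gr U n) : pullback c U f ∈
    gr U n := fun x hx => by
  obtain ⟨W, h, hxW, hf⟩ := hf x hx
  have hle : span ℝ {y : Fam V W | Word W n y} ≤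
      (span ℝ {y : Fam V W | Word W n y}).comap (pullback c W).toLinearMap :=
    Submodule.span_le.2 fun y hy => subset_span (Word.pullback c hy)
  exact ⟨W, h, hxW, hle hf⟩

lemma pullback_two {n : ℕ} {f : Fam V U} (hf : f ∈ gr U n) :
    pullback (fun j => (2 : ℝ) ^ ((j : ℕ) + 1)) U f = (2 : ℝ) ^ n • f := by
  refine eq_of_word hf (L := fun W => (pullback (fun j => (2 : ℝ) ^ ((j : ℕ) + 1)) W).toLinearMap)
    (L' := fun W => (2 : ℝ) ^ n • LinearMap.id) (fun _ _ => rfl) (fun _ _ => rfl) fun W y hy => ?_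
  change pullback (fun j => (2 : ℝ) ^ ((j : ℕ) + 1)) W y = (2 : ℝ) ^ n • y
  clear hf
  induction hy with
  | fn f => rw [pow_zero, one_smul]; rfl
  | mul j θ n y hy ih =>
    rw [map_mul, ih, pullback_lin, map_smul, smul_mul_smul_comm, pow_add _ _ n]

section Frames

variable {U : Opens M} (b : Frame V U)

/-- The linear functions of a coframe. -/
def coords (α : Idx r) : Fam V U := lin α.1 U (b.θ α)

lemma gradedCommuting_coords : GradedCommuting (fn V U) (coords b) :=
  ⟨fun _ _ => gr_signComm (lin_mem _) (lin_mem _), fun _ _ => fn_mul_comm _ _⟩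

lemma coords_apply (x : U) (α : Idx r) : coords b α x (fun α => b.e α x) = xi α := by
  rw [coords, lin_apply, sum_eq_single α.2]
  · rw [b.dual, if_pos rfl, one_smul]
  · intro i _ hi
    rw [b.dual, if_neg hi.symm, zero_smul]
  · simp

/-- The coefficient functions of a family in a frame. -/
def coeff (J : MultiExp r) : Fam V U →ₗ[ℝ] (U → ℝ) where
  toFun f x := monCoeff J (f x fun α => b.e α x)
  map_add' _ _ := funext fun _ => map_add _ _ _
  map_smul' c _ := funext fun _ => map_smul (monCoeff J) c _

lemma coeff_expand (c : MultiExp r →₀ Smooth m U) (J : MultiExp r) (x : U) :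
    coeff b J (expand (fn V U) (coords b) c) x = c J x := by
  classical
  induction c using Finsupp.induction_linear with
  | zero => rw [map_zero, map_zero]; rfl
  | add c d hc hd => rw [map_add, map_add, Pi.add_apply, hc, hd]; rfl
  | single K g =>
    let ev : Fam V U →+* FreeOp r := ⟨⟨⟨fun f => f x fun α => b.e α x, rfl⟩, fun _ _ => rfl⟩, rfl,
      fun _ _ => rfl⟩
    have h1 := map_monomialOf (B := FreeOp r) ev (coords b) K.1
    rw [expand_single]
    change monCoeff J (algebraMap ℝ (FreeOp r) (g x) * (monomialOf (coords b) K.1 x fun α => b.e α x)) = _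
    have h2 : (monomialOf (coords b) K.1 x fun α => b.e α x) = monomialOf xi K.1 :=
      h1.trans (congrArg (fun q => monomialOf q K.1) (funext (coords_apply b x)))
    rw [h2, ← Algebra.smul_def, map_smul, monCoeff_monomialOf, Finsupp.single_apply]
    split_ifs
    · exact mul_one _
    · exact mul_zero _

lemma injective_expand : Injective (expand (fn V U) (coords b)) := fun c d h =>
  Finsupp.ext fun J => Smooth.ext fun x => by rw [← coeff_expand b, h, coeff_expand]

lemma mem_range_of_word {n : ℕ} {y : Fam V U} (hy : Word U n y) : y ∈
    LinearMap.range (expand (fn V U) (coords b)) := by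
  rw [(gradedCommuting_coords b).range_expand, Subalgebra.mem_toSubmodule]
  induction hy with
  | fn f => exact Algebra.subset_adjoin (Or.inl ⟨f, rfl⟩)
  | mul j θ n y hy ih =>
    refine mul_mem ?_ ih
    rw [b.covec_eq θ, map_sum]
    refine sum_mem fun i _ => ?_
    rw [lin_mul]
    exact mul_mem (Algebra.subset_adjoin (Or.inl ⟨_, rfl⟩))
      (Algebra.subset_adjoin (Or.inr ⟨⟨j, i⟩, rfl⟩))

lemma monomial_mem (J : MultiExp r) (f : Smooth m U) :
    expand (fn V U) (coords b) (Finsupp.single J f) ∈ gr U (expDeg J.1) := by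
  rw [expand_single, ← zero_add (expDeg J.1)]
  exact SetLike.mul_mem_graded (fn_mem f) 
    (monomialOf_mem_graded (gr := gr U) (q := coords b) (fun α => lin_mem (b.θ α)) _)

lemma exists_expand {f : Fam V U} (hf : f ∈ gr U n) : ∃ c, expand (fn V U) (coords b) c = f := by
  classical
  let S (W : Opens M) : Fam V W →ₐ[ℝ] Fam V W := pullback (fun j => 2 ^ ((j : ℕ) + 1)) W
  have hS : ∀ {W : Opens M} (b : Frame V W) (c : MultiExp r →₀ Smooth m W) (J : MultiExp r)
      (x : W), coeff b J (S W (expand (fn V W) (coords b) c)) x = (2 : ℝ) ^ expDeg J.1 * c J x := by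
    intro W b c J x
    induction c using Finsupp.induction_linear with
    | zero => simp
    | add c d hc hd =>
      rw [map_add, map_add, map_add, Pi.add_apply, hc, hd, ← mul_add]
      rfl
    | single K g =>
      rw [pullback_two (monomial_mem b K g), map_smul, Pi.smul_apply, coeff_expand, smul_eq_mul,
        Finsupp.single_apply]
      split_ifs with h
      · rw [h]
      · exact (mul_zero _).trans (mul_zero _).symm
  have hloc : ∀ x ∈ U, ∃ (W : Opens M) (h : W ≤ U) (c : MultiExp r →₀ Smooth m W), x ∈ W ∧
      expand (fn V W) (coords (b.res h)) c = res h f ∧ ∀ J, expDeg J.1 ≠ n → c J = 0 := by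
    intro x hx
    obtain ⟨W, h, hxW, hfW⟩ := hf x hx
    have hle : span ℝ {y : Fam V W | Word W n y} ≤
        LinearMap.range (expand (Fam.fn V W) (coords (b.res h))) :=
      Submodule.span_le.2 fun y hy => mem_range_of_word (b.res h) hy
    obtain ⟨c, hc⟩ := hle hfW
    refine ⟨W, h, c, hxW, hc, fun J hJ => Smooth.ext fun y => ?_⟩
    have h1 := hS (b.res h) c J y
    rw [hc, pullback_two (res_mem h hf), map_smul, Pi.smul_apply, ← hc, coeff_expand,
      smul_eq_mul] at h1
    exact (mul_eq_mul_right_iff.1 h1).resolve_left fun h' =>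
      hJ (pow_right_injective₀ two_pos (by norm_num) h'.symm)
  let g : MultiExp r → Smooth m U := fun J => ⟨coeff b J f, contMDiff_of_locally fun x hx => by
    obtain ⟨W, h, c, hxW, hc, -⟩ := hloc x hx
    refine ⟨W, hxW, c J, fun y hy hy' => ?_⟩
    rw [← coeff_expand (b.res h), hc]
    rfl⟩
  let d : MultiExp r →₀ Smooth m U := Finsupp.onFinset (finite_expDeg_le (r := r) n).toFinset g
    fun J hJ => by
      by_contra hJn
      refine hJ (Smooth.ext fun x => ?_)
      obtain ⟨W, h, c, hxW, hc, h0⟩ := hloc x x.2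
      have h1 := coeff_expand (b.res h) c J ⟨x, hxW⟩
      rw [hc, h0 J fun h' => hJn (by simp [h'])] at h1
      exact h1
  refine ⟨d, ?_⟩
  funext x
  obtain ⟨W, h, c, hxW, hc, h0⟩ := hloc x x.2
  have key : res h (expand (fn V U) (coords b) d) = res h f := by
    rw [← hc]
    have h1 : res h (expand (fn V U) (coords b) d) = expand (fn V W) (coords (b.res h))
        (d.mapRange (Smooth.res h) (map_zero _)) := by
      rw [expand_apply, expand_apply, Finsupp.sum_mapRange_index (by simp), Finsupp.sum, map_sum]
      refine sum_congr rfl fun J _ => ?_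
      rw [map_mul]
      have h2 : res h (monomialOf (coords b) J.1) = monomialOf (coords (b.res h)) J.1 :=
        map_monomialOf (A := Fam V U) (B := Fam V W) (res h).toRingHom (coords b) J.1
      rw [h2]
      rfl
    rw [h1]
    congr 1
    refine Finsupp.ext fun J => Smooth.ext fun y => ?_
    rw [Finsupp.mapRange_apply]
    change d J ⟨y, h y.2⟩ = _
    rw [← coeff_expand (b.res h), hc]
    rfl
  exact congrFun key ⟨x, hxW⟩

end Frames

end Fam

lemma isInternal_of_eigenvalue {A : Type v} [Ring A] [Algebra ℝ A] {G : ℕ → Submodule ℝ A}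
    (φ : A →ₗ[ℝ] A) (h : ∀ n, ∀ f ∈ G n, φ f = (2 : ℝ) ^ n • f) (hG : ⨆ n, G n = ⊤) :
    DirectSum.IsInternal G :=
  DirectSum.isInternal_submodule_of_iSupIndep_of_iSup_eq_top
    (((Module.End.eigenspaces_iSupIndep φ).comp (f := fun n : ℕ => (2 : ℝ) ^ n)
      (pow_right_injective₀ two_pos (by norm_num))).mono fun n f hf =>
        Module.End.mem_eigenspace_iff.2 (h n f hf)) hG

namespace Fam

variable (V) in
/-- The sums of homogeneous families. -/
def full (U : Opens M) : Subalgebra ℝ (Fam V U) :=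
  (⨆ n, gr (V := V) U n).toSubalgebra
    (mem_iSup_of_mem 0 (SetLike.one_mem_graded (gr U))) fun f g hf hg => by
    have h : (⨆ n, gr (V := V) U n) * (⨆ n, gr (V := V) U n) ≤ ⨆ n, gr (V := V) U n := by
      simp only [Submodule.iSup_mul, Submodule.mul_iSup]
      exact iSup_le fun n => iSup_le fun k => Submodule.mul_le.2 fun a ha b hb =>
        mem_iSup_of_mem _ (SetLike.mul_mem_graded ha hb)
    exact h (Submodule.mul_mem_mul hf hg)

lemma gr_le_full {f : Fam V U} (hf : f ∈ gr U n) : f ∈ full V U :=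
  mem_iSup_of_mem (p := fun n => gr (V := V) U n) n hf

lemma full_le {S : Submodule ℝ (Fam V U)} (h : ∀ n, gr U n ≤ S) {f : Fam V U} (hf : f ∈ full V U) :
    f ∈ S := (iSup_le h : (⨆ n, gr (V := V) U n) ≤ S) hf

/-- A homomorphism that preserves the degrees, on sums of homogeneous families. -/
def fullMap (φ : Fam V W →ₐ[ℝ] Fam V U) (h : ∀ n f, f ∈ gr W n → φ f ∈ gr U n) :
    full V W →ₐ[ℝ] full V U :=
  (φ.comp (full V W).val).codRestrict _ fun f => full_le
    (S := (Subalgebra.toSubmodule (full V U)).comap φ.toLinearMap)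
    (fun n g hg => gr_le_full (h n g hg)) f.2

def fullGr (U : Opens M) (n : ℕ) :
    Submodule ℝ (full V U) := (gr U n).comap (full V U).val.toLinearMap

/-- The pullback along multiplication by scalars in the bundles. -/
def fullPullback (c : Fin p → ℝ) (U : Opens M) : full V U →ₐ[ℝ] full V U :=
  fullMap (pullback c U) fun _ _ => pullback_mem c

lemma iSup_fullGr (U : Opens M) : ⨆ n, fullGr (V := V) U n = ⊤ := by
  refine Submodule.map_injective_of_injective (f := (full V U).val.toLinearMap)
    Subtype.val_injective ?_
  rw [Submodule.map_iSup, Submodule.map_top]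
  have h : ∀ n, (fullGr (V := V) U n).map (full V U).val.toLinearMap = gr U n := fun n =>
    Submodule.map_comap_eq_self fun f hf => ⟨⟨f, gr_le_full hf⟩, rfl⟩
  simp only [h]
  refine le_antisymm (iSup_le fun n f hf => ⟨⟨f, gr_le_full hf⟩, rfl⟩) ?_
  rintro _ ⟨f, rfl⟩
  exact f.2

lemma isInternal_fullGr (U : Opens M) : DirectSum.IsInternal (fullGr (V := V) U) :=
  isInternal_of_eigenvalue (fullPullback (fun j => (2 : ℝ) ^ ((j : ℕ) + 1)) U).toLinearMap
    (fun _ _ hf => Subtype.ext (pullback_two hf)) (iSup_fullGr U)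

lemma Word.eq_fn {n : ℕ} {y : Fam V U} (hy : Word U n y) (hn : n = 0) : ∃ f, Fam.fn V U f = y := by
  cases hy with
  | fn f => exact ⟨f, rfl⟩
  | mul j θ n y hy => omega

lemma monCoeff_algebraMap (c : ℝ) :
    monCoeff (MultiExp.zero : MultiExp r) (algebraMap ℝ (FreeOp r) c) = c := by
  have h := monCoeff_monomialOf (MultiExp.zero : MultiExp r) MultiExp.zero
  rw [monomialOf_multiExp_zero, if_pos rfl] at h
  rw [Algebra.algebraMap_eq_smul_one, map_smul, h, smul_eq_mul, mul_one]

lemma fn_injective (U : Opens M) : Injective (fn V U) := fun f g h =>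
  Smooth.ext fun x => by
    have := congrArg (monCoeff (MultiExp.zero : MultiExp r)) (congrFun (congrFun h x) 0)
    exact (monCoeff_algebraMap (r := r) (f x)).symm.trans (this.trans (monCoeff_algebraMap (g x)))

lemma exists_fn_eq {f : Fam V U} (hf : f ∈ gr U 0) : ∃ g, fn V U g = f := by
  have hloc : ∀ x ∈ U, ∃ (W : Opens M) (h : W ≤ U) (g : Smooth m W), x ∈ W ∧
      fn V W g = res h f := fun x hx => by
    obtain ⟨W, h, hxW, hf⟩ := hf x hx
    have hle : span ℝ {y : Fam V W | Word W 0 y} ≤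
        LinearMap.range (fn V W).toLinearMap := Submodule.span_le.2 fun y hy => Word.eq_fn hy rfl
    obtain ⟨g, hg⟩ := hle hf
    exact ⟨W, h, g, hxW, hg⟩
  have hval : ∀ {W : Opens M} (h : W ≤ U) (g : Smooth m W), fn V W g = res h f → ∀ x : W,
      monCoeff (MultiExp.zero : MultiExp r) (f ⟨x, h x.2⟩ 0) = g x := fun h g hg x =>
    (congrArg (monCoeff (MultiExp.zero : MultiExp r)) (congrFun (congrFun hg.symm x) 0)).trans
      (monCoeff_algebraMap (g x))
  refine ⟨⟨fun x => monCoeff (MultiExp.zero : MultiExp r) (f x 0),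
    contMDiff_of_locally fun x hx => ?_⟩, funext fun x => ?_⟩
  · obtain ⟨W, h, g, hxW, hg⟩ := hloc x hx
    exact ⟨W, hxW, g, fun y hy _ => hval h g hg ⟨y, hy⟩⟩
  · obtain ⟨W, h, g, hxW, hg⟩ := hloc x x.2
    refine Eq.trans (funext fun e => ?_) (congrFun hg ⟨x, hxW⟩)
    exact congrArg (algebraMap ℝ (FreeOp r)) (hval h g hg ⟨x, hxW⟩)

variable (V) in
def fullFn (U : Opens M) : Smooth m U →ₐ[ℝ] full V U :=
  (fn V U).codRestrict _ fun f => gr_le_full (fn_mem f)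

/-- The linear functions of a coframe. -/
def fullLin (b : Frame V U) (α : Idx r) : full V U :=
  ⟨coords b α, gr_le_full (lin_mem _)⟩

lemma bijective_fullLin (b : Frame V U) : Bijective (expand (fullFn V U) (fullLin b)) := by
  have key : ∀ c, (full V U).val (expand (fullFn V U) (fullLin b) c) =
      expand (fn V U) (coords b) c := fun c => by
    rw [expand_apply, expand_apply, Finsupp.sum, map_sum]
    refine sum_congr rfl fun J _ => ?_
    rw [map_mul]
    exact congrArg _ (map_monomialOf (A := full V U) (B := Fam V U)
      (full V U).val.toRingHom _ J.1)
  refine ⟨fun c d hcd => injective_expand b ?_, fun f => ?_⟩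
  · rw [← key, ← key, hcd]
  · obtain ⟨c, hc⟩ := full_le (S := LinearMap.range (expand (fn V U) (coords b)))
      (fun n g hg => exists_expand b hg) f.2
    exact ⟨c, Subtype.ext ((key c).trans hc)⟩

end Fam

open Fam

variable (V) in
/-- The N-manifold of a graded vector bundle. -/
def freeManifold : NManifold.{u, max u w} m M r where
  O U := full V U
  instRing U := inferInstance
  instAlgebra U := (full V U).algebra
  gr U := fullGr U
  gradedMonoid U :=
    { one_mem := SetLike.one_mem_graded (gr (V := V) U)
      mul_mem := fun _ _ _ _ hf hg => SetLike.mul_mem_graded (A := gr (V := V) U) hf hg }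
  isInternal := isInternal_fullGr
  graded_comm U i j f g hf hg := Subtype.ext (gr_signComm hf hg :)
  res h := fullMap (res h) fun _ _ => res_mem h
  res_self _ _ := rfl
  res_res _ _ _ := rfl
  res_mem h _ _ hf := res_mem h hf
  locality U f hf := Subtype.ext (funext fun x => by
    obtain ⟨i, hi⟩ := Opens.mem_iSup.1 x.2
    exact (congrFun (congrArg Subtype.val (hf i)) ⟨x, hi⟩ :))
  glueing U n f hf hfg := by
    choose i hi using fun x : ↥(iSup U) => Opens.mem_iSup.1 x.2
    let F : Fam V (iSup U) := fun x => (f (i x)).1 ⟨x, hi x⟩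
    have hF : ∀ k, res (le_iSup U k) F = (f k).1 := fun k => funext fun x =>
      congrFun (congrArg Subtype.val (hfg (i ⟨x, le_iSup U k x.2⟩) k)) ⟨x, hi _, x.2⟩
    have hF' : F ∈ gr (iSup U) n := mem_of_locally fun x hx => by
      obtain ⟨k, hk⟩ := Opens.mem_iSup.1 hx
      exact ⟨U k, le_iSup U k, hk, (hF k).symm ▸ hf k⟩
    exact ⟨⟨F, gr_le_full hF'⟩, hF', fun k => Subtype.ext (hF k)⟩
  fn U := fullFn V U
  fn_injective U f g h := fn_injective U (congrArg Subtype.val h)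
  fn_range U := by
    refine Set.ext fun f => ⟨?_, fun hf => ?_⟩
    · rintro ⟨g, rfl⟩
      exact fn_mem g
    · obtain ⟨g, hg⟩ := exists_fn_eq hf
      exact ⟨g, Subtype.ext hg⟩
  fn_res _ _ := rfl
  exists_coordinates x := by
    obtain ⟨U, -, hx, ⟨b⟩⟩ := exists_frame V (Opens.mem_top x)
    exact ⟨U, hx, fullLin b, fun α => lin_mem _, fun U' h => bijective_fullLin (b.res h)⟩

lemma isCoordinates_fullLin (b : Frame V U) : (freeManifold V).IsCoordinates U (fullLin b) :=
  ⟨fun _ => lin_mem _, fun _ h => bijective_fullLin (b.res h)⟩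

open Fam

namespace Fam

/-- The pullback along the projection that omits the bundle `E j`. -/
def kill (j : Fin p) (U : Opens M) : (freeManifold V).O U →ₐ[ℝ] (freeManifold V).O U :=
  fullPullback (fun k => if k = j then 0 else 1) U

lemma kill_fullLin (j : Fin p) (b : Frame V U) (α : Idx r) : kill j U (fullLin b α) = if α.1 =
    j then 0 else fullLin b α := by
  have key := pullback_lin (fun k => if k = j then 0 else 1) (b.θ α)
  by_cases h : α.1 = j
  · rw [if_pos h, zero_smul, map_zero] at key
    rw [if_pos h]
    exact Subtype.ext key
  · rw [if_neg h, one_smul] at key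
    rw [if_neg h]
    exact Subtype.ext key

lemma kill_lin (j : Fin p) (θ : V.Covec j U) :
    pullback (fun k => if k = j then 0 else 1) U (lin j U θ) = 0 := by
  rw [pullback_lin, if_pos rfl, zero_smul, map_zero]

lemma kill_mem_polynomials (j : Fin p) (b : Frame V U) {f : (freeManifold V).O U}
    (hf : f ∈ (freeManifold V).polynomials U (fullLin b) ((j : ℕ) + 1)) : kill j U f ∈
    (freeManifold V).polynomials U (fullLin b) j := by
  have h : (freeManifold V).polynomials U (fullLin b) ((j : ℕ) + 1) ≤
      ((freeManifold V).polynomials U (fullLin b) j).comap (kill j U) := by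
    refine Algebra.adjoin_le ?_
    rintro _ (⟨g, rfl⟩ | ⟨α, hα, rfl⟩)
    · exact NManifold.fn_mem_polynomials _ _ g
    · change kill j U (fullLin b α) ∈ (freeManifold V).polynomials U (fullLin b) j
      rw [kill_fullLin]
      split_ifs with h
      · exact zero_mem _
      · refine NManifold.mem_polynomials _ (lt_of_le_of_ne (Nat.lt_succ_iff.1 hα) fun h' => ?_)
        exact h (Fin.ext h')
  exact h hf

lemma kill_of_mem_polynomials (j : Fin p) (b : Frame V U) {f : (freeManifold V).O U}
    (hf : f ∈ (freeManifold V).polynomials U (fullLin b) j) : kill j U f = f := by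
  have h : (freeManifold V).polynomials U (fullLin b) j ≤
      AlgHom.equalizer (kill j U) (AlgHom.id ℝ _) := by
    refine Algebra.adjoin_le ?_
    rintro _ (⟨g, rfl⟩ | ⟨α, hα, rfl⟩)
    · rfl
    · exact (kill_fullLin j b α).trans (if_neg fun h => Nat.ne_of_lt hα (congrArg _ h))
  exact h hf

lemma exists_frame_of_mem_level {k : ℕ} {f : (freeManifold V).O U}
    (hf : f ∈ (freeManifold V).level k U) (hx : x ∈ U) :
    ∃ (W : Opens M) (h : W ≤ U) (b : Frame V W), x ∈ W ∧ (freeManifold V).res h f ∈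
    (freeManifold V).polynomials W (fullLin b) k := by
  obtain ⟨W, h, hxW, hf⟩ := hf x hx
  obtain ⟨W', h', hxW', ⟨b⟩⟩ := exists_frame V hxW
  refine ⟨W', h'.trans h, b, hxW', (isCoordinates_fullLin b).generated_le k ?_⟩
  rw [← (freeManifold V).res_res h' h]
  exact (freeManifold V).res_generated k h' _ hf

lemma kill_mem_level (j : Fin p) {f : (freeManifold V).O U}
    (hf : f ∈ (freeManifold V).level ((j : ℕ) + 1) U) : kill j U f ∈
    (freeManifold V).level (j : ℕ) U := fun _ hx => by
  obtain ⟨W, h, b, hxW, hf⟩ := exists_frame_of_mem_level hf hx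
  exact ⟨W, h, hxW, NManifold.polynomials_le_generated (isCoordinates_fullLin b).mem j
    (kill_mem_polynomials j b hf)⟩

lemma kill_of_mem_level (j : Fin p) {f : (freeManifold V).O U}
    (hf : f ∈ (freeManifold V).level (j : ℕ) U) : kill j U f = f :=
  NManifold.ext_locally fun _ hx => by
    obtain ⟨W, h, b, hxW, hf⟩ := exists_frame_of_mem_level hf hx
    exact ⟨W, h, hxW, kill_of_mem_polynomials j b hf⟩

lemma lin_injective (j : Fin p) (U : Opens M) : Injective (lin (V := V) j U) := by
  refine (injective_iff_map_eq_zero _).2 fun θ hθ => ?_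
  refine Covec.ext fun x y => ?_
  by_cases hr : r j = 0
  · have := finite_fiber V j x
    have : Subsingleton (V.E j x) := Module.finrank_zero_iff.1 ((finrank_fiber V j x).trans hr)
    rw [Subsingleton.elim y 0, map_zero, map_zero]
  · obtain ⟨i⟩ : Nonempty (Fin (r j)) := ⟨⟨0, Nat.pos_of_ne_zero hr⟩⟩
    have h := congrFun (congrFun hθ x) (Pi.single ⟨j, i⟩ y)
    rw [lin_apply, sum_eq_single i, Pi.single_eq_same] at h
    · refine (smul_eq_zero.1 h).resolve_right fun h0 => ?_
      have := LinearMap.congr_fun h0 (Finsupp.single 0 1)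
      rw [xi_single, if_neg (fun h => h.2 rfl), LinearMap.zero_apply, Finsupp.single_eq_zero] at this
      exact mul_ne_zero one_ne_zero (pow_ne_zero _ (by norm_num)) this
    · intro k _ hk
      have hne : (⟨j, k⟩ : Idx r) ≠ ⟨j, i⟩ := fun h => hk (eq_of_heq (Sigma.mk.inj h).2)
      rw [Pi.single_eq_of_ne hne, map_zero, zero_smul]
    · simp

lemma eq_zero_of_map_sum_mul_add {A κ : Type*} [Fintype κ] [Ring A] [Algebra ℝ A] (K : A →ₐ[ℝ] A)
    {a q : κ → A} {g : A} (hq : ∀ i, K (q i) = 0) (hg : K g = g) (h : K (∑ i, a i * q i + g) = 0) :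
    g = 0 := by
  simpa [hq, hg] using h

lemma exists_lin_eq (j : Fin p) {f : (freeManifold V).O U}
    (hf : f ∈ (freeManifold V).gr U ((j : ℕ) + 1)) (h0 : kill j U f = 0) : ∃ θ, lin j U θ =
    f.1 := by
  have hloc : ∀ x : U, ∃ (W : Opens M) (h : W ≤ U) (η : V.Covec j W), (x : M) ∈ W ∧
      lin j W η = res h f.1 := fun x => by
    obtain ⟨W, h, hxW, ⟨b⟩⟩ := exists_frame V x.2
    obtain ⟨c, g, hg, hfg⟩ := (isCoordinates_fullLin b).exists_linear_add j le_rfl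
      ((freeManifold V).res_mem h _ f hf)
    have hk : kill j W ((freeManifold V).res h f) = 0 :=
      congrArg ((freeManifold V).res h) h0
    have hq : ∀ i, kill j W (fullLin b ⟨j, i⟩) = 0 := fun i =>
      (kill_fullLin j b ⟨j, i⟩).trans (if_pos rfl)
    replace hk := eq_zero_of_map_sum_mul_add (kill j W) hq (kill_of_mem_polynomials j b hg)
      ((congrArg (kill j W) hfg).symm.trans hk)
    replace hfg := hfg.trans ((congrArg _ hk).trans (add_zero _))
    refine ⟨W, h, ∑ i, Covec.mul (c i) (b.θ ⟨j, i⟩), hxW, ?_⟩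
    refine (map_sum (lin j W) _ _).trans ((sum_congr rfl fun i _ => lin_mul _ _).trans ?_)
    exact ((congrArg (full V W).val hfg).trans (map_sum (full V W).val _ _)).symm
  choose W h η hxW hη using hloc
  have hcompat : ∀ (x y : U) (hy : (y : M) ∈ W x), (η y).1 ⟨y, hxW y⟩ = (η x).1 ⟨y, hy⟩ :=
    fun x y hy => by
    have h := lin_injective (V := V) j (W x ⊓ W y)
    have := @h (Covec.res inf_le_right (η y)) (Covec.res inf_le_left (η x)) ((congrArg (res inf_le_right) (hη y)).trans
        (congrArg (res inf_le_left) (hη x)).symm)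
    exact congrFun (congrArg Subtype.val this) ⟨y, hy, hxW y⟩
  refine ⟨⟨fun x => (η x).1 ⟨x, hxW x⟩, mem_covec_of_locally fun x hx =>
    ⟨W ⟨x, hx⟩, hxW ⟨x, hx⟩, η ⟨x, hx⟩, fun y hy hy' => hcompat ⟨x, hx⟩ ⟨y, hy'⟩ hy⟩⟩,
    funext fun x => ?_⟩
  exact congrFun (hη x) ⟨x, hxW x⟩

end Fam

variable (V) in
/-- The splitting of the N-manifold of a graded vector bundle. -/
def freeSplitting : Splitting (freeManifold V) where
  s j U := ((kill j U).comp ((freeManifold V).level ((j : ℕ) + 1) U).val).codRestrict _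
    fun f => kill_mem_level j f.2
  degree j U n f hf := (pullback_mem (fun k => if k = j then 0 else 1) hf :)
  natural j U W h f g hg := by
    change kill j U g = (freeManifold V).res h (kill j W f)
    rw [hg]
    rfl
  retract j _ _ hf := kill_of_mem_level j hf

variable (V) in
/-- A graded vector bundle arises from the splitting of its N-manifold. -/
def freeIdentification : Identification (freeSplitting V) V where
  coord j U := (lin j U).codRestrict _ fun θ => gr_le_full (lin_mem θ)
  injective j U _ _ h := lin_injective j U (congrArg Subtype.val h)
  natural j U W h θ θ' hθ := Subtype.ext (by
    have : θ' = Covec.res h θ := Subtype.ext (funext hθ)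
    rw [this]
    rfl)
  linear j U f θ θ' h := Subtype.ext (by
    have : θ' = Covec.mul f θ := Subtype.ext (funext h)
    rw [this]
    exact lin_mul f θ)
  range j U := by
    refine Set.ext fun f => ⟨?_, fun ⟨hf, h, hs⟩ => ?_⟩
    · rintro ⟨θ, rfl⟩
      exact ⟨lin_mem θ, NManifold.mem_level le_rfl (lin_mem θ),
        Subtype.ext (Subtype.ext (kill_lin j θ))⟩
    · obtain ⟨θ, hθ⟩ := exists_lin_eq j hf (congrArg Subtype.val hs)
      exact ⟨θ, Subtype.ext hθ⟩

end GradedGeometry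

end

open GradedGeometry in
theorem propositionp {m : ℕ} {M : Type u} [TopologicalSpace M] [T2Space M]
    [SecondCountableTopology M] [ChartedSpace (EuclideanSpace ℝ (Fin m)) M]
    [IsManifold (𝓡 m) ∞ M] {p : ℕ} (r : Fin p → ℕ) :
    -- a split N-manifold gives a graded vector bundle
    (∀ (N : NManifold.{u, v} m M r) (σ : Splitting N),
      ∃ V : GradedBundle.{u, 0} m M r, Nonempty (Identification σ V)) ∧
    -- a graded vector bundle gives a split N-manifold
    (∀ V : GradedBundle.{u, w} m M r,
      ∃ (N : NManifold.{u, max u w} m M r) (σ : Splitting N), Nonempty (Identification σ V)) ∧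
    -- for fixed underlying split N-manifold and graded bundle: Q-structures and algebroid
    -- structures determine each other by the coordinate formulas
    (∀ (N : NManifold.{u, v} m M r) (σ : Splitting N) (V : GradedBundle.{u, w} m M r)
      (ι : Identification σ V),
      (∀ Q : QStructure N, ∃! Aρ : LInftyAlgebroid V × Anchor V, Corresponds ι Q Aρ.1 Aρ.2) ∧
      (∀ A : LInftyAlgebroid V, ∃! Qρ : QStructure N × Anchor V,
        Corresponds ι Qρ.1 A Qρ.2)) ∧
    -- isomorphisms correspond to each other
    (∀ (N : NManifold.{u, v} m M r) (σ : Splitting N)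
      (N' : NManifold.{u, v'} m M r) (σ' : Splitting N')
      (V : GradedBundle.{u, w} m M r) (V' : GradedBundle.{u, w'} m M r)
      (ι : Identification σ V) (ι' : Identification σ' V'),
      (∀ φ : SplitIso σ σ', ∃! Φ : BundleIso V V', Induces ι ι' φ Φ) ∧
      (∀ Φ : BundleIso V V', ∃! φ : SplitIso σ σ', Induces ι ι' φ Φ) ∧
      (∀ (φ : SplitIso σ σ') (Φ : BundleIso V V'), Induces ι ι' φ Φ →
        ∀ (Q : QStructure N) (Q' : QStructure N') (A : LInftyAlgebroid V)
          (A' : LInftyAlgebroid V') (ρ : Anchor V) (ρ' : Anchor V'),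
          Corresponds ι Q A ρ → Corresponds ι' Q' A' ρ' →
          ((∀ (U : TopologicalSpace.Opens M) (f : N.O U), φ.e U (Q.Q U f) = Q'.Q U (φ.e U f)) ↔
            (∀ (n : ℕ) (x : Fin n → V.Sec),
              Φ.onSec (A.a n x) = A'.a n (fun i => Φ.onSec (x i)))))) := by
  refine ⟨fun N σ => exists_bundle N σ,
    fun V => ⟨freeManifold V, freeSplitting V, ⟨freeIdentification V⟩⟩,
    fun N σ V ι => ⟨ι.existsUnique_algebroid, ι.existsUnique_qStructure⟩,
    fun N σ N' σ' V V' ι ι' => ⟨existsUnique_bundleIso ι ι', existsUnique_splitIso ι ι',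
      fun φ Φ h Q Q' A A' ρ ρ' hQ hQ' => h.intertwines_iff hQ hQ'⟩⟩
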